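/- Let $M_{24}$ be the automorphism group of the extended binary Golay code, acting on 24 letters. Classes are written in ATLAS notation. Let $g\in M_{24}$ lie in none of the classes 3B, 4C, 6B, 12B, 21A, 21B, 23A, 23B (cycle shapes $3^8$, $4^6$, $6^4$, $12^2$, $3\cdot 21$, $1\cdot 23$), and let $\chi(g)$ be its number of fixed letters. **Notation.** For $\tau\in\mathbb H$ and $z\in\mathbb C$ put $q^a=e^{2\pi i a\tau}$, $y^a=e^{2\pi i a z}$. Let $\eta$ be the Dedekind eta function, $E_2=1-24\sum_{n>0}\sigma_1(n)q^n$, and $$\theta_1=-iq^{1/8}y^{1/2}\prod_{n>0}(1-y^{-1}q^{n-1})(1-yq^n)(1-q^n),\qquad \theta_2=q^{1/8}y^{1/2}\prod_{n>0}(1+y^{-1}q^{n-1})(1+yq^n)(1-q^n),$$ $$\theta_3=\prod_{n>0}(1+y^{-1}q^{n-1/2})(1+yq^{n-1/2})(1-q^n),\qquad \theta_4=\prod_{n>0}(1-y^{-1}q^{n-1/2})(1-yq^{n-1/2})(1-q^n),$$ $$\mu(\tau,z)=\frac{-iy^{1/2}}{\theta_1(\tau,z)}\sum_{n\in\mathbb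 Z}(-1)^n\frac{y^nq^{n(n+1)/2}}{1-yq^n},\qquad F_2(\tau)=\sum_{\substack{r>s>0\\ r-s\ \mathrm{odd}}}(-1)^r s\,q^{rs/2}.$$ **The mock modular forms $H_g$ and the quasimodular forms $Q_g$.** Put $H_e=(48F_2-2E_2)/\eta^3=2q^{-1/8}(-1+45q+231q^2+\cdots)$ and $H_g=\frac{\chi(g)}{24}H_e-F_g/\eta^3$, where $F_g$ is the weight two form of Mathieu moonshine. With $\eta_m=\eta(m\tau)$ and $\Lambda_N=\frac N{24}\bigl(NE_2(N\tau)-E_2(\tau)\bigr)$ it is given, according to the class of $g$, by 1A: $0$; 2A: $16\Lambda_2$; 2B: $-24\Lambda_2+8\Lambda_4$; 3A: $6\Lambda_3$; 4A: $4\Lambda_2-6\Lambda_4+2\Lambda_8$; 4B: $4(\Lambda_4-\Lambda_2)$; 5A: $2\Lambda_5$; 6A: $2(\Lambda_6-\Lambda_2-\Lambda_3)$; 7A, 7B: $\Lambda_7$; 8A: $\Lambda_8-\Lambda_4$; 10A: $2\eta_1^3\eta_2\eta_5/\eta_{10}$; 11A: $\frac25(\Lambda_{11}-11\eta_1^2\eta_{11}^2)$;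 12A: $2\eta_1^3\eta_4^2\eta_6^3/(\eta_2\eta_3\eta_{12}^2)$; 14A, 14B: $\frac13(\Lambda_{14}-\Lambda_2-\Lambda_7-14\eta_1\eta_2\eta_7\eta_{14})$; 15A, 15B: $\frac14(\Lambda_{15}-\Lambda_3-\Lambda_5-15\eta_1\eta_3\eta_5\eta_{15})$. Let $Q_g=H_g\eta^3-2\chi(g)F_2$ (this is the holomorphic projection of $\widehat H_g\eta^3$, where $\widehat H_g$ is the completion of $H_g$). **The Duncan–Mack-Crane weak Jacobi form $\phi_g$.** Let $\lambda_i^{\pm1}$ $(1\le i\le 12)$ be the eigenvalues of $g$ on the permutation representation $\mathbb C^{24}$, labelled so that $\lambda_{11}=\lambda_{12}=1$. Let $\nu_i$ be square roots of the $\lambda_i$, with $\nu_{11}=\nu_{12}=1$. Put $$\eta_{\pm g}(\tau)=q\prod_{n>0}\prod_{i=1}^{12}(1\mp\lambda_i^{-1}q^n)(1\mp\lambda_iq^n),\quad C_{-g}=\prod_{i=1}^{12}\nu_i\,(1+\lambda_i^{-1}),\quad D_g=\prod_{i=1}^{10}\nu_i\,(1-\lambda_i^{-1}).$$ If the order $m$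 of $g$ is odd, the $\nu_i$ are chosen so that $\bigl(\prod_i\nu_i\bigr)^m=1$ (this is the lift of $g$ to the spin group that has the same order as $g$; for even $m$ one has $C_{-g}=0$). The real number $D_g$ is determined up to sign, and the labelling is chosen so that $D_g\le 0$. Put $$\phi_g(\tau,z)=-\frac12\left(\frac{\theta_4^2(\tau,z)}{\theta_4^2(\tau,0)}\frac{\eta_g(\tau/2)}{\eta_g(\tau)}-\frac{\theta_3^2(\tau,z)}{\theta_3^2(\tau,0)}\frac{\eta_{-g}(\tau/2)}{\eta_{-g}(\tau)}\right)-\frac12\left(D_g\,\eta_g(\tau)\frac{\theta_1^2(\tau,z)}{\eta^6(\tau)}+C_{-g}\,\eta_{-g}(\tau)\frac{\theta_2^2(\tau,z)}{\theta_2^2(\tau,0)}\right).$$ **Proposition.** Such a labelling of the eigenvalues and square roots exists. For every such labelling, every $\tau\in\mathbb H$ and every $z\in\mathbb C\setminus(\mathbb Z\tau+\mathbb Z)$, $$\frac{\eta^6(\tau)\phi_g(\tau,z)}{\theta_1^2(\tau,z)}=\chi(g)\bigl(\eta^3(\tau)\mu(\tau,z)+2F_2(\tau)\bigr)+Q_g(\tau),$$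 and equivalently $$\frac{\eta^6(\tau)\phi_g(\tau,z)}{\theta_1^2(\tau,z)}=H_g(\tau)\eta^3(\tau)+\chi(g)\eta^3(\tau)\mu(\tau,z).$$ -/

import Mathlib

open scoped UpperHalfPlane

noncomputable section

namespace Mathieu

/-! ### The Mathieu group `M₂₄` -/

/-- The 24 letters: the projective line over the field with 23 elements, with `none` as `∞`. -/
abbrev Letter : Type := Option (ZMod 23)

/-- The word whose support is `∞` together with the translate by `a` of the non-squares mod 23. -/
def golayWord (a : ZMod 23) : Letter → ZMod 2
  | none => 1
  | some x => if IsSquare (x - a) then 0 else 1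

/-- The extended binary Golay code, as the extended quadratic residue code mod 23. -/
def golayCode : Submodule (ZMod 2) (Letter → ZMod 2) :=
  Submodule.span (ZMod 2) (Set.range golayWord)

/-- `M₂₄`: the permutations of the 24 letters that preserve the extended binary Golay code. -/
def M24 : Subgroup (Equiv.Perm Letter) where
  carrier := {g | ∀ c : Letter → ZMod 2, c ∘ g ∈ golayCode ↔ c ∈ golayCode}
  one_mem' := fun _ => Iff.rfl
  mul_mem' := by
    intro a b ha hb c
    have h : c ∘ ⇑(a * b) = (c ∘ a) ∘ b := rfl
    rw [h, hb, ha]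
  inv_mem' := by
    intro a ha c
    have h : (c ∘ ⇑a⁻¹) ∘ a = c := by
      funext x
      simp
    rw [← ha (c ∘ ⇑a⁻¹), h]

/-- `χ(g)`: the number of letters fixed by `g`. -/
def chi (g : Equiv.Perm Letter) : ℕ :=
  (Finset.univ.filter fun x => g x = x).card

/-- The cycle shapes (cycles of length one omitted) of the `M₂₄`-classes
3B (`3⁸`), 4C (`4⁶`), 6B (`6⁴`), 12B (`12²`), 21A and 21B (`3·21`), 23A and 23B (`1·23`).
No other class of `M₂₄` has one of these shapes. -/
def excludedShapes : Set (Multiset ℕ) :=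
  { Multiset.replicate 8 3, Multiset.replicate 6 4, Multiset.replicate 4 6,
    Multiset.replicate 2 12, {3, 21}, {23} }

/-! ### Theta functions, the Appell--Lerch sum, Eisenstein series -/

/-- `ex x = e^{2πix}`, so that `q^a y^b = ex (a τ + b z)`. -/
def ex (x : ℂ) : ℂ := Complex.exp (2 * Real.pi * Complex.I * x)

/-- The index `n : ℕ` of the product stands for `n + 1`, here and in the products below. -/
def theta1 (τ z : ℂ) : ℂ :=
  -Complex.I * ex (τ / 8) * ex (z / 2) *
    ∏' n : ℕ, (1 - ex (n * τ - z)) * (1 - ex ((n + 1) * τ + z)) * (1 - ex ((n + 1) * τ))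

def theta2 (τ z : ℂ) : ℂ :=
  ex (τ / 8) * ex (z / 2) *
    ∏' n : ℕ, (1 + ex (n * τ - z)) * (1 + ex ((n + 1) * τ + z)) * (1 - ex ((n + 1) * τ))

def theta3 (τ z : ℂ) : ℂ :=
  ∏' n : ℕ, (1 + ex ((n + 1 / 2) * τ - z)) * (1 + ex ((n + 1 / 2) * τ + z)) *
    (1 - ex ((n + 1) * τ))

def theta4 (τ z : ℂ) : ℂ :=
  ∏' n : ℕ, (1 - ex ((n + 1 / 2) * τ - z)) * (1 - ex ((n + 1 / 2) * τ + z)) *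
    (1 - ex ((n + 1) * τ))

/-- The Appell--Lerch sum
`μ(τ,z) = -i y^{1/2} θ₁(τ,z)⁻¹ ∑ₙ (-1)ⁿ yⁿ q^{n(n+1)/2} / (1 - y qⁿ)`. -/
def mu (τ z : ℂ) : ℂ :=
  -Complex.I * ex (z / 2) / theta1 τ z *
    ∑' n : ℤ, (-1 : ℂ) ^ n * ex (n * z + n * (n + 1) / 2 * τ) / (1 - ex (z + n * τ))

/-- `F₂(τ) = ∑_{r > s > 0, r - s odd} (-1)^r s q^{rs/2}`. -/
def F2 (τ : ℂ) : ℂ :=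
  ∑' p : ℕ × ℕ,
    if 0 < p.2 ∧ p.2 < p.1 ∧ Odd (p.1 - p.2) then
      (-1 : ℂ) ^ p.1 * p.2 * ex (p.1 * p.2 / 2 * τ)
    else 0

/-- Mathlib's normalized weight two Eisenstein series `1 - 24q - ⋯`, as a function on `ℂ`
(meaningful on the upper half-plane). -/
def E2 (τ : ℂ) : ℂ := EisensteinSeries.E2 (UpperHalfPlane.ofComplex τ)

/-- `Λ_N = N q (d/dq) log (η(Nτ)/η(τ)) = (N/24)(N E₂(Nτ) - E₂(τ))`, of weight two on `Γ₀(N)`. -/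
def Lam (N : ℕ) (τ : ℂ) : ℂ := N / 24 * (N * E2 (N * τ) - E2 τ)

/-! ### The mock modular forms of Mathieu moonshine -/

/-- `η(mτ)` -/
def etaAt (m : ℕ) (τ : ℂ) : ℂ := ModularForm.eta (m * τ)

/-- `H_e = (48 F₂ - 2 E₂)/η³ = 2q^{-1/8}(-1 + 45q + 231q² + 770q³ + ⋯)`. -/
def He (τ : ℂ) : ℂ := (48 * F2 τ - 2 * E2 τ) / ModularForm.eta τ ^ 3

/-- The weight two modular form attached by Mathieu moonshine to the `M₂₄`-class with a given
cycle shape (cycles of length one omitted). Only the shapes of the classes other than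
3B, 4C, 6B, 12B, 21A, 21B, 23A, 23B are listed; the form is not used for other shapes. -/
def weightTwo (s : Multiset ℕ) (τ : ℂ) : ℂ :=
  if s = 0 then 0                                             -- 1A
  else if s = Multiset.replicate 8 2 then                     -- 2A
    16 * Lam 2 τ
  else if s = Multiset.replicate 12 2 then                    -- 2B
    -24 * Lam 2 τ + 8 * Lam 4 τ
  else if s = Multiset.replicate 6 3 then                     -- 3A
    6 * Lam 3 τ
  else if s = {2, 2, 2, 2, 4, 4, 4, 4} then                   -- 4A
    4 * Lam 2 τ - 6 * Lam 4 τ + 2 * Lam 8 τ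
  else if s = {2, 2, 4, 4, 4, 4} then                         -- 4B
    4 * (-Lam 2 τ + Lam 4 τ)
  else if s = {5, 5, 5, 5} then                               -- 5A
    2 * Lam 5 τ
  else if s = {2, 2, 3, 3, 6, 6} then                         -- 6A
    2 * (-Lam 2 τ - Lam 3 τ + Lam 6 τ)
  else if s = {7, 7, 7} then                                  -- 7A, 7B
    Lam 7 τ
  else if s = {2, 4, 8, 8} then                               -- 8A
    -Lam 4 τ + Lam 8 τ
  else if s = {2, 2, 10, 10} then                             -- 10A
    2 * (etaAt 1 τ ^ 3 * etaAt 2 τ * etaAt 5 τ / etaAt 10 τ)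
  else if s = {11, 11} then                                   -- 11A
    2 / 5 * (Lam 11 τ - 11 * (etaAt 1 τ ^ 2 * etaAt 11 τ ^ 2))
  else if s = {2, 4, 6, 12} then                              -- 12A
    2 * (etaAt 1 τ ^ 3 * etaAt 4 τ ^ 2 * etaAt 6 τ ^ 3 /
      (etaAt 2 τ * etaAt 3 τ * etaAt 12 τ ^ 2))
  else if s = {2, 7, 14} then                                 -- 14A, 14B
    1 / 3 * (-Lam 2 τ - Lam 7 τ + Lam 14 τ -
      14 * (etaAt 1 τ * etaAt 2 τ * etaAt 7 τ * etaAt 14 τ))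
  else if s = {3, 5, 15} then                                 -- 15A, 15B
    1 / 4 * (-Lam 3 τ - Lam 5 τ + Lam 15 τ -
      15 * (etaAt 1 τ * etaAt 3 τ * etaAt 5 τ * etaAt 15 τ))
  else 0

/-- The mock modular form `H_g` of Mathieu moonshine,
`H_g η³ = (χ(g)/24) H_e η³ - F_g` with `F_g` the weight two form of the class of `g`. -/
def H (g : Equiv.Perm Letter) (τ : ℂ) : ℂ :=
  chi g / 24 * He τ - weightTwo g.cycleType τ / ModularForm.eta τ ^ 3

/-- The quasimodular form `Q_g = H_g η³ - 2 χ(g) F₂`, the holomorphic projection of `Ĥ_g η³`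
for the completion `Ĥ_g` of `H_g`. -/
def Q (g : Equiv.Perm Letter) (τ : ℂ) : ℂ :=
  H g τ * ModularForm.eta τ ^ 3 - 2 * chi g * F2 τ

/-! ### The weak Jacobi forms of Duncan and Mack-Crane -/

/-- The eigenvalues `λ_i^{±1}` (`i = 1, …, 12`) of `g` on the 24-dimensional permutation
representation, labelled so that `λ₁₁ = λ₁₂ = 1`, with square roots `ν_i` of the `λ_i`.

The product of the `ν_i` is that of the lift of `g` to the spin group inside the lift of `M₂₄`;
this lift has the same order as `g`, which determines the product when the order of `g` is odd.
(When it is even, `-1` is an eigenvalue and `C_{-g} = 0`.) The product `D_g` of the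
`ν_i (1 - λ_i⁻¹)`, `i ≤ 10`, is real, and exchanging one `λ_i` for its inverse changes its sign;
the labelling is one for which it is not positive. -/
structure Labelling (g : Equiv.Perm Letter) where
  lam : Fin 12 → ℂ
  nu : Fin 12 → ℂ
  charpoly_eq : (g.permMatrix ℂ).charpoly =
    ∏ i, (Polynomial.X - Polynomial.C (lam i)) * (Polynomial.X - Polynomial.C (lam i)⁻¹)
  nu_sq : ∀ i, nu i ^ 2 = lam i
  nu_fixed : nu 10 = 1 ∧ nu 11 = 1
  lift : Odd (orderOf g) → (∏ i, nu i) ^ orderOf g = 1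
  sign : (∏ i : Fin 10, nu (i.castAdd 2) * (1 - (lam (i.castAdd 2))⁻¹)).re ≤ 0

/-- `q ∏_{n>0} ∏_i (1 - l_i⁻¹ qⁿ)(1 - l_i qⁿ)`: this is `η_g` when the `l_i` are the `λ_i`,
and `η_{-g}` when they are the `-λ_i`. -/
def etaEig (l : Fin 12 → ℂ) (τ : ℂ) : ℂ :=
  ex τ * ∏' n : ℕ, ∏ i, (1 - (l i)⁻¹ * ex ((n + 1) * τ)) * (1 - l i * ex ((n + 1) * τ))

namespace Labelling

variable {g : Equiv.Perm Letter} (L : Labelling g)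

/-- `η_g` -/
def etaPos (τ : ℂ) : ℂ := etaEig L.lam τ

/-- `η_{-g}` -/
def etaNeg (τ : ℂ) : ℂ := etaEig (fun i => -L.lam i) τ

/-- `C_{-g} = ν ∏_{i ≤ 12} (1 + λ_i⁻¹)` with `ν = ∏_{i ≤ 12} ν_i` -/
def CNeg : ℂ := (∏ i, L.nu i) * ∏ i, (1 + (L.lam i)⁻¹)

/-- `D_g = ν' ∏_{i ≤ 10} (1 - λ_i⁻¹)` with `ν' = ∏_{i ≤ 10} ν_i` -/
def D : ℂ := ∏ i : Fin 10, L.nu (i.castAdd 2) * (1 - (L.lam (i.castAdd 2))⁻¹)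

/-- The weak Jacobi form `φ_g` of weight zero and index one. -/
def phi (τ z : ℂ) : ℂ :=
  -(1 / 2) *
      (theta4 τ z ^ 2 / theta4 τ 0 ^ 2 * (L.etaPos (τ / 2) / L.etaPos τ) -
        theta3 τ z ^ 2 / theta3 τ 0 ^ 2 * (L.etaNeg (τ / 2) / L.etaNeg τ)) -
    1 / 2 *
      (L.D * L.etaPos τ * (theta1 τ z ^ 2 / ModularForm.eta τ ^ 6) +
        L.CNeg * L.etaNeg τ * (theta2 τ z ^ 2 / theta2 τ 0 ^ 2))

end Labelling

end Mathieu

end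

noncomputable section

namespace Mathieu

open Filter Topology

/-! ### The exponential `ex` -/

/-! For fixed τ both sides are affine functions of the Weierstrass function of z, taken here as the
Lambert series `wfun` = ∑ y qⁿ/(1 - y qⁿ)². On the right this is `eta_cube_mul_mu_add`: η³μ + 2F₂ =
-`wfun`. The Appell–Lerch quotient has the same periods and the same double pole, so by Liouville's
theorem (`elliptic_const`) the sum of η³μ and `wfun` is constant, and its value at the origin is
-2F₂. On the left, the addition formula of the sigma function (`kfun_add_mul_kfun_sub`), taken at
the three half periods h, turns η⁶θᵢ(z)²/(θᵢ(0)²θ₁(z)²) into `wfun` h - `wfun` z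
(`eta_mul_theta_div`), while the θ₁² term of φ_g becomes a constant in z.

Comparing the coefficient of `wfun` z and the constant term leaves two identities in τ alone. The
first has weight zero and says that φ_g(τ, 0) = χ(g) (`ShapeData.weight_zero`). The second has
weight two and expresses F_g through eta products and values of ℘ at half periods
(`ShapeData.weight_two`). `Labelling.eta_mul_phi` assembles them.

Both are proved by a Sturm type argument. Every ingredient is realised as the member with index (0,
1) of a family indexed by primitive vectors modulo M, on which τ ↦ -1/τ and τ ↦ τ + 1 act by moving
the index (`KFamily`). The building blocks are Klein forms and values of ℘ at rational points of the
lattice, for which the transformation laws are exact. The product of all distinct members, after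
squaring and multiplying by Δ, is a form of level one; if one member vanishes to high enough order
at i∞, division by a power of Δ gives a form of negative weight, hence zero (`family_eq_zero`,
`KFamily.eq_zero`). So finitely many coefficients at one cusp suffice, and these are computed in the
kernel with truncated integer power series (`checkZero`, `checkTwo`). To keep the number of members
small, they are counted up to units modulo M; this uses that the constants at the cusp are integers
and therefore Galois invariant (`prod_zpow_const`).

The form φ_g depends only on the cycle shape: η_g and η_{-g} are determined by the characteristic
polynomial, and so are the squares of C_{-g} and D_g. The sign of D_g is fixed by the sign condition
of a labelling, and that of C_{-g} by the condition on the lift (`Labelling.D_eq`,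
`Labelling.CNeg_eq`).

It remains to know which cycle shapes occur in M₂₄ (`exists_cycleType_eq`). Explicit elements show
that M₂₄ is five times transitive and that a sixth letter has two possible positions, inside or
outside the octad of the other five. Since two code words differ in at least eight letters, an
element that fixes the seven letters of `base` is trivial, so an element fixing the first five is
one of 48 known ones. Up to conjugacy a permutation has one of a few prescribed actions on five
letters; for each of them all 48 candidates are inspected. -/

lemma ex_add (x y : ℂ) : ex (x + y) = ex x * ex y := by
  simp only [ex, mul_add, Complex.exp_add]

lemma ex_neg (x : ℂ) : ex (-x) = (ex x)⁻¹ := by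
  simp only [ex, mul_neg, Complex.exp_neg]

lemma ex_sub (x y : ℂ) : ex (x - y) = ex x / ex y := by
  rw [sub_eq_add_neg, ex_add, ex_neg, div_eq_mul_inv]

@[simp] lemma ex_zero : ex 0 = 1 := by simp [ex]

lemma ex_ne_zero (x : ℂ) : ex x ≠ 0 := Complex.exp_ne_zero _

lemma ex_nat_mul (n : ℕ) (x : ℂ) : ex (n * x) = ex x ^ n := by
  simp only [ex, ← Complex.exp_nat_mul]; ring_nf

lemma ex_int_mul (n : ℤ) (x : ℂ) : ex (n * x) = ex x ^ n := by
  simp only [ex, ← Complex.exp_int_mul]; ring_nf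

@[simp] lemma ex_one : ex 1 = 1 := by simp [ex, Complex.exp_two_pi_mul_I]

@[simp] lemma ex_int (n : ℤ) : ex n = 1 := by
  rw [← mul_one (n : ℂ), ex_int_mul, ex_one, one_zpow]

lemma ex_add_int (x : ℂ) (n : ℤ) : ex (x + n) = ex x := by rw [ex_add, ex_int, mul_one]

lemma ex_half : ex (1 / 2) = -1 := by
  rw [ex, show 2 * (Real.pi : ℂ) * Complex.I * (1 / 2) = Real.pi * Complex.I by ring,
    Complex.exp_pi_mul_I]

lemma ex_quarter : ex (1 / 4) = Complex.I := by
  rw [ex, show 2 * (Real.pi : ℂ) * Complex.I * (1 / 4) = Real.pi / 2 * Complex.I by ring,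
    Complex.exp_pi_div_two_mul_I]

lemma norm_ex (x : ℂ) : ‖ex x‖ = Real.exp (-2 * Real.pi * x.im) := by
  simp [ex, Complex.norm_exp, mul_assoc]

lemma norm_ex_lt_one {τ : ℂ} (hτ : 0 < τ.im) : ‖ex τ‖ < 1 := by
  rw [norm_ex, Real.exp_lt_one_iff]
  nlinarith [mul_pos Real.pi_pos hτ]

lemma ex_eq_one_iff {x : ℂ} : ex x = 1 ↔ ∃ n : ℤ, x = n := by
  rw [ex, Complex.exp_eq_one_iff]
  refine exists_congr fun n => ⟨fun h => ?_, fun h => by rw [h]; ring⟩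
  have : (2 * (Real.pi : ℂ) * Complex.I) ≠ 0 := Complex.two_pi_I_ne_zero
  apply mul_left_cancel₀ this
  rw [h]; ring

@[fun_prop] lemma differentiable_ex : Differentiable ℂ ex := by unfold ex; fun_prop

lemma hasDerivAt_ex (x : ℂ) : HasDerivAt ex (2 * Real.pi * Complex.I * ex x) x := by
  have := ((hasDerivAt_id x).const_mul (2 * (Real.pi : ℂ) * Complex.I)).cexp
  simp only [mul_one, id] at this
  exact this.congr_deriv (mul_comm _ _)

/-! ### Infinite products -/

/-- The infinite `q`-Pochhammer symbol `(w; q)_∞`. -/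
def poch (w q : ℂ) : ℂ := ∏' n : ℕ, (1 - w * q ^ n)

lemma summable_poch (w : ℂ) {q : ℂ} (hq : ‖q‖ < 1) : Summable fun n : ℕ => ‖-(w * q ^ n)‖ := by
  simpa using (summable_geometric_of_lt_one (norm_nonneg _) hq).mul_left ‖w‖

lemma multipliable_poch (w : ℂ) {q : ℂ} (hq : ‖q‖ < 1) :
    Multipliable fun n : ℕ => 1 - w * q ^ n := by
  simpa [sub_eq_add_neg] using multipliable_one_add_of_summable (summable_poch w hq)

lemma poch_succ (w : ℂ) {q : ℂ} (hq : ‖q‖ < 1) : poch w q = (1 - w) * poch (w * q) q := by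
  have h : ∀ n : ℕ, 1 - w * q * q ^ n = 1 - w * q ^ (n + 1) := fun n => by ring
  rw [poch, poch, tprod_eq_zero_mul'
    (by simpa only [h] using multipliable_poch (w * q) hq)]
  simp [h]

lemma poch_ne_zero {w q : ℂ} (hq : ‖q‖ < 1) (h : ∀ n : ℕ, w * q ^ n ≠ 1) : poch w q ≠ 0 := by
  have := tprod_one_add_ne_zero_of_summable (f := fun n : ℕ => -(w * q ^ n))
    (fun i => by rw [← sub_eq_add_neg, sub_ne_zero]; exact (h i).symm)
    (summable_poch w hq)
  simpa [poch, sub_eq_add_neg] using this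

lemma poch_self_ne_zero {q : ℂ} (hq : ‖q‖ < 1) : poch q q ≠ 0 := by
  refine poch_ne_zero hq fun n h => ?_
  have h1 : ‖q * q ^ n‖ = 1 := by rw [h, norm_one]
  rw [← pow_succ', norm_pow] at h1
  exact (pow_lt_one₀ (norm_nonneg _) hq n.succ_ne_zero).ne h1

/-- Both arguments vary, so that the same statement gives holomorphy in z for a fixed nome and
holomorphy in τ. On a compact set the factors are dominated by a geometric series formed with the
maxima of |w| and |q|. -/
lemma differentiableOn_poch {U : Set ℂ} (hU : IsOpen U) {w q : ℂ → ℂ}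
    (hw : DifferentiableOn ℂ w U) (hq : DifferentiableOn ℂ q U) (h1 : ∀ s ∈ U, ‖q s‖ < 1) :
    DifferentiableOn ℂ (fun s => poch (w s) (q s)) U := by
  have key : HasProdLocallyUniformlyOn (fun (n : ℕ) s => 1 + -(w s * q s ^ n))
      (fun s => ∏' n : ℕ, (1 + -(w s * q s ^ n))) U := by
    apply hasProdLocallyUniformlyOn_of_forall_compact hU
    intro K hK hcK
    rcases K.eq_empty_or_nonempty with hN | hN
    · simpa [hasProdUniformlyOn_iff_tendstoUniformlyOn, hN] using tendstoUniformlyOn_empty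
    · obtain ⟨s0, hs0, HB⟩ := hcK.exists_isMaxOn hN ((hq.mono hK).continuousOn.norm)
      obtain ⟨s1, hs1, HC⟩ := hcK.exists_isMaxOn hN ((hw.mono hK).continuousOn.norm)
      refine ((summable_geometric_of_lt_one (norm_nonneg _) (h1 s0 (hK hs0))).mul_left
        ‖w s1‖).hasProdUniformlyOn_nat_one_add hcK (.of_forall fun n x hx => ?_) (fun n => ?_)
      · rw [norm_neg, norm_mul, norm_pow]
        exact mul_le_mul (HC hx) (pow_le_pow_left₀ (norm_nonneg _) (HB hx) n) (by positivity)
          (norm_nonneg _)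
      · exact ((hw.mono hK).continuousOn.mul ((hq.mono hK).continuousOn.pow n)).neg
  have := key.differentiableOn (.of_forall fun t => by
    have : DifferentiableOn ℂ (fun s => ∏ n ∈ t, (1 + -(w s * q s ^ n))) U :=
      DifferentiableOn.fun_finsetProd fun n _ =>
        (differentiableOn_const _).add (hw.mul (hq.pow n)).neg
    exact this) hU
  simpa [poch, sub_eq_add_neg] using this

lemma differentiable_poch_left {q : ℂ} (hq : ‖q‖ < 1) : Differentiable ℂ fun w => poch w q := by
  rw [← differentiableOn_univ]
  exact differentiableOn_poch isOpen_univ differentiableOn_id (differentiableOn_const _)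
    fun _ _ => hq

/-- `(w; q)_∞` is close to `1` for small `w`. -/
lemma norm_poch_sub_one_le (w : ℂ) {q : ℂ} (hq : ‖q‖ < 1) :
    ‖poch w q - 1‖ ≤ Real.exp (‖w‖ * (1 - ‖q‖)⁻¹) - 1 := by
  have hs := summable_poch w hq
  have ht : ∑' n : ℕ, ‖-(w * q ^ n)‖ = ‖w‖ * (1 - ‖q‖)⁻¹ := by
    simp only [norm_neg, norm_mul, norm_pow, tsum_mul_left,
      tsum_geometric_of_lt_one (norm_nonneg q) hq]
  refine le_of_tendsto (((multipliable_poch w hq).hasProd.sub_const 1).norm) (.of_forall fun t => ?_)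
  have h := t.norm_prod_one_add_sub_one_le fun n : ℕ => -(w * q ^ n)
  simp only [← sub_eq_add_neg] at h
  refine h.trans (sub_le_sub_right (Real.exp_le_exp.mpr ?_) 1)
  rw [← ht]
  exact hs.sum_le_tsum _ fun _ _ => norm_nonneg _

lemma eta_eq_poch {τ : ℂ} : ModularForm.eta τ = ex (τ / 24) * poch (ex τ) (ex τ) := by
  have h1 : Function.Periodic.qParam 24 τ = ex (τ / 24) := by
    simp only [Function.Periodic.qParam, ex]; congr 1; push_cast; ring
  have h2 : Function.Periodic.qParam 1 τ = ex τ := by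
    simp only [Function.Periodic.qParam, ex]; congr 1; push_cast; ring
  simp only [ModularForm.eta, ModularForm.eta_q, h1, h2, poch, pow_succ']

/-- `θ₁/η³`, normalized so that its derivative at `0` is `2π`. -/
def kfun (z τ : ℂ) : ℂ :=
  -Complex.I * ex (z / 2) * (poch (ex (-z)) (ex τ) * poch (ex τ * ex z) (ex τ)) /
    poch (ex τ) (ex τ) ^ 2

lemma tprod_three {τ : ℂ} (hτ : 0 < τ.im) (u v : ℂ) :
    ∏' n : ℕ, (1 - u * ex τ ^ n) * (1 - v * ex τ ^ n) * (1 - ex τ * ex τ ^ n) =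
      poch u (ex τ) * poch v (ex τ) * poch (ex τ) (ex τ) := by
  have hq := norm_ex_lt_one hτ
  rw [((multipliable_poch u hq).mul (multipliable_poch v hq)).tprod_mul (multipliable_poch _ hq),
    (multipliable_poch u hq).tprod_mul (multipliable_poch v hq)]
  rfl

lemma ex_nat_mul_add (n : ℕ) (τ z : ℂ) : ex (n * τ + z) = ex z * ex τ ^ n := by
  rw [ex_add, ex_nat_mul, mul_comm]

lemma ex_succ_mul_add (n : ℕ) (τ z : ℂ) : ex ((n + 1) * τ + z) = ex (τ + z) * ex τ ^ n := by
  rw [← ex_nat_mul_add]; congr 1; ring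

lemma theta1_eq_poch {τ : ℂ} (hτ : 0 < τ.im) (z : ℂ) :
    theta1 τ z = -Complex.I * ex (τ / 8) * ex (z / 2) *
      (poch (ex (-z)) (ex τ) * poch (ex τ * ex z) (ex τ) * poch (ex τ) (ex τ)) := by
  rw [theta1, ← tprod_three hτ]
  congr 1
  refine tprod_congr fun n => ?_
  rw [sub_eq_add_neg ((n : ℂ) * τ) z, ex_nat_mul_add, ex_succ_mul_add, ← ex_add τ z,
    ← add_zero (((n : ℂ) + 1) * τ), ex_succ_mul_add, add_zero]

lemma theta2_eq_poch {τ : ℂ} (hτ : 0 < τ.im) (z : ℂ) :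
    theta2 τ z = ex (τ / 8) * ex (z / 2) *
      (poch (-ex (-z)) (ex τ) * poch (-(ex τ * ex z)) (ex τ) * poch (ex τ) (ex τ)) := by
  rw [theta2, ← tprod_three hτ]
  congr 1
  refine tprod_congr fun n => ?_
  rw [sub_eq_add_neg ((n : ℂ) * τ) z, ex_nat_mul_add, ex_succ_mul_add, ← ex_add τ z,
    ← add_zero (((n : ℂ) + 1) * τ), ex_succ_mul_add, add_zero]
  ring

lemma ex_half_mul_add (n : ℕ) (τ z : ℂ) :
    ex ((n + 1 / 2) * τ + z) = ex (τ / 2 + z) * ex τ ^ n := by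
  rw [← ex_nat_mul_add]; congr 1; ring

lemma theta4_eq_poch {τ : ℂ} (hτ : 0 < τ.im) (z : ℂ) :
    theta4 τ z = poch (ex (τ / 2 - z)) (ex τ) * poch (ex (τ / 2 + z)) (ex τ) *
      poch (ex τ) (ex τ) := by
  rw [theta4, ← tprod_three hτ]
  refine tprod_congr fun n => ?_
  rw [sub_eq_add_neg (((n : ℂ) + 1 / 2) * τ) z, ex_half_mul_add, ex_half_mul_add,
    ← add_zero (((n : ℂ) + 1) * τ), ex_succ_mul_add, add_zero, ← sub_eq_add_neg]

lemma theta3_eq_poch {τ : ℂ} (hτ : 0 < τ.im) (z : ℂ) :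
    theta3 τ z = poch (-ex (τ / 2 - z)) (ex τ) * poch (-ex (τ / 2 + z)) (ex τ) *
      poch (ex τ) (ex τ) := by
  rw [theta3, ← tprod_three hτ]
  refine tprod_congr fun n => ?_
  rw [sub_eq_add_neg (((n : ℂ) + 1 / 2) * τ) z, ex_half_mul_add, ex_half_mul_add,
    ← add_zero (((n : ℂ) + 1) * τ), ex_succ_mul_add, add_zero, ← sub_eq_add_neg]
  ring

lemma theta1_eq_kfun {τ : ℂ} (hτ : 0 < τ.im) (z : ℂ) :
    theta1 τ z = kfun z τ * ModularForm.eta τ ^ 3 := by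
  have h8 : ex (τ / 8) = ex (τ / 24) ^ 3 := by rw [← ex_nat_mul]; congr 1; push_cast; ring
  have := poch_self_ne_zero (norm_ex_lt_one hτ)
  rw [theta1_eq_poch hτ, eta_eq_poch, kfun, h8]
  field_simp

/-! ### Elliptic properties of `kfun` -/

lemma kfun_neg {τ : ℂ} (hτ : 0 < τ.im) (z : ℂ) : kfun (-z) τ = -kfun z τ := by
  have hq := norm_ex_lt_one hτ
  have h1 := poch_succ (ex (-z)) hq
  have h2 := poch_succ (ex z) hq
  have hz : ex z = ex (z / 2) ^ 2 := by rw [← ex_nat_mul]; congr 1; push_cast; ring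
  have h0 := ex_ne_zero (z / 2)
  rw [kfun, kfun, neg_neg, h1, h2, neg_div, ex_neg, ex_neg, hz, mul_comm (ex τ), mul_comm (ex τ)]
  field_simp
  ring

lemma kfun_add_one (z τ : ℂ) : kfun (z + 1) τ = -kfun z τ := by
  have h1 : ex (z + 1) = ex z := by simpa using ex_add_int z 1
  rw [kfun, kfun, add_div, ex_add, ex_half, ex_neg, ex_neg, h1]
  ring

lemma kfun_add_tau {τ : ℂ} (hτ : 0 < τ.im) (z : ℂ) :
    kfun (z + τ) τ = -ex (-z - τ / 2) * kfun z τ := by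
  have hq := norm_ex_lt_one hτ
  have h1 := poch_succ (ex (-(z + τ))) hq
  have h2 := poch_succ (ex τ * ex z) hq
  have e1 : ex (-(z + τ)) * ex τ = ex (-z) := by rw [← ex_add]; congr 1; ring
  have e2 : ex τ * ex (z + τ) = ex τ * ex z * ex τ := by rw [ex_add]; ring
  have e3 : ex (-(z + τ)) = (ex τ * ex z)⁻¹ := by rw [ex_neg, ex_add, mul_comm]
  have e4 : ex (-z - τ / 2) = (ex (τ / 2))⁻¹ * (ex z)⁻¹ := by
    rw [ex_sub, ex_neg]; field_simp
  have e5 : ex τ = ex (τ / 2) ^ 2 := by rw [← ex_nat_mul]; congr 1; push_cast; ring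
  rw [kfun, kfun, h1, h2, e1, e2, e3, e4, add_div, ex_add, ← ex_neg z]
  have := ex_ne_zero (τ / 2)
  have := ex_ne_zero z
  rw [show (ex τ * ex z)⁻¹ = ((ex (τ / 2)) ^ 2 * ex z)⁻¹ by rw [e5],
    show 1 - ex τ * ex z = 1 - ex (τ / 2) ^ 2 * ex z by rw [e5], ex_neg]
  field_simp
  ring

/-- The lattice `ℤτ + ℤ`. -/
def inLat (τ z : ℂ) : Prop := ∃ m n : ℤ, z = m * τ + n

lemma inLat_zero (τ : ℂ) : inLat τ 0 := ⟨0, 0, by simp⟩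

lemma inLat.add {τ z w : ℂ} (hz : inLat τ z) (hw : inLat τ w) : inLat τ (z + w) := by
  obtain ⟨m, n, rfl⟩ := hz
  obtain ⟨m', n', rfl⟩ := hw
  exact ⟨m + m', n + n', by push_cast; ring⟩

lemma inLat.neg {τ z : ℂ} (hz : inLat τ z) : inLat τ (-z) := by
  obtain ⟨m, n, rfl⟩ := hz
  exact ⟨-m, -n, by push_cast; ring⟩

lemma inLat_neg {τ z : ℂ} : inLat τ (-z) ↔ inLat τ z :=
  ⟨fun h => by simpa using h.neg, inLat.neg⟩

lemma inLat_add_iff {τ z w : ℂ} (hw : inLat τ w) : inLat τ (z + w) ↔ inLat τ z :=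
  ⟨fun h => by simpa using h.add hw.neg, fun h => h.add hw⟩

lemma inLat_self (τ : ℂ) : inLat τ τ := ⟨1, 0, by simp⟩

lemma ex_mul_zpow_eq_one {τ z : ℂ} {n : ℤ} (h : ex z * ex τ ^ n = 1) : inLat τ z := by
  rw [← ex_int_mul, ← ex_add, ex_eq_one_iff] at h
  obtain ⟨m, hm⟩ := h
  exact ⟨-n, m, by rw [← hm]; push_cast; ring⟩

lemma kfun_ne_zero {τ z : ℂ} (hτ : 0 < τ.im) (hz : ¬ inLat τ z) : kfun z τ ≠ 0 := by
  have hq := norm_ex_lt_one hτ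
  have h1 : poch (ex (-z)) (ex τ) ≠ 0 := poch_ne_zero hq fun n h =>
    hz (inLat_neg.mp (ex_mul_zpow_eq_one (n := n) (by exact_mod_cast h)))
  have h2 : poch (ex τ * ex z) (ex τ) ≠ 0 := poch_ne_zero hq fun n h =>
    hz (ex_mul_zpow_eq_one (n := (n + 1 : ℕ)) (by
      rw [zpow_natCast, ← h]; ring))
  have h3 := poch_self_ne_zero hq
  simp [kfun, h1, h2, h3, ex_ne_zero]

@[simp] lemma kfun_zero (τ : ℂ) : kfun 0 τ = 0 := by
  have : poch 1 (ex τ) = 0 := by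
    rw [poch]
    exact tprod_of_exists_eq_zero ⟨0, by simp⟩
  simp [kfun, this]

/-- The zero at the origin is carried along the lattice by the two quasi-periods, in both
directions. -/
lemma kfun_eq_zero_of_inLat {τ : ℂ} (hτ : 0 < τ.im) {z : ℂ} (hz : inLat τ z) :
    kfun z τ = 0 := by
  have h1 : ∀ (n : ℤ) (z : ℂ), kfun z τ = 0 → kfun (z + n) τ = 0 := by
    intro n
    induction n using Int.induction_on with
    | zero => simp
    | succ n ih =>
      intro z hz
      have := kfun_add_one (z + n) τ
      push_cast
      rw [← add_assoc, this]
      simpa using ih z hz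
    | pred n ih =>
      intro z hz
      have := kfun_add_one (z + ((-n - 1 : ℤ) : ℂ)) τ
      rw [← neg_eq_zero, ← this]
      convert ih z hz using 2
      push_cast; ring
  have h2 : ∀ (n : ℤ) (z : ℂ), kfun z τ = 0 → kfun (z + n * τ) τ = 0 := by
    intro n
    induction n using Int.induction_on with
    | zero => simp
    | succ n ih =>
      intro z hz
      have := kfun_add_tau hτ (z + n * τ)
      push_cast
      rw [add_mul, one_mul, ← add_assoc, this]
      have h := ih z hz
      push_cast at h
      rw [h, mul_zero]
    | pred n ih =>
      intro z hz
      have := kfun_add_tau hτ (z + ((-n - 1 : ℤ) : ℂ) * τ)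
      have h := ih z hz
      rw [show z + ((-n - 1 : ℤ) : ℂ) * τ + τ = z + ((-n : ℤ) : ℂ) * τ by push_cast; ring, h] at this
      simpa [ex_ne_zero] using this.symm
  obtain ⟨m, n, rfl⟩ := hz
  have := h1 n _ (h2 m 0 (kfun_zero τ))
  simpa using this

lemma kfun_eq_zero_iff {τ : ℂ} (hτ : 0 < τ.im) {z : ℂ} : kfun z τ = 0 ↔ inLat τ z :=
  ⟨fun h => by_contra fun hz => kfun_ne_zero hτ hz h, kfun_eq_zero_of_inLat hτ⟩

lemma differentiable_kfun {τ : ℂ} (hτ : 0 < τ.im) : Differentiable ℂ fun z => kfun z τ := by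
  have hp := differentiable_poch_left (norm_ex_lt_one hτ)
  have h1 : Differentiable ℂ fun z => poch (ex (-z)) (ex τ) :=
    hp.comp (by fun_prop : Differentiable ℂ fun z => ex (-z))
  have h2 : Differentiable ℂ fun z => poch (ex τ * ex z) (ex τ) :=
    hp.comp (by fun_prop : Differentiable ℂ fun z => ex τ * ex z)
  unfold kfun
  fun_prop

end Mathieu

namespace Mathieu

open Filter Topology

/-! ### The Weierstrass function as a Lambert series -/

lemma exists_mul_pow_le (C : ℝ) {r ε : ℝ} (h0 : 0 ≤ r) (hr : r < 1) (hε : 0 < ε) :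
    ∃ N : ℕ, ∀ n, N ≤ n → C * r ^ n ≤ ε := by
  have h : Tendsto (fun n : ℕ => C * r ^ n) atTop (𝓝 (C * 0)) :=
    (tendsto_pow_atTop_nhds_zero_of_lt_one h0 hr).const_mul C
  rw [mul_zero] at h
  exact eventually_atTop.mp (h.eventually (eventually_le_nhds hε))

/-- A series of holomorphic functions with a summable bound outside a finite set of indices
is holomorphic. -/
lemma differentiableOn_tsum_of_bound {ι : Type*} {U : Set ℂ} (hU : IsOpen U) {F : ι → ℂ → ℂ}
    (hF : ∀ i, DifferentiableOn ℂ (F i) U) {u : ι → ℝ} (hu : Summable u) (s : Finset ι)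
    (hb : ∀ i ∉ s, ∀ z ∈ U, ‖F i z‖ ≤ u i) :
    DifferentiableOn ℂ (fun z => ∑' i, F i z) U ∧ ∀ z ∈ U, Summable fun i => F i z := by
  have hsum : ∀ z ∈ U, Summable fun i => F i z := fun z hz =>
    Summable.of_norm_bounded_eventually hu
      ((Finset.finite_toSet s).subset fun i hi => by_contra fun h => hi (hb i h z hz))
  refine ⟨?_, hsum⟩
  have h2 : DifferentiableOn ℂ (fun z => ∑' i : {i // i ∉ s}, F i z) U :=
    Complex.differentiableOn_tsum_of_summable_norm (hu.subtype {i | i ∉ s}) (fun i => hF i) hU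
      fun i z hz => hb i i.2 z hz
  have h1 : DifferentiableOn ℂ (fun z => ∑ i ∈ s, F i z) U :=
    DifferentiableOn.fun_sum fun i _ => hF i
  refine (h1.add h2).congr fun z hz => ?_
  exact ((hsum z hz).sum_add_tsum_subtype_compl s).symm

/-- `w/(1-w)²`. -/
def gfun (w : ℂ) : ℂ := w / (1 - w) ^ 2

lemma gfun_inv (w : ℂ) : gfun w⁻¹ = gfun w := by
  rcases eq_or_ne w 0 with rfl | hw
  · simp [gfun]
  rcases eq_or_ne w 1 with rfl | h1
  · simp [gfun]
  have h2 : 1 - w ≠ 0 := sub_ne_zero.mpr h1.symm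
  have h3 : w - 1 ≠ 0 := sub_ne_zero.mpr h1
  have h4 : 1 - w⁻¹ = (w - 1) / w := by field_simp
  rw [gfun, gfun, h4]
  field_simp
  ring

lemma norm_gfun_le {w : ℂ} (hw : ‖w‖ ≤ 1 / 2) : ‖gfun w‖ ≤ 4 * ‖w‖ := by
  have h1 : 1 / 2 ≤ ‖1 - w‖ := by
    have := norm_sub_norm_le 1 w
    rw [norm_one] at this
    linarith
  rw [gfun, norm_div, norm_pow, div_le_iff₀ (by positivity)]
  have : (1 / 2 : ℝ) ^ 2 ≤ ‖1 - w‖ ^ 2 := by gcongr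
  nlinarith [norm_nonneg w]

lemma differentiableAt_gfun {w : ℂ} (h : w ≠ 1) : DifferentiableAt ℂ gfun w := by
  have : (1 - w) ^ 2 ≠ 0 := pow_ne_zero _ (sub_ne_zero.mpr h.symm)
  unfold gfun
  fun_prop (disch := assumption)

/-- The Lambert series `∑_{n ≥ 0} u qⁿ / (1 - u qⁿ)²`. -/
def afun (u q : ℂ) : ℂ := ∑' n : ℕ, gfun (u * q ^ n)

lemma norm_gfun_mul_pow_le {u q : ℂ} {C r : ℝ} (hu : ‖u‖ ≤ C) (hq : ‖q‖ ≤ r) {n : ℕ}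
    (hn : C * r ^ n ≤ 1 / 2) : ‖gfun (u * q ^ n)‖ ≤ 4 * (C * r ^ n) := by
  have h : ‖u * q ^ n‖ ≤ C * r ^ n := by
    rw [norm_mul, norm_pow]
    exact mul_le_mul hu (pow_le_pow_left₀ (norm_nonneg _) hq n) (by positivity)
      ((norm_nonneg _).trans hu)
  exact (norm_gfun_le (h.trans hn)).trans (by linarith)

lemma summable_afun (u : ℂ) {q : ℂ} (hq : ‖q‖ < 1) : Summable fun n : ℕ => gfun (u * q ^ n) := by
  obtain ⟨N, hN⟩ := exists_mul_pow_le ‖u‖ (norm_nonneg q) hq (by norm_num : (0 : ℝ) < 1 / 2)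
  refine Summable.of_norm_bounded_eventually
    (((summable_geometric_of_lt_one (norm_nonneg q) hq).mul_left ‖u‖).mul_left 4)
    ((Finset.finite_toSet (Finset.range N)).subset fun n hn => ?_)
  by_contra h
  exact hn (norm_gfun_mul_pow_le le_rfl le_rfl (hN n (by simpa using h)))

lemma afun_succ (u : ℂ) {q : ℂ} (hq : ‖q‖ < 1) : afun u q = gfun u + afun (u * q) q := by
  rw [afun, (summable_afun u hq).tsum_eq_zero_add, afun]
  simp [pow_succ', mul_assoc]

lemma mul_pow_ne_one_of_poch_ne_zero {u q : ℂ} (h : poch u q ≠ 0) (n : ℕ) : u * q ^ n ≠ 1 :=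
  fun h1 => h (tprod_of_exists_eq_zero ⟨n, by rw [h1, sub_self]⟩)

/-- Nonvanishing of `poch` is a compact way to say that no u qⁿ equals 1, that is, that no term of
the Lambert series has a pole. Only finitely many terms escape the geometric bound, locally in the
parameter. -/
lemma differentiableOn_afun {U : Set ℂ} (hU : IsOpen U) {u q : ℂ → ℂ}
    (hu : DifferentiableOn ℂ u U) (hq : DifferentiableOn ℂ q U) (h1 : ∀ s ∈ U, ‖q s‖ < 1)
    (h0 : ∀ s ∈ U, poch (u s) (q s) ≠ 0) :
    DifferentiableOn ℂ (fun s => afun (u s) (q s)) U := by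
  intro s0 hs0
  obtain ⟨r, hr, hr1⟩ := exists_between (h1 s0 hs0)
  have hc1 := (hu.differentiableAt (hU.mem_nhds hs0)).continuousAt.norm
  have hc2 := (hq.differentiableAt (hU.mem_nhds hs0)).continuousAt.norm
  have hev : ∀ᶠ s in 𝓝 s0, s ∈ U ∧ ‖u s‖ < ‖u s0‖ + 1 ∧ ‖q s‖ < r :=
    (show ∀ᶠ s in 𝓝 s0, s ∈ U from hU.mem_nhds hs0).and ((hc1.eventually_lt_const (by simp)).and (hc2.eventually_lt_const hr))
  obtain ⟨V, hV, hVo, hs0V⟩ := eventually_nhds_iff.mp hev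
  obtain ⟨N, hN⟩ := exists_mul_pow_le (‖u s0‖ + 1) ((norm_nonneg _).trans hr.le) hr1
    (by norm_num : (0 : ℝ) < 1 / 2)
  have h0r := (norm_nonneg _).trans hr.le
  have := (differentiableOn_tsum_of_bound hVo (F := fun (n : ℕ) s => gfun (u s * q s ^ n))
    (fun n s hs => ?_)
    (((summable_geometric_of_lt_one h0r hr1).mul_left (‖u s0‖ + 1)).mul_left 4)
    (Finset.range N) (fun n hn s hs => norm_gfun_mul_pow_le (hV s hs).2.1.le (hV s hs).2.2.le
      (hN n (by simpa using hn)))).1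
  · exact (this.differentiableAt (hVo.mem_nhds hs0V)).differentiableWithinAt
  · have hsU := (hV s hs).1
    have hd := (hu.mul (hq.pow n)).differentiableAt (hU.mem_nhds hsU)
    exact ((differentiableAt_gfun (mul_pow_ne_one_of_poch_ne_zero (h0 s hsU) n)).comp s
      hd).differentiableWithinAt

/-- `∑_{n ∈ ℤ} y qⁿ / (1 - y qⁿ)²`. -/
def wfun (z τ : ℂ) : ℂ := afun (ex z) (ex τ) + afun (ex τ * ex (-z)) (ex τ)

/-- The term n = 0 is the only singular one at the origin; it is split off from the rest. -/
lemma wfun_eq_gfun_add {τ : ℂ} (hτ : 0 < τ.im) (z : ℂ) :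
    wfun z τ = gfun (ex z) + (afun (ex τ * ex z) (ex τ) + afun (ex τ * ex (-z)) (ex τ)) := by
  rw [wfun, afun_succ (ex z) (norm_ex_lt_one hτ), mul_comm (ex z), add_assoc]

lemma wfun_add_one (z τ : ℂ) : wfun (z + 1) τ = wfun z τ := by
  have h1 : ex (z + 1) = ex z := by simpa using ex_add_int z 1
  rw [wfun, wfun, ex_neg, ex_neg, h1]

lemma wfun_add_tau {τ : ℂ} (hτ : 0 < τ.im) (z : ℂ) : wfun (z + τ) τ = wfun z τ := by
  have hq := norm_ex_lt_one hτ
  have e1 : ex τ * ex (-(z + τ)) = ex (-z) := by rw [← ex_add]; congr 1; ring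
  rw [wfun, e1, wfun_eq_gfun_add hτ, afun_succ (ex (-z)) hq, ex_add, ex_neg, gfun_inv,
    mul_comm (ex z), mul_comm (ex z)⁻¹]
  ring

lemma poch_ne_zero_of_not_inLat {τ z : ℂ} (hτ : 0 < τ.im) (hz : ¬ inLat τ z) :
    poch (ex z) (ex τ) ≠ 0 ∧ poch (ex τ * ex (-z)) (ex τ) ≠ 0 := by
  have hq := norm_ex_lt_one hτ
  refine ⟨poch_ne_zero hq fun n h => hz (ex_mul_zpow_eq_one (n := n) (by exact_mod_cast h)),
    poch_ne_zero hq fun n h => hz (inLat_neg.mp (ex_mul_zpow_eq_one (n := (n + 1 : ℕ)) ?_))⟩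
  rw [zpow_natCast, ← h]; ring

lemma isOpen_not_inLat {τ : ℂ} (hτ : 0 < τ.im) : IsOpen {z | ¬ inLat τ z} := by
  have : {z | ¬ inLat τ z} = (fun z => kfun z τ) ⁻¹' {0}ᶜ := by
    ext z; simp [kfun_eq_zero_iff hτ]
  rw [this]
  exact isOpen_compl_singleton.preimage (differentiable_kfun hτ).continuous

lemma differentiableAt_wfun {τ z : ℂ} (hτ : 0 < τ.im) (hz : ¬ inLat τ z) :
    DifferentiableAt ℂ (fun z => wfun z τ) z := by
  have hU := isOpen_not_inLat hτ
  have h : DifferentiableOn ℂ (fun z => wfun z τ) {z | ¬ inLat τ z} :=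
    (differentiableOn_afun hU (by fun_prop) (by fun_prop) (fun _ _ => norm_ex_lt_one hτ)
      fun s hs => (poch_ne_zero_of_not_inLat hτ hs).1).add
    (differentiableOn_afun hU (by fun_prop) (by fun_prop) (fun _ _ => norm_ex_lt_one hτ)
      fun s hs => (poch_ne_zero_of_not_inLat hτ hs).2)
  exact h.differentiableAt (hU.mem_nhds hz)

/-! ### Liouville's theorem for elliptic functions -/

lemma eventually_not_inLat {τ : ℂ} (hτ : 0 < τ.im) : ∀ᶠ z in 𝓝[≠] (0 : ℂ), ¬ inLat τ z := by
  have hτ0 : 0 < min τ.im 1 := lt_min hτ one_pos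
  rw [eventually_nhdsWithin_iff]
  filter_upwards [Metric.ball_mem_nhds (0 : ℂ) hτ0] with z hz hz0 ⟨m, n, h⟩
  rw [mem_ball_zero_iff] at hz
  have h1 : |z.im| < τ.im := (Complex.abs_im_le_norm z).trans_lt (hz.trans_le (min_le_left _ _))
  have h2 : |z.re| < 1 := (Complex.abs_re_le_norm z).trans_lt (hz.trans_le (min_le_right _ _))
  have hm : m = 0 := by
    rw [h] at h1
    simp only [Complex.add_im, Complex.mul_im, Complex.intCast_re, Complex.intCast_im, zero_mul,
      add_zero, abs_mul, abs_of_pos hτ] at h1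
    have : |(m : ℝ)| < 1 := by
      by_contra! hc
      nlinarith
    exact_mod_cast Int.abs_lt_one_iff.mp (by exact_mod_cast this)
  subst hm
  rw [h] at h2
  simp only [Int.cast_zero, zero_mul, zero_add, Complex.intCast_re] at h2
  have hn : n = 0 := Int.abs_lt_one_iff.mp (by exact_mod_cast h2)
  exact hz0 (by rw [h, hn]; simp)

/-- Translation to the fundamental parallelogram, with fractional parts as coordinates. -/
lemma exists_reduce {τ : ℂ} (hτ : 0 < τ.im) (z : ℂ) :
    ∃ m n : ℤ, ‖z - (m * τ + n)‖ ≤ ‖τ‖ + 1 := by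
  refine ⟨⌊z.im / τ.im⌋, ⌊(z - ⌊z.im / τ.im⌋ * τ).re - Int.fract (z.im / τ.im) * τ.re⌋, ?_⟩
  set m := ⌊z.im / τ.im⌋ with hm
  set t := Int.fract (z.im / τ.im) with ht
  set w := (z - m * τ).re - t * τ.re with hw
  have him : z.im = (m + t) * τ.im := by
    rw [hm, ht, Int.floor_add_fract]; field_simp
  have key : z - (m * τ + ⌊w⌋) = (t : ℝ) * τ + ((Int.fract w : ℝ) : ℂ) := by
    apply Complex.ext
    · simp only [Complex.sub_re, Complex.add_re, Complex.intCast_re, Complex.mul_re,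
        Complex.ofReal_re, Complex.ofReal_im, Complex.intCast_im, zero_mul, sub_zero,
        ← Int.self_sub_floor w]
      rw [show (w : ℝ) = z.re - m * τ.re - t * τ.re by simp [hw]]
      ring
    · simp [him]; ring
  rw [key]
  refine (norm_add_le _ _).trans (add_le_add ?_ ?_)
  · rw [norm_mul, Complex.norm_real, Real.norm_of_nonneg (Int.fract_nonneg _)]
    exact mul_le_of_le_one_left (norm_nonneg _) (Int.fract_lt_one _).le
  · rw [Complex.norm_real, Real.norm_of_nonneg (Int.fract_nonneg _)]
    exact (Int.fract_lt_one _).le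

/-- Periodicity along both generators implies periodicity along the lattice. -/
lemma periodic_of_generators {τ : ℂ} {f : ℂ → ℂ} (h1 : ∀ z, f (z + 1) = f z)
    (h2 : ∀ z, f (z + τ) = f z) (z : ℂ) (m n : ℤ) : f (z + (m * τ + n)) = f z := by
  have p1 : Function.Periodic f (m * τ) := by
    simpa using (show Function.Periodic f τ from h2).int_mul m
  have p2 : Function.Periodic f (n : ℂ) := by
    simpa using (show Function.Periodic f 1 from h1).int_mul n
  exact (p1.add_period p2) z

/-- An elliptic function without singularities outside the lattice, and with at most a removable
singularity at the origin, is constant. -/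
lemma elliptic_const {τ : ℂ} (hτ : 0 < τ.im) {f : ℂ → ℂ} (h1 : ∀ z, f (z + 1) = f z)
    (h2 : ∀ z, f (z + τ) = f z) (hd : ∀ z, ¬ inLat τ z → DifferentiableAt ℂ f z)
    (h0 : Tendsto (fun z => z * f z) (𝓝[≠] 0) (𝓝 0)) :
    ∃ c, (∀ z, ¬ inLat τ z → f z = c) ∧ Tendsto f (𝓝[≠] 0) (𝓝 c) := by
  classical
  -- The hypothesis z f(z) → 0, in the form required by Riemann's theorem on removable
  -- singularities.
  have ho : (fun z => f z - f 0) =o[𝓝[≠] (0 : ℂ)] fun z => (z - 0)⁻¹ := by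
    simp only [sub_zero]
    rw [Asymptotics.isLittleO_iff_tendsto' (by
      filter_upwards [self_mem_nhdsWithin] with z hz h
      exact absurd (inv_eq_zero.mp h) hz)]
    have h3 : Tendsto (fun z : ℂ => z * f 0) (𝓝[≠] 0) (𝓝 0) := by
      have : Tendsto (fun z : ℂ => z * f 0) (𝓝 0) (𝓝 (0 * f 0)) :=
        (continuous_id.mul continuous_const).tendsto 0
      rw [zero_mul] at this
      exact this.mono_left nhdsWithin_le_nhds
    have := h0.sub h3
    rw [sub_zero] at this
    refine this.congr fun z => ?_
    rw [div_inv_eq_mul]; ring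
  have hev : ∀ᶠ z in 𝓝[≠] (0 : ℂ), DifferentiableAt ℂ f z :=
    (eventually_not_inLat hτ).mono fun z hz => hd z hz
  have hlim := Complex.tendsto_limUnder_of_differentiable_on_punctured_nhds_of_isLittleO hev ho
  set c := limUnder (𝓝[≠] (0 : ℂ)) f with hc
  -- The values of f on the lattice are arbitrary, so they are replaced by the limit at the origin.
  -- The new function is entire, doubly periodic and hence bounded.
  set F : ℂ → ℂ := fun z => if inLat τ z then c else f z with hF
  have hper : ∀ z (m n : ℤ), F (z + (m * τ + n)) = F z := fun z m n => by
    simp only [hF, inLat_add_iff (⟨m, n, rfl⟩ : inLat τ (m * τ + n)),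
      periodic_of_generators h1 h2]
  have hF0 : DifferentiableAt ℂ F 0 := by
    rw [eventually_nhdsWithin_iff] at hev
    have hmem : {z : ℂ | z ≠ 0 → DifferentiableAt ℂ f z} ∈ 𝓝 (0 : ℂ) := hev
    have h := Complex.differentiableOn_update_limUnder_of_isLittleO hmem
      (fun z hz => (hz.1 hz.2).differentiableWithinAt) ho
    refine (h.differentiableAt hmem).congr_of_eventuallyEq ?_
    have h3 := eventually_not_inLat hτ
    rw [eventually_nhdsWithin_iff] at h3
    filter_upwards [h3] with z hz
    rcases eq_or_ne z 0 with rfl | hz0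
    · simp [hF, inLat_zero, hc]
    · simp [hF, hz hz0, Function.update_of_ne hz0]
  have hFd : Differentiable ℂ F := by
    intro z
    by_cases hz : inLat τ z
    · obtain ⟨m, n, rfl⟩ := hz
      have : F = fun w => F (w + ((-m : ℤ) * τ + (-n : ℤ))) := by
        funext w; rw [hper]
      rw [this]
      refine DifferentiableAt.comp (m * τ + n) (g := F) (f := fun w => w + ((-m : ℤ) * τ + (-n : ℤ)))
        ?_ (by fun_prop)
      have e : (m * τ + n + ((-m : ℤ) * τ + (-n : ℤ)) : ℂ) = 0 := by push_cast; ring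
      simpa only [e] using hF0
    · refine (hd z hz).congr_of_eventuallyEq ?_
      filter_upwards [(isOpen_not_inLat hτ).mem_nhds hz] with w hw
      simp only [hF]
      rw [if_neg hw]
  have hb : Bornology.IsBounded (Set.range F) := by
    refine ((isCompact_closedBall (0 : ℂ) (‖τ‖ + 1)).image hFd.continuous).isBounded.subset ?_
    rintro _ ⟨z, rfl⟩
    obtain ⟨m, n, hmn⟩ := exists_reduce hτ z
    refine ⟨z - (m * τ + n), by simpa using hmn, ?_⟩
    rw [← hper _ m n, sub_add_cancel]
  refine ⟨c, fun z hz => ?_, hlim⟩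
  have := hFd.apply_eq_apply_of_bounded hb z 0
  simpa [hF, hz, inLat_zero] using this

end Mathieu

namespace Mathieu

open Filter Topology

/-! ### Behaviour at the origin -/

/-- `2 - y - 1/y = 4 sin² πz`. -/
def sfun (z : ℂ) : ℂ := 2 - ex z - ex (-z)

lemma gfun_ex (z : ℂ) : gfun (ex z) = -(sfun z)⁻¹ := by
  have h0 := ex_ne_zero z
  have : sfun z = -((1 - ex z) ^ 2 / ex z) := by
    rw [sfun, ex_neg]; field_simp; ring
  rw [this, gfun, inv_neg, neg_neg, inv_div]

/-- `∏_{n > 0} (1 + s qⁿ/(1-qⁿ)²)`. -/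
def psifun (τ s : ℂ) : ℂ := ∏' n : ℕ, (1 + s * gfun (ex τ * ex τ ^ n))

lemma summable_norm_gfun {τ : ℂ} (hτ : 0 < τ.im) :
    Summable fun n : ℕ => ‖gfun (ex τ * ex τ ^ n)‖ := (summable_afun _ (norm_ex_lt_one hτ)).norm

lemma ex_mul_pow_ne_one {τ : ℂ} (hτ : 0 < τ.im) (n : ℕ) : ex τ * ex τ ^ n ≠ 1 :=
  mul_pow_ne_one_of_poch_ne_zero (poch_self_ne_zero (norm_ex_lt_one hτ)) n

/-- Factor by factor, (1 - Qy)(1 - Q/y) = (1 - Q)² (1 + s Q/(1-Q)²) with s = 2 - y - 1/y. Everything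
even in z thus becomes a power series in s. -/
lemma poch_mul_poch {τ : ℂ} (hτ : 0 < τ.im) (z : ℂ) :
    poch (ex τ * ex z) (ex τ) * poch (ex τ * ex (-z)) (ex τ) =
      poch (ex τ) (ex τ) ^ 2 * psifun τ (sfun z) := by
  have hq := norm_ex_lt_one hτ
  have hm : Multipliable fun n : ℕ => 1 + sfun z * gfun (ex τ * ex τ ^ n) :=
    multipliable_one_add_of_summable (by simpa using (summable_norm_gfun hτ).mul_left ‖sfun z‖)
  have hp := multipliable_poch (ex τ) hq
  rw [sq]
  simp only [poch, psifun]
  rw [← (multipliable_poch _ hq).tprod_mul (multipliable_poch _ hq), ← hp.tprod_mul hp,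
    ← (hp.mul hp).tprod_mul hm]
  refine tprod_congr fun n => ?_
  have h1 : 1 - ex τ * ex τ ^ n ≠ 0 := sub_ne_zero.mpr (ex_mul_pow_ne_one hτ n).symm
  have h0 := ex_ne_zero z
  rw [gfun, sfun, ex_neg]
  field_simp
  ring

lemma kfun_eq_psifun {τ : ℂ} (hτ : 0 < τ.im) (z : ℂ) :
    kfun z τ = -Complex.I * ex (z / 2) * (1 - ex (-z)) * psifun τ (sfun z) := by
  have hq := norm_ex_lt_one hτ
  have := poch_self_ne_zero hq
  rw [kfun, poch_succ (ex (-z)) hq, mul_comm (ex (-z)) (ex τ)]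
  have h := poch_mul_poch hτ z
  rw [div_eq_iff (pow_ne_zero 2 this)]
  linear_combination (-Complex.I * ex (z / 2) * (1 - ex (-z))) * h

lemma kfun_sq {τ : ℂ} (hτ : 0 < τ.im) (z : ℂ) :
    kfun z τ ^ 2 = sfun z * psifun τ (sfun z) ^ 2 := by
  have hz : ex z = ex (z / 2) ^ 2 := by rw [← ex_nat_mul]; congr 1; push_cast; ring
  have h0 := ex_ne_zero (z / 2)
  rw [kfun_eq_psifun hτ]
  generalize psifun τ (sfun z) = p
  rw [sfun, ex_neg, hz]
  field_simp
  linear_combination (ex (z / 2) ^ 2 - 1) ^ 2 * p ^ 2 * Complex.I_sq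

/-- The derivative of a product of factors 1 + s gₙ at s = 0 is the sum of the gₙ. -/
lemma hasDerivAt_psifun {τ : ℂ} (hτ : 0 < τ.im) :
    HasDerivAt (psifun τ) (afun (ex τ) (ex τ)) 0 := by
  have hs := summable_norm_gfun hτ
  have hd : ∀ n : ℕ, Differentiable ℂ fun s : ℂ => 1 + s * gfun (ex τ * ex τ ^ n) := fun n => by
    fun_prop
  have hl : HasProdLocallyUniformlyOn (fun (n : ℕ) (s : ℂ) => 1 + s * gfun (ex τ * ex τ ^ n))
      (psifun τ) Set.univ := by
    apply hasProdLocallyUniformlyOn_of_forall_compact isOpen_univ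
    intro K _ hcK
    rcases K.eq_empty_or_nonempty with hN | hN
    · simpa [hasProdUniformlyOn_iff_tendstoUniformlyOn, hN] using tendstoUniformlyOn_empty
    · obtain ⟨s0, hs0, HB⟩ := hcK.exists_isMaxOn hN continuous_norm.continuousOn
      refine (hs.mul_left ‖s0‖).hasProdUniformlyOn_nat_one_add hcK (.of_forall fun n x hx => ?_)
        (fun n => by fun_prop)
      rw [norm_mul]
      exact mul_le_mul_of_nonneg_right (HB hx) (norm_nonneg _)
  have hdiff : DifferentiableAt ℂ (psifun τ) 0 := by
    have := hl.differentiableOn (.of_forall fun t => by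
      have : DifferentiableOn ℂ (fun s => ∏ n ∈ t, (1 + s * gfun (ex τ * ex τ ^ n))) Set.univ :=
        DifferentiableOn.fun_finsetProd fun n _ => (hd n).differentiableOn
      exact this) isOpen_univ
    exact (this 0 (Set.mem_univ _)).differentiableAt univ_mem
  have h0 : psifun τ 0 = 1 := by simp [psifun]
  have hlog := logDeriv_tprod_eq_tsum (s := Set.univ) isOpen_univ (Set.mem_univ (0 : ℂ))
    (f := fun (n : ℕ) (s : ℂ) => 1 + s * gfun (ex τ * ex τ ^ n)) (fun n => by simp)
    (fun n => (hd n).differentiableOn) (by simpa [logDeriv_apply] using hs.of_norm) ⟨_, hl⟩ (by simp)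
  have hlog' : logDeriv (psifun τ) 0 = afun (ex τ) (ex τ) := by
    simpa [logDeriv_apply, afun, h0] using! hlog
  rw [logDeriv_apply, h0, div_one] at hlog'
  rw [← hlog']
  exact hdiff.hasDerivAt

lemma sfun_ne_zero_iff {z : ℂ} : sfun z = 0 ↔ ex z = 1 := by
  have h0 := ex_ne_zero z
  have : sfun z = -((1 - ex z) ^ 2 / ex z) := by
    rw [sfun, ex_neg]; field_simp; ring
  rw [this, neg_eq_zero, div_eq_zero_iff, or_iff_left h0, sq_eq_zero_iff, sub_eq_zero, eq_comm]

lemma tendsto_sfun : Tendsto sfun (𝓝[≠] 0) (𝓝[≠] 0) := by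
  rw [tendsto_nhdsWithin_iff]
  constructor
  · have : Continuous sfun := by
      have := differentiable_ex.continuous
      unfold sfun; fun_prop
    have h := this.tendsto 0
    rw [show sfun 0 = 0 by norm_num [sfun]] at h
    exact h.mono_left nhdsWithin_le_nhds
  -- The zeros of `sfun` are the integers; the lattice of τ = i is used only because it contains
  -- them and is discrete.
  · have hτ : 0 < Complex.I.im := by simp
    filter_upwards [eventually_not_inLat hτ] with z hz h
    rw [Set.mem_singleton_iff, sfun_ne_zero_iff, ex_eq_one_iff] at h
    obtain ⟨n, hn⟩ := h
    exact hz ⟨0, n, by simpa using hn⟩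

lemma hasDerivAt_ex_zero : HasDerivAt ex (2 * Real.pi * Complex.I) 0 := by
  simpa using hasDerivAt_ex 0

lemma hasDerivAt_kfun_zero {τ : ℂ} (hτ : 0 < τ.im) :
    HasDerivAt (fun z => kfun z τ) (2 * Real.pi) 0 := by
  have e0 : HasDerivAt ex (2 * Real.pi * Complex.I) (-(0 : ℂ)) := by simpa using hasDerivAt_ex 0
  have h1 : HasDerivAt (fun z : ℂ => 1 - ex (-z)) (2 * Real.pi * Complex.I) 0 := by
    have := ((HasDerivAt.comp (0 : ℂ) e0 (hasDerivAt_neg (0 : ℂ))).const_sub 1)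
    simpa [Function.comp_def] using this
  have hs : DifferentiableAt ℂ sfun 0 := by unfold sfun; fun_prop
  have h2 : DifferentiableAt ℂ (fun z => -Complex.I * ex (z / 2) * psifun τ (sfun z)) 0 := by
    have h3 : DifferentiableAt ℂ (psifun τ) (sfun 0) := by
      rw [show sfun 0 = 0 by norm_num [sfun]]
      exact (hasDerivAt_psifun hτ).differentiableAt
    have h4 : DifferentiableAt ℂ (fun z => psifun τ (sfun z)) 0 := h3.comp (0 : ℂ) hs
    fun_prop
  have h3 := h1.mul h2.hasDerivAt
  have e : (fun z => kfun z τ) =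
      (fun z : ℂ => 1 - ex (-z)) * fun z => -Complex.I * ex (z / 2) * psifun τ (sfun z) := by
    funext z
    simp only [kfun_eq_psifun hτ, Pi.mul_apply]
    ring
  rw [e]
  refine h3.congr_deriv ?_
  have h0 : psifun τ (sfun 0) = 1 := by simp [psifun, sfun]; norm_num
  simp only [h0, neg_zero, zero_div, ex_zero]
  linear_combination (-2 * (Real.pi : ℂ)) * Complex.I_sq

lemma tendsto_kfun_div {τ : ℂ} (hτ : 0 < τ.im) :
    Tendsto (fun z => kfun z τ / z) (𝓝[≠] 0) (𝓝 (2 * Real.pi)) := by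
  have := (hasDerivAt_kfun_zero hτ).tendsto_slope
  refine this.congr fun z => ?_
  simp [slope_def_field]

lemma continuousAt_wfun_regular {τ : ℂ} (hτ : 0 < τ.im) :
    ContinuousAt (fun z => afun (ex τ * ex z) (ex τ) + afun (ex τ * ex (-z)) (ex τ)) 0 := by
  have hq := norm_ex_lt_one hτ
  have hp := differentiable_poch_left hq
  have hU : IsOpen ({u : ℂ | poch u (ex τ) ≠ 0}) :=
    isOpen_compl_singleton.preimage hp.continuous
  have h := differentiableOn_afun hU differentiableOn_id (differentiableOn_const (ex τ))
    (fun _ _ => hq) (fun _ h => h)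
  have ha : ContinuousAt (fun u => afun u (ex τ)) (ex τ) :=
    (h.differentiableAt (hU.mem_nhds (poch_self_ne_zero hq))).continuousAt
  have hc := differentiable_ex.continuous
  refine ContinuousAt.add (ContinuousAt.comp (f := fun z => ex τ * ex z) (g := fun u => afun u (ex τ))
    (by simpa using ha) (by fun_prop)) (ContinuousAt.comp (f := fun z => ex τ * ex (-z))
    (g := fun u => afun u (ex τ)) (by simpa using ha) (by fun_prop))

lemma tendsto_wfun_sub_gfun {τ : ℂ} (hτ : 0 < τ.im) :
    Tendsto (fun z => wfun z τ - gfun (ex z)) (𝓝[≠] 0) (𝓝 (2 * afun (ex τ) (ex τ))) := by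
  have h := (continuousAt_wfun_regular hτ).tendsto
  simp only [neg_zero, ex_zero, mul_one, ← two_mul] at h
  refine (h.mono_left nhdsWithin_le_nhds).congr fun z => ?_
  rw [wfun_eq_gfun_add hτ]; ring

/-- With s = `sfun` z and G = `afun` (ex τ) (ex τ), one has `kfun`² = s(1 + Gs + ⋯)² and `wfun` =
-1/s + 2G + ⋯. The poles cancel, and so do the constants -2G and 2G. -/
lemma tendsto_inv_kfun_sq_add_wfun {τ : ℂ} (hτ : 0 < τ.im) :
    Tendsto (fun z => (kfun z τ ^ 2)⁻¹ + wfun z τ) (𝓝[≠] 0) (𝓝 0) := by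
  set G := afun (ex τ) (ex τ) with hG
  have h0 : psifun τ 0 = 1 := by simp [psifun]
  have hd := hasDerivAt_psifun hτ
  have hsl : Tendsto (fun s => (psifun τ s - 1) / s) (𝓝[≠] 0) (𝓝 G) := by
    refine hd.tendsto_slope.congr fun s => ?_
    simp [slope_def_field, h0]
  have hc : Tendsto (psifun τ) (𝓝[≠] 0) (𝓝 1) := by
    have := hd.continuousAt.tendsto
    rw [h0] at this
    exact this.mono_left nhdsWithin_le_nhds
  have hlim : Tendsto (fun s => -((psifun τ s - 1) / s) * (psifun τ s + 1) / psifun τ s ^ 2)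
      (𝓝[≠] 0) (𝓝 (-G * (1 + 1) / 1 ^ 2)) :=
    (hsl.neg.mul (hc.add_const 1)).div (hc.pow 2) (by simp)
  have h1 := (hlim.comp tendsto_sfun).add (tendsto_wfun_sub_gfun hτ)
  have e : -G * (1 + 1) / 1 ^ 2 + 2 * G = 0 := by ring
  rw [e] at h1
  refine h1.congr' ?_
  have hne : ∀ᶠ s in 𝓝[≠] (0 : ℂ), psifun τ s ≠ 0 := hc.eventually_ne one_ne_zero
  filter_upwards [tendsto_sfun.eventually hne, tendsto_sfun.eventually self_mem_nhdsWithin]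
    with z hz hz0
  have hz0 : sfun z ≠ 0 := hz0
  rw [kfun_sq hτ, gfun_ex]
  simp only [Function.comp]
  field_simp
  ring

/-- As `sfun` does not involve τ, it may be compared with `kfun`² at any point, here τ = i. -/
lemma tendsto_sfun_div_sq :
    Tendsto (fun z => sfun z / z ^ 2) (𝓝[≠] 0) (𝓝 (4 * Real.pi ^ 2)) := by
  have hτ : 0 < Complex.I.im := by simp
  have h1 := (tendsto_kfun_div hτ).pow 2
  have h0 : psifun Complex.I 0 = 1 := by simp [psifun]
  have hc : Tendsto (psifun Complex.I) (𝓝[≠] 0) (𝓝 1) := by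
    have := (hasDerivAt_psifun hτ).continuousAt.tendsto
    rw [h0] at this
    exact this.mono_left nhdsWithin_le_nhds
  have h2 := h1.div ((hc.comp tendsto_sfun).pow 2) (by simp)
  rw [show (2 * (Real.pi : ℂ)) ^ 2 / 1 ^ 2 = 4 * Real.pi ^ 2 by ring] at h2
  refine h2.congr' ?_
  filter_upwards [tendsto_sfun.eventually (hc.eventually_ne one_ne_zero)] with z hz
  simp only [Function.comp, Pi.div_apply, div_pow, kfun_sq hτ]
  field_simp

/-- With c = 2πi, `sfun` z = -(cz)² - (cz)⁴/12 + O(z⁵), so that -1/`sfun` z = 1/(cz)² - 1/12 + ⋯.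
Together with the Lambert series this produces the constant -E₂/12 of `wfun`. -/
lemma tendsto_gfun_ex_add :
    Tendsto (fun z => gfun (ex z) + 1 / (4 * Real.pi ^ 2 * z ^ 2)) (𝓝[≠] 0) (𝓝 (-(1 / 12))) := by
  set c : ℂ := 2 * Real.pi * Complex.I with hc
  have hpi : (Real.pi : ℂ) ≠ 0 := by exact_mod_cast Real.pi_ne_zero
  have hc2 : c ^ 2 = -4 * Real.pi ^ 2 := by rw [hc]; linear_combination 4 * (Real.pi : ℂ) ^ 2 * Complex.I_sq
  have hb := Complex.exp_sub_sum_range_isBigO_pow 5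
  have t1 : Tendsto (fun z : ℂ => c * z) (𝓝 0) (𝓝 0) := by
    have : Continuous fun z : ℂ => c * z := by fun_prop
    simpa using this.tendsto 0
  have t2 : Tendsto (fun z : ℂ => -(c * z)) (𝓝 0) (𝓝 0) := by simpa using t1.neg
  have hO : (fun z : ℂ => sfun z + (c * z) ^ 2 + (c * z) ^ 4 / 12) =O[𝓝 0] fun z => z ^ 5 := by
    have b1 := (hb.comp_tendsto t1)
    have b2 := (hb.comp_tendsto t2)
    have e1 : ((fun x : ℂ => x ^ 5) ∘ fun z => c * z) =O[𝓝 0] fun z : ℂ => z ^ 5 := by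
      have : ((fun x : ℂ => x ^ 5) ∘ fun z => c * z) = fun z => c ^ 5 * z ^ 5 := by
        funext z; simp [mul_pow]
      rw [this]
      exact Asymptotics.isBigO_const_mul_self _ _ _
    have e2 : ((fun x : ℂ => x ^ 5) ∘ fun z => -(c * z)) =O[𝓝 0] fun z : ℂ => z ^ 5 := by
      have : ((fun x : ℂ => x ^ 5) ∘ fun z => -(c * z)) = fun z => (-c) ^ 5 * z ^ 5 := by
        funext z; simp [← mul_pow]
      rw [this]
      exact Asymptotics.isBigO_const_mul_self _ _ _
    have := ((b1.trans e1).neg_left).sub (b2.trans e2)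
    refine this.congr_left fun z => ?_
    have x1 : Complex.exp (c * z) = ex z := by rw [ex]
    have x2 : Complex.exp (-(c * z)) = ex (-z) := by rw [ex]; congr 1; ring
    simp only [Function.comp, x1, x2, sfun, Finset.sum_range_succ, Finset.sum_range_zero,
      Nat.factorial]
    push_cast
    ring
  have hlim1 : Tendsto (fun z => (sfun z + (c * z) ^ 2) / z ^ 4) (𝓝[≠] 0) (𝓝 (-(c ^ 4 / 12))) := by
    have ho : (fun z : ℂ => sfun z + (c * z) ^ 2 + (c * z) ^ 4 / 12) =o[𝓝 0] fun z => z ^ 4 := by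
      refine hO.trans_isLittleO ?_
      exact Asymptotics.isLittleO_pow_pow (by norm_num)
    have := (ho.mono nhdsWithin_le_nhds (l := 𝓝[≠] 0)).tendsto_div_nhds_zero
    have h2 := this.add_const (-(c ^ 4 / 12))
    rw [zero_add] at h2
    refine h2.congr' ?_
    filter_upwards [self_mem_nhdsWithin] with z hz
    have hz : z ≠ 0 := hz
    field_simp
    ring
  have hlim := hlim1.div tendsto_sfun_div_sq
    (mul_ne_zero (by norm_num) (pow_ne_zero 2 hpi))
  have hlim2 := hlim.div_const (c ^ 2)
  have e : -(c ^ 4 / 12) / (4 * Real.pi ^ 2) / c ^ 2 = 1 / 12 := by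
    rw [show c ^ 4 = (c ^ 2) ^ 2 by ring, hc2]
    field_simp
  rw [e] at hlim2
  refine hlim2.neg.congr' ?_
  filter_upwards [self_mem_nhdsWithin, tendsto_sfun.eventually self_mem_nhdsWithin] with z hz hs
  have hz : z ≠ 0 := hz
  have hs : sfun z ≠ 0 := hs
  simp only [Pi.div_apply]
  rw [gfun_ex, mul_pow, hc2]
  field_simp
  ring

/-- The divisor sum ∑ σ₁(n)qⁿ is resummed over one of the two factors by w/(1-w)² = ∑ c wᶜ. -/
lemma E2_eq_afun {τ : ℂ} (hτ : 0 < τ.im) : E2 τ = 1 - 24 * afun (ex τ) (ex τ) := by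
  have hq := norm_ex_lt_one hτ
  have h := EisensteinSeries.E2_eq_tsum_cexp (UpperHalfPlane.ofComplex τ)
  rw [E2, h]
  have hco : ((UpperHalfPlane.ofComplex τ : ℍ) : ℂ) = τ := by
    rw [UpperHalfPlane.ofComplex_apply_of_im_pos hτ]
  rw [hco]
  congr 2
  have := tsum_prod_pow_eq_tsum_sigma 1 hq
  have e : Complex.exp (2 * Real.pi * Complex.I * τ) = ex τ := rfl
  rw [e, ← this, tsum_pnat_eq_tsum_succ (f := fun d : ℕ => ∑' c : ℕ+, (c : ℂ) ^ 1 * ex τ ^ (d * c : ℕ)),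
    afun]
  refine tsum_congr fun n => ?_
  have hn : ‖ex τ * ex τ ^ n‖ < 1 := by
    rw [← pow_succ', norm_pow]
    exact pow_lt_one₀ (norm_nonneg _) hq n.succ_ne_zero
  have h2 := tsum_coe_mul_geometric_of_norm_lt_one hn
  rw [gfun, ← h2, tsum_pnat_eq_tsum_succ (f := fun c : ℕ => (c : ℂ) ^ 1 * ex τ ^ ((n + 1) * c : ℕ)),
    (by
      have := (hasSum_coe_mul_geometric_of_norm_lt_one hn).summable
      exact this : Summable fun c : ℕ => (c : ℂ) * (ex τ * ex τ ^ n) ^ c).tsum_eq_zero_add]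
  simp only [Nat.cast_zero, zero_mul, zero_add]
  refine tsum_congr fun c => ?_
  rw [pow_one, ← pow_succ', ← pow_mul]

/-- The constant term of the Laurent expansion of `wfun` at the origin. -/
lemma tendsto_wfun_add {τ : ℂ} (hτ : 0 < τ.im) :
    Tendsto (fun z => wfun z τ + 1 / (4 * Real.pi ^ 2 * z ^ 2)) (𝓝[≠] 0) (𝓝 (-(E2 τ / 12))) := by
  have h := (tendsto_wfun_sub_gfun hτ).add tendsto_gfun_ex_add
  have e : 2 * afun (ex τ) (ex τ) + -(1 / 12) = -(E2 τ / 12) := by rw [E2_eq_afun hτ]; ring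
  rw [e] at h
  refine h.congr fun z => ?_
  ring

end Mathieu

namespace Mathieu

open Filter Topology

/-! ### The addition formula -/

lemma tendsto_mul_zero_of_tendsto {f : ℂ → ℂ} {c : ℂ} (h : Tendsto f (𝓝[≠] 0) (𝓝 c)) :
    Tendsto (fun z => z * f z) (𝓝[≠] 0) (𝓝 0) := by
  have h1 : Tendsto (fun z : ℂ => z) (𝓝[≠] 0) (𝓝 0) := tendsto_id.mono_left nhdsWithin_le_nhds
  simpa using h1.mul h

/-- The numerator, divided by `kfun` u τ ^ 2, is even in z with value -1 at z = 0. Its derivative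
there vanishes, and the quotient has the double pole of -1/`kfun`² without residue. -/
lemma tendsto_kfun_mul_kfun {τ : ℂ} (hτ : 0 < τ.im) {u : ℂ} (hu : ¬ inLat τ u) :
    Tendsto (fun z => z * (kfun (z + u) τ * kfun (z - u) τ / (kfun z τ ^ 2 * kfun u τ ^ 2) +
      (kfun z τ ^ 2)⁻¹)) (𝓝[≠] 0) (𝓝 0) := by
  have hk := kfun_ne_zero hτ hu
  set h : ℂ → ℂ := fun z => kfun (z + u) τ * kfun (z - u) τ / kfun u τ ^ 2 with hh
  have hK := differentiable_kfun hτ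
  have hd : Differentiable ℂ h := by
    have h1 : Differentiable ℂ fun z => kfun (z + u) τ :=
      hK.comp (by fun_prop : Differentiable ℂ fun z : ℂ => z + u)
    have h2 : Differentiable ℂ fun z => kfun (z - u) τ :=
      hK.comp (by fun_prop : Differentiable ℂ fun z : ℂ => z - u)
    fun_prop
  have h0 : h 0 = -1 := by
    simp only [hh, zero_add, zero_sub, kfun_neg hτ]
    field_simp
  have heven : ∀ z, h (-z) = h z := fun z => by
    simp only [hh]
    rw [show -z + u = -(z - u) by ring, show -z - u = -(z + u) by ring, kfun_neg hτ, kfun_neg hτ]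
    ring
  have hder : HasDerivAt h 0 0 := by
    have h1 : HasDerivAt h (deriv h 0) 0 := hd.differentiableAt.hasDerivAt
    have h2 : HasDerivAt (fun z => h (-z)) (-deriv h 0) 0 := by
      have h1' : HasDerivAt h (deriv h 0) (-(0 : ℂ)) := by simpa using h1
      simpa [Function.comp_def] using h1'.comp (0 : ℂ) (hasDerivAt_neg (0 : ℂ))
    simp only [heven] at h2
    have := h1.unique h2
    rw [self_eq_neg] at this
    rwa [this] at h1
  have hs : Tendsto (fun z => (h z + 1) / z) (𝓝[≠] 0) (𝓝 0) := by
    refine hder.tendsto_slope.congr fun z => ?_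
    simp [slope_def_field, h0]
  have := hs.div ((tendsto_kfun_div hτ).pow 2) (by simp [Real.pi_ne_zero])
  rw [zero_div] at this
  refine this.congr' ?_
  filter_upwards [eventually_not_inLat hτ, self_mem_nhdsWithin] with z hz hz0
  have hz0 : z ≠ 0 := hz0
  have := kfun_ne_zero hτ hz
  simp only [hh, Pi.div_apply]
  field_simp

lemma differentiableAt_kfun {τ : ℂ} (hτ : 0 < τ.im) (z : ℂ) :
    DifferentiableAt ℂ (fun z => kfun z τ) z := (differentiable_kfun hτ).differentiableAt

/-- The addition formula for the sigma function, in multiplicative form. -/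
lemma kfun_add_mul_kfun_sub {τ : ℂ} (hτ : 0 < τ.im) {z u : ℂ} (hz : ¬ inLat τ z)
    (hu : ¬ inLat τ u) :
    kfun (z + u) τ * kfun (z - u) τ / (kfun z τ ^ 2 * kfun u τ ^ 2) = wfun z τ - wfun u τ := by
  have hk := kfun_ne_zero hτ hu
  obtain ⟨c, hc, -⟩ : ∃ c, (∀ z, ¬ inLat τ z → (fun z => kfun (z + u) τ * kfun (z - u) τ /
      (kfun z τ ^ 2 * kfun u τ ^ 2) - (wfun z τ - wfun u τ)) z = c) ∧
      Tendsto (fun z => kfun (z + u) τ * kfun (z - u) τ / (kfun z τ ^ 2 * kfun u τ ^ 2) -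
        (wfun z τ - wfun u τ)) (𝓝[≠] 0) (𝓝 c) := by
    refine elliptic_const hτ ?_ ?_ ?_ ?_
    · intro z
      rw [show z + 1 + u = z + u + 1 by ring, show z + 1 - u = z - u + 1 by ring, kfun_add_one,
        kfun_add_one, kfun_add_one, wfun_add_one, neg_mul_neg, neg_sq]
    · intro z
      rw [show z + τ + u = z + u + τ by ring, show z + τ - u = z - u + τ by ring, kfun_add_tau hτ,
        kfun_add_tau hτ, kfun_add_tau hτ, wfun_add_tau hτ]
      have e : ex (-(z + u) - τ / 2) * ex (-(z - u) - τ / 2) = ex (-z - τ / 2) ^ 2 := by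
        rw [sq, ← ex_add, ← ex_add]; congr 1; ring
      have h0 := ex_ne_zero (-z - τ / 2)
      congr 1
      by_cases hz : kfun z τ = 0
      · simp [hz]
      generalize ex (-z - τ / 2) = t1 at *
      generalize ex (-(z + u) - τ / 2) = t2 at *
      generalize ex (-(z - u) - τ / 2) = t3 at *
      field_simp
      linear_combination kfun (z + u) τ * kfun (z - u) τ * e
    · intro z hz
      have h1 : DifferentiableAt ℂ (fun z => kfun (z + u) τ) z :=
        DifferentiableAt.comp z (f := fun z => z + u) (g := fun z => kfun z τ)
          (differentiableAt_kfun hτ (z + u)) (by fun_prop)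
      have h2 : DifferentiableAt ℂ (fun z => kfun (z - u) τ) z :=
        DifferentiableAt.comp z (f := fun z => z - u) (g := fun z => kfun z τ)
          (differentiableAt_kfun hτ (z - u)) (by fun_prop)
      have h3 := differentiableAt_kfun hτ z
      have h4 := differentiableAt_wfun hτ hz
      have h5 : kfun z τ ^ 2 * kfun u τ ^ 2 ≠ 0 :=
        mul_ne_zero (pow_ne_zero 2 (kfun_ne_zero hτ hz)) (pow_ne_zero 2 hk)
      fun_prop (disch := assumption)
    · have h1 := (tendsto_kfun_mul_kfun hτ hu).sub
        (tendsto_mul_zero_of_tendsto ((tendsto_inv_kfun_sq_add_wfun hτ).sub_const (wfun u τ)))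
      rw [sub_zero] at h1
      refine h1.congr fun z => ?_
      ring
  beta_reduce at hc
  have h1 := hc z hz
  -- At z = u both sides of the formula vanish, which shows that the constant is zero.
  have h2 := hc u hu
  simp only [sub_self, kfun_zero, mul_zero, zero_div] at h2
  rw [← h2] at h1
  exact sub_eq_zero.mp h1

/-! ### Modular transformations -/

lemma im_neg_one_div {τ : ℂ} (hτ : 0 < τ.im) : 0 < (-1 / τ).im := by
  have h : τ ≠ 0 := fun h => by simp [h] at hτ
  rw [neg_div, Complex.neg_im, one_div, Complex.inv_im, neg_div, neg_neg]
  exact div_pos hτ (Complex.normSq_pos.mpr h)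

lemma ne_zero_of_im_pos {τ : ℂ} (hτ : 0 < τ.im) : τ ≠ 0 := fun h => by simp [h] at hτ

lemma inLat_div {τ z : ℂ} (hτ : 0 < τ.im) : inLat (-1 / τ) (z / τ) ↔ inLat τ z := by
  have h := ne_zero_of_im_pos hτ
  constructor
  · rintro ⟨m, n, hmn⟩
    refine ⟨n, -m, ?_⟩
    rw [div_eq_iff h] at hmn
    rw [hmn]; push_cast; field_simp; ring
  · rintro ⟨m, n, rfl⟩
    refine ⟨-n, m, ?_⟩
    push_cast; field_simp; ring

/-- The quotient of the two sides is elliptic: the Gaussian factor is exactly what makes the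
quasi-periods of z ↦ `kfun` (z/τ) (-1/τ) match those of `kfun` z τ. Its limit at the origin gives
the constant τ⁻¹, since both functions have derivative 2π there in their own variable. -/
lemma kfun_S {τ : ℂ} (hτ : 0 < τ.im) (z : ℂ) :
    kfun (z / τ) (-1 / τ) = τ⁻¹ * ex (z ^ 2 / (2 * τ)) * kfun z τ := by
  have h0 := ne_zero_of_im_pos hτ
  have hτ' := im_neg_one_div hτ
  by_cases hz : inLat τ z
  · rw [kfun_eq_zero_of_inLat hτ hz, kfun_eq_zero_of_inLat hτ' ((inLat_div hτ).mpr hz), mul_zero]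
  have hlim : Tendsto (fun z => kfun (z / τ) (-1 / τ) * ex (-(z ^ 2 / (2 * τ))) / kfun z τ) (𝓝[≠] 0)
      (𝓝 τ⁻¹) := by
    have h1 : Tendsto (fun z : ℂ => z / τ) (𝓝[≠] 0) (𝓝[≠] 0) := by
      rw [tendsto_nhdsWithin_iff]
      constructor
      · have : Continuous fun z : ℂ => z / τ := by fun_prop
        have := this.tendsto 0
        rw [zero_div] at this
        exact this.mono_left nhdsWithin_le_nhds
      · filter_upwards [self_mem_nhdsWithin] with z hz
        exact div_ne_zero hz h0
    have h2 := (tendsto_kfun_div hτ').comp h1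
    have h3 := h2.div (tendsto_kfun_div hτ) (by simp [Real.pi_ne_zero])
    have h4 : Tendsto (fun z : ℂ => ex (-(z ^ 2 / (2 * τ))) / τ) (𝓝[≠] 0) (𝓝 τ⁻¹) := by
      have hc := differentiable_ex.continuous
      have : Continuous fun z : ℂ => ex (-(z ^ 2 / (2 * τ))) / τ := by fun_prop
      have := this.tendsto 0
      simp only [ne_eq, OfNat.ofNat_ne_zero, not_false_eq_true, zero_pow, zero_div, neg_zero,
        ex_zero, one_div] at this
      exact this.mono_left nhdsWithin_le_nhds
    have h5 := h3.mul h4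
    rw [div_self (by simp [Real.pi_ne_zero]), one_mul] at h5
    refine h5.congr' ?_
    filter_upwards [self_mem_nhdsWithin] with z hz
    have hz : z ≠ 0 := hz
    simp only [Function.comp, Pi.div_apply]
    field_simp
  obtain ⟨c, hc, hlim'⟩ : ∃ c, (∀ z, ¬ inLat τ z → (fun z => kfun (z / τ) (-1 / τ) * ex (-(z ^ 2 / (2 * τ))) / kfun z τ) z = c) ∧
      Tendsto (fun z => kfun (z / τ) (-1 / τ) * ex (-(z ^ 2 / (2 * τ))) / kfun z τ) (𝓝[≠] 0) (𝓝 c) := by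
    refine elliptic_const hτ ?_ ?_ ?_ (tendsto_mul_zero_of_tendsto hlim)
    · intro z
      have h1 := kfun_add_tau hτ' ((z + 1) / τ)
      rw [show (z + 1) / τ + -1 / τ = z / τ by field_simp; ring] at h1
      have e : ex (-(z ^ 2 / (2 * τ))) =
          ex (-((z + 1) ^ 2 / (2 * τ))) * (ex (-((z + 1) / τ) - -1 / τ / 2))⁻¹ := by
        rw [← ex_neg, ← ex_add]; congr 1; field_simp; ring
      rw [h1, e, kfun_add_one]
      have := ex_ne_zero (-((z + 1) / τ) - -1 / τ / 2)
      generalize ex (-((z + 1) / τ) - -1 / τ / 2) = t1 at *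
      field_simp
    · intro z
      rw [show (z + τ) / τ = z / τ + 1 by field_simp, kfun_add_one, kfun_add_tau hτ]
      have e : ex (-((z + τ) ^ 2 / (2 * τ))) = ex (-(z ^ 2 / (2 * τ))) * ex (-z - τ / 2) := by
        rw [← ex_add]; congr 1; field_simp; ring
      have := ex_ne_zero (-z - τ / 2)
      rw [e]
      generalize ex (-z - τ / 2) = t1 at *
      field_simp
    · intro z hz
      have h1 : DifferentiableAt ℂ (fun z => kfun (z / τ) (-1 / τ)) z :=
        DifferentiableAt.comp z (f := fun z => z / τ) (g := fun z => kfun z (-1 / τ))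
          (differentiableAt_kfun hτ' (z / τ)) (by fun_prop)
      have h3 := differentiableAt_kfun hτ z
      have h5 : kfun z τ ≠ 0 := kfun_ne_zero hτ hz
      have h6 : 2 * τ ≠ 0 := mul_ne_zero two_ne_zero h0
      fun_prop (disch := assumption)
  beta_reduce at hc
  have hcc : c = τ⁻¹ := tendsto_nhds_unique hlim' hlim
  have := hc z hz
  rw [hcc, ex_neg, div_eq_iff (kfun_ne_zero hτ hz)] at this
  have he := ex_ne_zero (z ^ 2 / (2 * τ))
  generalize ex (z ^ 2 / (2 * τ)) = t at this he ⊢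
  field_simp at this ⊢
  linear_combination this

lemma ex_add_one (z : ℂ) : ex (z + 1) = ex z := by simpa using ex_add_int z 1

lemma kfun_T (z τ : ℂ) : kfun z (τ + 1) = kfun z τ := by simp only [kfun, ex_add_one]

/-- The Weierstrass `℘`-function divided by `(2πi)²`. -/
def etfun (z τ : ℂ) : ℂ := wfun z τ + E2 τ / 12

lemma etfun_T {τ : ℂ} (hτ : 0 < τ.im) (z : ℂ) : etfun z (τ + 1) = etfun z τ := by
  rw [etfun, etfun, E2_eq_afun hτ, E2_eq_afun (by simpa using hτ), wfun, wfun, ex_add_one]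

/-- By the addition formula the difference is a quotient of values of `kfun`, in which the Gaussian
factors of `kfun_S` cancel by the parallelogram law. -/
lemma wfun_sub_wfun_S {τ : ℂ} (hτ : 0 < τ.im) {z u : ℂ} (hz : ¬ inLat τ z) (hu : ¬ inLat τ u) :
    wfun (z / τ) (-1 / τ) - wfun (u / τ) (-1 / τ) = τ ^ 2 * (wfun z τ - wfun u τ) := by
  have h0 := ne_zero_of_im_pos hτ
  have hτ' := im_neg_one_div hτ
  rw [← kfun_add_mul_kfun_sub hτ hz hu, ← kfun_add_mul_kfun_sub hτ' (by rwa [inLat_div hτ])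
    (by rwa [inLat_div hτ]), ← add_div, ← sub_div, kfun_S hτ, kfun_S hτ, kfun_S hτ, kfun_S hτ]
  have e : ex ((z + u) ^ 2 / (2 * τ)) * ex ((z - u) ^ 2 / (2 * τ)) =
      ex (z ^ 2 / (2 * τ)) ^ 2 * ex (u ^ 2 / (2 * τ)) ^ 2 := by
    rw [← ex_nat_mul, ← ex_nat_mul, ← ex_add, ← ex_add]; congr 1; push_cast; field_simp; ring
  have := kfun_ne_zero hτ hz
  have := kfun_ne_zero hτ hu
  have := ex_ne_zero (z ^ 2 / (2 * τ))
  have := ex_ne_zero (u ^ 2 / (2 * τ))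
  generalize ex (z ^ 2 / (2 * τ)) = t1 at *
  generalize ex (u ^ 2 / (2 * τ)) = t2 at *
  generalize ex ((z + u) ^ 2 / (2 * τ)) = t3 at *
  generalize ex ((z - u) ^ 2 / (2 * τ)) = t4 at *
  field_simp
  linear_combination kfun (z + u) τ * kfun (z - u) τ * e

/-- The constant terms at z → 0 in the law for `wfun` z - `wfun` u. The polar parts correspond to
each other, and the constant -E₂/12 completes `wfun` u on either side. The quasi-modularity of E₂
itself is not needed. -/
lemma etfun_S {τ : ℂ} (hτ : 0 < τ.im) {u : ℂ} (hu : ¬ inLat τ u) :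
    etfun (u / τ) (-1 / τ) = τ ^ 2 * etfun u τ := by
  have h0 := ne_zero_of_im_pos hτ
  have hτ' := im_neg_one_div hτ
  have h1 : Tendsto (fun z : ℂ => z / τ) (𝓝[≠] 0) (𝓝[≠] 0) := by
    rw [tendsto_nhdsWithin_iff]
    constructor
    · have : Continuous fun z : ℂ => z / τ := by fun_prop
      have := this.tendsto 0
      rw [zero_div] at this
      exact this.mono_left nhdsWithin_le_nhds
    · filter_upwards [self_mem_nhdsWithin] with z hz
      exact div_ne_zero hz h0
  have l1 := ((tendsto_wfun_add hτ').comp h1).sub_const (wfun (u / τ) (-1 / τ))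
  have l2 := ((tendsto_wfun_add hτ).sub_const (wfun u τ)).const_mul (τ ^ 2)
  have := tendsto_nhds_unique (l1.congr' ?_) l2
  · rw [etfun, etfun]
    linear_combination -this
  · filter_upwards [self_mem_nhdsWithin, eventually_not_inLat hτ] with z hz hzl
    have hz : z ≠ 0 := hz
    have h := wfun_sub_wfun_S hτ hzl hu
    have hpi : (Real.pi : ℂ) ≠ 0 := by exact_mod_cast Real.pi_ne_zero
    have e : 1 / (4 * (Real.pi : ℂ) ^ 2 * (z / τ) ^ 2) = τ ^ 2 * (1 / (4 * Real.pi ^ 2 * z ^ 2)) := by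
      field_simp
    simp only [Function.comp, e]
    linear_combination h

end Mathieu

namespace Mathieu

open Filter Topology

/-! ### The Appell--Lerch sum -/

lemma le_norm_one_sub_ex {w : ℂ} {b : ℝ} (h : b ≤ |w.im|) :
    1 - Real.exp (-2 * Real.pi * b) ≤ ‖1 - ex w‖ := by
  have hpi := Real.pi_pos
  rcases le_total 0 w.im with h0 | h0
  · rw [abs_of_nonneg h0] at h
    have h1 : ‖ex w‖ ≤ Real.exp (-2 * Real.pi * b) := by
      rw [norm_ex]; apply Real.exp_le_exp.2; nlinarith
    have h2 := norm_sub_norm_le 1 (ex w)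
    rw [norm_one] at h2; linarith
  · rw [abs_of_nonpos h0] at h
    have h1 : Real.exp (2 * Real.pi * b) ≤ ‖ex w‖ := by
      rw [norm_ex]; apply Real.exp_le_exp.2; nlinarith
    have h2 := norm_sub_norm_le (ex w) 1
    rw [norm_one, norm_sub_rev] at h2
    have h3 : Real.exp (2 * Real.pi * b) * Real.exp (-2 * Real.pi * b) = 1 := by
      rw [← Real.exp_add]; simp
    nlinarith [Real.exp_pos (2 * Real.pi * b), Real.exp_pos (-2 * Real.pi * b),
      sq_nonneg (Real.exp (2 * Real.pi * b) - 1), sq_nonneg (Real.exp (-2 * Real.pi * b) - 1),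
      sq_nonneg (Real.exp (2 * Real.pi * b) - Real.exp (-2 * Real.pi * b))]

/-- The numerators of the terms of the Appell--Lerch sums. -/
def lnum (τ w : ℂ) (n : ℤ) : ℂ := (-1 : ℂ) ^ n * ex (n * w + n * (n + 1) / 2 * τ)

/-- A summable bound for `lnum`. -/
def lbound (T B : ℝ) (n : ℤ) : ℝ :=
  Real.exp (-Real.pi * (T * n ^ 2 - 2 * (B + T / 2) * |n|))

lemma summable_lbound {T : ℝ} (hT : 0 < T) (B : ℝ) : Summable (lbound T B) := by
  unfold lbound
  simpa using summable_pow_mul_jacobiTheta₂_term_bound (B + T / 2) hT 0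

lemma norm_lnum_le {τ w : ℂ} (hτ : 0 < τ.im) {B : ℝ} (hw : |w.im| ≤ B) (n : ℤ) :
    ‖lnum τ w n‖ ≤ lbound τ.im B n := by
  have hpi := Real.pi_pos
  rw [lnum, norm_mul, norm_zpow, norm_neg, norm_one, one_zpow, one_mul, norm_ex, lbound]
  apply Real.exp_le_exp.2
  have e : ((n : ℂ) * w + n * (n + 1) / 2 * τ).im = n * w.im + n * (n + 1) / 2 * τ.im := by
    have : (n : ℂ) * w + n * (n + 1) / 2 * τ = ((n : ℝ) : ℂ) * w +
        ((n * (n + 1) / 2 : ℝ) : ℂ) * τ := by push_cast; ring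
    rw [this, Complex.add_im, Complex.im_ofReal_mul, Complex.im_ofReal_mul]
  rw [e]
  push_cast
  have h1 : -(n * w.im) ≤ |(n : ℝ)| * B := by
    refine (neg_le_abs _).trans ?_
    rw [abs_mul]; gcongr
  have h2 : -((n : ℝ) * τ.im) ≤ |(n : ℝ)| * τ.im := by
    refine (neg_le_abs _).trans ?_
    rw [abs_mul, abs_of_pos hτ]
  nlinarith

lemma differentiable_lnum (τ : ℂ) {w : ℂ → ℂ} (hw : Differentiable ℂ w) (n : ℤ) :
    Differentiable ℂ fun z => lnum τ (w z) n := by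
  unfold lnum
  have := differentiable_ex
  exact (differentiable_ex.comp (by fun_prop)).const_mul _

/-- The Appell--Lerch sum with numerators evaluated at `w z`. -/
def lsum (w : ℂ → ℂ) (τ z : ℂ) : ℂ := ∑' n : ℤ, lnum τ (w z) n / (1 - ex (z + n * τ))

lemma one_sub_ex_ne_zero {τ z : ℂ} (hz : ¬ inLat τ z) (n : ℤ) : 1 - ex (z + n * τ) ≠ 0 := by
  intro h
  obtain ⟨m, hm⟩ := ex_eq_one_iff.1 (sub_eq_zero.1 h).symm
  exact hz ⟨-n, m, by push_cast; linear_combination hm⟩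

lemma im_add_int_mul (z τ : ℂ) (n : ℤ) : (z + n * τ).im = z.im + n * τ.im := by
  have : z + n * τ = z + ((n : ℝ) : ℂ) * τ := by push_cast; ring
  rw [this, Complex.add_im, Complex.im_ofReal_mul]

/-- The numerators decay like a Gaussian in n. The two cases in use are w = id, the Appell–Lerch
sum, and w = 0, the partial fraction expansion of 1/θ₁. -/
lemma lsum_aux {τ : ℂ} (hτ : 0 < τ.im) {w : ℂ → ℂ} (hw : Differentiable ℂ w)
    (hb : ∀ z, |(w z).im| ≤ |z.im|) {z : ℂ} (hz : ¬ inLat τ z) :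
    DifferentiableAt ℂ (lsum w τ) z ∧ Summable fun n : ℤ => lnum τ (w z) n / (1 - ex (z + n * τ)) := by
  set B : ℝ := |z.im| + 1
  have hop : IsOpen ({z : ℂ | ¬ inLat τ z} ∩ {z | |z.im| < B}) :=
    (isOpen_not_inLat hτ).inter (isOpen_lt (by fun_prop) continuous_const)
  have hmem : z ∈ ({z : ℂ | ¬ inLat τ z} ∩ {z | |z.im| < B}) := ⟨hz, by simp [B]⟩
  have hδ : 0 < 1 - Real.exp (-2 * Real.pi * τ.im) := by
    have : Real.exp (-2 * Real.pi * τ.im) < 1 := by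
      rw [Real.exp_lt_one_iff]; nlinarith [mul_pos Real.pi_pos hτ]
    linarith
  -- On the strip |Im z| < B one has |Im(z + nτ)| ≥ Im τ as soon as |n| ≥ N, which keeps the
  -- denominators away from zero.
  obtain ⟨N, hN⟩ := exists_nat_ge ((B + τ.im) / τ.im)
  rw [div_le_iff₀ hτ] at hN
  have key := differentiableOn_tsum_of_bound hop (ι := ℤ)
    (F := fun n z => lnum τ (w z) n / (1 - ex (z + n * τ)))
    (u := fun n => lbound τ.im B n / (1 - Real.exp (-2 * Real.pi * τ.im))) ?_
    ((summable_lbound hτ B).div_const _) (Finset.Icc (-(N : ℤ)) N) ?_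
  · exact ⟨(key.1 z hmem).differentiableAt (hop.mem_nhds hmem), key.2 z hmem⟩
  · intro n s hs
    refine DifferentiableAt.differentiableWithinAt ?_
    refine ((differentiable_lnum τ hw n) s).div ?_ (one_sub_ex_ne_zero hs.1 n)
    exact (differentiable_const _ |>.sub (differentiable_ex.comp (by fun_prop))) s
  · intro n hn s hs
    have hn' : (N : ℝ) ≤ |(n : ℝ)| := by
      have : (N : ℤ) ≤ |n| := by
        simp only [Finset.mem_Icc, not_and_or, not_le] at hn
        rcases hn with h | h
        · exact (by omega : (N : ℤ) ≤ -n).trans (neg_le_abs n)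
        · exact h.le.trans (le_abs_self n)
      exact_mod_cast this
    rw [norm_div]
    refine div_le_div₀ (Real.exp_pos _).le
      (norm_lnum_le hτ ((hb s).trans hs.2.le) n) hδ (le_norm_one_sub_ex ?_)
    rw [im_add_int_mul]
    have h1 : |(n : ℝ)| * τ.im ≤ |s.im + n * τ.im| + |s.im| := by
      rw [← abs_of_pos hτ, ← abs_mul, abs_of_pos hτ]
      calc |(n : ℝ) * τ.im| = |(s.im + n * τ.im) - s.im| := by ring_nf
        _ ≤ _ := abs_sub _ _
    have h2 : |s.im| < B := hs.2
    nlinarith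

lemma lnum_sub_one (τ w : ℂ) (n : ℤ) :
    lnum τ (w + τ) (n - 1) = -(ex w)⁻¹ * (ex τ)⁻¹ * lnum τ w n := by
  have h : (-1 : ℂ) ≠ 0 := by norm_num
  rw [lnum, lnum, zpow_sub₀ h, ← ex_neg, ← ex_neg]
  have : ((n - 1 : ℤ) : ℂ) * (w + τ) + ((n - 1 : ℤ) : ℂ) * (((n - 1 : ℤ) : ℂ) + 1) / 2 * τ =
    -w + -τ + (n * w + n * (n + 1) / 2 * τ) := by push_cast; ring
  rw [this, ex_add, ex_add (-w)]; norm_num; ring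

lemma lsum_shift (w : ℂ → ℂ) (τ z : ℂ) :
    lsum w τ (z + τ) = ∑' n : ℤ, lnum τ (w (z + τ)) (n - 1) / (1 - ex (z + n * τ)) := by
  rw [lsum, ← (Equiv.subRight (1 : ℤ)).tsum_eq]
  refine tsum_congr fun n => ?_
  simp only [Equiv.subRight_apply]
  congr 3
  push_cast; ring

lemma lsum_id_add_tau (τ z : ℂ) :
    lsum id τ (z + τ) = -(ex z)⁻¹ * (ex τ)⁻¹ * lsum id τ z := by
  rw [lsum_shift, lsum, ← tsum_mul_left]
  refine tsum_congr fun n => ?_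
  rw [id, id, lnum_sub_one]; ring

lemma lsum_id_add_one (τ z : ℂ) : lsum id τ (z + 1) = lsum id τ z := by
  rw [lsum, lsum]
  refine tsum_congr fun n => ?_
  rw [id, id, lnum, lnum, show (n : ℂ) * (z + 1) + n * (n + 1) / 2 * τ =
    n * z + n * (n + 1) / 2 * τ + n by ring, ex_add_int, show z + 1 + n * τ = z + n * τ + 1 by ring,
    ex_add_one]

/-- The substitution n ↦ 1 - n preserves the exponent of q and reverses the sign. -/
lemma tsum_lnum_neg_tau (τ : ℂ) : ∑' n : ℤ, lnum τ (-τ) n = 0 := by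
  have h := (Equiv.subLeft (1 : ℤ)).tsum_eq fun n => lnum τ (-τ) n
  have h2 : ∀ n : ℤ, lnum τ (-τ) (Equiv.subLeft (1 : ℤ) n) = -lnum τ (-τ) n := by
    intro n
    rw [Equiv.subLeft_apply, lnum, lnum, zpow_sub₀ (by norm_num : (-1 : ℂ) ≠ 0)]
    have e : ((1 - n : ℤ) : ℂ) * -τ + ((1 - n : ℤ) : ℂ) * (((1 - n : ℤ) : ℂ) + 1) / 2 * τ =
      n * -τ + n * (n + 1) / 2 * τ := by push_cast; ring
    have h1 : ((-1 : ℂ) ^ n)⁻¹ = (-1) ^ n := by rw [← inv_zpow]; norm_num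
    rw [e, zpow_one, div_eq_mul_inv, h1]
    ring
  simp only [h2, tsum_neg] at h
  linear_combination -(1 / 2 : ℂ) * h

/-- After the shift of n the numerator has lost a factor qⁿ. Writing 1 = (1 - yqⁿ) + yqⁿ restores it
at the cost of a theta series that vanishes by `tsum_lnum_neg_tau`. -/
lemma lsum_zero_add_tau {τ : ℂ} (hτ : 0 < τ.im) {z : ℂ} (hz : ¬ inLat τ z) :
    lsum 0 τ (z + τ) = -ex z * lsum 0 τ z := by
  have h1 := (lsum_aux hτ (w := 0) (differentiable_const 0) (by simp) hz).2
  have h2 : Summable fun n : ℤ => lnum τ (-τ) n :=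
    Summable.of_norm_bounded (summable_lbound hτ |(-τ).im|)
      fun n => norm_lnum_le hτ le_rfl n
  have h3 : lsum 0 τ (z + τ) = -(∑' n : ℤ, lnum τ (-τ) n) - ex z * lsum 0 τ z := by
    rw [lsum_shift, lsum, ← tsum_mul_left, ← tsum_neg, ← h2.neg.tsum_sub (h1.mul_left _)]
    refine tsum_congr fun n => ?_
    have hne := one_sub_ex_ne_zero hz n
    have e1 := lnum_sub_one τ (-τ) n
    rw [neg_add_cancel, ex_neg, inv_inv, neg_mul, mul_inv_cancel₀ (ex_ne_zero τ), neg_one_mul] at e1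
    have e2 : lnum τ 0 n = ex τ ^ n * lnum τ (-τ) n := by
      rw [lnum, lnum, ← ex_int_mul, mul_left_comm, ← ex_add]; ring_nf
    simp only [Pi.zero_apply]
    rw [e1, e2]
    rw [ex_add, ex_int_mul] at hne ⊢
    field_simp
    ring
  rw [h3, tsum_lnum_neg_tau]; ring

/-- The terms of `lsum id - lsum 0`. -/
def dterm (τ : ℂ) (n : ℤ) (z : ℂ) : ℂ :=
  if n = 0 then 0 else (lnum τ z n - lnum τ 0 n) / (1 - ex (z + n * τ))

lemma half_strip_im {τ z : ℂ} (hz : |z.im| < τ.im / 2) {n : ℤ} (hn : n ≠ 0) :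
    τ.im / 2 ≤ |(z + n * τ).im| := by
  have hτ : 0 < τ.im := by linarith [abs_nonneg z.im]
  have h0 : (1 : ℝ) ≤ |(n : ℝ)| := by exact_mod_cast Int.one_le_abs hn
  rw [im_add_int_mul]
  have h1 : |(n : ℝ)| * τ.im ≤ |z.im + n * τ.im| + |z.im| := by
    rw [← abs_of_pos hτ, ← abs_mul, abs_of_pos hτ]
    calc |(n : ℝ) * τ.im| = |(z.im + n * τ.im) - z.im| := by ring_nf
      _ ≤ _ := abs_sub _ _
  nlinarith

lemma half_strip_delta {τ : ℂ} (hτ : 0 < τ.im) :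
    0 < 1 - Real.exp (-2 * Real.pi * (τ.im / 2)) := by
  have : Real.exp (-2 * Real.pi * (τ.im / 2)) < 1 := by
    rw [Real.exp_lt_one_iff]; nlinarith [mul_pos Real.pi_pos hτ]
  linarith

lemma half_strip_ne {τ z : ℂ} (hz : |z.im| < τ.im / 2) {n : ℤ} (hn : n ≠ 0) :
    1 - ex (z + n * τ) ≠ 0 := by
  have h1 := le_norm_one_sub_ex (half_strip_im hz hn)
  have h2 := half_strip_delta (τ := τ) (by linarith [abs_nonneg z.im])
  intro h
  rw [h, norm_zero] at h1
  linarith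

lemma isOpen_half_strip (τ : ℂ) : IsOpen {z : ℂ | |z.im| < τ.im / 2} :=
  isOpen_lt (by fun_prop) continuous_const

lemma differentiableOn_quot (τ : ℂ) {w : ℂ → ℂ} (hw : Differentiable ℂ w) {n : ℤ} (hn : n ≠ 0) :
    DifferentiableOn ℂ (fun z => lnum τ (w z) n / (1 - ex (z + n * τ)))
      {z : ℂ | |z.im| < τ.im / 2} := by
  intro s hs
  refine DifferentiableAt.differentiableWithinAt ?_
  refine ((differentiable_lnum τ hw n) s).div ?_ (half_strip_ne hs hn)
  exact (differentiable_const _ |>.sub (differentiable_ex.comp (by fun_prop))) s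

lemma norm_quot_le {τ z w : ℂ} (hz : |z.im| < τ.im / 2) (hw : |w.im| ≤ τ.im / 2) {n : ℤ}
    (hn : n ≠ 0) : ‖lnum τ w n / (1 - ex (z + n * τ))‖ ≤
      lbound τ.im (τ.im / 2) n / (1 - Real.exp (-2 * Real.pi * (τ.im / 2))) := by
  have hτ : 0 < τ.im := by linarith [abs_nonneg z.im]
  rw [norm_div]
  exact div_le_div₀ (Real.exp_pos _).le (norm_lnum_le hτ hw n) (half_strip_delta hτ)
    (le_norm_one_sub_ex (half_strip_im hz hn))

/-- In the difference of the two sums the singular term n = 0 disappears, so that it is holomorphic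
in the strip |Im z| < Im τ/2 and may be differentiated term by term. -/
lemma hasSum_deriv_dterm {τ : ℂ} (hτ : 0 < τ.im) :
    HasSum (fun n => deriv (dterm τ n) 0) (deriv (fun z => ∑' n, dterm τ n z) 0) ∧
      DifferentiableAt ℂ (fun z => ∑' n, dterm τ n z) 0 := by
  have h0 : (0 : ℂ) ∈ {z : ℂ | |z.im| < τ.im / 2} := by simp [hτ]
  set u : ℤ → ℝ := fun n => lbound τ.im (τ.im / 2) n / (1 - Real.exp (-2 * Real.pi * (τ.im / 2))) +
    lbound τ.im (τ.im / 2) n / (1 - Real.exp (-2 * Real.pi * (τ.im / 2))) with hu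
  have hsum : Summable u :=
    ((summable_lbound hτ _).div_const _).add ((summable_lbound hτ _).div_const _)
  have hd : ∀ n, DifferentiableOn ℂ (dterm τ n) {z : ℂ | |z.im| < τ.im / 2} := by
    intro n
    by_cases hn : n = 0
    · have : dterm τ n = fun _ => 0 := by funext z; simp [dterm, hn]
      rw [this]; exact differentiableOn_const 0
    · have : dterm τ n = fun z => lnum τ (id z) n / (1 - ex (z + n * τ)) -
          lnum τ ((fun _ => 0 : ℂ → ℂ) z) n / (1 - ex (z + n * τ)) := by
        funext z; simp [dterm, hn, sub_div]
      rw [this]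
      exact (differentiableOn_quot τ differentiable_id hn).sub
        (differentiableOn_quot τ (differentiable_const 0) hn)
  have hb : ∀ (n : ℤ) (z : ℂ), z ∈ {z : ℂ | |z.im| < τ.im / 2} → ‖dterm τ n z‖ ≤ u n := by
    intro n z hz
    by_cases hn : n = 0
    · have h1 := (half_strip_delta hτ).le
      have h2 : 0 ≤ lbound τ.im (τ.im / 2) n := (Real.exp_pos _).le
      simp only [dterm, hn, if_true, norm_zero, hu]
      subst hn
      positivity
    · simp only [dterm, hn, if_false, sub_div, hu]
      refine (norm_sub_le _ _).trans (add_le_add (norm_quot_le hz (le_of_lt hz) hn)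
        (norm_quot_le hz (by simp; linarith) hn))
  exact ⟨Complex.hasSum_deriv_of_summable_norm hsum hd (isOpen_half_strip τ) hb h0,
    (Complex.differentiableOn_tsum_of_summable_norm hsum hd (isOpen_half_strip τ) hb).differentiableAt
      ((isOpen_half_strip τ).mem_nhds h0)⟩

lemma deriv_dterm (τ : ℂ) (n : ℤ) (hτ : 0 < τ.im) : deriv (dterm τ n) 0 =
    2 * Real.pi * Complex.I * ((-1) ^ n * n * ex (n * (n + 1) / 2 * τ) / (1 - ex (n * τ))) := by
  by_cases hn : n = 0
  · have : dterm τ n = fun _ => 0 := by funext z; simp [dterm, hn]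
    rw [this]; simp [hn]
  · have e : dterm τ n = fun z => (lnum τ z n - lnum τ 0 n) / (1 - ex (z + n * τ)) := by
      funext z; simp [dterm, hn]
    have h1 : HasDerivAt (fun z => lnum τ z n - lnum τ 0 n)
        ((-1) ^ n * (2 * Real.pi * Complex.I * ex (n * (n + 1) / 2 * τ) * n)) 0 := by
      unfold lnum
      refine HasDerivAt.sub_const _ (HasDerivAt.const_mul _ ?_)
      have h2 : HasDerivAt (fun z : ℂ => (n : ℂ) * z + n * (n + 1) / 2 * τ) n 0 := by
        simpa using ((hasDerivAt_id (0 : ℂ)).const_mul (n : ℂ)).add_const (n * (n + 1) / 2 * τ)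
      have h3 := (hasDerivAt_ex ((n : ℂ) * 0 + n * (n + 1) / 2 * τ)).comp (0 : ℂ) h2
      rw [mul_zero, zero_add] at h3
      exact (h3.congr_deriv (by ring)) 
    have hne := half_strip_ne (τ := τ) (z := 0) (by simp [hτ]) hn
    have h2 : HasDerivAt (fun z => 1 - ex (z + n * τ))
        (deriv (fun z => 1 - ex (z + n * τ)) 0) 0 :=
      ((differentiable_const _ |>.sub (differentiable_ex.comp (by fun_prop))) 0).hasDerivAt
    have h3 := (h1.div h2 hne).deriv
    rw [e]
    refine h3.trans ?_
    rw [sub_self, zero_mul, sub_zero]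
    rw [zero_add] at hne ⊢
    field_simp

lemma lsum_sub_lsum {τ : ℂ} (hτ : 0 < τ.im) {z : ℂ} (hz : ¬ inLat τ z) :
    lsum id τ z - lsum 0 τ z = ∑' n, dterm τ n z := by
  have h1 := (lsum_aux hτ (w := id) differentiable_id (by simp) hz).2
  have h2 := (lsum_aux hτ (w := 0) (differentiable_const 0) (by simp) hz).2
  rw [lsum, lsum, ← h1.tsum_sub h2]
  refine tsum_congr fun n => ?_
  by_cases hn : n = 0
  · simp [dterm, hn, lnum]
  · simp [dterm, hn, sub_div]

/-- Only the term 1/(1 - y) contributes; the remainder R is continuous at the origin, where `kfun`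
vanishes. -/
lemma tendsto_lsum_zero {τ : ℂ} (hτ : 0 < τ.im) :
    Tendsto (fun z => lsum 0 τ z * kfun z τ * ex (z / 2)) (𝓝[≠] 0) (𝓝 Complex.I) := by
  set R : ℂ → ℂ := fun z => ∑' n : ℤ, if n = 0 then 0 else lnum τ 0 n / (1 - ex (z + n * τ)) with hR
  have hRd : DifferentiableOn ℂ R {z : ℂ | |z.im| < τ.im / 2} := by
    refine Complex.differentiableOn_tsum_of_summable_norm (u := fun n => lbound τ.im (τ.im / 2) n /
      (1 - Real.exp (-2 * Real.pi * (τ.im / 2)))) ((summable_lbound hτ _).div_const _) ?_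
      (isOpen_half_strip τ) ?_
    · intro n
      by_cases hn : n = 0
      · simp only [hn, if_true]; exact differentiableOn_const 0
      · simp only [hn, if_false]
        exact differentiableOn_quot τ (differentiable_const 0) hn
    · intro n z hz
      by_cases hn : n = 0
      · have h1 := (half_strip_delta hτ).le
        have h2 : 0 ≤ lbound τ.im (τ.im / 2) n := (Real.exp_pos _).le
        simp only [hn, if_true, norm_zero]
        subst hn
        positivity
      · simp only [hn, if_false]
        exact norm_quot_le hz (by simp; linarith) hn
  have hRc : ContinuousAt R 0 := (hRd.differentiableAt
    ((isOpen_half_strip τ).mem_nhds (by simp [hτ]))).continuousAt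
  have hk : ContinuousAt (fun z => kfun z τ) 0 := (differentiableAt_kfun hτ 0).continuousAt
  have hk0 : kfun 0 τ = 0 := kfun_zero τ
  have he : ContinuousAt (fun z => ex (z / 2)) 0 := by
    have := differentiable_ex
    exact (differentiable_ex.comp (by fun_prop : Differentiable ℂ fun z : ℂ => z / 2)).continuous.continuousAt
  have h1 : Tendsto (fun z => R z * kfun z τ * ex (z / 2)) (𝓝[≠] 0) (𝓝 0) := by
    have : Tendsto (fun z => R z * kfun z τ * ex (z / 2)) (𝓝 0) (𝓝 (R 0 * kfun 0 τ * ex (0 / 2))) :=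
      ((hRc.mul hk).mul he).tendsto
    rw [hk0, mul_zero, zero_mul] at this
    exact this.mono_left nhdsWithin_le_nhds
  have h2 : Tendsto (fun z => (1 - ex z)⁻¹ * kfun z τ * ex (z / 2)) (𝓝[≠] 0) (𝓝 Complex.I) := by
    have hs : Tendsto (fun z : ℂ => (ex z - 1) / z) (𝓝[≠] 0) (𝓝 (2 * Real.pi * Complex.I)) := by
      have := hasDerivAt_ex_zero.tendsto_slope
      refine this.congr fun z => ?_
      rw [slope_def_field, ex_zero, sub_zero]
    have hs2 := ((tendsto_kfun_div hτ).div hs (by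
      simp [Real.pi_ne_zero])).neg.mul (he.tendsto.mono_left nhdsWithin_le_nhds)
    have e : -(2 * (Real.pi : ℂ) / (2 * Real.pi * Complex.I)) * ex (0 / 2) = Complex.I := by
      have : (Real.pi : ℂ) ≠ 0 := by exact_mod_cast Real.pi_ne_zero
      rw [zero_div, ex_zero]
      field_simp
      rw [Complex.I_sq]
    rw [e] at hs2
    refine hs2.congr' ?_
    filter_upwards [self_mem_nhdsWithin, eventually_not_inLat hτ] with z hz hz2
    have h3 := one_sub_ex_ne_zero hz2 0
    simp only [Int.cast_zero, zero_mul, add_zero] at h3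
    have h4 : ex z - 1 ≠ 0 := fun h => h3 (by linear_combination -h)
    have hz' : z ≠ 0 := hz
    simp only [Pi.div_apply]
    field_simp
    ring
  have h3 := h1.add h2
  rw [zero_add] at h3
  refine h3.congr' ?_
  filter_upwards [eventually_not_inLat hτ] with z hz
  have hsm := (lsum_aux hτ (w := 0) (differentiable_const 0) (by simp) hz).2
  have : lsum 0 τ z = (1 - ex z)⁻¹ + R z := by
    rw [lsum, hsm.tsum_eq_add_tsum_ite 0]
    simp [hR, lnum]
  rw [this]; ring

/-- The partial fraction expansion of 1/θ₁: the quasi-periods of the three factors cancel, and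
Liouville's theorem applies. -/
lemma lsum_zero_eq {τ : ℂ} (hτ : 0 < τ.im) {z : ℂ} (hz : ¬ inLat τ z) :
    lsum 0 τ z * kfun z τ * ex (z / 2) = Complex.I := by
  have hlim := tendsto_lsum_zero hτ
  obtain ⟨c, hc, hc2⟩ : ∃ c, (∀ z, ¬ inLat τ z → lsum 0 τ z * kfun z τ * ex (z / 2) = c) ∧
      Tendsto (fun z => lsum 0 τ z * kfun z τ * ex (z / 2)) (𝓝[≠] 0) (𝓝 c) := by
    refine elliptic_const hτ ?_ ?_ ?_ (tendsto_mul_zero_of_tendsto hlim)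
    · intro z
      have : lsum 0 τ (z + 1) = lsum 0 τ z := by
        rw [lsum, lsum]
        refine tsum_congr fun n => ?_
        rw [show z + 1 + n * τ = z + n * τ + 1 by ring, ex_add_one]; rfl
      rw [this, kfun_add_one, show (z + 1) / 2 = z / 2 + 1 / 2 by ring, ex_add, ex_half]; ring
    · intro z
      by_cases hz : inLat τ z
      · rw [kfun_eq_zero_of_inLat hτ hz, kfun_eq_zero_of_inLat hτ (hz.add (inLat_self τ))]; ring
      · rw [lsum_zero_add_tau hτ hz, kfun_add_tau hτ, show (z + τ) / 2 = z / 2 + τ / 2 by ring]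
        rw [show -z - τ / 2 = -z + -(τ / 2) by ring, ex_add, ex_add, ex_neg, ex_neg]
        have h1 := ex_ne_zero z
        have h2 := ex_ne_zero (τ / 2)
        generalize ex (τ / 2) = t at *
        generalize ex z = s at *
        field_simp
    · intro z hz
      refine ((lsum_aux hτ (w := 0) (differentiable_const 0) (by simp) hz).1.mul
        (differentiableAt_kfun hτ z)).mul ?_
      exact (differentiable_ex.comp (by fun_prop : Differentiable ℂ fun z : ℂ => z / 2)) z
  rw [hc z hz, tendsto_nhds_unique hc2 hlim]

end Mathieu

/-! ### The value of the Appell–Lerch sum at the origin -/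

namespace Mathieu

open Filter Topology

lemma summable_F2_aux {τ : ℂ} (hτ : 0 < τ.im) : Summable fun p : ℕ × ℕ =>
    (-1 : ℂ) ^ p.1 * (p.1 + 1) * ex ((p.1 + 1) * (p.1 + 2) / 2 * τ) * ex ((p.1 + 1) * τ) ^ p.2 := by
  set r := ‖ex τ‖ with hr
  have hr1 : r < 1 := norm_ex_lt_one hτ
  have hr0 : 0 ≤ r := norm_nonneg _
  have h1 : Summable fun n : ℕ => ((n : ℝ) + 1) * r ^ (n + 1) := by
    have := summable_pow_mul_geometric_of_norm_lt_one 1 (r := r) (by rwa [Real.norm_of_nonneg hr0])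
    have := (summable_nat_add_iff 1).2 this
    simpa using this
  have h2 : Summable fun n : ℕ => r ^ n := summable_geometric_of_lt_one hr0 hr1
  refine Summable.of_norm_bounded (h1.mul_of_nonneg h2 (fun n => by positivity)
    (fun n => by positivity)) ?_
  rintro ⟨n, k⟩
  have e1 : ex (((n : ℂ) + 1) * (n + 2) / 2 * τ) = ex τ ^ ((n + 1) * (n + 2) / 2) := by
    rw [← ex_nat_mul]
    congr 2
    rw [Nat.cast_div]
    · push_cast; ring
    · have := Nat.even_mul_succ_self (n + 1)
      exact this.two_dvd
    · norm_num
  have e2 : ex (((n : ℂ) + 1) * τ) = ex τ ^ (n + 1) := by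
    rw [← ex_nat_mul]; push_cast; rfl
  simp only [norm_mul, norm_pow, norm_neg, norm_one, one_pow, one_mul, e1, e2, ← hr]
  have h3 : ‖(n : ℂ) + 1‖ = (n : ℝ) + 1 := by
    have : (n : ℂ) + 1 = ((n + 1 : ℕ) : ℂ) := by push_cast; rfl
    rw [this, Complex.norm_natCast]; push_cast; rfl
  rw [h3, ← pow_mul]
  have h4 : n + 1 ≤ (n + 1) * (n + 2) / 2 := by
    rw [Nat.le_div_iff_mul_le (by norm_num)]; nlinarith
  have h5 : k ≤ (n + 1) * k := by nlinarith
  have h6 := pow_le_pow_of_le_one hr0 hr1.le h4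
  have h7 := pow_le_pow_of_le_one hr0 hr1.le h5
  gcongr

/-- The pairs are parametrised by s = n + 1 and r = s + 1 + 2k, and the sum over k is a geometric
series. -/
lemma F2_eq_tsum {τ : ℂ} (hτ : 0 < τ.im) : F2 τ = ∑' n : ℕ,
    (-1 : ℂ) ^ n * (n + 1) * ex ((n + 1) * (n + 2) / 2 * τ) / (1 - ex ((n + 1) * τ)) := by
  have hs := summable_F2_aux hτ
  have hi : Function.Injective fun p : ℕ × ℕ => (p.1 + 1 + 2 * p.2 + 1, p.1 + 1) := by
    rintro ⟨a, b⟩ ⟨c, d⟩ h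
    simp only [Prod.mk.injEq] at h ⊢
    omega
  have h1 : F2 τ = ∑' p : ℕ × ℕ, (-1 : ℂ) ^ p.1 * (p.1 + 1) *
      ex ((p.1 + 1) * (p.1 + 2) / 2 * τ) * ex ((p.1 + 1) * τ) ^ p.2 := by
    rw [F2, ← hi.tsum_eq]
    · refine tsum_congr fun ⟨n, k⟩ => ?_
      rw [if_pos ⟨by simp, by simp, ⟨k, by omega⟩⟩]
      rw [← ex_nat_mul, mul_assoc _ (ex _), ← ex_add,
        show n + 1 + 2 * k + 1 = 2 * (k + 1) + n by ring, pow_add, pow_mul]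
      push_cast
      norm_num
      left
      ring_nf
    · intro p hp
      rw [Function.mem_support, ne_eq, ite_eq_right_iff, Classical.not_imp] at hp
      obtain ⟨⟨h1, h2, k, hk⟩, -⟩ := hp
      exact ⟨(p.2 - 1, k), by ext <;> simp <;> omega⟩
  rw [h1, hs.tsum_prod]
  refine tsum_congr fun n => ?_
  dsimp only
  have him : 0 < (((n : ℂ) + 1) * τ).im := by
    have : ((n : ℂ) + 1) * τ = ((n + 1 : ℝ) : ℂ) * τ := by push_cast; rfl
    rw [this, Complex.im_ofReal_mul]
    positivity
  rw [tsum_mul_left, tsum_geometric_of_norm_lt_one (norm_ex_lt_one him), ← div_eq_mul_inv]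

/-- The terms with indices n and -n coincide, and the positive half is -F₂ by `F2_eq_tsum`. -/
lemma tsum_dterm_coeff {τ : ℂ} (hτ : 0 < τ.im)
    (hs : Summable fun n : ℤ => (-1 : ℂ) ^ n * n * ex (n * (n + 1) / 2 * τ) / (1 - ex (n * τ))) :
    ∑' n : ℤ, (-1 : ℂ) ^ n * n * ex (n * (n + 1) / 2 * τ) / (1 - ex (n * τ)) = -(2 * F2 τ) := by
  have h0 : ∑' n : ℕ+, (-1 : ℂ) ^ ((n : ℕ) : ℤ) * (((n : ℕ) : ℤ) : ℂ) *
      ex ((((n : ℕ) : ℤ) : ℂ) * ((((n : ℕ) : ℤ) : ℂ) + 1) / 2 * τ) /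
        (1 - ex ((((n : ℕ) : ℤ) : ℂ) * τ)) =
      ∑' n : ℕ, (-1 : ℂ) ^ ((n + 1 : ℕ) : ℤ) * (((n + 1 : ℕ) : ℤ) : ℂ) *
      ex ((((n + 1 : ℕ) : ℤ) : ℂ) * ((((n + 1 : ℕ) : ℤ) : ℂ) + 1) / 2 * τ) /
        (1 - ex ((((n + 1 : ℕ) : ℤ) : ℂ) * τ)) :=
    tsum_pnat_eq_tsum_succ (f := fun n : ℕ => (-1 : ℂ) ^ (n : ℤ) * ((n : ℤ) : ℂ) *
      ex (((n : ℤ) : ℂ) * (((n : ℤ) : ℂ) + 1) / 2 * τ) / (1 - ex (((n : ℤ) : ℂ) * τ)))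
  rw [tsum_int_eq_zero_add_two_mul_tsum_pnat ?_ hs, F2_eq_tsum hτ,
    h0]
  · simp only [Int.cast_zero, mul_zero, zero_mul, zero_div, zero_add, ← mul_neg, ← tsum_neg]
    rw [nsmul_eq_mul, Nat.cast_ofNat]
    congr 1
    apply tsum_congr
    intro n
    rw [zpow_natCast, pow_succ]
    push_cast
    rw [show ((n : ℂ) + 1) * (n + 1 + 1) = (n + 1) * (n + 2) by ring]
    ring
  · intro n
    by_cases hn : n = 0
    · simp [hn]
    have hne : 1 - ex (n * τ) ≠ 0 := by
      simpa using half_strip_ne (τ := τ) (z := 0) (by simp [hτ]) hn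
    have hne2 : 1 - ex (((-n : ℤ) : ℂ) * τ) ≠ 0 := by
      simpa using half_strip_ne (τ := τ) (z := 0) (by simp [hτ]) (neg_ne_zero.2 hn)
    have h1 : (-1 : ℂ) ^ (-n) = (-1) ^ n := by rw [zpow_neg, ← inv_zpow]; norm_num
    have h2 : ex (((-n : ℤ) : ℂ) * (((-n : ℤ) : ℂ) + 1) / 2 * τ) =
        ex (n * (n + 1) / 2 * τ) * (ex (n * τ))⁻¹ := by
      rw [← ex_neg, ← ex_add]; push_cast; ring_nf
    have h3 : ex (((-n : ℤ) : ℂ) * τ) = (ex (n * τ))⁻¹ := by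
      rw [← ex_neg]; push_cast; ring_nf
    rw [h3] at hne2
    dsimp only
    rw [h1, h2, h3]
    have h0 := ex_ne_zero (n * τ)
    generalize ex (n * τ) = t at *
    rw [div_eq_div_iff hne2 hne]
    push_cast
    field_simp
    ring

lemma tendsto_dterm {τ : ℂ} (hτ : 0 < τ.im) :
    Tendsto (fun z => -Complex.I * ex (z / 2) * (∑' n, dterm τ n z) / kfun z τ) (𝓝[≠] 0)
      (𝓝 (-(2 * F2 τ))) := by
  have hpi : (Real.pi : ℂ) ≠ 0 := by exact_mod_cast Real.pi_ne_zero
  obtain ⟨h1, h2⟩ := hasSum_deriv_dterm hτ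
  have hI : (2 * Real.pi * Complex.I : ℂ) ≠ 0 := by simp [Real.pi_ne_zero]
  have h3 : deriv (fun z => ∑' n, dterm τ n z) 0 = 2 * Real.pi * Complex.I * -(2 * F2 τ) := by
    rw [← h1.tsum_eq]
    have hs := h1.summable
    simp only [deriv_dterm τ _ hτ] at hs ⊢
    rw [tsum_mul_left, tsum_dterm_coeff hτ ((summable_mul_left_iff hI).1 hs)]
  have h4 := h2.hasDerivAt.tendsto_slope
  rw [h3] at h4
  have he : Tendsto (fun z => ex (z / 2)) (𝓝[≠] 0) (𝓝 1) := by
    have : ContinuousAt (fun z => ex (z / 2)) 0 := by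
      exact (differentiable_ex.comp
        (by fun_prop : Differentiable ℂ fun z : ℂ => z / 2)).continuous.continuousAt
    have := this.tendsto
    rw [zero_div, ex_zero] at this
    exact this.mono_left nhdsWithin_le_nhds
  have h5 := ((he.const_mul (-Complex.I)).mul h4).div (tendsto_kfun_div hτ) (by simp [hpi])
  have e : -Complex.I * 1 * (2 * Real.pi * Complex.I * -(2 * F2 τ)) / (2 * Real.pi) =
      -(2 * F2 τ) := by
    field_simp
    rw [Complex.I_sq]; ring
  rw [e] at h5
  refine h5.congr' ?_
  filter_upwards [self_mem_nhdsWithin] with z hz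
  have hz : z ≠ 0 := hz
  have h0 : ∑' n, dterm τ n 0 = 0 := by
    rw [← tsum_zero]
    exact tsum_congr fun n => by simp [dterm]
  simp only [Pi.div_apply, slope_def_field, h0, sub_zero]
  field_simp

lemma eta_ne_zero {τ : ℂ} (hτ : 0 < τ.im) : ModularForm.eta τ ≠ 0 :=
  ModularForm.eta_ne_zero hτ

lemma eta_cube_mul_mu_eq {τ : ℂ} (hτ : 0 < τ.im) (z : ℂ) :
    ModularForm.eta τ ^ 3 * mu τ z = -Complex.I * ex (z / 2) * lsum id τ z / kfun z τ := by
  have := eta_ne_zero hτ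
  rw [mu, theta1_eq_kfun hτ, lsum]
  have e : ∀ n : ℤ, lnum τ (id z) n / (1 - ex (z + n * τ)) =
    (-1 : ℂ) ^ n * ex (n * z + n * (n + 1) / 2 * τ) / (1 - ex (z + n * τ)) := fun n => rfl
  simp only [e]
  generalize (∑' n : ℤ, (-1 : ℂ) ^ n * ex (n * z + n * (n + 1) / 2 * τ) /
    (1 - ex (z + n * τ))) = s
  by_cases hk : kfun z τ = 0
  · simp [hk]
  field_simp

/-- The Appell--Lerch sum `μ` in terms of the Weierstrass function. -/
theorem eta_cube_mul_mu_add {τ : ℂ} (hτ : 0 < τ.im) {z : ℂ} (hz : ¬ inLat τ z) :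
    ModularForm.eta τ ^ 3 * mu τ z + 2 * F2 τ = -wfun z τ := by
  rw [eta_cube_mul_mu_eq hτ]
  set f : ℂ → ℂ := fun z => -Complex.I * ex (z / 2) * lsum id τ z / kfun z τ + wfun z τ with hf
  -- Split the sum as `lsum id` = (`lsum id` - `lsum 0`) + `lsum 0`. The second part contributes
  -- 1/`kfun`², whose pole and constant term cancel against `wfun`; the first part contributes -2F₂.
  have hlim : Tendsto f (𝓝[≠] 0) (𝓝 (-(2 * F2 τ))) := by
    have := (tendsto_dterm hτ).add (tendsto_inv_kfun_sq_add_wfun hτ)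
    rw [add_zero] at this
    refine this.congr' ?_
    filter_upwards [eventually_not_inLat hτ] with z hz
    have h1 := lsum_zero_eq hτ hz
    have hk := kfun_ne_zero hτ hz
    rw [← lsum_sub_lsum hτ hz, hf]
    dsimp only
    have e : lsum id τ z = (lsum id τ z - lsum 0 τ z) + lsum 0 τ z := by ring
    have h2 : -Complex.I * ex (z / 2) * lsum 0 τ z / kfun z τ = (kfun z τ ^ 2)⁻¹ := by
      field_simp
      linear_combination (-Complex.I) * h1 - Complex.I_sq
    have h3 : -Complex.I * ex (z / 2) * lsum id τ z / kfun z τ =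
        -Complex.I * ex (z / 2) * (lsum id τ z - lsum 0 τ z) / kfun z τ +
        -Complex.I * ex (z / 2) * lsum 0 τ z / kfun z τ := by ring
    rw [h3, h2]; ring
  obtain ⟨c, hc, hc2⟩ : ∃ c, (∀ z, ¬ inLat τ z → f z = c) ∧ Tendsto f (𝓝[≠] 0) (𝓝 c) := by
    refine elliptic_const hτ ?_ ?_ ?_ (tendsto_mul_zero_of_tendsto hlim)
    · intro z
      simp only [hf]
      rw [lsum_id_add_one, kfun_add_one, wfun_add_one, show (z + 1) / 2 = z / 2 + 1 / 2 by ring,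
        ex_add, ex_half]; ring
    · intro z
      simp only [hf]
      rw [wfun_add_tau hτ, lsum_id_add_tau, kfun_add_tau hτ]
      congr 1
      rw [show (z + τ) / 2 = z / 2 + τ / 2 by ring]
      rw [show -z - τ / 2 = -z + -(τ / 2) by ring, ex_add, ex_add, ex_neg, ex_neg,
        show ex τ = ex (τ / 2) * ex (τ / 2) by rw [← ex_add]; ring_nf]
      have h1 := ex_ne_zero z
      have h2 := ex_ne_zero (τ / 2)
      generalize ex (τ / 2) = t at *
      generalize ex z = s at *
      by_cases hk : kfun z τ = 0
      · simp [hk]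
      field_simp
    · intro z hz
      refine DifferentiableAt.add (DifferentiableAt.div (DifferentiableAt.mul ?_
        (lsum_aux hτ differentiable_id (by simp) hz).1) (differentiableAt_kfun hτ z)
        (kfun_ne_zero hτ hz)) (differentiableAt_wfun hτ hz)
      exact ((differentiable_ex.comp
        (by fun_prop : Differentiable ℂ fun z : ℂ => z / 2)).const_mul _) z
  have h1 := hc z hz
  rw [tendsto_nhds_unique hc2 hlim] at h1
  simp only [hf] at h1
  linear_combination h1

end Mathieu

namespace Mathieu

open Filter Topology
open scoped MatrixGroups Manifold

/-! ### A vanishing criterion for families of functions permuted by the modular group -/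

/-- The filter of neighbourhoods of `i∞` in `ℂ`. -/
def imInf : Filter ℂ := comap Complex.im atTop

lemma eventually_imInf_le (A : ℝ) : ∀ᶠ τ in imInf, A ≤ τ.im :=
  (eventually_ge_atTop A).comap _

lemma tendsto_coe_imInf : Tendsto (fun τ : ℍ => (τ : ℂ)) UpperHalfPlane.atImInfty imInf := by
  rw [imInf, tendsto_comap_iff]
  exact tendsto_comap

lemma tendsto_ex_imInf : Tendsto ex imInf (𝓝 0) := by
  rw [tendsto_zero_iff_norm_tendsto_zero]
  simp only [norm_ex]
  refine Real.tendsto_exp_atBot.comp ?_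
  have : Tendsto (fun y : ℝ => -2 * Real.pi * y) atTop atBot :=
    tendsto_id.const_mul_atTop_of_neg (by nlinarith [Real.pi_pos])
  exact this.comp tendsto_comap

lemma tendsto_poch {α : Type*} {l : Filter α} {w q : α → ℂ} (hw : Tendsto w l (𝓝 0))
    (hq : Tendsto q l (𝓝 0)) : Tendsto (fun a => poch (w a) (q a)) l (𝓝 1) := by
  rw [tendsto_iff_norm_sub_tendsto_zero]
  have h1 : Tendsto (fun a => Real.exp (‖w a‖ * (1 - ‖q a‖)⁻¹) - 1) l (𝓝 0) := by
    have h2 : Tendsto (fun a => ‖w a‖ * (1 - ‖q a‖)⁻¹) l (𝓝 (‖(0 : ℂ)‖ * (1 - ‖(0 : ℂ)‖)⁻¹)) :=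
      hw.norm.mul ((hq.norm.const_sub 1).inv₀ (by simp))
    rw [norm_zero, zero_mul] at h2
    have := ((Real.continuous_exp.tendsto 0).comp h2).sub_const 1
    simpa using this
  refine squeeze_zero' (Eventually.of_forall fun a => norm_nonneg _) ?_ h1
  have h3 := hq.norm.eventually (gt_mem_nhds (by simp : ‖(0 : ℂ)‖ < 1))
  filter_upwards [h3] with a ha
  exact norm_poch_sub_one_le _ ha

/-- The discriminant form as a function on `ℂ`. -/
def disc (τ : ℂ) : ℂ := ModularForm.eta τ ^ 24

lemma disc_eq (τ : ℂ) : disc τ = ex τ * poch (ex τ) (ex τ) ^ 24 := by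
  rw [disc, eta_eq_poch, mul_pow, ← ex_nat_mul]
  congr 2
  push_cast; ring

lemma disc_ne_zero {τ : ℂ} (hτ : 0 < τ.im) : disc τ ≠ 0 := pow_ne_zero _ (eta_ne_zero hτ)

lemma csqrt_pow_24 {z : ℂ} (hz : z ≠ 0) : z.sqrt ^ 24 = z ^ 12 := by
  rw [sqrt_eq_exp hz, ← Complex.exp_nat_mul]
  ring_nf
  rw [show (Complex.log z * 12) = (12 : ℕ) * Complex.log z by push_cast; ring,
    Complex.exp_nat_mul, Complex.exp_log hz]

lemma disc_S {τ : ℂ} (hτ : 0 < τ.im) : disc (-1 / τ) = τ ^ 12 * disc τ := by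
  have h := ModularForm.eta_comp_eq_csqrt_I_inv (show τ ∈ UpperHalfPlane.upperHalfPlaneSet from hτ)
  simp only [Function.comp_apply, Pi.smul_apply, Pi.mul_apply, smul_eq_mul] at h
  rw [disc, h, mul_pow, mul_pow, inv_pow, csqrt_pow_24 Complex.I_ne_zero,
    csqrt_pow_24 (ne_zero_of_im_pos hτ), disc, show Complex.I ^ 12 = (Complex.I ^ 4) ^ 3 by ring,
    Complex.I_pow_four]
  ring

lemma disc_T (τ : ℂ) : disc (τ + 1) = disc τ := by
  simp only [disc_eq, ex_add_one]

lemma differentiableOn_disc : DifferentiableOn ℂ disc {τ | 0 < τ.im} := by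
  have h : ∀ τ ∈ {τ : ℂ | 0 < τ.im}, ‖ex τ‖ < 1 := fun τ hτ => norm_ex_lt_one hτ
  have hop : IsOpen {τ : ℂ | 0 < τ.im} := isOpen_lt continuous_const (by fun_prop)
  refine DifferentiableOn.congr ?_ fun τ _ => disc_eq τ
  exact differentiable_ex.differentiableOn.mul ((differentiableOn_poch hop
    differentiable_ex.differentiableOn differentiable_ex.differentiableOn h).pow 24)

lemma tendsto_disc_div : Tendsto (fun τ => disc τ / ex τ) imInf (𝓝 1) := by
  have := (tendsto_poch tendsto_ex_imInf tendsto_ex_imInf).pow 24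
  rw [one_pow] at this
  refine this.congr fun τ => ?_
  rw [disc_eq, mul_div_cancel_left₀ _ (ex_ne_zero τ)]

lemma disc_isBigO : disc =O[imInf] ex :=
  Asymptotics.isBigO_of_div_tendsto_nhds (Eventually.of_forall fun τ h => absurd h (ex_ne_zero τ))
    1 tendsto_disc_div

lemma ex_isBigO_disc : ex =O[imInf] disc := by
  refine Asymptotics.isBigO_of_div_tendsto_nhds ?_ 1 ?_
  · filter_upwards [eventually_imInf_le 1] with τ hτ h
    exact absurd h (disc_ne_zero (by linarith))
  · have := tendsto_disc_div.inv₀ one_ne_zero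
    simp only [inv_div, inv_one] at this
    exact this

/-- The two generators of SL₂(ℤ) give invariance under the whole group, and boundedness at i∞ is
boundedness at every cusp. There are no level one forms of negative weight. -/
lemma eq_zero_of_neg_weight {F : ℂ → ℂ} {k : ℤ} (hk : k < 0)
    (hd : DifferentiableOn ℂ F {τ | 0 < τ.im})
    (hS : ∀ τ : ℂ, 0 < τ.im → F (-1 / τ) = τ ^ k * F τ)
    (hT : ∀ τ : ℂ, 0 < τ.im → F (τ + 1) = F τ)
    (hb : F =O[imInf] fun _ => (1 : ℂ)) {τ : ℂ} (hτ : 0 < τ.im) : F τ = 0 := by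
  set G : ℍ → ℂ := fun τ => F τ with hG
  have h1 : (SlashAction.map k ModularGroup.S G) = G := by
    ext z
    have hz : (z : ℂ) ≠ 0 := z.ne_zero
    rw [ModularForm.SL_slash_apply, UpperHalfPlane.modular_S_smul]
    have := hS z z.2
    rw [ModularGroup.denom_S]
    simp only [hG]
    rw [show ((-(z : ℂ))⁻¹) = -1 / z by rw [neg_div, one_div, inv_neg]]
    rw [this, zpow_neg]
    field_simp
  have h2 : (SlashAction.map k ModularGroup.T G) = G := by
    ext z
    rw [ModularForm.SL_slash_apply, UpperHalfPlane.modular_T_smul]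
    have := hT z z.2
    have h3 : UpperHalfPlane.denom ModularGroup.T z = 1 := by
      rw [ModularGroup.denom_apply]
      simp [ModularGroup.T]
    rw [h3]
    simp [hG, add_comm (1 : ℂ), this]
  have hslash := SlashInvariantForm.slash_action_generators_SL2Z h1 h2
  have hbd : UpperHalfPlane.IsBoundedAtImInfty G := by
    have := hb.comp_tendsto tendsto_coe_imInf
    exact (this.trans (Asymptotics.isBigO_of_le _ fun x => by simp) :
      G =O[UpperHalfPlane.atImInfty] fun _ => (1 : ℝ))
  let f : ModularForm 𝒮ℒ k :=
    { toFun := G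
      slash_action_eq' := by
        rintro A ⟨A, rfl⟩
        exact hslash A
      holo' := by
        rw [UpperHalfPlane.mdifferentiable_iff]
        refine hd.congr fun z hz => ?_
        simp [hG, UpperHalfPlane.ofComplex_apply_of_im_pos hz]
      bdd_at_cusps' := by
        intro c hc
        rw [Subgroup.IsArithmetic.isCusp_iff_isCusp_SL2Z] at hc
        rw [OnePoint.isBoundedAt_iff_forall_SL2Z hc]
        intro γ _
        exact (hslash γ).symm ▸ hbd }
  have := ModularFormClass.levelOne_neg_weight_eq_zero hk f
  exact congrFun this ⟨τ, hτ⟩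

/-- The weight `k` action of `τ ↦ -1/τ` on functions on the upper half-plane. -/
def slashS (k : ℤ) (g : ℍ → ℂ) (τ : ℍ) : ℂ :=
  (τ : ℂ) ^ (-k) * g ⟨-1 / (τ : ℂ), im_neg_one_div τ.2⟩

/-- The action of `τ ↦ τ + 1` on functions on the upper half-plane. -/
def slashT (g : ℍ → ℂ) (τ : ℍ) : ℂ := g ⟨(τ : ℂ) + 1, by simpa using τ.2⟩

lemma slashS_injective (k : ℤ) : Function.Injective (slashS k) := by
  intro f g h
  funext τ
  have h1 := congrFun h ⟨-1 / (τ : ℂ), im_neg_one_div τ.2⟩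
  have h2 : (-1 / (τ : ℂ)) ≠ 0 := by simp [τ.ne_zero]
  have h3 := mul_left_cancel₀ (zpow_ne_zero _ h2) h1
  have h4 : (⟨-1 / (-1 / (τ : ℂ)), im_neg_one_div (im_neg_one_div τ.2)⟩ : ℍ) = τ := by
    ext1; simp
  rwa [h4] at h3

lemma slashT_injective : Function.Injective slashT := by
  intro f g h
  funext τ
  have h1 := congrFun h ⟨(τ : ℂ) - 1, by simpa using τ.2⟩
  have h4 : (⟨(τ : ℂ) - 1 + 1, by simpa using τ.2⟩ : ℍ) = τ := by
    ext1; simp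
  simp only [slashT] at h1
  rwa [h4] at h1

/-- A family of holomorphic functions on the upper half-plane that is permuted by the modular
group with weight `k`, takes at most `n` values, is bounded at `i∞` and has a member vanishing to
an order greater than `nk/12`, is zero. -/
theorem family_eq_zero {ι : Type*} {f : ι → ℂ → ℂ} {s t : ι → ι} {k : ℤ} {i₀ : ι}
    (hgen : ∀ P : ι → Prop, P i₀ → (∀ i, P i → P (s i)) → (∀ i, P i → P (t i)) → ∀ i, P i)
    (hS : ∀ i (τ : ℂ), 0 < τ.im → f i (-1 / τ) = τ ^ k * f (s i) τ)
    (hT : ∀ i (τ : ℂ), 0 < τ.im → f i (τ + 1) = f (t i) τ)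
    (hd : ∀ i, DifferentiableOn ℂ (f i) {τ | 0 < τ.im})
    (hb : ∀ i, f i =O[imInf] fun _ => (1 : ℂ))
    {m : ℕ} (h0 : f i₀ =O[imInf] fun τ => ex τ ^ m)
    {κ : Type*} (p : κ → ι) (L : Finset κ)
    (hL : ∀ i, ∃ j ∈ L, ∀ τ : ℂ, 0 < τ.im → f i τ = f (p j) τ)
    (hk : 0 ≤ k) (hm : L.card * k < 12 * m) {τ : ℂ} (hτ : 0 < τ.im) : f i₀ τ = 0 := by
  classical
  set φ : ι → ℍ → ℂ := fun i τ => f i τ with hφ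
  -- The set of functions, not of indices: repetitions are removed, so that injectivity of the two
  -- slash operators makes them permutations of `A`.
  set A : Finset (ℍ → ℂ) := L.image fun j => φ (p j) with hA
  have hmem : ∀ i, φ i ∈ A := by
    intro i
    obtain ⟨j, hj, h⟩ := hL i
    exact Finset.mem_image.2 ⟨j, hj, funext fun τ => (h τ τ.2).symm⟩
  have hex : ∀ g ∈ A, ∃ i, g = φ i := by
    intro g hg
    obtain ⟨j, -, rfl⟩ := Finset.mem_image.1 hg
    exact ⟨_, rfl⟩
  have hcard : (A.card : ℤ) * k < 12 * m :=
    (mul_le_mul_of_nonneg_right (by exact_mod_cast Finset.card_image_le) hk).trans_lt hm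
  have hslS : ∀ i, slashS k (φ i) = φ (s i) := by
    intro i
    funext τ
    simp only [slashS, hφ]
    rw [hS i τ τ.2, ← mul_assoc, ← zpow_add₀ τ.ne_zero]
    simp
  have hslT : ∀ i, slashT (φ i) = φ (t i) := fun i => funext fun τ => hT i τ τ.2
  have himS : A.image (slashS k) = A := by
    refine Finset.eq_of_subset_of_card_le ?_ ?_
    · intro g hg
      obtain ⟨g', hg', rfl⟩ := Finset.mem_image.1 hg
      obtain ⟨i, rfl⟩ := hex g' hg'
      rw [hslS]; exact hmem _
    · rw [Finset.card_image_of_injective _ (slashS_injective k)]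
  have himT : A.image slashT = A := by
    refine Finset.eq_of_subset_of_card_le ?_ ?_
    · intro g hg
      obtain ⟨g', hg', rfl⟩ := Finset.mem_image.1 hg
      obtain ⟨i, rfl⟩ := hex g' hg'
      rw [hslT]; exact hmem _
    · rw [Finset.card_image_of_injective _ slashT_injective]
  -- The norm to level one. It has weight |A| k and inherits the vanishing order m of the
  -- distinguished member, as the other factors are bounded.
  set N : ℍ → ℂ := ∏ g ∈ A, g with hN
  have hext : ∀ τ : ℂ, ∀ hτ : 0 < τ.im, N (UpperHalfPlane.ofComplex τ) = N ⟨τ, hτ⟩ := by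
    intro τ hτ; rw [UpperHalfPlane.ofComplex_apply_of_im_pos hτ]
  have hMD : ∀ g ∈ A, MDiff g := by
    intro g hg
    obtain ⟨i, rfl⟩ := hex g hg
    rw [UpperHalfPlane.mdifferentiable_iff]
    refine (hd i).congr fun z hz => ?_
    simp [hφ, UpperHalfPlane.ofComplex_apply_of_im_pos hz]
  have hNd : DifferentiableOn ℂ (fun τ => N (UpperHalfPlane.ofComplex τ)) {τ | 0 < τ.im} := by
    have : ∀ g ∈ A, DifferentiableOn ℂ (fun τ => g (UpperHalfPlane.ofComplex τ)) {τ | 0 < τ.im} :=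
      fun g hg => UpperHalfPlane.mdifferentiable_iff.1 (hMD g hg)
    have h2 := DifferentiableOn.fun_finsetProd this
    refine h2.congr fun z _ => ?_
    simp only [hN, Finset.prod_apply]
  have hNS : ∀ τ : ℍ, N ⟨-1 / (τ : ℂ), im_neg_one_div τ.2⟩ = (τ : ℂ) ^ (A.card * k) * N τ := by
    intro τ
    have h1 : ∀ g ∈ A, g ⟨-1 / (τ : ℂ), im_neg_one_div τ.2⟩ = (τ : ℂ) ^ k * slashS k g τ := by
      intro g _
      rw [slashS, ← mul_assoc, ← zpow_add₀ τ.ne_zero]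
      simp
    rw [hN, Finset.prod_apply, Finset.prod_congr rfl h1, Finset.prod_mul_distrib,
      Finset.prod_const, Finset.prod_apply, mul_comm (A.card : ℤ), zpow_mul, zpow_natCast]
    congr 1
    conv_rhs => rw [← himS, Finset.prod_image fun a _ b _ h => slashS_injective k h]
  have hNT : ∀ τ : ℍ, N ⟨(τ : ℂ) + 1, by simpa using τ.2⟩ = N τ := by
    intro τ
    rw [hN, Finset.prod_apply, Finset.prod_apply]
    conv_rhs => rw [← himT, Finset.prod_image fun a _ b _ h => slashT_injective h]
    rfl
  have hbd : ∀ g ∈ A, (fun τ => g (UpperHalfPlane.ofComplex τ)) =O[imInf] fun _ => (1 : ℂ) := by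
    intro g hg
    obtain ⟨i, rfl⟩ := hex g hg
    refine (hb i).congr' ?_ EventuallyEq.rfl
    filter_upwards [eventually_imInf_le 1] with τ hτ
    simp [hφ, UpperHalfPlane.ofComplex_apply_of_im_pos (show 0 < τ.im by linarith)]
  have hNO : (fun τ => N (UpperHalfPlane.ofComplex τ)) =O[imInf] fun τ => ex τ ^ m := by
    have h1 : (fun τ => φ i₀ (UpperHalfPlane.ofComplex τ)) =O[imInf] fun τ => ex τ ^ m := by
      refine h0.congr' ?_ EventuallyEq.rfl
      filter_upwards [eventually_imInf_le 1] with τ hτ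
      simp [hφ, UpperHalfPlane.ofComplex_apply_of_im_pos (show 0 < τ.im by linarith)]
    have h2 : (fun τ => ∏ g ∈ A.erase (φ i₀), g (UpperHalfPlane.ofComplex τ)) =O[imInf]
        fun τ => ∏ g ∈ A.erase (φ i₀), (1 : ℂ) :=
      Asymptotics.IsBigO.finsetProd fun g hg => hbd g (Finset.mem_of_mem_erase hg)
    have h3 := h1.mul h2
    simp only [Finset.prod_const_one, mul_one] at h3
    refine h3.congr_left fun τ => ?_
    rw [Finset.mul_prod_erase A (fun g => g (UpperHalfPlane.ofComplex τ)) (hmem i₀), hN,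
      Finset.prod_apply]
  have hN0 : N = 0 := by
    funext τ
    -- Division by Δᵐ leaves a bounded function of weight |A| k - 12m, which is negative.
    have h1 : (fun τ => N (UpperHalfPlane.ofComplex τ) / disc τ ^ m) (τ : ℂ) = 0 := by
      refine eq_zero_of_neg_weight (F := fun τ => N (UpperHalfPlane.ofComplex τ) / disc τ ^ m)
        (τ := (τ : ℂ)) (k := A.card * k - 12 * m) (by linarith) ?_ ?_ ?_ ?_ τ.2
      · exact hNd.div (differentiableOn_disc.pow m) fun τ hτ => pow_ne_zero _ (disc_ne_zero hτ)
      · intro τ hτ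
        have hS := hNS ⟨τ, hτ⟩
        have h0 : τ ≠ 0 := ne_zero_of_im_pos hτ
        rw [hext _ (im_neg_one_div hτ), hext _ hτ, hS, disc_S hτ, zpow_sub₀ h0, zpow_mul τ 12,
          mul_pow]
        have hd := disc_ne_zero hτ
        norm_cast
        field_simp
      · intro τ hτ
        have hτ' : 0 < (τ + 1).im := by simpa using hτ
        rw [hext _ hτ, hext _ hτ', disc_T, hNT ⟨τ, hτ⟩]
      · have h1 := hNO.mul ((ex_isBigO_disc.pow m).inv_rev ?_)
        · refine (h1.congr_left fun τ => (div_eq_mul_inv _ _).symm).trans ?_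
          refine Asymptotics.isBigO_of_le _ fun τ => ?_
          rw [mul_inv_cancel₀ (pow_ne_zero _ (ex_ne_zero τ))]
        · exact Eventually.of_forall fun τ h => absurd h (pow_ne_zero _ (ex_ne_zero τ))
    simp only [div_eq_zero_iff, pow_ne_zero _ (disc_ne_zero τ.2), or_false,
      UpperHalfPlane.ofComplex_apply] at h1
    exact h1
  obtain ⟨g, hg, hg0⟩ := (UpperHalfPlane.prod_eq_zero_iff (f := fun g => g) hMD).1 hN0
  obtain ⟨i, rfl⟩ := hex g hg
  -- Some factor of the product vanishes identically, not necessarily the distinguished one; the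
  -- vanishing is passed along the generators.
  have hiff : ∀ i, φ i = 0 ↔ φ i₀ = 0 := by
    refine hgen _ Iff.rfl (fun i hi => ?_) fun i hi => ?_
    · rw [← hi, ← hslS]
      have : slashS k (0 : ℍ → ℂ) = 0 := by funext τ; simp [slashS]
      exact ⟨fun h => slashS_injective k (h.trans this.symm), fun h => by rw [h, this]⟩
    · rw [← hi, ← hslT]
      have : slashT (0 : ℍ → ℂ) = 0 := by funext τ; simp [slashT]
      exact ⟨fun h => slashT_injective (h.trans this.symm), fun h => by rw [h, this]⟩
  exact congrFun ((hiff i).1 hg0) ⟨τ, hτ⟩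

end Mathieu

namespace Mathieu

open Filter Topology

/-! ### Klein forms -/

/-- The Klein form with rational characteristics `a, b`. -/
def klein (a b : ℚ) (τ : ℂ) : ℂ := ex (a * (a * τ + b) / 2) * kfun (a * τ + b) τ

lemma inLat_rat {τ : ℂ} (hτ : 0 < τ.im) {a b : ℚ} :
    inLat τ (a * τ + b) ↔ ∃ m n : ℤ, a = m ∧ b = n := by
  constructor
  · rintro ⟨m, n, h⟩
    have h1 := congrArg Complex.im h
    have e1 : ((a : ℂ) * τ + b).im = a * τ.im := by
      rw [show (a : ℂ) * τ + b = ((a : ℝ) : ℂ) * τ + ((b : ℝ) : ℂ) by push_cast; rfl,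
        Complex.add_im, Complex.im_ofReal_mul, Complex.ofReal_im, add_zero]
    have e2 : ((m : ℂ) * τ + n).im = m * τ.im := by
      rw [show (m : ℂ) * τ + n = ((m : ℝ) : ℂ) * τ + ((n : ℝ) : ℂ) by push_cast; rfl,
        Complex.add_im, Complex.im_ofReal_mul, Complex.ofReal_im, add_zero]
    rw [e1, e2] at h1
    have h2 : (a : ℝ) = m := mul_right_cancel₀ hτ.ne' h1
    have h3 : a = m := by exact_mod_cast h2
    refine ⟨m, n, h3, ?_⟩
    rw [h3] at h
    push_cast at h
    exact_mod_cast add_left_cancel h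
  · rintro ⟨m, n, rfl, rfl⟩
    exact ⟨m, n, by push_cast; rfl⟩

/-- The exponential prefactor of the Klein form absorbs the Gaussian factor of `kfun_S`, so that the
characteristics transform as a vector without multiplier. -/
lemma klein_S {τ : ℂ} (hτ : 0 < τ.im) (a b : ℚ) :
    klein a b (-1 / τ) = τ⁻¹ * klein b (-a) τ := by
  have h0 := ne_zero_of_im_pos hτ
  have e : (a : ℂ) * (-1 / τ) + b = (b * τ + ((-a : ℚ) : ℂ)) / τ := by
    push_cast; field_simp; ring
  have e2 : ex (a * ((b * τ + ((-a : ℚ) : ℂ)) / τ) / 2) *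
      ex ((b * τ + ((-a : ℚ) : ℂ)) ^ 2 / (2 * τ)) = ex (b * (b * τ + ((-a : ℚ) : ℂ)) / 2) := by
    rw [← ex_add]
    congr 1
    push_cast
    field_simp
    ring
  rw [klein, klein, e, kfun_S hτ, ← e2]
  ring

lemma klein_T (a b : ℚ) (τ : ℂ) : klein a b (τ + 1) = klein a (a + b) τ := by
  rw [klein, klein, kfun_T]
  push_cast
  ring_nf

lemma kfun_add_int (z τ : ℂ) (n : ℤ) : kfun (z + n) τ = (-1) ^ n * kfun z τ := by
  induction n using Int.induction_on with
  | zero => simp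
  | succ n ih =>
    rw [show z + ((n + 1 : ℤ) : ℂ) = z + (n : ℤ) + 1 by push_cast; ring, kfun_add_one, ih,
      zpow_add_one₀ (by norm_num)]
    ring
  | pred n ih =>
    have h := kfun_add_one (z + ((-n - 1 : ℤ) : ℂ)) τ
    rw [show z + ((-n - 1 : ℤ) : ℂ) + 1 = z + ((-n : ℤ) : ℂ) by push_cast; ring, ih] at h
    rw [zpow_sub_one₀ (by norm_num), show ((-1 : ℂ))⁻¹ = -1 by norm_num]
    linear_combination h

lemma kfun_add_int_mul {τ : ℂ} (hτ : 0 < τ.im) (z : ℂ) (m : ℤ) :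
    kfun (z + m * τ) τ = (-1) ^ m * ex (-(m * z) - m ^ 2 * τ / 2) * kfun z τ := by
  induction m using Int.induction_on with
  | zero => simp [ex_zero]
  | succ n ih =>
    rw [show z + ((n + 1 : ℤ) : ℂ) * τ = z + ((n : ℤ) : ℂ) * τ + τ by push_cast; ring,
      kfun_add_tau hτ, ih, zpow_add_one₀ (by norm_num)]
    have : ex (-(((n + 1 : ℤ) : ℂ) * z) - ((n + 1 : ℤ) : ℂ) ^ 2 * τ / 2) =
        ex (-(z + ((n : ℤ) : ℂ) * τ) - τ / 2) *
          ex (-(((n : ℤ) : ℂ) * z) - ((n : ℤ) : ℂ) ^ 2 * τ / 2) := by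
      rw [← ex_add]; push_cast; ring_nf
    rw [this]; ring
  | pred n ih =>
    have h := kfun_add_tau hτ (z + ((-n - 1 : ℤ) : ℂ) * τ)
    rw [show z + ((-n - 1 : ℤ) : ℂ) * τ + τ = z + ((-n : ℤ) : ℂ) * τ by push_cast; ring, ih] at h
    rw [zpow_sub_one₀ (by norm_num)]
    have : ex (-(((-n - 1 : ℤ) : ℂ) * z) - ((-n - 1 : ℤ) : ℂ) ^ 2 * τ / 2) =
        (ex (-(z + ((-n - 1 : ℤ) : ℂ) * τ) - τ / 2))⁻¹ *
          ex (-(((-n : ℤ) : ℂ) * z) - ((-n : ℤ) : ℂ) ^ 2 * τ / 2) := by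
      rw [← ex_neg, ← ex_add]; push_cast; ring_nf
    rw [this]
    have hne := ex_ne_zero (-(z + ((-n - 1 : ℤ) : ℂ) * τ) - τ / 2)
    generalize ex (-(z + ((-n - 1 : ℤ) : ℂ) * τ) - τ / 2) = t at *
    generalize kfun (z + ((-n - 1 : ℤ) : ℂ) * τ) τ = w at *
    have h2 : w = -t⁻¹ * (-t * w) := by field_simp
    rw [h2, ← h]
    norm_num
    ring

/-- The factor is independent of τ and has absolute value one. Periodicity of products of Klein
forms reduces to the cancellation of these factors. -/
lemma klein_add_int {τ : ℂ} (hτ : 0 < τ.im) (a b : ℚ) (m n : ℤ) :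
    klein (a + m) (b + n) τ = (-1) ^ (m * n + m + n) * ex ((a * n - b * m) / 2) * klein a b τ := by
  have e : ((a + m : ℚ) : ℂ) * τ + ((b + n : ℚ) : ℂ) = (a * τ + b + n) + m * τ := by
    push_cast; ring
  have h1 : (-1 : ℂ) ≠ 0 := by norm_num
  have e2 : (-1 : ℂ) ^ (m * n) = ex (-((m : ℂ) * n) / 2) := by
    rw [show -((m : ℂ) * n) / 2 = ((-(m * n) : ℤ) : ℂ) * (1 / 2) by push_cast; ring, ex_int_mul,
      ex_half, zpow_neg, ← inv_zpow]
    norm_num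
  rw [klein, klein, e, kfun_add_int_mul hτ, kfun_add_int, zpow_add₀ h1, zpow_add₀ h1, e2]
  have e3 : ex (((a + m : ℚ) : ℂ) * (a * τ + b + n + m * τ) / 2) *
      ex (-(m * (a * τ + b + n)) - m ^ 2 * τ / 2) =
      ex (-((m : ℂ) * n) / 2) * ex ((a * n - b * m) / 2) * ex (a * (a * τ + b) / 2) := by
    rw [← ex_add, ← ex_add, ← ex_add]; push_cast; ring_nf
  linear_combination ((-1 : ℂ) ^ m * (-1 : ℂ) ^ n * kfun (a * τ + b) τ) * e3

lemma klein_ne_zero {τ : ℂ} (hτ : 0 < τ.im) {a b : ℚ} (h : ¬ ∃ m n : ℤ, a = m ∧ b = n) :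
    klein a b τ ≠ 0 :=
  mul_ne_zero (ex_ne_zero _) (kfun_ne_zero hτ fun h' => h ((inLat_rat hτ).1 h'))

lemma isOpen_upper : IsOpen {τ : ℂ | 0 < τ.im} := isOpen_lt continuous_const (by fun_prop)

lemma differentiableOn_ex_comp {f : ℂ → ℂ} {U : Set ℂ} (hf : DifferentiableOn ℂ f U) :
    DifferentiableOn ℂ (fun τ => ex (f τ)) U :=
  differentiable_ex.comp_differentiableOn hf

lemma differentiableOn_klein (a b : ℚ) : DifferentiableOn ℂ (klein a b) {τ | 0 < τ.im} := by
  have h : ∀ τ ∈ {τ : ℂ | 0 < τ.im}, ‖ex τ‖ < 1 := fun τ hτ => norm_ex_lt_one hτ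
  have he := differentiable_ex.differentiableOn (s := {τ : ℂ | 0 < τ.im})
  unfold klein kfun
  refine (differentiableOn_ex_comp (by fun_prop)).mul (((differentiableOn_ex_comp
    (by fun_prop)).const_mul _ |>.mul ?_).div ?_ ?_)
  · exact (differentiableOn_poch isOpen_upper (differentiableOn_ex_comp (by fun_prop)) he h).mul
      (differentiableOn_poch isOpen_upper (he.mul (differentiableOn_ex_comp (by fun_prop))) he h)
  · exact (differentiableOn_poch isOpen_upper he he h).pow 2
  · exact fun τ hτ => pow_ne_zero _ (poch_self_ne_zero (h τ hτ))

/-- The translate of the weight two function `etfun` to a rational point of the lattice. -/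
def etq (a b : ℚ) (τ : ℂ) : ℂ := etfun (a * τ + b) τ

lemma etq_S {τ : ℂ} (hτ : 0 < τ.im) {a b : ℚ} (h : ¬ ∃ m n : ℤ, a = m ∧ b = n) :
    etq a b (-1 / τ) = τ ^ 2 * etq b (-a) τ := by
  have h0 := ne_zero_of_im_pos hτ
  have e : (a : ℂ) * (-1 / τ) + b = (b * τ + ((-a : ℚ) : ℂ)) / τ := by
    push_cast; field_simp; ring
  rw [etq, etq, e, etfun_S hτ]
  rw [inLat_rat hτ]
  rintro ⟨m, n, h1, h2⟩
  exact h ⟨-n, m, by push_cast; linarith, h1⟩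

lemma etq_T {τ : ℂ} (hτ : 0 < τ.im) (a b : ℚ) : etq a b (τ + 1) = etq a (a + b) τ := by
  rw [etq, etq, etfun_T hτ]
  push_cast
  ring_nf

lemma etq_add_int {τ : ℂ} (hτ : 0 < τ.im) (a b : ℚ) (m n : ℤ) :
    etq (a + m) (b + n) τ = etq a b τ := by
  have e : ((a + m : ℚ) : ℂ) * τ + ((b + n : ℚ) : ℂ) = (a * τ + b) + (m * τ + n) := by
    push_cast; ring
  rw [etq, etq, e, etfun, etfun, periodic_of_generators (f := fun z => wfun z τ)
    (fun z => wfun_add_one z τ) (fun z => wfun_add_tau hτ z)]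

lemma differentiableOn_E2 : DifferentiableOn ℂ E2 {τ | 0 < τ.im} := by
  have h : ∀ τ ∈ {τ : ℂ | 0 < τ.im}, ‖ex τ‖ < 1 := fun τ hτ => norm_ex_lt_one hτ
  have he := differentiable_ex.differentiableOn (s := {τ : ℂ | 0 < τ.im})
  refine DifferentiableOn.congr ?_ fun τ hτ => E2_eq_afun hτ
  exact ((differentiableOn_afun isOpen_upper he he h fun τ hτ =>
    poch_self_ne_zero (h τ hτ)).const_mul _).const_sub _

lemma differentiableOn_etq {a b : ℚ} (hab : ¬ ∃ m n : ℤ, a = m ∧ b = n) :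
    DifferentiableOn ℂ (etq a b) {τ | 0 < τ.im} := by
  have h : ∀ τ ∈ {τ : ℂ | 0 < τ.im}, ‖ex τ‖ < 1 := fun τ hτ => norm_ex_lt_one hτ
  have he := differentiable_ex.differentiableOn (s := {τ : ℂ | 0 < τ.im})
  have hl : ∀ τ ∈ {τ : ℂ | 0 < τ.im}, ¬ inLat τ (a * τ + b) := fun τ hτ h' =>
    hab ((inLat_rat hτ).1 h')
  unfold etq etfun wfun
  refine DifferentiableOn.add (DifferentiableOn.add ?_ ?_) (differentiableOn_E2.div_const _)
  · exact differentiableOn_afun isOpen_upper (differentiableOn_ex_comp (by fun_prop)) he h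
      fun τ hτ => (poch_ne_zero_of_not_inLat hτ (hl τ hτ)).1
  · exact differentiableOn_afun isOpen_upper (he.mul (differentiableOn_ex_comp (by fun_prop))) he h
      fun τ hτ => (poch_ne_zero_of_not_inLat hτ (hl τ hτ)).2

/-! ### Growth at the cusp -/

/-- `F` grows at most as `q⁻ʳ` at `i∞`. -/
def Growth (r : ℝ) (F : ℂ → ℂ) : Prop :=
  F =O[imInf] fun τ => Real.exp (2 * Real.pi * r * τ.im)

lemma Growth.mul {r s : ℝ} {F G : ℂ → ℂ} (hF : Growth r F) (hG : Growth s G) :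
    Growth (r + s) fun τ => F τ * G τ := by
  refine (Asymptotics.IsBigO.mul hF hG).congr_right fun τ => ?_
  rw [← Real.exp_add]; ring_nf

lemma Growth.mono {r s : ℝ} {F : ℂ → ℂ} (hF : Growth r F) (h : r ≤ s) : Growth s F := by
  refine hF.trans (Asymptotics.IsBigO.of_bound 1 ?_)
  filter_upwards [eventually_imInf_le 0] with τ hτ
  rw [Real.norm_of_nonneg (Real.exp_pos _).le, Real.norm_of_nonneg (Real.exp_pos _).le, one_mul]
  apply Real.exp_le_exp.2
  have := Real.pi_pos
  gcongr

lemma Growth.add {r : ℝ} {F G : ℂ → ℂ} (hF : Growth r F) (hG : Growth r G) :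
    Growth r fun τ => F τ + G τ := Asymptotics.IsBigO.add hF hG

lemma Growth.const_mul {r : ℝ} {F : ℂ → ℂ} (hF : Growth r F) (c : ℂ) :
    Growth r fun τ => c * F τ := Asymptotics.IsBigO.const_mul_left hF c

lemma growth_zero_iff {F : ℂ → ℂ} : Growth 0 F ↔ F =O[imInf] fun _ => (1 : ℂ) := by
  unfold Growth
  simp only [mul_zero, zero_mul, Real.exp_zero]
  exact ⟨fun h => h.trans (Asymptotics.isBigO_of_le _ fun _ => by simp),
    fun h => h.trans (Asymptotics.isBigO_of_le _ fun _ => by simp)⟩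

lemma growth_const (c : ℂ) : Growth 0 fun _ => c :=
  growth_zero_iff.2 (Asymptotics.isBigO_const_const c one_ne_zero _)

lemma growth_of_tendsto {F : ℂ → ℂ} {c : ℂ} (h : Tendsto F imInf (𝓝 c)) : Growth 0 F :=
  growth_zero_iff.2 (h.isBigO_one ℂ)

lemma growth_ex (r : ℝ) (c : ℂ) : Growth r fun τ => ex (-(r * τ) + c) := by
  refine Asymptotics.IsBigO.of_bound ‖ex c‖ (Eventually.of_forall fun τ => ?_)
  rw [ex_add, norm_mul, mul_comm, norm_ex (-(r * τ)), Complex.neg_im, Complex.im_ofReal_mul,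
    Real.norm_of_nonneg (Real.exp_pos _).le]
  apply le_of_eq; ring_nf

lemma growth_disc : Growth (-1) disc := by
  refine disc_isBigO.trans ?_
  have : Growth (-1) ex := by simpa using growth_ex (-1) 0
  exact this

lemma Growth.prod {ι : Type*} (s : Finset ι) {r : ι → ℝ} {F : ι → ℂ → ℂ}
    (h : ∀ i ∈ s, Growth (r i) (F i)) : Growth (∑ i ∈ s, r i) fun τ => ∏ i ∈ s, F i τ := by
  classical
  induction s using Finset.induction_on with
  | empty => simpa using growth_const 1
  | insert i s hi ih =>
    simp only [Finset.prod_insert hi, Finset.sum_insert hi]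
    exact (h i (Finset.mem_insert_self _ _)).mul
      (ih fun j hj => h j (Finset.mem_insert_of_mem hj))

lemma Growth.sum {ι : Type*} (s : Finset ι) {r : ℝ} {F : ι → ℂ → ℂ}
    (h : ∀ i ∈ s, Growth r (F i)) : Growth r fun τ => ∑ i ∈ s, F i τ :=
  Asymptotics.IsBigO.congr_left (Asymptotics.IsBigO.sum h) fun τ => Finset.sum_apply τ s F

lemma tendsto_ex_of_pos {r : ℝ} (hr : 0 < r) (c : ℂ) :
    Tendsto (fun τ => ex (r * τ + c)) imInf (𝓝 0) := by
  have h1 : Tendsto (fun τ : ℂ => (r : ℂ) * τ) imInf imInf := by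
    rw [imInf, tendsto_comap_iff]
    have : (Complex.im ∘ fun τ : ℂ => (r : ℂ) * τ) = fun τ => r * τ.im := by
      funext τ; simp
    rw [this]
    exact tendsto_comap.const_mul_atTop hr
  have := (tendsto_ex_imInf.comp h1).mul_const (ex c)
  rw [zero_mul] at this
  refine this.congr fun τ => ?_
  rw [Function.comp_apply, ← ex_add]

/-- The leading part of a Klein form at `i∞`. -/
lemma klein_eq_main {τ : ℂ} (hτ : 0 < τ.im) (a b : ℚ) : klein a b τ =
    (-Complex.I * (ex (-((-((a ^ 2 + a) / 2 : ℝ) : ℝ) * τ) + (a + 1) * b / 2) -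
      ex (-((((a - a ^ 2) / 2 : ℝ) : ℝ) * τ) + (a - 1) * b / 2))) *
    (poch (ex ((1 - a : ℝ) * τ + (-b))) (ex τ) * poch (ex ((1 + a : ℝ) * τ + b)) (ex τ) /
      poch (ex τ) (ex τ) ^ 2) := by
  rw [klein, kfun, poch_succ (ex (-(a * τ + b))) (norm_ex_lt_one hτ), ← ex_add, ← ex_add]
  rw [show -((a : ℂ) * τ + b) + τ = ((1 - a : ℝ) : ℂ) * τ + -b by push_cast; ring,
    show τ + ((a : ℂ) * τ + b) = ((1 + a : ℝ) : ℂ) * τ + b by push_cast; ring]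
  have e1 : ex (a * (a * τ + b) / 2) * ex ((a * τ + b) / 2) =
      ex (-(((-((a ^ 2 + a) / 2 : ℝ) : ℝ) : ℂ) * τ) + (a + 1) * b / 2) := by
    rw [← ex_add]; push_cast; ring_nf
  have e2 : ex (a * (a * τ + b) / 2) * ex ((a * τ + b) / 2) * ex (-(a * τ + b)) =
      ex (-((((a - a ^ 2) / 2 : ℝ) : ℂ) * τ) + (a - 1) * b / 2) := by
    rw [← ex_add, ← ex_add]; push_cast; ring_nf
  rw [← e1, ← e2]
  ring

lemma tendsto_klein_unit {a : ℚ} (b : ℚ) (h0 : 0 ≤ a) (h1 : a < 1) :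
    Tendsto (fun τ => poch (ex ((1 - a : ℝ) * τ + (-b))) (ex τ) *
      poch (ex ((1 + a : ℝ) * τ + b)) (ex τ) / poch (ex τ) (ex τ) ^ 2) imInf (𝓝 1) := by
  have h0' : (0 : ℝ) ≤ a := by exact_mod_cast h0
  have h1' : (a : ℝ) < 1 := by exact_mod_cast h1
  have h2 := tendsto_poch (tendsto_ex_of_pos (r := 1 - a) (by linarith) (-b)) tendsto_ex_imInf
  have h3 := tendsto_poch (tendsto_ex_of_pos (r := 1 + a) (by linarith) b) tendsto_ex_imInf
  have h4 := (tendsto_poch tendsto_ex_imInf tendsto_ex_imInf).pow 2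
  have h5 := (h2.mul h3).div h4 (by norm_num)
  rw [mul_one, one_pow, div_one] at h5
  exact h5

/-- The leading exponent of q is (a² - a)/2, whose minimum on the unit interval is -1/8, attained at
a = 1/2. -/
lemma growth_klein_of_lt {a : ℚ} (b : ℚ) (h0 : 0 ≤ a) (h1 : a < 1) :
    Growth (1 / 8) (klein a b) := by
  have h0' : (0 : ℝ) ≤ a := by exact_mod_cast h0
  have h1' : (a : ℝ) < 1 := by exact_mod_cast h1
  have g1 := (growth_ex (-((a ^ 2 + a) / 2 : ℝ)) ((a + 1) * b / 2)).mono
    (show (-((a ^ 2 + a) / 2 : ℝ)) ≤ 1 / 8 by nlinarith)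
  have g2 := (growth_ex ((a - a ^ 2) / 2 : ℝ) ((a - 1) * b / 2)).mono
    (show ((a - a ^ 2) / 2 : ℝ) ≤ 1 / 8 by nlinarith [sq_nonneg ((a : ℝ) - 1 / 2)])
  have g3 := ((g1.add (g2.const_mul (-1))).const_mul (-Complex.I)).mul
    (growth_of_tendsto (tendsto_klein_unit b h0 h1))
  rw [add_zero] at g3
  refine Asymptotics.IsBigO.congr' g3 ?_ EventuallyEq.rfl
  filter_upwards [eventually_imInf_le 1] with τ hτ
  rw [klein_eq_main (by linarith)]
  ring

/-- The leading exponent (a² - a)/2 is never positive, so the inverse stays bounded. For a = 0 the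
leading coefficient is a constant depending on b. -/
lemma growth_klein_inv_of_lt {a b : ℚ} (h0 : 0 ≤ a) (h1 : a < 1)
    (hab : ¬ ∃ m n : ℤ, a = m ∧ b = n) : Growth 0 fun τ => (klein a b τ)⁻¹ := by
  have h0' : (0 : ℝ) ≤ a := by exact_mod_cast h0
  have h1' : (a : ℝ) < 1 := by exact_mod_cast h1
  have hu := (tendsto_klein_unit b h0 h1).inv₀ one_ne_zero
  have key : Growth 0 fun τ => (-Complex.I *
      (ex (-((-((a ^ 2 + a) / 2 : ℝ) : ℝ) * τ) + (a + 1) * b / 2) -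
      ex (-((((a - a ^ 2) / 2 : ℝ) : ℝ) * τ) + (a - 1) * b / 2)))⁻¹ := by
    rcases h0.eq_or_lt with rfl | hpos
    · refine Asymptotics.IsBigO.congr_left (growth_const (-Complex.I *
        (ex (b / 2) - ex (-b / 2)))⁻¹) fun τ => ?_
      norm_num
    · have hpos' : (0 : ℝ) < a := by exact_mod_cast hpos
      have g1 : Growth 0 fun τ => ex (((a - a ^ 2) / 2 : ℝ) * τ + -((a - 1) * b / 2)) := by
        have := (growth_ex (-((a - a ^ 2) / 2 : ℝ)) (-((a - 1) * b / 2))).mono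
          (show (-((a - a ^ 2) / 2 : ℝ)) ≤ 0 by nlinarith)
        refine Asymptotics.IsBigO.congr_left this fun τ => ?_
        push_cast; ring_nf
      have g2 : Tendsto (fun τ => (Complex.I * (1 - ex ((a : ℝ) * τ + b)))⁻¹) imInf
          (𝓝 (Complex.I * (1 - 0))⁻¹) :=
        (((tendsto_ex_of_pos hpos' b).const_sub 1).const_mul _).inv₀ (by simp)
      have g3 := g1.mul (growth_of_tendsto g2)
      rw [add_zero] at g3
      refine Asymptotics.IsBigO.congr_left g3 fun τ => ?_
      have e1 : ex (-((-((a ^ 2 + a) / 2 : ℝ) : ℝ) * τ) + (a + 1) * b / 2) =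
          ex ((a : ℝ) * τ + b) * ex (-((((a - a ^ 2) / 2 : ℝ) : ℝ) * τ) + (a - 1) * b / 2) := by
        rw [← ex_add]; push_cast; ring_nf
      have e2 : ex (((a - a ^ 2) / 2 : ℝ) * τ + -((a - 1) * b / 2)) =
          (ex (-((((a - a ^ 2) / 2 : ℝ) : ℝ) * τ) + (a - 1) * b / 2))⁻¹ := by
        rw [← ex_neg]; push_cast; ring_nf
      rw [e1, e2, ← mul_inv]
      congr 1
      ring
  have g := key.mul (growth_of_tendsto hu)
  rw [add_zero] at g
  refine Asymptotics.IsBigO.congr' g ?_ EventuallyEq.rfl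
  filter_upwards [eventually_imInf_le 1] with τ hτ
  rw [klein_eq_main (by linarith)]
  exact (mul_inv _ _).symm

lemma norm_ex_rat (r : ℚ) : ‖ex (r : ℂ)‖ = 1 := by
  rw [norm_ex, show (r : ℂ) = ((r : ℝ) : ℂ) by push_cast; rfl, Complex.ofReal_im]; simp

/-- An integral translation multiplies the form by a number of absolute value one, so growth need
only be studied for 0 ≤ a < 1. -/
lemma norm_klein_fract {τ : ℂ} (hτ : 0 < τ.im) (a b : ℚ) :
    ‖klein a b τ‖ = ‖klein (Int.fract a) b τ‖ := by
  have h := klein_add_int hτ (Int.fract a) b ⌊a⌋ 0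
  rw [Int.fract_add_floor, Int.cast_zero, add_zero] at h
  have e : ((Int.fract a : ℚ) * ((0 : ℤ) : ℂ) - b * ⌊a⌋) / 2 = ((-(b * ⌊a⌋) / 2 : ℚ) : ℂ) := by
    push_cast; ring
  rw [h, norm_mul, norm_mul, e, norm_ex_rat, norm_zpow, norm_neg, norm_one, one_zpow, one_mul,
    one_mul]

lemma growth_klein (a b : ℚ) : Growth (1 / 8) (klein a b) := by
  refine Asymptotics.IsBigO.trans ?_ (growth_klein_of_lt b (Int.fract_nonneg a) (Int.fract_lt_one a))
  refine Asymptotics.IsBigO.of_bound 1 ?_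
  filter_upwards [eventually_imInf_le 1] with τ hτ
  rw [norm_klein_fract (by linarith), one_mul]

lemma not_int_fract {a b : ℚ} (hab : ¬ ∃ m n : ℤ, a = m ∧ b = n) :
    ¬ ∃ m n : ℤ, Int.fract a = m ∧ b = n := by
  rintro ⟨m, n, h1, h2⟩
  exact hab ⟨⌊a⌋ + m, n, by rw [Int.cast_add, ← h1, Int.floor_add_fract], h2⟩

lemma growth_klein_inv {a b : ℚ} (hab : ¬ ∃ m n : ℤ, a = m ∧ b = n) :
    Growth 0 fun τ => (klein a b τ)⁻¹ := by
  refine Asymptotics.IsBigO.trans ?_ (growth_klein_inv_of_lt (Int.fract_nonneg a)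
    (Int.fract_lt_one a) (not_int_fract hab))
  refine Asymptotics.IsBigO.of_bound 1 ?_
  filter_upwards [eventually_imInf_le 1] with τ hτ
  rw [norm_inv, norm_inv, norm_klein_fract (by linarith), one_mul]

lemma tendsto_afun {α : Type*} {l : Filter α} {u q : α → ℂ} (hu : Tendsto u l (𝓝 0))
    (hq : Tendsto q l (𝓝 0)) : Tendsto (fun a => afun (u a) (q a)) l (𝓝 0) := by
  rw [tendsto_zero_iff_norm_tendsto_zero]
  have h1 : Tendsto (fun a => 8 * ‖u a‖) l (𝓝 0) := by simpa using hu.norm.const_mul 8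
  have h2 : ∀ {v : α → ℂ}, Tendsto v l (𝓝 0) → ∀ᶠ a in l, ‖v a‖ ≤ 1 / 2 := by
    intro v hv
    have h3 := hv.norm
    rw [norm_zero] at h3
    exact (h3.eventually (gt_mem_nhds (by norm_num : (0 : ℝ) < 1 / 2))).mono fun a h => h.le
  refine squeeze_zero' (Eventually.of_forall fun a => norm_nonneg _) ?_ h1
  filter_upwards [h2 hu, h2 hq] with a ha hb
  have h3 : ∀ n : ℕ, ‖gfun (u a * q a ^ n)‖ ≤ 4 * ‖u a‖ * (1 / 2) ^ n := by
    intro n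
    rw [mul_assoc]
    refine norm_gfun_mul_pow_le le_rfl hb ?_
    calc ‖u a‖ * (1 / 2) ^ n ≤ 1 / 2 * 1 := by
          gcongr; exact pow_le_one₀ (by norm_num) (by norm_num)
      _ = 1 / 2 := by norm_num
  have h4 : HasSum (fun n : ℕ => 4 * ‖u a‖ * (1 / 2 : ℝ) ^ n) (4 * ‖u a‖ * 2) :=
    hasSum_geometric_two.mul_left _
  refine (tsum_of_norm_bounded h4 h3).trans (le_of_eq (by ring))

lemma growth_E2 : Growth 0 E2 := by
  have := ((tendsto_afun tendsto_ex_imInf tendsto_ex_imInf).const_mul 24).const_sub 1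
  refine Asymptotics.IsBigO.congr' (growth_of_tendsto this) ?_ EventuallyEq.rfl
  filter_upwards [eventually_imInf_le 1] with τ hτ
  rw [E2_eq_afun (by linarith)]

lemma growth_etq_of_lt {a b : ℚ} (h0 : 0 ≤ a) (h1 : a < 1) : Growth 0 (etq a b) := by
  have h0' : (0 : ℝ) ≤ a := by exact_mod_cast h0
  have h1' : (a : ℝ) < 1 := by exact_mod_cast h1
  have g1 := growth_of_tendsto (tendsto_afun (tendsto_ex_of_pos (r := 1 + a) (by linarith) b)
    tendsto_ex_imInf)
  have g2 := growth_of_tendsto (tendsto_afun (tendsto_ex_of_pos (r := 1 - a) (by linarith) (-b))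
    tendsto_ex_imInf)
  have g3 : Growth 0 fun τ => gfun (ex ((a : ℝ) * τ + b)) := by
    rcases h0.eq_or_lt with rfl | hpos
    · refine Asymptotics.IsBigO.congr_left (growth_const (gfun (ex b))) fun τ => ?_
      norm_num
    · have hpos' : (0 : ℝ) < a := by exact_mod_cast hpos
      have : Tendsto gfun (𝓝 0) (𝓝 (gfun 0)) :=
        (differentiableAt_gfun (w := 0) (by norm_num)).continuousAt
      exact growth_of_tendsto (this.comp (tendsto_ex_of_pos hpos' b))
  refine Asymptotics.IsBigO.congr' ((g3.add (g1.add g2)).add (growth_E2.const_mul (1 / 12))) ?_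
    EventuallyEq.rfl
  filter_upwards [eventually_imInf_le 1] with τ hτ
  rw [etq, etfun, wfun_eq_gfun_add (by linarith), ← ex_add, ← ex_add]
  rw [show τ + -((a : ℂ) * τ + b) = ((1 - a : ℝ) : ℂ) * τ + -b by push_cast; ring,
    show τ + ((a : ℂ) * τ + b) = ((1 + a : ℝ) : ℂ) * τ + b by push_cast; ring]
  push_cast
  ring

lemma growth_etq (a b : ℚ) : Growth 0 (etq a b) := by
  refine Asymptotics.IsBigO.congr' (growth_etq_of_lt (b := b) (Int.fract_nonneg a)
    (Int.fract_lt_one a)) ?_ EventuallyEq.rfl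
  filter_upwards [eventually_imInf_le 1] with τ hτ
  have h := etq_add_int (τ := τ) (by linarith) (Int.fract a) b ⌊a⌋ 0
  rw [Int.fract_add_floor, Int.cast_zero, add_zero] at h
  exact h.symm

end Mathieu

namespace Mathieu

open Filter Topology

/-! ### Families indexed by primitive vectors -/

/-- Primitive vectors modulo `M`. -/
def Prim (M : ℕ) (c d : ℤ) : Prop := ∃ x y z : ℤ, c * x + d * y + M * z = 1

lemma Prim.S {M : ℕ} {c d : ℤ} (h : Prim M c d) : Prim M d (-c) := by
  obtain ⟨x, y, z, h⟩ := h
  exact ⟨y, -x, z, by linarith⟩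

lemma Prim.T {M : ℕ} {c d : ℤ} (h : Prim M c d) : Prim M c (c + d) := by
  obtain ⟨x, y, z, h⟩ := h
  exact ⟨x - y, y, z, by linarith⟩

lemma Prim.add {M : ℕ} {c d : ℤ} (h : Prim M c d) (m n : ℤ) : Prim M (c + M * m) (d + M * n) := by
  obtain ⟨x, y, z, h⟩ := h
  exact ⟨x, y, z - m * x - n * y, by linarith⟩

lemma Prim.mul {M : ℕ} {c d u w r : ℤ} (h : Prim M c d) (hu : u * w = 1 + M * r) :
    Prim M (u * c) (u * d) := by
  obtain ⟨x, y, z, h⟩ := h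
  refine ⟨w * x, w * y, (1 + M * r) * z - r, ?_⟩
  linear_combination (1 + M * r : ℤ) * h + (c * x + d * y) * hu

/-- Functions indexed by primitive vectors modulo `M` and permuted by the modular group with
weight `k`, holomorphic and of moderate growth at `i∞`. -/
structure KFamily (k : ℤ) (M : ℕ) (f : ℤ → ℤ → ℂ → ℂ) : Prop where
  S : ∀ c d, Prim M c d → ∀ τ : ℂ, 0 < τ.im → f c d (-1 / τ) = τ ^ k * f d (-c) τ
  T : ∀ c d, Prim M c d → ∀ τ : ℂ, 0 < τ.im → f c d (τ + 1) = f c (c + d) τ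
  per : ∀ c d, Prim M c d → ∀ m n : ℤ, ∀ τ : ℂ, 0 < τ.im →
    f (c + M * m) (d + M * n) τ = f c d τ
  holo : ∀ c d, Prim M c d → DifferentiableOn ℂ (f c d) {τ | 0 < τ.im}
  growth : ∀ c d, Prim M c d → Growth (1 / 2) (f c d)

lemma KFamily.add {k : ℤ} {M : ℕ} {f g : ℤ → ℤ → ℂ → ℂ} (hf : KFamily k M f)
    (hg : KFamily k M g) : KFamily k M fun c d τ => f c d τ + g c d τ where
  S c d h τ hτ := by rw [hf.S c d h τ hτ, hg.S c d h τ hτ]; ring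
  T c d h τ hτ := by rw [hf.T c d h τ hτ, hg.T c d h τ hτ]
  per c d h m n τ hτ := by rw [hf.per c d h m n τ hτ, hg.per c d h m n τ hτ]
  holo c d h := (hf.holo c d h).add (hg.holo c d h)
  growth c d h := (hf.growth c d h).add (hg.growth c d h)

lemma KFamily.const_mul {k : ℤ} {M : ℕ} {f : ℤ → ℤ → ℂ → ℂ} (hf : KFamily k M f) (r : ℂ) :
    KFamily k M fun c d τ => r * f c d τ where
  S c d h τ hτ := by rw [hf.S c d h τ hτ]; ring
  T c d h τ hτ := by rw [hf.T c d h τ hτ]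
  per c d h m n τ hτ := by rw [hf.per c d h m n τ hτ]
  holo c d h := (hf.holo c d h).const_mul r
  growth c d h := (hf.growth c d h).const_mul r

lemma kfamily_const (M : ℕ) (r : ℂ) : KFamily 0 M fun _ _ _ => r where
  S c d h τ hτ := by simp
  T c d h τ hτ := rfl
  per c d h m n τ hτ := rfl
  holo c d h := differentiableOn_const r
  growth c d h := (growth_const r).mono (by norm_num)

/-- The vectors reached from `(0, 1)` by the generators of the modular group. -/
inductive Reach : ℤ × ℤ → Prop
  | base : Reach (0, 1)
  | S {v : ℤ × ℤ} : Reach v → Reach (v.2, -v.1)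
  | T {v : ℤ × ℤ} : Reach v → Reach (v.1, v.1 + v.2)

lemma Reach.prim {v : ℤ × ℤ} (h : Reach v) (M : ℕ) : Prim M v.1 v.2 := by
  induction h with
  | base => exact ⟨0, 1, 0, by simp⟩
  | S _ ih => exact ih.S
  | T _ ih => exact ih.T

/-- The members at (0, u) coincide by hypothesis, and the generators commute with multiplication of
the index by a unit. Hence the distinct members are counted by vectors up to units, that is, by a
projective line modulo M. -/
lemma KFamily.mul_unit {k : ℤ} {M : ℕ} {f : ℤ → ℤ → ℂ → ℂ} (hf : KFamily k M f)
    (hbase : ∀ u : ℤ, Prim M 0 u → ∀ τ : ℂ, 0 < τ.im → f 0 u τ = f 0 1 τ)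
    {v : ℤ × ℤ} (hv : Reach v) {u w r : ℤ} (hu : u * w = 1 + M * r) :
    ∀ τ : ℂ, 0 < τ.im → f (u * v.1) (u * v.2) τ = f v.1 v.2 τ := by
  induction hv with
  | base =>
    intro τ hτ
    simp only [mul_zero, mul_one]
    exact hbase u ⟨0, w, -r, by linarith⟩ τ hτ
  | @S v hv ih =>
    intro τ hτ
    have h1 := ih (-1 / τ) (im_neg_one_div hτ)
    rw [hf.S _ _ ((hv.prim M).mul hu) τ hτ, hf.S _ _ (hv.prim M) τ hτ] at h1
    have := mul_left_cancel₀ (zpow_ne_zero _ (ne_zero_of_im_pos hτ)) h1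
    simpa using this
  | @T v hv ih =>
    intro τ hτ
    have h1 := ih (τ + 1) (by simpa using hτ)
    rw [hf.T _ _ ((hv.prim M).mul hu) τ hτ, hf.T _ _ (hv.prim M) τ hτ] at h1
    simpa [mul_add] using h1

/-- Representatives of the primitive vectors modulo `M` up to units. -/
def primList (M : ℕ) : List (ℕ × ℕ) :=
  (((List.range M).flatMap fun c => (List.range M).map fun d => (c, d)).filter fun p =>
    Nat.gcd (Nat.gcd p.1 p.2) M == 1 &&
      (List.range M).all fun u => Nat.gcd u M != 1 || p.1 < u * p.1 % M ||
        (p.1 == u * p.1 % M && p.2 ≤ u * p.2 % M))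

/-- The list `L` represents the orbit of `(0, 1)` modulo `M` up to units. -/
def closedList (M : ℕ) (L : List (ℕ × ℕ)) : Bool :=
  let ok : ℕ → ℕ → Bool := fun c d => L.any fun p => (List.range M).any fun u =>
    Nat.gcd u M == 1 && (u * p.1) % M == c % M && (u * p.2) % M == d % M
  ok 0 1 && L.all fun p => ok p.2 (M - p.1 % M) && ok p.1 (p.1 + p.2)

lemma exists_mul_of_mod_eq {M a b : ℕ} (h : a % M = b % M) : ∃ r : ℤ, (a : ℤ) = b + M * r := by
  have h2 : (b : ℤ) ≡ a [ZMOD M] := by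
    have : (b : ℤ) % M = a % M := by exact_mod_cast h.symm
    exact this
  obtain ⟨r, hr⟩ := h2.dvd
  exact ⟨r, by linarith⟩

/-- The Boolean check establishes closure under the two generators modulo M and up to units.
Induction along the generators extends it to the whole orbit of integral vectors. -/
lemma exists_rep {M : ℕ} (hM : 0 < M) {L : List (ℕ × ℕ)} (h : closedList M L = true) {v : ℤ × ℤ}
    (hv : Reach v) : ∃ p ∈ L, ∃ u w r m n : ℤ, u * w = 1 + M * r ∧
      v.1 = u * p.1 + M * m ∧ v.2 = u * p.2 + M * n := by
  simp only [closedList, List.any_eq_true, List.mem_range, Bool.and_eq_true, beq_iff_eq,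
    List.all_eq_true] at h
  obtain ⟨h0, h1⟩ := h
  have key : ∀ (c d : ℕ), (∃ p ∈ L, ∃ u < M, (Nat.gcd u M = 1 ∧
      (u * p.1) % M = c % M) ∧ (u * p.2) % M = d % M) → ∀ u' w' r' m' n' : ℤ,
      u' * w' = 1 + M * r' → ∃ p ∈ L, ∃ u w r m n : ℤ, u * w = 1 + M * r ∧
      u' * c + M * m' = u * p.1 + M * m ∧ u' * d + M * n' = u * p.2 + M * n := by
    rintro c d ⟨p, hp, u, -, ⟨h1, h2⟩, h3⟩ u' w' r' m' n' hu'
    obtain ⟨w, r1, hr1⟩ : ∃ w r1 : ℤ, u * w = 1 + M * r1 :=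
      ⟨Nat.gcdA u M, -Nat.gcdB u M, by
        have := Nat.gcd_eq_gcd_ab u M
        rw [h1] at this
        push_cast at this
        linarith⟩
    obtain ⟨r2, hr2⟩ := exists_mul_of_mod_eq h2
    obtain ⟨r3, hr3⟩ := exists_mul_of_mod_eq h3
    push_cast at hr2 hr3
    refine ⟨p, hp, u' * u, w' * w, r' * (1 + M * r1) + r1, m' - u' * r2, n' - u' * r3, ?_, ?_, ?_⟩
    · linear_combination (u * w : ℤ) * hu' + (1 + M * r') * hr1
    · linear_combination (-u') * hr2
    · linear_combination (-u') * hr3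
  induction hv with
  | base =>
    obtain ⟨p, hp, u, w, r, m, n, e1, e2, e3⟩ := key 0 1 h0 1 1 0 0 0 (by simp)
    exact ⟨p, hp, u, w, r, m, n, e1, by simpa using e2, by simpa using e3⟩
  | @S v _ ih =>
    obtain ⟨p, hp, u, w, r, m, n, e1, e2, e3⟩ := ih
    obtain ⟨p', hp', u', w', r', m', n', e1', e2', e3'⟩ :=
      -- The check stores the class of -p.1 as the natural number M - p.1 % M, which differs from
      -- -p.1 by M(1 + p.1 / M).
      key _ _ (h1 p hp).1 u w r n (-m + -u * (1 + p.1 / M)) e1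
    refine ⟨p', hp', u', w', r', m', n', e1', by rw [e3, ← e2'], ?_⟩
    rw [← e3', e2]
    have h3 : p.1 % M < M := Nat.mod_lt _ hM
    have h4 : (p.1 : ℤ) % M + M * (p.1 / M) = p.1 := Int.emod_add_mul_ediv _ _
    push_cast [h3.le]
    linear_combination u * h4
  | @T v _ ih =>
    obtain ⟨p, hp, u, w, r, m, n, e1, e2, e3⟩ := ih
    obtain ⟨p', hp', u', w', r', m', n', e1', e2', e3'⟩ :=
      key _ _ (h1 p hp).2 u w r m (m + n) e1
    refine ⟨p', hp', u', w', r', m', n', e1', by rw [e2, ← e2'], ?_⟩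
    rw [← e3', e2, e3]
    push_cast
    ring

/-- Vanishing of a family of modular functions from its expansion at one cusp. -/
theorem KFamily.eq_zero {k : ℤ} {M : ℕ} {f : ℤ → ℤ → ℂ → ℂ} (hf : KFamily k M f) (hM : 0 < M)
    (hk : 0 ≤ k)
    (hbase : ∀ u : ℤ, Prim M 0 u → ∀ τ : ℂ, 0 < τ.im → f 0 u τ = f 0 1 τ)
    {L : List (ℕ × ℕ)} (hL : closedList M L = true) {m : ℕ}
    (h0 : f 0 1 =O[imInf] fun τ => ex (τ / 2) ^ m) (hm : L.length * (2 * k + 12) < 12 * (m + 1))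
    {τ : ℂ} (hτ : 0 < τ.im) : f 0 1 τ = 0 := by
  classical
  have hτ0 : ∀ {τ : ℂ}, 0 < τ.im → τ ≠ 0 := ne_zero_of_im_pos
  have hex : ∀ i : {v // Reach v}, ∃ p ∈ L, ∀ τ : ℂ, 0 < τ.im →
      f i.1.1 i.1.2 τ = f p.1 p.2 τ := by
    rintro ⟨v, hv⟩
    obtain ⟨p, hp, u, w, r, m, n, e1, e2, e3⟩ := exists_rep hM hL hv
    refine ⟨p, hp, fun τ hτ => ?_⟩
    have e1' : w * u = 1 + M * r := by linarith
    have e4 : w * v.1 = p.1 + M * (r * p.1 + w * m) := by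
      rw [e2]; linear_combination (p.1 : ℤ) * e1
    have e5 : w * v.2 = p.2 + M * (r * p.2 + w * n) := by
      rw [e3]; linear_combination (p.2 : ℤ) * e1
    rw [← hf.mul_unit hbase hv e1' τ hτ]
    have hP : Prim M p.1 p.2 := by
      have := ((hv.prim M).mul e1').add (-(r * p.1 + w * m)) (-(r * p.2 + w * n))
      rw [e4, e5] at this
      convert this using 1 <;> ring
    rw [e4, e5, hf.per _ _ hP _ _ τ hτ]
  choose q hq hq2 using hex
  -- A listed representative need not be a reachable integral vector, so it is replaced by a
  -- reachable vector assigned to it. The value at representatives that are never assigned is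
  -- irrelevant.
  let p : ℕ × ℕ → {v // Reach v} := fun j =>
    if h : ∃ i, q i = j then h.choose else ⟨_, Reach.base⟩
  have hp : ∀ i, q (p (q i)) = q i := fun i => by
    have h : ∃ i', q i' = q i := ⟨i, rfl⟩
    simp only [p, dif_pos h]
    exact h.choose_spec
  have hcard : (L.toFinset.card : ℤ) * (2 * k + 12) < 12 * ((m + 1 : ℕ) : ℤ) := by
    push_cast
    refine lt_of_le_of_lt (mul_le_mul_of_nonneg_right ?_ (by linarith)) hm
    exact_mod_cast L.toFinset_card_le
  -- A member may grow like q^(-1/2), so f² Δ is bounded. Its weight is 2k + 12, and f = O(q^(m/2))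
  -- gives it order m + 1; squaring also turns half-integral powers of q into integral ones.
  have h1 := family_eq_zero (ι := {v // Reach v}) (f := fun i τ => f i.1.1 i.1.2 τ ^ 2 * disc τ)
    (s := fun i => ⟨_, i.2.S⟩) (t := fun i => ⟨_, i.2.T⟩) (k := 2 * k + 12) (i₀ := ⟨_, Reach.base⟩)
    (m := m + 1) (p := p) (τ := τ)
    ?_ ?_ ?_ ?_ ?_ ?_ L.toFinset ?_ (by linarith) hcard hτ
  · exact pow_eq_zero_iff (two_ne_zero) |>.1 ((mul_eq_zero.1 h1).resolve_right (disc_ne_zero hτ))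
  · rintro P h0 hS hT ⟨v, hv⟩
    induction hv with
    | base => exact h0
    | S _ ih => exact hS _ ih
    | T _ ih => exact hT _ ih
  · rintro ⟨v, hv⟩ τ hτ
    dsimp only
    rw [hf.S _ _ (hv.prim M) τ hτ, disc_S hτ, zpow_add₀ (ne_zero_of_im_pos hτ), mul_comm 2 k,
      zpow_mul]
    norm_cast
    ring
  · rintro ⟨v, hv⟩ τ hτ
    dsimp only
    rw [hf.T _ _ (hv.prim M) τ hτ, disc_T]
  · rintro ⟨v, hv⟩
    exact ((hf.holo _ _ (hv.prim M)).pow 2).mul differentiableOn_disc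
  · rintro ⟨v, hv⟩
    have g := hf.growth _ _ (hv.prim M)
    have g2 := ((g.mul g).mul growth_disc).mono (show (1 / 2 + 1 / 2 + -1 : ℝ) ≤ 0 by norm_num)
    refine (growth_zero_iff.1 g2).congr_left fun τ => by ring
  · have g := (h0.mul h0).mul disc_isBigO
    refine g.congr (fun τ => by simp only [pow_two]) fun τ => ?_
    rw [← pow_add, ← two_mul, pow_mul, pow_succ, show ex τ = ex (τ / 2) ^ 2 by
      rw [pow_two, ← ex_add]; ring_nf]
  · intro i
    refine ⟨q i, List.mem_toFinset.2 (hq i), fun τ hτ => ?_⟩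
    rw [hq2 i τ hτ, hq2 (p (q i)) τ hτ, hp]

end Mathieu

/-! ### Modular families built from products of Klein forms -/

namespace Mathieu

open Filter Topology

lemma ex_sum {ι : Type*} (s : Finset ι) (f : ι → ℂ) : ex (∑ i ∈ s, f i) = ∏ i ∈ s, ex (f i) := by
  classical
  induction s using Finset.induction_on with
  | empty => simp [ex_zero]
  | insert i s hi ih => rw [Finset.sum_insert hi, Finset.prod_insert hi, ex_add, ih]

lemma zpow_sum {ι : Type*} (s : Finset ι) {x : ℂ} (hx : x ≠ 0) (f : ι → ℤ) :
    x ^ (∑ i ∈ s, f i) = ∏ i ∈ s, x ^ f i := by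
  classical
  induction s using Finset.induction_on with
  | empty => simp
  | insert i s hi ih => rw [Finset.sum_insert hi, Finset.prod_insert hi, zpow_add₀ hx, ih]

/-- Combining the two integrality statements with the Bézout relation of the primitive vector would
give N ∣ a. This keeps the points away from the zeros of Klein forms and the poles of ℘. -/
lemma not_int_of_prim {M N : ℕ} {a c d : ℤ} (hN : 0 < N) (hNM : N ∣ M) (ha : ¬ (N : ℤ) ∣ a)
    (h : Prim M c d) : ¬ ∃ m n : ℤ, (a * c / N : ℚ) = m ∧ (a * d / N : ℚ) = n := by
  rintro ⟨m, n, h1, h2⟩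
  obtain ⟨x, y, z, h⟩ := h
  obtain ⟨r, rfl⟩ := hNM
  have hN' : (N : ℚ) ≠ 0 := by positivity
  rw [div_eq_iff hN'] at h1 h2
  have h1' : a * c = m * N := by exact_mod_cast h1
  have h2' : a * d = n * N := by exact_mod_cast h2
  refine ha ⟨m * x + n * y + a * r * z, ?_⟩
  push_cast at h
  linear_combination (-a) * h + x * h1' + y * h2'

/-- Products of powers of Klein forms at the points `(a i) v / N + h`, for `v = (c, d)` and
`h = (h₁, h₂)`. -/
def kprod {ι : Type*} [Fintype ι] (a e : ι → ℤ) (N : ℕ) (h₁ h₂ : ℚ) (c d : ℤ) (τ : ℂ) : ℂ :=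
  ∏ i, klein (a i * c / N + h₁) (a i * d / N + h₂) τ ^ e i

section kprod

variable {ι : Type*} [Fintype ι] (a e : ι → ℤ) (N : ℕ) (h₁ h₂ : ℚ) (c d : ℤ)

lemma kprod_S {τ : ℂ} (hτ : 0 < τ.im) : kprod a e N h₁ h₂ c d (-1 / τ) =
    τ ^ (-∑ i, e i) * kprod a e N h₂ (-h₁) d (-c) τ := by
  rw [kprod, kprod, ← Finset.sum_neg_distrib, zpow_sum _ (ne_zero_of_im_pos hτ),
    ← Finset.prod_mul_distrib]
  refine Finset.prod_congr rfl fun i _ => ?_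
  rw [klein_S hτ, mul_zpow, inv_zpow, zpow_neg]
  congr 3
  push_cast; ring

lemma kprod_T (τ : ℂ) : kprod a e N h₁ h₂ c d (τ + 1) = kprod a e N h₁ (h₁ + h₂) c (c + d) τ := by
  refine Finset.prod_congr rfl fun i _ => ?_
  rw [klein_T]
  congr 2
  push_cast; ring

/-- The multipliers of all factors are collected into one sign and one exponential, each governed by
a single sum. -/
lemma prod_klein_add_int {τ : ℂ} (hτ : 0 < τ.im) (α β : ι → ℚ) (m n : ι → ℤ) :
    ∏ i, klein (α i + m i) (β i + n i) τ ^ e i =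
      (-1) ^ (∑ i, e i * (m i * n i + m i + n i)) *
        ex ((∑ i, e i * (α i * n i - β i * m i) : ℚ) / 2) * ∏ i, klein (α i) (β i) τ ^ e i := by
  have h1 : ((∑ i, e i * (α i * n i - β i * m i) : ℚ) : ℂ) / 2 =
      ∑ i, (e i : ℂ) * (((α i : ℂ) * n i - β i * m i) / 2) := by
    push_cast
    rw [Finset.sum_div]
    exact Finset.sum_congr rfl fun i _ => by ring
  rw [h1, ex_sum, zpow_sum _ (by norm_num), ← Finset.prod_mul_distrib, ← Finset.prod_mul_distrib]
  refine Finset.prod_congr rfl fun i _ => ?_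
  rw [klein_add_int hτ, mul_zpow, mul_zpow, ex_int_mul, mul_comm (e i), zpow_mul]

lemma ex_half_even {r : ℚ} {n : ℤ} (h : r = 2 * n) : ex ((r : ℂ) / 2) = 1 := by
  rw [h]
  push_cast
  rw [mul_div_cancel_left₀ _ (by norm_num), ex_int]

/-- The part of the exponent linear in the exponents `a` vanishes because the weighted sum of `a` is
zero. The part from the half period is trivial because the total multiplicity is a multiple of four.
-/
lemma kprod_add_int {τ : ℂ} (hτ : 0 < τ.im) (ha : ∑ i, e i * a i = 0) {n₁ n₂ n₃ : ℤ}
    (he : ∑ i, e i = 4 * n₃) (hh₁ : 2 * h₁ = n₁) (hh₂ : 2 * h₂ = n₂) (m n : ℤ) :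
    kprod a e N (h₁ + m) (h₂ + n) c d τ = kprod a e N h₁ h₂ c d τ := by
  have h := prod_klein_add_int e hτ (fun i => a i * c / N + h₁) (fun i => a i * d / N + h₂)
    (fun _ => m) (fun _ => n)
  have hs : (-1 : ℂ) ^ (∑ i, e i * (m * n + m + n)) = 1 := by
    rw [← Finset.sum_mul, he, show 4 * n₃ * (m * n + m + n) = 2 * (2 * n₃ * (m * n + m + n)) by ring,
      zpow_mul]
    norm_num
  have haq : ∑ i, (e i : ℚ) * a i = 0 := by exact_mod_cast ha
  have heq : ∑ i, (e i : ℚ) = 4 * n₃ := by exact_mod_cast he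
  have hx : (∑ i, e i * ((a i * c / N + h₁) * n - (a i * d / N + h₂) * m) : ℚ) =
      2 * ((n₃ * (n₁ * n - n₂ * m) : ℤ) : ℚ) := by
    have : ∀ i, (e i * ((a i * c / N + h₁) * n - (a i * d / N + h₂) * m) : ℚ) =
        e i * a i * ((c * n - d * m) / N) + e i * (h₁ * n - h₂ * m) := fun i => by ring
    simp only [this, Finset.sum_add_distrib, ← Finset.sum_mul, haq, heq]
    push_cast
    rw [← hh₁, ← hh₂]; ring
  rw [hs, ex_half_even hx, one_mul, one_mul] at h
  rw [kprod, kprod, ← h]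
  refine Finset.prod_congr rfl fun i _ => ?_
  simp only [add_assoc]

/-- The quadratic condition makes the exponential factor of a translation by N·hh trivial, and the
parity condition does the same for the sign. The integer `hh` enlarges the level when N alone does
not satisfy them. -/
lemma kprod_per {τ : ℂ} (hτ : 0 < τ.im) {hh : ℕ} (hN : 0 < N) (hp : Even (∑ i, e i * a i * hh))
    (ha : ∑ i, e i * a i = 0 ∨ (h₁ = 0 ∧ h₂ = 0)) (hq : (2 * N : ℤ) ∣ hh * ∑ i, e i * a i ^ 2)
    (m n : ℤ) : kprod a e N h₁ h₂ (c + (N * hh : ℕ) * m) (d + (N * hh : ℕ) * n) τ =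
      kprod a e N h₁ h₂ c d τ := by
  have hN' : (N : ℚ) ≠ 0 := by positivity
  have h := prod_klein_add_int e hτ (fun i => a i * c / N + h₁) (fun i => a i * d / N + h₂)
    (fun i => a i * hh * m) (fun i => a i * hh * n)
  obtain ⟨r, hr⟩ := hq
  have hs : Even (∑ i, e i * (a i * hh * m * (a i * hh * n) + a i * hh * m + a i * hh * n)) := by
    have h1 : ∀ i, e i * (a i * hh * m * (a i * hh * n) + a i * hh * m + a i * hh * n) =
        e i * (a i * hh * (a i * hh - 1)) * (m * n) + e i * a i * hh * (m * n + m + n) :=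
      fun i => by ring
    rw [← Finset.sum_mul] at hp
    simp only [h1, Finset.sum_add_distrib, ← Finset.sum_mul]
    refine Even.add (Even.mul_right ?_ _) (hp.mul_right _)
    exact Finset.even_sum _ fun i _ => (Int.even_mul_pred_self _).mul_left _
  have hs' := Even.neg_one_zpow (α := ℂ) hs
  have hx : (∑ i, e i * ((a i * c / N + h₁) * ((a i * hh * n : ℤ) : ℚ) -
      (a i * d / N + h₂) * ((a i * hh * m : ℤ) : ℚ)) : ℚ) =
      2 * ((r * (c * n - d * m) : ℤ) : ℚ) := by
    have h1 : ∀ i, (e i * ((a i * c / N + h₁) * ((a i * hh * n : ℤ) : ℚ) -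
        (a i * d / N + h₂) * ((a i * hh * m : ℤ) : ℚ)) : ℚ) =
        e i * a i ^ 2 * (hh / N * (c * n - d * m)) + e i * a i * (hh * (h₁ * n - h₂ * m)) :=
      fun i => by push_cast; field_simp; ring
    have hrq : (hh * ∑ i, (e i : ℚ) * a i ^ 2) = 2 * N * r := by exact_mod_cast hr
    have h2 : (∑ i, (e i : ℚ) * a i) * (hh * (h₁ * n - h₂ * m)) = 0 := by
      rcases ha with ha | ⟨rfl, rfl⟩
      · have haq : ∑ i, (e i : ℚ) * a i = 0 := by exact_mod_cast ha
        rw [haq]; ring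
      · ring
    simp only [h1, Finset.sum_add_distrib, ← Finset.sum_mul, h2]
    push_cast
    field_simp
    linear_combination (c * n - d * m : ℚ) * hrq
  rw [hs', ex_half_even hx, one_mul, one_mul] at h
  rw [kprod, kprod, ← h]
  refine Finset.prod_congr rfl fun i _ => ?_
  congr 2
  · push_cast; field_simp; ring
  · push_cast; field_simp; ring

lemma differentiableOn_kprod (hne : ∀ i, e i < 0 → ¬ ∃ m n : ℤ,
    (a i * c / N + h₁ : ℚ) = m ∧ (a i * d / N + h₂ : ℚ) = n) :
    DifferentiableOn ℂ (kprod a e N h₁ h₂ c d) {τ | 0 < τ.im} := by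
  unfold kprod
  refine DifferentiableOn.fun_finsetProd fun i _ => ?_
  refine DifferentiableOn.zpow (differentiableOn_klein _ _) ?_
  by_cases h : e i < 0
  · exact Or.inl fun τ hτ => klein_ne_zero hτ (hne i h)
  · exact Or.inr (not_lt.1 h)

lemma growth_pow {r : ℝ} {F : ℂ → ℂ} (h : Growth r F) (n : ℕ) :
    Growth (n * r) fun τ => F τ ^ n := by
  induction n with
  | zero => simpa using growth_const 1
  | succ n ih =>
    have := ih.mul h
    rw [show (n : ℝ) * r + r = ((n + 1 : ℕ) : ℝ) * r by push_cast; ring] at this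
    simpa only [pow_succ] using this

lemma growth_kprod (hne : ∀ i, e i < 0 → ¬ ∃ m n : ℤ,
    (a i * c / N + h₁ : ℚ) = m ∧ (a i * d / N + h₂ : ℚ) = n) :
    Growth (∑ i, (max (e i) 0 : ℤ) / 8) (kprod a e N h₁ h₂ c d) := by
  unfold kprod
  refine Growth.prod _ fun i _ => ?_
  by_cases h : e i < 0
  · obtain ⟨n, hn⟩ := Int.eq_ofNat_of_zero_le (show 0 ≤ -e i by omega)
    have := growth_pow (growth_klein_inv (hne i h)) n
    rw [max_eq_right h.le]
    simp only [mul_zero, Int.cast_zero, zero_div] at this ⊢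
    have e' : e i = -(n : ℤ) := by omega
    simp only [e', zpow_neg, zpow_natCast, ← inv_pow]
    exact this
  · obtain ⟨n, hn⟩ := Int.eq_ofNat_of_zero_le (not_lt.1 h)
    have := growth_pow (growth_klein (a i * c / N + h₁) (a i * d / N + h₂)) n
    rw [max_eq_left (not_lt.1 h), hn]
    simp only [zpow_natCast]
    convert this using 1
    push_cast; ring

end kprod

/-- The product of twelve Klein forms and the discriminant, of weight zero. -/
def tprod12 (a : Fin 12 → ℤ) (N : ℕ) (h₁ h₂ : ℚ) (c d : ℤ) (τ : ℂ) : ℂ :=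
  disc τ * kprod a (fun _ => 1) N h₁ h₂ c d τ

section tprod12

variable {a : Fin 12 → ℤ} {N hh : ℕ}

lemma tprod12_S (a : Fin 12 → ℤ) (N : ℕ) (h₁ h₂ : ℚ) (c d : ℤ) {τ : ℂ} (hτ : 0 < τ.im) :
    tprod12 a N h₁ h₂ c d (-1 / τ) = tprod12 a N h₂ (-h₁) d (-c) τ := by
  rw [tprod12, tprod12, disc_S hτ, kprod_S _ _ _ _ _ _ _ hτ]
  simp only [Finset.sum_const, Finset.card_univ, Fintype.card_fin]
  have := ne_zero_of_im_pos hτ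
  norm_num
  norm_cast
  field_simp

lemma tprod12_T (a : Fin 12 → ℤ) (N : ℕ) (h₁ h₂ : ℚ) (c d : ℤ) (τ : ℂ) :
    tprod12 a N h₁ h₂ c d (τ + 1) = tprod12 a N h₁ (h₁ + h₂) c (c + d) τ := by
  rw [tprod12, tprod12, disc_T, kprod_T]

lemma tprod12_add_int (ha : ∑ i, a i = 0) (h₁ h₂ : ℚ) (c d : ℤ) {τ : ℂ} (hτ : 0 < τ.im)
    {n₁ n₂ : ℤ} (hh₁ : 2 * h₁ = n₁) (hh₂ : 2 * h₂ = n₂) (m n : ℤ) :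
    tprod12 a N (h₁ + m) (h₂ + n) c d τ = tprod12 a N h₁ h₂ c d τ := by
  rw [tprod12, tprod12, kprod_add_int _ _ _ _ _ _ _ hτ (by simpa using ha) (n₃ := 3) (by simp)
    hh₁ hh₂]

lemma tprod12_per (hN : 0 < N) (ha : ∑ i, a i = 0) (hq : (2 * N : ℤ) ∣ hh * ∑ i, a i ^ 2)
    (h₁ h₂ : ℚ) (c d : ℤ) {τ : ℂ} (hτ : 0 < τ.im) (m n : ℤ) :
    tprod12 a N h₁ h₂ (c + (N * hh : ℕ) * m) (d + (N * hh : ℕ) * n) τ =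
      tprod12 a N h₁ h₂ c d τ := by
  rw [tprod12, tprod12, kprod_per _ _ _ _ _ _ _ hτ hN]
  · simp [← Finset.sum_mul, ha]
  · left; simpa using ha
  · simpa using hq

lemma differentiableOn_tprod12 (a : Fin 12 → ℤ) (N : ℕ) (h₁ h₂ : ℚ) (c d : ℤ) :
    DifferentiableOn ℂ (tprod12 a N h₁ h₂ c d) {τ | 0 < τ.im} :=
  differentiableOn_disc.mul (differentiableOn_kprod _ _ _ _ _ _ _ fun _ h => absurd h (by norm_num))

lemma growth_tprod12 (a : Fin 12 → ℤ) (N : ℕ) (h₁ h₂ : ℚ) (c d : ℤ) :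
    Growth (1 / 2) (tprod12 a N h₁ h₂ c d) := by
  have h := growth_disc.mul (growth_kprod a (fun _ => 1) N h₁ h₂ c d
    fun _ h => absurd h (by norm_num))
  -- Twelve Klein forms grow at most like q^(-12/8) and Δ decays like q, which leaves q^(-1/2).
  refine h.mono ?_
  norm_num

/-- The three nonzero half periods are permuted by the modular group. -/
theorem kfamily_sum (hN : 0 < N) (ha : ∑ i, a i = 0) (hq : (2 * N : ℤ) ∣ hh * ∑ i, a i ^ 2)
    {k : ℤ} {E : ℚ → ℚ → ℂ → ℂ}
    (hS : ∀ (h₁ h₂ : ℚ) (τ : ℂ), 0 < τ.im → (∃ m n : ℤ, 2 * h₁ = m ∧ 2 * h₂ = n) →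
      (¬ ∃ m n : ℤ, h₁ = m ∧ h₂ = n) → E h₁ h₂ (-1 / τ) = τ ^ k * E h₂ (-h₁) τ)
    (hT : ∀ h₁ h₂ (τ : ℂ), 0 < τ.im → E h₁ h₂ (τ + 1) = E h₁ (h₁ + h₂) τ)
    (hE : ∀ h₁ h₂ (τ : ℂ), 0 < τ.im → ∀ m n : ℤ, E (h₁ + m) (h₂ + n) τ = E h₁ h₂ τ)
    (hd : ∀ h₁ h₂ : ℚ, (¬ ∃ m n : ℤ, h₁ = m ∧ h₂ = n) →
      DifferentiableOn ℂ (E h₁ h₂) {τ | 0 < τ.im})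
    (hg : ∀ h₁ h₂, Growth 0 (E h₁ h₂)) :
    KFamily k (N * hh) fun c d τ => tprod12 a N (1 / 2) 0 c d τ * E (1 / 2) 0 τ +
      tprod12 a N (1 / 2) (1 / 2) c d τ * E (1 / 2) (1 / 2) τ +
      tprod12 a N 0 (1 / 2) c d τ * E 0 (1 / 2) τ := by
  have hhalf : ∀ m : ℤ, (1 / 2 : ℚ) ≠ m := by
    intro m h
    have : (1 : ℚ) = 2 * m := by linarith
    have h2 : (1 : ℤ) = 2 * m := by exact_mod_cast this
    omega
  have n1 : ¬ ∃ m n : ℤ, (1 / 2 : ℚ) = m ∧ (0 : ℚ) = n := fun ⟨m, _, h, _⟩ => hhalf m h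
  have n2 : ¬ ∃ m n : ℤ, (1 / 2 : ℚ) = m ∧ (1 / 2 : ℚ) = n := fun ⟨m, _, h, _⟩ => hhalf m h
  have n3 : ¬ ∃ m n : ℤ, (0 : ℚ) = m ∧ (1 / 2 : ℚ) = n := fun ⟨_, m, _, h⟩ => hhalf m h
  -- Modulo integral vectors, τ ↦ -1/τ exchanges (1/2, 0) with (0, 1/2) and τ ↦ τ + 1 exchanges
  -- (1/2, 0) with (1/2, 1/2), each fixing the remaining half period.
  refine ⟨?_, ?_, ?_, ?_, ?_⟩
  · intro c d h τ hτ
    simp only [tprod12_S a N _ _ _ _ hτ]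
    rw [hS _ _ _ hτ ⟨1, 0, by norm_num, by norm_num⟩ n1,
      hS _ _ _ hτ ⟨1, 1, by norm_num, by norm_num⟩ n2,
      hS _ _ _ hτ ⟨0, 1, by norm_num, by norm_num⟩ n3]
    have e1 := tprod12_add_int (N := N) ha 0 (1 / 2) d (-c) hτ (n₁ := 0) (n₂ := 1)
      (by norm_num) (by norm_num) 0 (-1)
    have e2 := tprod12_add_int (N := N) ha (1 / 2) (1 / 2) d (-c) hτ (n₁ := 1) (n₂ := 1)
      (by norm_num) (by norm_num) 0 (-1)
    have e3 := hE 0 (1 / 2) τ hτ 0 (-1)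
    have e4 := hE (1 / 2) (1 / 2) τ hτ 0 (-1)
    norm_num at e1 e2 e3 e4 ⊢
    rw [e1, e2, e3, e4]
    ring
  · intro c d h τ hτ
    simp only [tprod12_T, hT _ _ _ hτ]
    have e2 := tprod12_add_int (N := N) ha (1 / 2) 0 c (c + d) hτ (n₁ := 1) (n₂ := 0)
      (by norm_num) (by norm_num) 0 1
    have e3 := hE (1 / 2) 0 τ hτ 0 1
    norm_num at e2 e3 ⊢
    rw [e2, e3]
    ring
  · intro c d h m n τ hτ
    simp only [tprod12_per hN ha hq _ _ _ _ hτ]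
  · intro c d h
    exact (((differentiableOn_tprod12 _ _ _ _ _ _).mul (hd _ _ n1)).add
      ((differentiableOn_tprod12 _ _ _ _ _ _).mul (hd _ _ n2))).add
      ((differentiableOn_tprod12 _ _ _ _ _ _).mul (hd _ _ n3))
  · intro c d h
    have : ∀ h₁ h₂, Growth (1 / 2) fun τ => tprod12 a N h₁ h₂ c d τ * E h₁ h₂ τ := fun h₁ h₂ => by
      simpa using (growth_tprod12 a N h₁ h₂ c d).mul (hg h₁ h₂)
    exact ((this _ _).add (this _ _)).add (this _ _)

end tprod12

/-- The Eisenstein family, the sum of `etq` over the nonzero multiples of `v / n`. -/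
def eisSum (n : ℕ) (c d : ℤ) (τ : ℂ) : ℂ :=
  ∑ j ∈ Finset.Ico 1 n, etq ((j : ℤ) * c / n) ((j : ℤ) * d / n) τ

lemma kfamily_eisSum {n M : ℕ} (hn : 0 < n) (hnM : n ∣ M) : KFamily 2 M (eisSum n) := by
  have hni : ∀ {c d : ℤ}, Prim M c d → ∀ j ∈ Finset.Ico 1 n, ¬ ∃ m k : ℤ,
      ((j : ℤ) * c / n : ℚ) = m ∧ ((j : ℤ) * d / n : ℚ) = k := by
    intro c d h j hj
    refine not_int_of_prim hn hnM ?_ h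
    rw [Finset.mem_Ico] at hj
    rw [Int.natCast_dvd_natCast]
    exact fun h' => absurd (Nat.le_of_dvd (by omega) h') (by omega)
  refine ⟨?_, ?_, ?_, ?_, ?_⟩
  · intro c d h τ hτ
    rw [eisSum, eisSum, Finset.mul_sum]
    refine Finset.sum_congr rfl fun j hj => ?_
    rw [etq_S hτ (hni h j hj), show τ ^ (2 : ℤ) = τ ^ 2 from zpow_ofNat τ 2]
    congr 2
    push_cast; ring
  · intro c d h τ hτ
    refine Finset.sum_congr rfl fun j hj => ?_
    rw [etq_T hτ]
    congr 2
    push_cast; ring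
  · intro c d h m k τ hτ
    refine Finset.sum_congr rfl fun j hj => ?_
    obtain ⟨r, rfl⟩ := hnM
    have hn' : (n : ℚ) ≠ 0 := by positivity
    rw [← etq_add_int hτ ((j : ℤ) * c / n) ((j : ℤ) * d / n) (j * r * m) (j * r * k)]
    congr 1
    · push_cast; field_simp
    · push_cast; field_simp
  · intro c d h
    unfold eisSum
    exact DifferentiableOn.fun_sum fun j hj => differentiableOn_etq (hni h j hj)
  · intro c d h
    exact (Growth.sum _ fun j _ => growth_etq _ _).mono (by norm_num)

/-- Products of powers of Klein forms at multiples of `v / N` and a power of the discriminant. -/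
lemma kfamily_kprod {ι : Type*} [Fintype ι] {a e : ι → ℤ} {N hh ε : ℕ} (hN : 0 < N)
    (hp : Even (∑ i, e i * a i * hh)) (hq : (2 * N : ℤ) ∣ hh * ∑ i, e i * a i ^ 2)
    (hneg : ∀ i, e i < 0 → ¬ (N : ℤ) ∣ a i)
    (hgr : ∑ i, max (e i) 0 ≤ 8 * ε + 4) :
    KFamily (12 * ε - ∑ i, e i) (N * hh) fun c d τ => disc τ ^ ε * kprod a e N 0 0 c d τ := by
  have hni : ∀ {c d : ℤ}, Prim (N * hh) c d → ∀ i, e i < 0 → ¬ ∃ m k : ℤ,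
      (a i * c / N + 0 : ℚ) = m ∧ (a i * d / N + 0 : ℚ) = k := by
    intro c d h i hi
    rw [add_zero, add_zero]
    exact not_int_of_prim hN (Dvd.intro hh rfl) (hneg i hi) h
  refine ⟨?_, ?_, ?_, ?_, ?_⟩
  · intro c d h τ hτ
    rw [disc_S hτ, kprod_S _ _ _ _ _ _ _ hτ, mul_pow, ← pow_mul, neg_zero, sub_eq_add_neg,
      zpow_add₀ (ne_zero_of_im_pos hτ)]
    norm_cast
    ring
  · intro c d h τ hτ
    rw [disc_T, kprod_T, add_zero]
  · intro c d h m n τ hτ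
    rw [kprod_per _ _ _ _ _ _ _ hτ hN hp (Or.inr ⟨rfl, rfl⟩) hq]
  · intro c d h
    exact (differentiableOn_disc.pow ε).mul (differentiableOn_kprod _ _ _ _ _ _ _ (hni h))
  · intro c d h
    refine ((growth_pow growth_disc ε).mul (growth_kprod _ _ _ _ _ _ _ (hni h))).mono ?_
    rw [← Finset.sum_div, ← Int.cast_sum]
    have : ((∑ i, max (e i) 0 : ℤ) : ℝ) ≤ 8 * ε + 4 := by exact_mod_cast hgr
    linarith

end Mathieu

namespace Mathieu

open Filter Topology

/-! ### Eigenvalue data -/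

/-- The multiset of exponents `±a i` modulo `N` is that of the eigenvalues of a permutation with
cycle lengths `s`. -/
def EigenData (N : ℕ) (a : Fin 12 → ℤ) (s : List ℕ) : Prop :=
  (∀ m ∈ s, 0 < m ∧ m ∣ N) ∧
    List.Perm ((List.ofFn fun i => a i % N) ++ (List.ofFn fun i => -a i % N))
      (s.flatMap fun m => (List.range m).map fun j => ((j * (N / m) : ℕ) : ℤ))

lemma prod_nthRootsFinset {M : Type*} [CommMonoid M] {ζ : ℂ} {m : ℕ}
    (hζ : IsPrimitiveRoot ζ m) (f : ℂ → M) :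
    ∏ z ∈ Polynomial.nthRootsFinset m (1 : ℂ), f z = ∏ j ∈ Finset.range m, f (ζ ^ j) := by
  classical
  rw [Polynomial.nthRootsFinset, ← Multiset.toFinset_eq hζ.nthRoots_one_nodup]
  simp only [Finset.prod_mk]
  rw [hζ.nthRoots_eq (one_pow m), Multiset.map_map]
  simp only [Finset.prod, Finset.range_val, Function.comp_def, mul_one]

/-- An m-cycle has the m-th roots of unity as eigenvalues. The permutation of exponents in
`EigenData` therefore regroups a product over eigenvalues by cycles, for every primitive N-th root.
-/
lemma EigenData.prod {M : Type*} [CommMonoid M] {N : ℕ} {a : Fin 12 → ℤ} {s : List ℕ}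
    (h : EigenData N a s) {ζ : ℂ} (hN : 0 < N) (hζ : IsPrimitiveRoot ζ N) (f : ℂ → M) :
    ∏ i, f (ζ ^ a i) * f (ζ ^ (-a i)) =
      (s.map fun m => ∏ z ∈ Polynomial.nthRootsFinset m (1 : ℂ), f z).prod := by
  have hmod : ∀ r : ℤ, ζ ^ (r % N) = ζ ^ r := by
    intro r
    have h1 : ζ ^ ((N : ℤ) * (r / N)) = 1 := by rw [zpow_mul, zpow_natCast, hζ.pow_eq_one, one_zpow]
    conv_rhs => rw [← Int.emod_add_mul_ediv r N, zpow_add₀ (hζ.ne_zero hN.ne'), h1, mul_one]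
  have h1 := (h.2.map fun r : ℤ => f (ζ ^ r)).prod_eq
  rw [List.map_append, List.prod_append, List.map_ofFn, List.map_ofFn, List.prod_ofFn,
    List.prod_ofFn, ← Finset.prod_mul_distrib] at h1
  simp only [Function.comp_def, hmod] at h1
  rw [h1, List.map_flatMap, List.flatMap_def, List.prod_flatten, List.map_map]
  congr 1
  refine List.map_congr_left fun m hm => ?_
  obtain ⟨hm0, r, rfl⟩ := h.1 m hm
  have hr : IsPrimitiveRoot (ζ ^ r) m := hζ.pow hN (mul_comm m r)
  rw [prod_nthRootsFinset hr, Function.comp_apply, List.map_map, Nat.mul_div_cancel_left _ hm0,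
    Finset.prod_eq_multiset_prod, Finset.range_val, Multiset.range, Multiset.map_coe,
    Multiset.prod_coe]
  congr 1
  refine List.map_congr_left fun j _ => ?_
  rw [Function.comp_apply, zpow_natCast, ← pow_mul, mul_comm]

lemma EigenData.prod_one_sub {N : ℕ} {a : Fin 12 → ℤ} {s : List ℕ}
    (h : EigenData N a s) {ζ : ℂ} (hN : 0 < N) (hζ : IsPrimitiveRoot ζ N) (X : ℂ) :
    ∏ i, (1 - ζ ^ a i * X) * (1 - ζ ^ (-a i) * X) = (s.map fun m => 1 - X ^ m).prod := by
  rw [h.prod hN hζ fun z => 1 - z * X]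
  congr 1
  refine List.map_congr_left fun m hm => ?_
  obtain ⟨hm0, r, rfl⟩ := h.1 m hm
  rw [← (hζ.pow hN (mul_comm m r)).pow_sub_pow_eq_prod_sub_mul _ _ hm0, one_pow]

lemma EigenData.prod_X_sub {N : ℕ} {a : Fin 12 → ℤ} {s : List ℕ}
    (h : EigenData N a s) {ζ : ℂ} (hN : 0 < N) (hζ : IsPrimitiveRoot ζ N) :
    ∏ i, (Polynomial.X - Polynomial.C (ζ ^ a i)) * (Polynomial.X - Polynomial.C (ζ ^ (-a i))) =
      (s.map fun m => (Polynomial.X ^ m - 1 : Polynomial ℂ)).prod := by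
  rw [h.prod hN hζ fun z => Polynomial.X - Polynomial.C z]
  congr 1
  refine List.map_congr_left fun m hm => ?_
  obtain ⟨hm0, r, rfl⟩ := h.1 m hm
  rw [← Polynomial.X_pow_sub_one_eq_prod hm0 (hζ.pow hN (mul_comm m r))]

lemma isPrimitiveRoot_ex {N : ℕ} (hN : 0 < N) {M : ℕ} (hNM : N ∣ M) {u : ℤ} (hu : Prim M 0 u) :
    IsPrimitiveRoot (ex (u / N)) N := by
  have h1 : IsPrimitiveRoot (ex (1 / N)) N := by
    have := Complex.isPrimitiveRoot_exp N hN.ne'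
    rwa [show Complex.exp (2 * Real.pi * Complex.I / N) = ex (1 / N) by rw [ex]; ring_nf] at this
  have h2 : ex (u / N) = ex (1 / N) ^ u := by rw [← ex_int_mul]; ring_nf
  rw [h2]
  refine h1.zpow_of_gcd_eq_one u ?_
  obtain ⟨x, y, z, h⟩ := hu
  obtain ⟨r, rfl⟩ := hNM
  rw [← Int.isCoprime_iff_gcd_eq_one]
  push_cast at h
  exact ⟨y, r * z, by linarith⟩

/-- An integral value of an integral polynomial at a primitive root of unity is its value at the
other ones. -/
lemma aeval_pow_coprime {N : ℕ} (hN : 0 < N) {ζ : ℂ} (hζ : IsPrimitiveRoot ζ N)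
    (P : Polynomial ℤ) {r : ℤ} (h : Polynomial.aeval ζ P = r) {u : ℕ} (hu : u.Coprime N) :
    Polynomial.aeval (ζ ^ u) P = r := by
  have h1 := hζ.minpoly_eq_pow_coprime hu
  have h2 : minpoly ℤ ζ ∣ P - Polynomial.C r := by
    apply minpoly.isIntegrallyClosed_dvd (hζ.isIntegral hN)
    simp [h]
  rw [h1] at h2
  obtain ⟨Q, hQ⟩ := h2
  have h3 := congrArg (Polynomial.aeval (ζ ^ u)) hQ
  rw [map_mul, minpoly.aeval, zero_mul, map_sub] at h3
  simp only [eq_intCast, map_intCast] at h3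
  exact sub_eq_zero.1 h3

/-- The product is an integral polynomial in a primitive root of unity. If its value is an integer,
Galois conjugation does not change it, so all cusp vectors (0, u) give the same constant. -/
lemma prod_zpow_const {N : ℕ} (hN : 0 < N) {M : ℕ} (hNM : N ∣ M) {n : ℕ} (a : Fin n → ℤ) (t : ℤ)
    {r : ℤ} (h : ∏ i, (1 + t * ex (1 / N) ^ (-a i)) = r) {u : ℤ} (hu : Prim M 0 u) :
    ∏ i, (1 + t * ex (u / N) ^ (-a i)) = r := by
  have hN' : (N : ℤ) ≠ 0 := by positivity
  have hp1 := isPrimitiveRoot_ex hN hNM (u := 1) ⟨0, 1, 0, by simp⟩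
  have hpu := isPrimitiveRoot_ex hN hNM hu
  push_cast at hp1
  have hmod : ∀ {ζ : ℂ}, IsPrimitiveRoot ζ N → ∀ b : ℤ, ζ ^ (b % N).toNat = ζ ^ b := by
    intro ζ hζ b
    have h1 : ζ ^ ((N : ℤ) * (b / N)) = 1 := by rw [zpow_mul, zpow_natCast, hζ.pow_eq_one, one_zpow]
    rw [← zpow_natCast, Int.toNat_of_nonneg (Int.emod_nonneg _ hN')]
    conv_rhs => rw [← Int.emod_add_mul_ediv b N, zpow_add₀ (hζ.ne_zero hN.ne'), h1, mul_one]
  -- The exponents are reduced modulo N to make them nonnegative.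
  set P : Polynomial ℤ := ∏ i, (1 + Polynomial.C t * Polynomial.X ^ (-a i % N).toNat) with hP
  have hev : ∀ {ζ : ℂ}, IsPrimitiveRoot ζ N →
      Polynomial.aeval ζ P = ∏ i, (1 + t * ζ ^ (-a i)) := by
    intro ζ hζ
    rw [hP, map_prod]
    refine Finset.prod_congr rfl fun i _ => ?_
    rw [← hmod hζ]
    simp
  have hu2 : ex (u / N) = ex (1 / N) ^ (u % N).toNat := by
    rw [hmod hp1, ← ex_int_mul]; ring_nf
  have hco : (u % N).toNat.Coprime N := by
    rw [hu2] at hpu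
    by_cases h0 : N = 1
    · rw [h0]; exact Nat.coprime_one_right _
    exact (hp1.pow_iff_coprime hN _).1 hpu
  rw [← hev hpu, hu2]
  exact aeval_pow_coprime hN hp1 P (by rw [hev hp1, h]) hco

/-! ### Products of `poch` over eigenvalues -/

lemma prod_poch {q : ℂ} (hq : ‖q‖ < 1) {ι : Type*} (s : Finset ι) (w : ι → ℂ) :
    ∏ i ∈ s, poch (w i) q = ∏' n : ℕ, ∏ i ∈ s, (1 - w i * q ^ n) :=
  (Multipliable.tprod_finsetProd fun i _ => multipliable_poch (w i) hq).symm

lemma list_prod_poch {q w : ℂ} (hq : ‖q‖ < 1) (s : List ℕ) (hs : ∀ m ∈ s, 0 < m) :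
    (Multipliable fun n : ℕ => (s.map fun m => 1 - (w * q ^ n) ^ m).prod) ∧
      ∏' n : ℕ, (s.map fun m => 1 - (w * q ^ n) ^ m).prod =
        (s.map fun m => poch (w ^ m) (q ^ m)).prod := by
  induction s with
  | nil => simp [multipliable_one]
  | cons m s ih =>
    obtain ⟨h1, h2⟩ := ih fun k hk => hs k (List.mem_cons_of_mem _ hk)
    have hm : 0 < m := hs m List.mem_cons_self
    have hq' : ‖q ^ m‖ < 1 := by
      rw [norm_pow]; exact pow_lt_one₀ (norm_nonneg _) hq hm.ne'
    have h3 := multipliable_poch (w ^ m) hq'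
    have e : ∀ n : ℕ, w ^ m * (q ^ m) ^ n = (w * q ^ n) ^ m := fun n => by
      rw [mul_pow, ← pow_mul, ← pow_mul, Nat.mul_comm]
    simp only [e] at h3
    simp only [List.map_cons, List.prod_cons]
    refine ⟨h3.mul h1, ?_⟩
    rw [h3.tprod_mul h1, h2, poch]
    simp only [e]

/-- The product over the cycle lengths `m` of `poch (w ^ m) (q ^ m)`. -/
def pochProd (s : List ℕ) (w q : ℂ) : ℂ := (s.map fun m => poch (w ^ m) (q ^ m)).prod

lemma EigenData.prod_poch {N : ℕ} {a : Fin 12 → ℤ} {s : List ℕ}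
    (h : EigenData N a s) {ζ : ℂ} (hN : 0 < N) (hζ : IsPrimitiveRoot ζ N) (w : ℂ) {q : ℂ}
    (hq : ‖q‖ < 1) :
    ∏ i, poch (w * ζ ^ a i) q * poch (w * ζ ^ (-a i)) q = pochProd s w q := by
  rw [Finset.prod_mul_distrib, Mathieu.prod_poch hq, Mathieu.prod_poch hq]
  rw [← Multipliable.tprod_mul (multipliable_prod fun i _ => multipliable_poch _ hq)
    (multipliable_prod fun i _ => multipliable_poch _ hq), pochProd,
    ← (list_prod_poch (w := w) hq s fun m hm => (h.1 m hm).1).2]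
  refine tprod_congr fun n => ?_
  rw [← Finset.prod_mul_distrib, ← h.prod_one_sub hN hζ]
  refine Finset.prod_congr rfl fun i _ => ?_
  ring

/-! ### Klein forms at the cusp -/

lemma klein_half {τ : ℂ} (hτ : 0 < τ.im) (b : ℚ) : klein (1 / 2) b τ =
    Complex.I * ex (-(τ / 8) - b / 4) *
      (poch (ex (τ / 2) * ex b) (ex τ) * poch (ex (τ / 2) * ex (-b)) (ex τ)) /
        poch (ex τ) (ex τ) ^ 2 := by
  have hq := norm_ex_lt_one hτ
  have e1 : ex (-(((1 / 2 : ℚ) : ℂ) * τ + b)) * ex τ = ex (τ / 2) * ex (-b) := by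
    rw [← ex_add, ← ex_add]; push_cast; ring_nf
  have e2 : ex τ * ex (((1 / 2 : ℚ) : ℂ) * τ + b) = ex (τ / 2) * ex b * ex τ := by
    rw [← ex_add, ← ex_add, ← ex_add]; push_cast; ring_nf
  rw [klein, kfun, poch_succ _ hq, e1, e2, poch_succ (ex (τ / 2) * ex b) hq]
  have e3 : ex (((1 / 2 : ℚ) : ℂ) * (((1 / 2 : ℚ) : ℂ) * τ + b) / 2) *
      ex ((((1 / 2 : ℚ) : ℂ) * τ + b) / 2) * (1 - ex (-(((1 / 2 : ℚ) : ℂ) * τ + b))) =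
      -ex (-(τ / 8) - b / 4) * (1 - ex (τ / 2) * ex b) := by
    rw [mul_sub, mul_one, ← ex_add, ← ex_add, mul_sub, mul_one, neg_mul, ← ex_add, ← ex_add]
    push_cast; ring_nf
  linear_combination (-Complex.I * (poch (ex (τ / 2) * ex (-b)) (ex τ) *
    poch (ex (τ / 2) * ex b * ex τ) (ex τ)) / poch (ex τ) (ex τ) ^ 2) * e3

lemma klein_zero {τ : ℂ} (hτ : 0 < τ.im) (b : ℚ) : klein 0 b τ =
    -Complex.I * ex (b / 2) * (1 - ex (-b)) *
      (poch (ex τ * ex b) (ex τ) * poch (ex τ * ex (-b)) (ex τ)) / poch (ex τ) (ex τ) ^ 2 := by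
  have hq := norm_ex_lt_one hτ
  rw [klein, kfun, poch_succ _ hq]
  simp only [Rat.cast_zero, zero_mul, zero_add, zero_div, ex_zero]
  rw [mul_comm (ex (-(b : ℂ))) (ex τ)]
  ring

end Mathieu

/-! ### The members of the families at the cusp vectors (0, u) -/

namespace Mathieu

open Filter Topology

section base

variable {N : ℕ} {a : Fin 12 → ℤ} {s : List ℕ}

lemma ex_rat_div (u b : ℤ) (N : ℕ) : ex ((b * u / N : ℚ) : ℂ) = ex (u / N) ^ b := by
  rw [← ex_int_mul]; push_cast; ring_nf

lemma sum_cast_eq_zero {n : ℕ} {a : Fin n → ℤ} (ha : ∑ i, a i = 0) (t : ℂ) :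
    ∑ i, (a i : ℂ) * t = 0 := by
  have : ∑ i, (a i : ℂ) = 0 := by exact_mod_cast ha
  rw [← Finset.sum_mul, this, zero_mul]

lemma disc_eq_sq (τ : ℂ) : disc τ = ex (τ / 2) ^ 2 * poch (ex τ) (ex τ) ^ 24 := by
  rw [disc_eq, pow_two, ← ex_add, add_halves]

lemma prod_ex_const {n : ℕ} (x y : ℂ) {a : Fin n → ℤ} (ha : ∑ i, a i = 0) :
    ∏ i, ex (x + a i * y) = ex (n * x) := by
  rw [← ex_sum, Finset.sum_add_distrib, sum_cast_eq_zero ha]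
  simp

/-- The product of Klein forms at the eigenvalues, shifted by the half period τ/2, is
η_g(τ/2)/η_g(τ). As the exponents sum to zero, the phases of the individual forms cancel. -/
lemma tprod12_half_zero (h : EigenData N a s) (hN : 0 < N) (ha : ∑ i, a i = 0) {M : ℕ}
    (hNM : N ∣ M) {u : ℤ} (hu : Prim M 0 u) {τ : ℂ} (hτ : 0 < τ.im) :
    ex (τ / 2) * tprod12 a N (1 / 2) 0 0 u τ = pochProd s (ex (τ / 2)) (ex τ) := by
  have hζ := isPrimitiveRoot_ex hN hNM hu
  have hP := poch_self_ne_zero (norm_ex_lt_one hτ)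
  have e : ∀ i, klein ((a i : ℚ) * (0 : ℤ) / N + 1 / 2) (a i * u / N + 0) τ =
      Complex.I * ex (-(τ / 8) + a i * (-(u / (4 * N)))) *
      (poch (ex (τ / 2) * ex (u / N) ^ a i) (ex τ) *
        poch (ex (τ / 2) * ex (u / N) ^ (-a i)) (ex τ)) / poch (ex τ) (ex τ) ^ 2 := by
    intro i
    rw [show (a i : ℚ) * (0 : ℤ) / N + 1 / 2 = 1 / 2 by push_cast; ring, add_zero, klein_half hτ,
      ex_neg, ex_rat_div, zpow_neg]
    congr 4
    push_cast; field_simp; ring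
  have hx : ex (τ / 2) ≠ 0 := ex_ne_zero _
  rw [tprod12, kprod]
  simp only [zpow_one, e]
  rw [Finset.prod_div_distrib, Finset.prod_mul_distrib, h.prod_poch hN hζ _ (norm_ex_lt_one hτ),
    Finset.prod_mul_distrib, prod_ex_const _ _ ha, disc_eq_sq]
  simp only [Finset.prod_const, Finset.card_univ, Fintype.card_fin]
  have e2 : ex (((12 : ℕ) : ℂ) * -(τ / 8)) = (ex (τ / 2) ^ 3)⁻¹ := by
    rw [← ex_nat_mul, ← ex_neg]; push_cast; ring_nf
  have hI : Complex.I ^ 12 = 1 := by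
    rw [show (12 : ℕ) = 4 * 3 by norm_num, pow_mul, Complex.I_pow_four, one_pow]
  rw [e2, hI]
  field_simp

/-- The shift by (τ + 1)/2 gives -η_{-g}(τ/2)/η_{-g}(τ). The sign is the twelfth power of the phase
e^(-2πi/8), and it is the relative sign of the two quotients in φ_g. -/
lemma tprod12_half_half (h : EigenData N a s) (hN : 0 < N) (ha : ∑ i, a i = 0) {M : ℕ}
    (hNM : N ∣ M) {u : ℤ} (hu : Prim M 0 u) {τ : ℂ} (hτ : 0 < τ.im) :
    ex (τ / 2) * tprod12 a N (1 / 2) (1 / 2) 0 u τ = -pochProd s (-ex (τ / 2)) (ex τ) := by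
  have hζ := isPrimitiveRoot_ex hN hNM hu
  have hP := poch_self_ne_zero (norm_ex_lt_one hτ)
  have e : ∀ i, klein ((a i : ℚ) * (0 : ℤ) / N + 1 / 2) (a i * u / N + 1 / 2) τ =
      Complex.I * ex (-(τ / 8) - 1 / 8 + a i * (-(u / (4 * N)))) *
      (poch (-ex (τ / 2) * ex (u / N) ^ a i) (ex τ) *
        poch (-ex (τ / 2) * ex (u / N) ^ (-a i)) (ex τ)) / poch (ex τ) (ex τ) ^ 2 := by
    intro i
    have e1 : ex ((a i * u / N + 1 / 2 : ℚ) : ℂ) = -ex (u / N) ^ a i := by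
      rw [← ex_rat_div, show (((a i * u / N + 1 / 2 : ℚ) : ℂ)) =
        ((a i * u / N : ℚ) : ℂ) + 1 / 2 by push_cast; ring, ex_add, ex_half]
      ring
    rw [show (a i : ℚ) * (0 : ℤ) / N + 1 / 2 = 1 / 2 by push_cast; ring, klein_half hτ,
      ex_neg, e1, zpow_neg, inv_neg, mul_neg, mul_neg, ← neg_mul, ← neg_mul]
    congr 4
    push_cast; field_simp; ring
  have hx : ex (τ / 2) ≠ 0 := ex_ne_zero _
  rw [tprod12, kprod]
  simp only [zpow_one, e]
  rw [Finset.prod_div_distrib, Finset.prod_mul_distrib, h.prod_poch hN hζ _ (norm_ex_lt_one hτ),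
    Finset.prod_mul_distrib, prod_ex_const _ _ ha, disc_eq_sq]
  simp only [Finset.prod_const, Finset.card_univ, Fintype.card_fin]
  have e2 : ex (((12 : ℕ) : ℂ) * (-(τ / 8) - 1 / 8)) = -(ex (τ / 2) ^ 3)⁻¹ := by
    rw [← ex_nat_mul, ← ex_neg, show ((12 : ℕ) : ℂ) * (-(τ / 8) - 1 / 8) =
      -(((3 : ℕ) : ℂ) * (τ / 2)) + ((-2 : ℤ) : ℂ) + 1 / 2 by push_cast; ring, ex_add, ex_half,
      ex_add_int]
    ring
  have hI : Complex.I ^ 12 = 1 := by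
    rw [show (12 : ℕ) = 4 * 3 by norm_num, pow_mul, Complex.I_pow_four, one_pow]
  rw [e2, hI]
  field_simp

/-- The shift by 1/2 gives C_{-g} η_{-g}(τ), the constant being that of the labelling whose square
roots have exponents a/(2N). -/
lemma tprod12_zero_half (h : EigenData N a s) (hN : 0 < N) (ha : ∑ i, a i = 0) {M : ℕ}
    (hNM : N ∣ M) {u : ℤ} (hu : Prim M 0 u) {τ : ℂ} (hτ : 0 < τ.im) :
    tprod12 a N 0 (1 / 2) 0 u τ = (∏ i, (1 + ex (u / N) ^ (-a i))) *
      (ex τ * pochProd s (-ex τ) (ex τ)) := by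
  have hζ := isPrimitiveRoot_ex hN hNM hu
  have hP := poch_self_ne_zero (norm_ex_lt_one hτ)
  have e : ∀ i, klein ((a i : ℚ) * (0 : ℤ) / N + 0) (a i * u / N + 1 / 2) τ =
      ex (0 + a i * (u / (2 * N))) * (1 + ex (u / N) ^ (-a i)) *
      (poch (-ex τ * ex (u / N) ^ a i) (ex τ) *
        poch (-ex τ * ex (u / N) ^ (-a i)) (ex τ)) / poch (ex τ) (ex τ) ^ 2 := by
    intro i
    have e1 : ex ((a i * u / N + 1 / 2 : ℚ) : ℂ) = -ex (u / N) ^ a i := by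
      rw [← ex_rat_div, show (((a i * u / N + 1 / 2 : ℚ) : ℂ)) =
        ((a i * u / N : ℚ) : ℂ) + 1 / 2 by push_cast; ring, ex_add, ex_half]
      ring
    have e2 : ex (((a i * u / N + 1 / 2 : ℚ) : ℂ) / 2) =
        Complex.I * ex (0 + a i * (u / (2 * N))) := by
      rw [← ex_quarter, ← ex_add]
      congr 1
      push_cast; field_simp; ring
    rw [show (a i : ℚ) * (0 : ℤ) / N + 0 = 0 by push_cast; ring, klein_zero hτ,
      ex_neg, e1, e2, zpow_neg, inv_neg, mul_neg, mul_neg, ← neg_mul, ← neg_mul]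
    linear_combination (-(ex (0 + a i * (u / (2 * N))) * (1 + (ex (u / N) ^ a i)⁻¹) *
      (poch (-ex τ * ex (u / N) ^ a i) (ex τ) *
        poch (-ex τ * (ex (u / N) ^ a i)⁻¹) (ex τ)) / poch (ex τ) (ex τ) ^ 2)) * Complex.I_sq
  rw [tprod12, kprod]
  simp only [zpow_one, e]
  rw [Finset.prod_div_distrib, Finset.prod_mul_distrib, h.prod_poch hN hζ _ (norm_ex_lt_one hτ),
    Finset.prod_mul_distrib, prod_ex_const _ _ ha, disc_eq]
  simp only [Finset.prod_const, Finset.card_univ, Fintype.card_fin, mul_zero, ex_zero]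
  field_simp

/-- The first ten exponents. -/
def cut (a : Fin 12 → ℤ) (i : Fin 10) : ℤ := a (i.castAdd 2)

lemma prod_fin_twelve {M : Type*} [CommMonoid M] (f : Fin 12 → M) :
    ∏ i, f i = (∏ i : Fin 10, f (i.castAdd 2)) * (f 10 * f 11) := by
  have h := Fin.prod_univ_add (a := 10) (b := 2) f
  rwa [Fin.prod_univ_two] at h

lemma sum_cut (ha : ∑ i, a i = 0) (h10 : a 10 = 0) (h11 : a 11 = 0) : ∑ i, cut a i = 0 := by
  have : ∑ i, a i = ∑ i : Fin 10, a (i.castAdd 2) + ∑ i : Fin 2, a (i.natAdd 10) :=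
    Fin.sum_univ_add (a := 10) (b := 2) (fun i : Fin 12 => a i)
  rw [Fin.sum_univ_two, ha] at this
  have h1 : a (Fin.natAdd 10 (0 : Fin 2)) = 0 := h10
  have h2 : a (Fin.natAdd 10 (1 : Fin 2)) = 0 := h11
  rw [h1, h2] at this
  unfold cut
  linarith

/-- Without a shift the two trivial eigenvalue pairs would make the product vanish; they are left
out. Ten Klein forms and Δ have weight two and yield η_g times a constant of the type of D_g. The
omitted pairs account for the fourth power of `poch`. -/
lemma kprod_cut (h : EigenData N a s) (hN : 0 < N) (ha : ∑ i, a i = 0) (h10 : a 10 = 0)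
    (h11 : a 11 = 0) {M : ℕ} (hNM : N ∣ M) {u : ℤ} (hu : Prim M 0 u) {τ : ℂ} (hτ : 0 < τ.im) :
    disc τ * kprod (cut a) (fun _ => 1) N 0 0 0 u τ =
      -(∏ i, (1 - ex (u / N) ^ (-cut a i))) * (ex τ * pochProd s (ex τ) (ex τ)) := by
  have hζ := isPrimitiveRoot_ex hN hNM hu
  have hP := poch_self_ne_zero (norm_ex_lt_one hτ)
  have hcut := sum_cut ha h10 h11
  have e : ∀ i, klein ((cut a i : ℚ) * (0 : ℤ) / N + 0) (cut a i * u / N + 0) τ =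
      -Complex.I * ex (0 + cut a i * (u / (2 * N))) * (1 - ex (u / N) ^ (-cut a i)) *
      (poch (ex τ * ex (u / N) ^ cut a i) (ex τ) *
        poch (ex τ * ex (u / N) ^ (-cut a i)) (ex τ)) / poch (ex τ) (ex τ) ^ 2 := by
    intro i
    rw [show (cut a i : ℚ) * (0 : ℤ) / N + 0 = 0 by push_cast; ring, add_zero, klein_zero hτ,
      ex_neg, ex_rat_div, zpow_neg]
    congr 5
    push_cast; field_simp; ring
  have hsplit : pochProd s (ex τ) (ex τ) = (∏ i, (poch (ex τ * ex (u / N) ^ cut a i) (ex τ) *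
        poch (ex τ * ex (u / N) ^ (-cut a i)) (ex τ))) * poch (ex τ) (ex τ) ^ 4 := by
    rw [← h.prod_poch hN hζ _ (norm_ex_lt_one hτ)]
    have := Fin.prod_univ_add (a := 10) (b := 2)
      (fun i : Fin 12 => poch (ex τ * ex (u / N) ^ a i) (ex τ) *
        poch (ex τ * ex (u / N) ^ (-a i)) (ex τ))
    refine this.trans ?_
    rw [Fin.prod_univ_two]
    have h1 : a (Fin.natAdd 10 (0 : Fin 2)) = 0 := h10
    have h2 : a (Fin.natAdd 10 (1 : Fin 2)) = 0 := h11
    rw [h1, h2]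
    simp only [neg_zero, zpow_zero, mul_one, cut]
    ring
  rw [kprod, hsplit]
  simp only [zpow_one, e]
  rw [Finset.prod_div_distrib, Finset.prod_mul_distrib, Finset.prod_mul_distrib,
    Finset.prod_mul_distrib, prod_ex_const _ _ hcut, disc_eq]
  simp only [Finset.prod_const, Finset.card_univ, Fintype.card_fin, mul_zero, ex_zero]
  have hI : (-Complex.I) ^ 10 = -1 := by
    rw [show (10 : ℕ) = 4 * 2 + 2 by norm_num, pow_add, pow_mul, neg_pow, Complex.I_pow_four,
      neg_sq, Complex.I_sq]
    norm_num
  rw [hI]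
  field_simp

end base

/-! ### Eisenstein series -/

lemma hasSum_gfun {w : ℂ} (hw : ‖w‖ < 1) : HasSum (fun n : ℕ => (n : ℂ) * w ^ n) (gfun w) :=
  hasSum_coe_mul_geometric_of_norm_lt_one hw

/-- Orthogonality of the n-th roots of unity, applied to ∑ k wᵏ: only multiples of n survive. -/
lemma sum_gfun_root {n : ℕ} (hn : 0 < n) {ζ : ℂ} (hζ : IsPrimitiveRoot ζ n) {w : ℂ}
    (hw : ‖w‖ < 1) : ∑ j ∈ Finset.range n, gfun (w * ζ ^ j) = n ^ 2 * gfun (w ^ n) := by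
  have hn1 : ‖ζ‖ = 1 := hζ.norm'_eq_one hn.ne'
  have h1 : ∀ j ∈ Finset.range n, HasSum (fun k : ℕ => (k : ℂ) * (w * ζ ^ j) ^ k)
      (gfun (w * ζ ^ j)) := fun j _ => hasSum_gfun (by rwa [norm_mul, norm_pow, hn1, one_pow, mul_one])
  have h2 := hasSum_sum h1
  have h3 : ∀ k : ℕ, ∑ j ∈ Finset.range n, (k : ℂ) * (w * ζ ^ j) ^ k =
      if n ∣ k then (n : ℂ) * (k * w ^ k) else 0 := by
    intro k
    have e1 : ∀ j, (k : ℂ) * (w * ζ ^ j) ^ k = k * w ^ k * (ζ ^ k) ^ j := fun j => by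
      rw [mul_pow, ← pow_mul, ← pow_mul, Nat.mul_comm j k]; ring
    simp only [e1, ← Finset.mul_sum]
    split_ifs with h
    · rw [(hζ.pow_eq_one_iff_dvd k).2 h]; simp; ring
    · have h5 : ζ ^ k ≠ 1 := fun h' => h ((hζ.pow_eq_one_iff_dvd k).1 h')
      rw [geom_sum_eq h5, ← pow_mul, Nat.mul_comm, pow_mul, hζ.pow_eq_one]; simp
  simp only [h3] at h2
  have h4 : HasSum (fun m : ℕ => (n : ℂ) ^ 2 * (m * (w ^ n) ^ m)) (n ^ 2 * gfun (w ^ n)) :=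
    (hasSum_gfun (by rw [norm_pow]; exact pow_lt_one₀ (norm_nonneg _) hw hn.ne')).mul_left _
  have hinj : Function.Injective fun m : ℕ => n * m := fun a b h => Nat.eq_of_mul_eq_mul_left hn h
  rw [← hinj.hasSum_iff] at h2
  · refine h2.unique ?_
    convert h4 using 2 with m
    simp only [Function.comp_apply, dvd_mul_right, if_true, pow_mul]
    push_cast
    ring
  · intro k hk
    rw [if_neg]
    rintro ⟨m, rfl⟩
    exact hk ⟨m, rfl⟩

lemma tendsto_gfun_at {ξ : ℂ} (hξ : ξ ≠ 1) : Tendsto (fun z => gfun (ex z * ξ)) (𝓝 0) (𝓝 (gfun ξ)) := by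
  have h : ContinuousAt (fun z => gfun (ex z * ξ)) 0 := by
    unfold gfun ex
    refine ContinuousAt.div (by fun_prop) (by fun_prop) ?_
    simpa [sub_eq_zero] using hξ.symm
  simpa [ContinuousAt] using h

lemma sum_gfun_root_self {n : ℕ} (hn : 0 < n) {ζ : ℂ} (hζ : IsPrimitiveRoot ζ n) :
    ∑ j ∈ Finset.Ico 1 n, gfun (ζ ^ j) = (1 - (n : ℂ) ^ 2) / 12 := by
  have hn0 : (n : ℂ) ≠ 0 := by exact_mod_cast hn.ne'
  -- The point w = 1 is approached through w = `ex z` with Im z > 0, where |w| < 1 and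
  -- `sum_gfun_root` holds. The double poles cancel, and the constants -1/12 from
  -- `tendsto_gfun_ex_add` give (1 - n²)/12.
  have hle : 𝓝[{z : ℂ | 0 < z.im}] 0 ≤ 𝓝[≠] 0 := by
    refine nhdsWithin_mono _ fun z hz h => ?_
    rw [Set.mem_singleton_iff] at h
    simp [h] at hz
  have : (𝓝[{z : ℂ | 0 < z.im}] 0).NeBot := by
    rw [← mem_closure_iff_nhdsWithin_neBot]
    rw [Complex.closure_setOfPred_lt_im]
    simp
  have hmul : Tendsto (fun z : ℂ => n * z) (𝓝[≠] 0) (𝓝[≠] 0) := by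
    refine tendsto_nhdsWithin_iff.2 ⟨?_, ?_⟩
    · exact ((continuous_const_mul (n : ℂ)).tendsto' 0 0 (mul_zero _)).mono_left nhdsWithin_le_nhds
    · filter_upwards [self_mem_nhdsWithin] with z hz
      exact mul_ne_zero hn0 hz
  have h1 : Tendsto (fun z => ∑ j ∈ Finset.Ico 1 n, gfun (ex z * ζ ^ j)) (𝓝[{z : ℂ | 0 < z.im}] 0)
      (𝓝 (∑ j ∈ Finset.Ico 1 n, gfun (ζ ^ j))) := by
    refine tendsto_finsetSum _ fun j hj => (tendsto_gfun_at ?_).mono_left nhdsWithin_le_nhds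
    have hj' := Finset.mem_Ico.1 hj
    exact hζ.pow_ne_one_of_pos_of_lt (by omega) hj'.2
  have h2 := (((tendsto_gfun_ex_add.comp hmul).const_mul ((n : ℂ) ^ 2)).sub
    tendsto_gfun_ex_add).mono_left hle
  rw [show (1 - (n : ℂ) ^ 2) / 12 = (n : ℂ) ^ 2 * -(1 / 12) - -(1 / 12) by ring]
  refine tendsto_nhds_unique h1 (h2.congr' ?_)
  filter_upwards [self_mem_nhdsWithin, hle self_mem_nhdsWithin] with z hz hz0
  have h3 := sum_gfun_root hn hζ (norm_ex_lt_one hz)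
  rw [Finset.range_eq_Ico, Finset.sum_eq_sum_Ico_succ_bot hn, pow_zero, mul_one,
    ← ex_nat_mul] at h3
  have hz0' : z ≠ 0 := hz0
  simp only [Function.comp_apply]
  have hpi : (Real.pi : ℂ) ≠ 0 := by exact_mod_cast Real.pi_ne_zero
  rw [eq_comm, ← sub_eq_zero]
  simp only [zero_add] at h3
  rw [eq_sub_of_add_eq' h3]
  field_simp
  ring

lemma sum_afun_root {n : ℕ} (hn : 0 < n) {ζ : ℂ} (hζ : IsPrimitiveRoot ζ n) {q : ℂ} (hq : ‖q‖ < 1) :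
    ∑ j ∈ Finset.Ico 1 n, afun (q * ζ ^ j) q =
      (n : ℂ) ^ 2 * afun (q ^ n) (q ^ n) - afun q q := by
  have hqn : ‖q ^ n‖ < 1 := by rw [norm_pow]; exact pow_lt_one₀ (norm_nonneg _) hq hn.ne'
  have h0 : afun q q + ∑ j ∈ Finset.Ico 1 n, afun (q * ζ ^ j) q =
      ∑ j ∈ Finset.range n, afun (q * ζ ^ j) q := by
    rw [Finset.range_eq_Ico, Finset.sum_eq_sum_Ico_succ_bot hn, pow_zero, mul_one]
  rw [eq_sub_iff_add_eq', h0]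
  have h1 := hasSum_sum fun j (_ : j ∈ Finset.range n) => (summable_afun (q * ζ ^ j) hq).hasSum
  refine h1.unique ?_
  have h2 := (summable_afun (q ^ n) hqn).hasSum.mul_left ((n : ℂ) ^ 2)
  refine (congrArg (fun f : ℕ → ℂ => HasSum f _) (funext fun k => ?_)).mpr h2
  rw [← pow_mul, ← pow_add, show n + n * k = (k + 1) * n by ring, pow_mul,
    ← sum_gfun_root hn hζ (by
      rw [norm_pow]; exact pow_lt_one₀ (norm_nonneg _) hq (by omega : k + 1 ≠ 0))]
  exact Finset.sum_congr rfl fun j _ => by congr 1; ring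

/-- At the cusp the points are the nontrivial n-th division points on the real period. Summing over
the roots of unity turns the Lambert series into those of E₂(nτ) and E₂(τ), so that Λ_n is a member
of a modular family. -/
lemma eisSum_zero {n : ℕ} (hn : 0 < n) {M : ℕ} (hnM : n ∣ M) {u : ℤ} (hu : Prim M 0 u) {τ : ℂ}
    (hτ : 0 < τ.im) : eisSum n 0 u τ = -2 * Lam n τ := by
  have hζ := isPrimitiveRoot_ex hn hnM hu
  have hnτ : 0 < ((n : ℂ) * τ).im := by
    rw [← nsmul_eq_mul, Complex.smul_im, nsmul_eq_mul]; positivity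
  have hq := norm_ex_lt_one hτ
  set ζ := ex (u / n) with hζd
  have h1 : ∀ j ∈ Finset.Ico 1 n, etq ((j : ℤ) * (0 : ℤ) / n) ((j : ℤ) * u / n) τ =
      (gfun (ζ ^ j) + (afun (ex τ * ζ ^ j) (ex τ) + afun (ex τ * ζ⁻¹ ^ j) (ex τ))) +
        E2 τ / 12 := by
    intro j _
    have e : ex (((j : ℤ) * u / n : ℚ) : ℂ) = ζ ^ j := by
      rw [hζd, ← ex_nat_mul]; push_cast; ring_nf
    rw [etq, etfun, show ((((j : ℤ) : ℚ) * ((0 : ℤ) : ℚ) / n : ℚ) : ℂ) * τ +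
      (((j : ℤ) * u / n : ℚ) : ℂ) = (((j : ℤ) * u / n : ℚ) : ℂ) by push_cast; ring,
      wfun_eq_gfun_add hτ, ex_neg, e, inv_pow]
  rw [eisSum, Finset.sum_congr rfl h1, Finset.sum_add_distrib, Finset.sum_add_distrib,
    Finset.sum_add_distrib, sum_gfun_root_self hn hζ, sum_afun_root hn hζ hq,
    sum_afun_root hn hζ.inv hq, Lam, E2_eq_afun hτ, E2_eq_afun hnτ, ex_nat_mul]
  simp only [Finset.sum_const, Nat.card_Ico, nsmul_eq_mul]
  rw [Nat.cast_sub hn]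
  push_cast
  ring

end Mathieu

namespace Mathieu

open Filter Topology

/-! ### Truncated power series with integer coefficients -/

/-- The value of the polynomial with the listed coefficients. -/
def ev (x : ℂ) : List ℤ → ℂ
  | [] => 0
  | c :: l => c + x * ev x l

/-- Coefficientwise sum. -/
def ladd : List ℤ → List ℤ → List ℤ
  | [], m => m
  | l, [] => l
  | c :: l, d :: m => (c + d) :: ladd l m

/-- Product of polynomials. -/
def lmul : List ℤ → List ℤ → List ℤ
  | [], _ => []
  | c :: l, m => ladd (m.map (c * ·)) (0 :: lmul l m)

/-- Substitution of `x ^ (k + 1)` for `x`. -/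
def lexpand (k : ℕ) : List ℤ → List ℤ
  | [] => []
  | c :: l => c :: (List.replicate k 0 ++ lexpand k l)

section ev

variable {x : ℂ}

lemma ev_ladd (l m : List ℤ) : ev x (ladd l m) = ev x l + ev x m := by
  induction l generalizing m with
  | nil => simp [ladd, ev]
  | cons c l ih =>
    cases m with
    | nil => simp [ladd, ev]
    | cons d m => simp only [ladd, ev, ih]; push_cast; ring

lemma ev_smul (c : ℤ) (l : List ℤ) : ev x (l.map (c * ·)) = c * ev x l := by
  induction l with
  | nil => simp [ev]
  | cons d l ih => simp only [List.map_cons, ev, ih]; push_cast; ring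

lemma ev_lmul (l m : List ℤ) : ev x (lmul l m) = ev x l * ev x m := by
  induction l with
  | nil => simp [lmul, ev]
  | cons c l ih => simp only [lmul, ev, ev_ladd, ev_smul, ih]; push_cast; ring

lemma ev_append (l m : List ℤ) : ev x (l ++ m) = ev x l + x ^ l.length * ev x m := by
  induction l with
  | nil => simp [ev]
  | cons c l ih => simp only [List.cons_append, ev, ih, List.length_cons]; ring

lemma ev_replicate_zero (k : ℕ) : ev x (List.replicate k 0) = 0 := by
  induction k with
  | zero => simp [ev]
  | succ k ih => simp [List.replicate_succ, ev, ih]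

lemma ev_shift (k : ℕ) (l : List ℤ) : ev x (List.replicate k 0 ++ l) = x ^ k * ev x l := by
  rw [ev_append, ev_replicate_zero, List.length_replicate, zero_add]

lemma ev_lexpand (k : ℕ) (l : List ℤ) : ev x (lexpand k l) = ev (x ^ (k + 1)) l := by
  induction l with
  | nil => simp [lexpand, ev]
  | cons c l ih => simp only [lexpand, ev, ev_shift, ih]; ring

lemma ev_map_range (f : ℕ → ℤ) (n : ℕ) :
    ev x ((List.range n).map f) = ∑ j ∈ Finset.range n, (f j : ℂ) * x ^ j := by
  induction n with
  | zero => simp [ev]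
  | succ n ih =>
    rw [List.range_succ, List.map_append, ev_append, ih, Finset.sum_range_succ]
    simp [ev, mul_comm]

lemma ev_eq_zero {l : List ℤ} (h : (l.all fun c => c == 0) = true) : ev x l = 0 := by
  induction l with
  | nil => rfl
  | cons c l ih =>
    simp only [List.all_cons, Bool.and_eq_true, beq_iff_eq] at h
    rw [ev, ih h.2, h.1]
    simp

end ev

lemma continuous_ev (l : List ℤ) : Continuous fun x => ev x l := by
  induction l with
  | nil => exact continuous_const
  | cons c l ih => unfold ev; fun_prop

lemma ev_isBigO_one (l : List ℤ) : (fun x => ev x l) =O[𝓝 0] fun _ => (1 : ℂ) :=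
  ((continuous_ev l).tendsto 0).isBigO_one ℂ

/-- The function `F` has the power series expansion `l` up to order `P`. -/
def Ex (P : ℕ) (F : ℂ → ℂ) (l : List ℤ) : Prop :=
  (fun x => F x - ev x l) =O[𝓝 0] fun x : ℂ => x ^ P

lemma pow_isBigO_pow {a b : ℕ} (h : a ≤ b) :
    (fun x : ℂ => x ^ b) =O[𝓝 0] fun x => x ^ a := by
  obtain ⟨c, rfl⟩ := Nat.exists_eq_add_of_le h
  have h1 : (fun x : ℂ => x ^ c) =O[𝓝 0] fun _ => (1 : ℂ) :=
    ((continuous_pow c).tendsto 0).isBigO_one ℂ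
  have := (Asymptotics.isBigO_refl (fun x : ℂ => x ^ a) (𝓝 0)).mul h1
  simpa only [pow_add, mul_one] using this

namespace Ex

variable {P : ℕ} {F G : ℂ → ℂ} {l m : List ℤ}

lemma of_ev (l : List ℤ) : Ex P (fun x => ev x l) l := by
  unfold Ex
  simp only [sub_self]
  exact Asymptotics.isBigO_zero _ _

lemma congr (h : Ex P F l) (e : ∀ᶠ x in 𝓝 0, F x = G x) : Ex P G l := by
  refine Asymptotics.IsBigO.congr' h ?_ EventuallyEq.rfl
  filter_upwards [e] with x hx
  rw [hx]

lemma isBigO_one (h : Ex P F l) : F =O[𝓝 0] fun _ => (1 : ℂ) := by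
  have h1 : (fun x : ℂ => x ^ P) =O[𝓝 0] fun _ => (1 : ℂ) :=
    ((continuous_pow P).tendsto 0).isBigO_one ℂ
  have := (Asymptotics.IsBigO.trans h h1).add (ev_isBigO_one l)
  simpa only [sub_add_cancel] using this

lemma add (hF : Ex P F l) (hG : Ex P G m) : Ex P (fun x => F x + G x) (ladd l m) := by
  unfold Ex
  refine (Asymptotics.IsBigO.add hF hG).congr_left fun x => ?_
  rw [ev_ladd]; ring

lemma smul (hF : Ex P F l) (c : ℤ) : Ex P (fun x => c * F x) (l.map (c * ·)) := by
  unfold Ex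
  refine (Asymptotics.IsBigO.const_mul_left hF (c : ℂ)).congr_left fun x => ?_
  rw [ev_smul]; ring

lemma mul (hF : Ex P F l) (hG : Ex P G m) : Ex P (fun x => F x * G x) (lmul l m) := by
  have h1 := hF.isBigO_one.mul hG
  have h2 := Asymptotics.IsBigO.mul hF (ev_isBigO_one m)
  simp only [one_mul, mul_one] at h1 h2
  unfold Ex
  refine (h1.add h2).congr_left fun x => ?_
  rw [ev_lmul]; ring

lemma take (hF : Ex P F l) : Ex P F (l.take P) := by
  have h : (fun x => ev x l - ev x (l.take P)) =O[𝓝 0] fun x : ℂ => x ^ P := by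
    by_cases hP : l.length ≤ P
    · rw [List.take_of_length_le hP]
      simp only [sub_self]
      exact Asymptotics.isBigO_zero _ _
    · have h1 := (Asymptotics.isBigO_refl (fun x : ℂ => x ^ P) (𝓝 0)).mul
        (ev_isBigO_one (l.drop P))
      simp only [mul_one] at h1
      refine h1.congr_left fun x => ?_
      conv_rhs => rw [← List.take_append_drop P l]
      rw [ev_append, List.length_take_of_le (by omega)]
      simp
  unfold Ex
  refine (Asymptotics.IsBigO.add hF h).congr_left fun x => ?_
  ring

lemma shift (hF : Ex P F l) (k : ℕ) :
    Ex P (fun x => x ^ k * F x) (List.replicate k 0 ++ l) := by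
  have h1 : (fun x : ℂ => x ^ k) =O[𝓝 0] fun _ => (1 : ℂ) :=
    ((continuous_pow k).tendsto 0).isBigO_one ℂ
  have h2 := h1.mul hF
  simp only [one_mul] at h2
  unfold Ex
  refine h2.congr_left fun x => ?_
  rw [ev_shift]; ring

lemma isBigO (hF : Ex P F l) (h : (l.all fun c => c == 0) = true) :
    F =O[𝓝 0] fun x : ℂ => x ^ P := by
  unfold Ex at hF
  simpa only [ev_eq_zero h, sub_zero] using hF

end Ex

lemma poch_sub_one_isBigO {α : Type*} {l : Filter α} {w q : α → ℂ} (hw : Tendsto w l (𝓝 0))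
    (hq : Tendsto q l (𝓝 0)) : (fun a => poch (w a) (q a) - 1) =O[l] w := by
  have h2 : ∀ {v : α → ℂ}, Tendsto v l (𝓝 0) → ∀ᶠ a in l, ‖v a‖ ≤ 1 / 2 := by
    intro v hv
    have h3 := hv.norm
    rw [norm_zero] at h3
    exact (h3.eventually (gt_mem_nhds (by norm_num : (0 : ℝ) < 1 / 2))).mono fun a h => h.le
  refine Asymptotics.IsBigO.of_bound 4 ?_
  filter_upwards [h2 hw, h2 hq] with a h3 h4
  refine (norm_poch_sub_one_le _ (by linarith)).trans ?_
  have h5 : (1 - ‖q a‖)⁻¹ ≤ 2 := by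
    rw [inv_le_comm₀ (by linarith) (by norm_num)]; linarith
  have h6 : 0 ≤ (1 - ‖q a‖)⁻¹ := inv_nonneg.2 (by linarith)
  have h7 : ‖w a‖ * (1 - ‖q a‖)⁻¹ ≤ ‖w a‖ * 2 := by gcongr
  have h8 : 0 ≤ ‖w a‖ * (1 - ‖q a‖)⁻¹ := by positivity
  have h9 := Real.abs_exp_sub_one_le (x := ‖w a‖ * (1 - ‖q a‖)⁻¹)
    (by rw [abs_of_nonneg h8]; linarith)
  rw [abs_of_nonneg h8] at h9
  linarith [le_abs_self (Real.exp (‖w a‖ * (1 - ‖q a‖)⁻¹) - 1)]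

lemma afun_isBigO {α : Type*} {l : Filter α} {u q : α → ℂ} (hu : Tendsto u l (𝓝 0))
    (hq : Tendsto q l (𝓝 0)) : (fun a => afun (u a) (q a)) =O[l] u := by
  have h2 : ∀ {v : α → ℂ}, Tendsto v l (𝓝 0) → ∀ᶠ a in l, ‖v a‖ ≤ 1 / 2 := by
    intro v hv
    have h3 := hv.norm
    rw [norm_zero] at h3
    exact (h3.eventually (gt_mem_nhds (by norm_num : (0 : ℝ) < 1 / 2))).mono fun a h => h.le
  refine Asymptotics.IsBigO.of_bound 8 ?_
  filter_upwards [h2 hu, h2 hq] with a ha hb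
  have h3 : ∀ n : ℕ, ‖gfun (u a * q a ^ n)‖ ≤ 4 * ‖u a‖ * (1 / 2) ^ n := by
    intro n
    rw [mul_assoc]
    refine norm_gfun_mul_pow_le le_rfl hb ?_
    calc ‖u a‖ * (1 / 2) ^ n ≤ 1 / 2 * 1 := by
          gcongr; exact pow_le_one₀ (by norm_num) (by norm_num)
      _ = 1 / 2 := by norm_num
  have h4 : HasSum (fun n : ℕ => 4 * ‖u a‖ * (1 / 2 : ℝ) ^ n) (4 * ‖u a‖ * 2) :=
    hasSum_geometric_two.mul_left _
  exact (tsum_of_norm_bounded h4 h3).trans (le_of_eq (by ring))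

lemma tendsto_const_mul_pow (s : ℂ) {a : ℕ} (ha : 0 < a) :
    Tendsto (fun x : ℂ => s * x ^ a) (𝓝 0) (𝓝 0) :=
  Continuous.tendsto' (by fun_prop) 0 0 (by simp [ha.ne'])

lemma tendsto_pow_zero {a : ℕ} (ha : 0 < a) : Tendsto (fun x : ℂ => x ^ a) (𝓝 0) (𝓝 0) := by
  simpa using tendsto_const_mul_pow 1 ha

lemma eventually_norm_pow_lt {b : ℕ} (hb : 0 < b) : ∀ᶠ x : ℂ in 𝓝 0, ‖x ^ b‖ < 1 := by
  have := (tendsto_pow_zero hb).norm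
  rw [norm_zero] at this
  exact this.eventually (gt_mem_nhds one_pos)

/-- Truncated multiplication by `1 - s x ^ k`. -/
def lfac (P : ℕ) (s : ℤ) (k : ℕ) (l : List ℤ) : List ℤ :=
  (ladd l (List.replicate k 0 ++ l.map (-s * ·))).take P

/-- Truncated multiplication by the first `n` factors of `poch (s x ^ a) (x ^ b)`. -/
def lpoch (P : ℕ) (s : ℤ) (b : ℕ) : ℕ → ℕ → List ℤ → List ℤ
  | 0, _, l => l
  | n + 1, a, l => lpoch P s b n (a + b) (lfac P s a l)

lemma Ex.lfac {P : ℕ} {F : ℂ → ℂ} {l : List ℤ} (h : Ex P F l) (s : ℤ) (k : ℕ) :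
    Ex P (fun x => F x * (1 - s * x ^ k)) (lfac P s k l) := by
  refine (h.add ((h.smul (-s)).shift k)).take.congr (Eventually.of_forall fun x => ?_)
  push_cast; ring

/-- After n factors the remaining product starts at exponent a + nb ≥ P and is 1 + O(x^P), so it
does not affect the truncated expansion. -/
lemma Ex.lpoch {P : ℕ} {s : ℤ} {b : ℕ} (hb : 0 < b) {n a : ℕ} (ha : 0 < a) (hP : P ≤ a + n * b)
    {F : ℂ → ℂ} {l : List ℤ} (h : Ex P F l) :
    Ex P (fun x => F x * poch (s * x ^ a) (x ^ b)) (lpoch P s b n a l) := by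
  induction n generalizing a F l with
  | zero =>
    have h1 := poch_sub_one_isBigO (tendsto_const_mul_pow s ha) (tendsto_pow_zero hb)
    have h2 : (fun x : ℂ => poch (s * x ^ a) (x ^ b) - 1) =O[𝓝 0] fun x => x ^ P :=
      h1.trans (((pow_isBigO_pow (by omega)).const_mul_left _))
    have h3 := h.isBigO_one.mul h2
    simp only [one_mul] at h3
    unfold Ex at h ⊢
    refine (h.add h3).congr_left fun x => ?_
    rw [Mathieu.lpoch]; ring
  | succ n ih =>
    rw [Mathieu.lpoch]
    refine (ih (a := a + b) (by omega) (by rw [Nat.succ_mul] at hP; omega)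
      (h.lfac s a)).congr ?_
    filter_upwards [eventually_norm_pow_lt hb] with x hx
    rw [poch_succ (s * x ^ a) hx, pow_add, mul_assoc, mul_assoc (s : ℂ)]

/-- The expansion of `gfun (s x ^ (k + 1))`. -/
def lgfun (P : ℕ) (s : ℤ) (k : ℕ) : List ℤ :=
  (lexpand k ((List.range (P / (k + 1) + 1)).map fun j : ℕ => (j : ℤ) * s ^ j)).take P

lemma gfun_sub_sum {w : ℂ} (hw : w ≠ 1) (n : ℕ) :
    gfun w - ∑ j ∈ Finset.range n, (j : ℂ) * w ^ j =
      w ^ n * ((n - (n - 1) * w) / (1 - w) ^ 2) := by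
  have h : 1 - w ≠ 0 := sub_ne_zero.2 hw.symm
  induction n with
  | zero => simp [gfun]
  | succ n ih =>
    rw [Finset.sum_range_succ, ← sub_sub, ih]
    field_simp
    push_cast
    ring

/-- The closed form of the remainder in `gfun_sub_sum` shows that P/(k+1) + 1 terms are enough. -/
lemma Ex.lgfun (P : ℕ) (s : ℤ) (k : ℕ) :
    Ex P (fun x => gfun (s * x ^ (k + 1))) (lgfun P s k) := by
  refine Ex.take ?_
  set n := P / (k + 1) + 1 with hn
  have hP : P ≤ (k + 1) * n := by
    rw [hn]; have := Nat.lt_mul_div_succ P (Nat.succ_pos k); simpa using this.le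
  have hw := tendsto_const_mul_pow s k.succ_pos
  have h1 : ∀ᶠ x : ℂ in 𝓝 0, (s : ℂ) * x ^ (k + 1) ≠ 1 :=
    hw.eventually (isOpen_ne.mem_nhds zero_ne_one)
  have h2 : (fun x : ℂ => ((n : ℂ) - (n - 1) * (s * x ^ (k + 1))) / (1 - s * x ^ (k + 1)) ^ 2)
      =O[𝓝 0] fun _ => (1 : ℂ) := by
    have : Tendsto (fun x : ℂ => ((n : ℂ) - (n - 1) * (s * x ^ (k + 1))) /
      (1 - s * x ^ (k + 1)) ^ 2) (𝓝 0) (𝓝 (((n : ℂ) - (n - 1) * 0) / (1 - 0) ^ 2)) :=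
      ((hw.const_mul _).const_sub _).div ((hw.const_sub 1).pow 2) (by simp)
    exact this.isBigO_one ℂ
  have h3 : (fun x : ℂ => ((s : ℂ) * x ^ (k + 1)) ^ n) =O[𝓝 0] fun x => x ^ P := by
    simp only [mul_pow, ← pow_mul]
    exact (pow_isBigO_pow hP).const_mul_left _
  have h4 := h3.mul h2
  simp only [mul_one] at h4
  refine h4.congr' ?_ EventuallyEq.rfl
  filter_upwards [h1] with x hx
  rw [← gfun_sub_sum hx, ev_lexpand, ev_map_range]
  congr 1
  refine Finset.sum_congr rfl fun j _ => ?_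
  push_cast; ring

/-- The sum of the expansions of the first `n` terms of `afun (s x ^ (a + 1)) (x ^ b)`. -/
def lafun (P : ℕ) (s : ℤ) (b : ℕ) : ℕ → ℕ → List ℤ
  | 0, _ => []
  | n + 1, a => ladd (lgfun P s a) (lafun P s b n (a + b))

lemma Ex.lafun {P : ℕ} {s : ℤ} {b : ℕ} (hb : 0 < b) {n a : ℕ} (hP : P ≤ a + 1 + n * b) :
    Ex P (fun x => afun (s * x ^ (a + 1)) (x ^ b)) (lafun P s b n a) := by
  induction n generalizing a with
  | zero =>
    have h1 := afun_isBigO (tendsto_const_mul_pow s a.succ_pos) (tendsto_pow_zero hb)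
    have h2 := h1.trans (((pow_isBigO_pow (a := P) (by omega)).const_mul_left _))
    unfold Ex
    simpa [Mathieu.lafun, ev] using h2
  | succ n ih =>
    rw [Mathieu.lafun]
    refine ((Ex.lgfun P s a).add (ih (a := a + b) (by rw [Nat.succ_mul] at hP; omega))).congr ?_
    filter_upwards [eventually_norm_pow_lt hb] with x hx
    rw [afun_succ (s * x ^ (a + 1)) hx, mul_assoc, ← pow_add, add_right_comm]

/-! ### The two families of identities -/

/-- Truncated multiplication by the product of the `poch ((s x ^ c) ^ m) ((x ^ b) ^ m)`. -/
def lpochs (P : ℕ) (s : ℤ) (c b : ℕ) : List ℕ → List ℤ → List ℤ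
  | [], l => l
  | m :: L, l => lpochs P s c b L (lpoch P (s ^ m) (b * m) (P / (b * m) + 1) (c * m) l)

lemma Ex.lpochs {P : ℕ} {s : ℤ} {c b : ℕ} (hc : 0 < c) (hb : 0 < b) {L : List ℕ}
    (hL : ∀ m ∈ L, 0 < m) {F : ℂ → ℂ} {l : List ℤ} (h : Ex P F l) :
    Ex P (fun x => F x * pochProd L (s * x ^ c) (x ^ b)) (lpochs P s c b L l) := by
  induction L generalizing F l with
  | nil => simpa [pochProd, Mathieu.lpochs] using h
  | cons m L ih =>
    have hm := hL m List.mem_cons_self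
    have hbm : 0 < b * m := by positivity
    rw [Mathieu.lpochs]
    have h1 := h.lpoch (s := s ^ m) hbm (n := P / (b * m) + 1) (a := c * m) (by positivity)
      (by have := Nat.lt_mul_div_succ P hbm
          rw [Nat.mul_comm] at this; omega)
    refine (ih (fun k hk => hL k (List.mem_cons_of_mem _ hk)) h1).congr
      (Eventually.of_forall fun x => ?_)
    rw [pochProd, pochProd, List.map_cons, List.prod_cons, mul_pow, ← pow_mul, ← pow_mul]
    push_cast; ring

/-- `E2 (n τ)` as a function of `x = ex (τ / 2)`. -/
def E2x (n : ℕ) (x : ℂ) : ℂ := 1 - 24 * afun (x ^ (2 * n)) (x ^ (2 * n))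

/-- The expansion of `afun (s x ^ a) (x ^ b)`. -/
def lafun' (P : ℕ) (s : ℤ) (a b : ℕ) : List ℤ := lafun P s b (P / b + 1) (a - 1)

lemma Ex.lafun' {P : ℕ} {s : ℤ} {a b : ℕ} (ha : 0 < a) (hb : 0 < b) :
    Ex P (fun x => afun (s * x ^ a) (x ^ b)) (lafun' P s a b) := by
  have := Ex.lafun (P := P) (s := s) hb (n := P / b + 1) (a := a - 1)
    (by have := Nat.lt_mul_div_succ P hb
        rw [Nat.mul_comm] at this; omega)
  rwa [Nat.sub_add_cancel ha] at this

/-- The expansion of `E2 (n τ)`. -/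
def lE2 (P n : ℕ) : List ℤ := ladd [1] ((lafun' P 1 (2 * n) (2 * n)).map (-24 * ·))

lemma Ex.lE2 {P n : ℕ} (hn : 0 < n) : Ex P (E2x n) (lE2 P n) := by
  have h1 := (Ex.lafun' (P := P) (s := 1) (a := 2 * n) (b := 2 * n) (by omega) (by omega)).smul (-24)
  refine ((Ex.of_ev [1]).add h1).congr (Eventually.of_forall fun x => ?_)
  simp [ev, E2x, sub_eq_add_neg]

/-- Twelve times the value of `etfun` at the half period with parameter `s x ^ a`, up to the
constant coming from a parameter of absolute value one. -/
def halfE (s : ℤ) (a : ℕ) (x : ℂ) : ℂ := 24 * afun (s * x ^ a) (x ^ 2) + E2x 1 x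

lemma Ex.halfE {P : ℕ} {s : ℤ} {a : ℕ} (ha : 0 < a) :
    Ex P (halfE s a) (ladd ((Mathieu.lafun' P s a 2).map (24 * ·)) (Mathieu.lE2 P 1)) :=
  (((Ex.lafun' (P := P) (s := s) ha two_pos).smul 24).add (Ex.lE2 one_pos)).congr
    (Eventually.of_forall fun x => by simp [Mathieu.halfE])

/-- The weight zero combination for the cycle shape `s`. -/
def combZero (s : List ℕ) (C χ : ℤ) (x : ℂ) : ℂ :=
  pochProd s x (x ^ 2) - pochProd s (-x) (x ^ 2) +
    C * (x ^ 3 * pochProd s (-x ^ 2) (x ^ 2)) + 2 * χ * x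

/-- The first `P` coefficients of `combZero s C χ` vanish. -/
def checkZero (P : ℕ) (s : List ℕ) (C χ : ℤ) : Bool :=
  ((ladd (ladd (lpochs P 1 1 2 s [1]) ((lpochs P (-1) 1 2 s [1]).map (-1 * ·)))
    (ladd ((List.replicate 3 0 ++ lpochs P (-1) 2 2 s [1]).map (C * ·)) [0, 2 * χ])).take P).all
      fun c => c == 0

lemma ex_one' (P : ℕ) : Ex P (fun _ => 1) [1] :=
  (Ex.of_ev [1]).congr (Eventually.of_forall fun x => by simp [ev])

lemma combZero_isBigO {P : ℕ} {s : List ℕ} {C χ : ℤ} (hs : ∀ m ∈ s, 0 < m)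
    (h : checkZero P s C χ = true) : combZero s C χ =O[𝓝 0] fun x : ℂ => x ^ P := by
  have h1 := ((ex_one' P).lpochs (s := 1) (c := 1) one_pos two_pos hs).add
    (((ex_one' P).lpochs (s := -1) (c := 1) one_pos two_pos hs).smul (-1))
  have h2 := ((((ex_one' P).lpochs (s := -1) (c := 2) two_pos two_pos hs).shift 3).smul C).add
    (Ex.of_ev [0, 2 * χ])
  refine ((h1.add h2).take.isBigO h).congr_left fun x => ?_
  simp [ev, combZero]
  ring

/-- The weight two combination for the cycle shape `s`, where the weight two form is `den⁻¹` times
the sum of the `c Λ_n` for `(c, n)` in `lams` and of a multiple of the eta product of `s`, plus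
`cX` times the quotient of `num` by `dn`; the coefficient of the eta product is `δ`. -/
def combTwo (s : List ℕ) (C den δ cX : ℤ) (lams : List (ℤ × ℕ)) (num dn : List ℕ) (x : ℂ) : ℂ :=
  (den * (pochProd s x (x ^ 2) * halfE 1 1 x - pochProd s (-x) (x ^ 2) * halfE (-1) 1 x +
    C * (x ^ 3 * (pochProd s (-x ^ 2) (x ^ 2) * (halfE (-1) 2 x - 3)))) +
    12 * δ * (x ^ 3 * pochProd s (x ^ 2) (x ^ 2)) -
    x * (lams.map fun p => (p.1 * p.2 : ℂ) * (p.2 * E2x p.2 x - E2x 1 x)).sum) *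
      pochProd dn (x ^ 2) (x ^ 2) - 24 * den * cX * (x * pochProd num (x ^ 2) (x ^ 2))

/-- The expansion of the sum of the `24 c Λ_n`. -/
def llams (P : ℕ) : List (ℤ × ℕ) → List ℤ
  | [] => []
  | p :: L => ladd ((ladd ((lE2 P p.2).map ((p.2 : ℤ) * ·)) ((lE2 P 1).map (-1 * ·))).map
      ((p.1 * p.2) * ·)) (llams P L)

lemma Ex.llams {P : ℕ} {lams : List (ℤ × ℕ)} (h : ∀ p ∈ lams, 0 < p.2) :
    Ex P (fun x => (lams.map fun p => (p.1 * p.2 : ℂ) * (p.2 * E2x p.2 x - E2x 1 x)).sum)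
      (llams P lams) := by
  induction lams with
  | nil => exact (Ex.of_ev []).congr (Eventually.of_forall fun x => by simp [ev])
  | cons p L ih =>
    have h1 := h p List.mem_cons_self
    refine ((((Ex.lE2 h1).smul p.2).add ((Ex.lE2 one_pos).smul (-1))).smul (p.1 * p.2)).add
      (ih fun r hr => h r (List.mem_cons_of_mem _ hr)) |>.congr (Eventually.of_forall fun x => ?_)
    simp only [List.map_cons, List.sum_cons]
    push_cast
    ring

/-- The first `P` coefficients of `combTwo s C den δ cX lams num dn` vanish. -/
def checkTwo (P : ℕ) (s : List ℕ) (C den δ cX : ℤ) (lams : List (ℤ × ℕ)) (num dn : List ℕ) :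
    Bool :=
  ((ladd (lpochs P 1 2 2 dn
    ((ladd (ladd ((ladd
      (ladd (lmul (lpochs P 1 1 2 s [1]) (ladd ((lafun' P 1 1 2).map (24 * ·)) (lE2 P 1)))
        ((lmul (lpochs P (-1) 1 2 s [1])
          (ladd ((lafun' P (-1) 1 2).map (24 * ·)) (lE2 P 1))).map (-1 * ·)))
      ((List.replicate 3 0 ++ lmul (lpochs P (-1) 2 2 s [1])
        (ladd (ladd ((lafun' P (-1) 2 2).map (24 * ·)) (lE2 P 1)) [-3])).map (C * ·))).map
          (den * ·))
      ((List.replicate 3 0 ++ lpochs P 1 2 2 s [1]).map (12 * δ * ·)))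
      ((List.replicate 1 0 ++ llams P lams).map (-1 * ·))).take P))
    ((List.replicate 1 0 ++ lpochs P 1 2 2 num [1]).map (-24 * den * cX * ·))).take P).all
      fun c => c == 0

lemma combTwo_isBigO {P : ℕ} {s : List ℕ} {C den δ cX : ℤ} {lams : List (ℤ × ℕ)} {num dn : List ℕ}
    (hs : ∀ m ∈ s, 0 < m) (hl : ∀ p ∈ lams, 0 < p.2) (hnum : ∀ m ∈ num, 0 < m)
    (hdn : ∀ m ∈ dn, 0 < m) (h : checkTwo P s C den δ cX lams num dn = true) :
    combTwo s C den δ cX lams num dn =O[𝓝 0] fun x : ℂ => x ^ P := by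
  have one := ex_one' P
  have h1 := ((one.lpochs (s := 1) (c := 1) one_pos two_pos hs).mul (Ex.halfE (s := 1) one_pos)).add
    (((one.lpochs (s := -1) (c := 1) one_pos two_pos hs).mul (Ex.halfE (s := -1) one_pos)).smul (-1))
  have h2 := (((one.lpochs (s := -1) (c := 2) two_pos two_pos hs).mul
    ((Ex.halfE (s := -1) two_pos).add (Ex.of_ev [-3]))).shift 3).smul C
  have h3 := ((one.lpochs (s := 1) (c := 2) two_pos two_pos hs).shift 3).smul (12 * δ)
  have h4 := ((Ex.llams (P := P) hl).shift 1).smul (-1)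
  have h5 := ((((h1.add h2).smul den).add h3).add h4).take.lpochs (s := 1) (c := 2)
    two_pos two_pos hdn
  have h6 := ((one.lpochs (s := 1) (c := 2) two_pos two_pos hnum).shift 1).smul (-24 * den * cX)
  refine ((h5.add h6).take.isBigO h).congr_left fun x => ?_
  simp [ev, combTwo]
  ring

end Mathieu

namespace Mathieu

open Filter Topology

/-! ### Vanishing of the combinations -/

lemma ex_eq_half_sq (τ : ℂ) : ex τ = ex (τ / 2) ^ 2 := by
  rw [pow_two, ← ex_add, add_halves]

lemma tendsto_ex_half_imInf : Tendsto (fun τ => ex (τ / 2)) imInf (𝓝 0) := by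
  rw [tendsto_zero_iff_norm_tendsto_zero]
  have h := tendsto_ex_imInf.norm
  rw [norm_zero] at h
  have h1 := (Real.continuous_sqrt.tendsto 0).comp h
  rw [Real.sqrt_zero] at h1
  refine h1.congr fun τ => ?_
  rw [Function.comp_apply, ex_eq_half_sq, norm_pow, Real.sqrt_sq (norm_nonneg _)]

/-- The expansion is that of x f with x = q^(1/2), which clears the pole at the cusp; one order is
lost on dividing by x. -/
lemma isBigO_of_mul {f : ℂ → ℂ} {m : ℕ} {G : ℂ → ℂ} (hG : G =O[𝓝 0] fun x : ℂ => x ^ (m + 1))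
    (h : ∀ τ : ℂ, 0 < τ.im → ex (τ / 2) * f τ = G (ex (τ / 2))) :
    f =O[imInf] fun τ => ex (τ / 2) ^ m := by
  have h1 := (hG.comp_tendsto tendsto_ex_half_imInf).mul
    (Asymptotics.isBigO_refl (fun τ => (ex (τ / 2))⁻¹) imInf)
  refine h1.congr' ?_ (Eventually.of_forall fun τ => ?_)
  · filter_upwards [eventually_imInf_le 1] with τ hτ
    simp only [Function.comp_apply]
    rw [← h τ (by linarith)]
    field_simp [ex_ne_zero]
  · simp only [Function.comp_apply]
    rw [pow_succ, mul_assoc, mul_inv_cancel₀ (ex_ne_zero _), mul_one]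

lemma prim_one (M : ℕ) : Prim M 0 1 := ⟨0, 1, 0, by simp⟩

lemma im_nat_mul {n : ℕ} (hn : 0 < n) {τ : ℂ} (hτ : 0 < τ.im) : 0 < ((n : ℂ) * τ).im := by
  rw [← nsmul_eq_mul, Complex.smul_im, nsmul_eq_mul]; positivity

section vanishing

variable {N hh : ℕ} {a : Fin 12 → ℤ} {s : List ℕ} {C : ℤ}

/-- The three shifted products of Klein forms, summed over the half periods, and the constant 2χ
form a family of weight zero. Its member at every (0, u), multiplied by x, is `combZero`. -/
theorem combZero_eq_zero {χ : ℤ} {m : ℕ} (h : EigenData N a s) (hN : 0 < N) (hhh : 0 < hh)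
    (ha : ∑ i, a i = 0) (hq : (2 * N : ℤ) ∣ hh * ∑ i, a i ^ 2)
    (hC : ∏ i, (1 + ex (1 / N) ^ (-a i)) = C)
    (hL : closedList (N * hh) (primList (N * hh)) = true)
    (hm : (primList (N * hh)).length < m + 1)
    (hck : checkZero (m + 1) s C χ = true) {τ : ℂ} (hτ : 0 < τ.im) :
    combZero s C χ (ex (τ / 2)) = 0 := by
  set f : ℤ → ℤ → ℂ → ℂ := fun c d τ => (tprod12 a N (1 / 2) 0 c d τ * 1 +
      tprod12 a N (1 / 2) (1 / 2) c d τ * 1 + tprod12 a N 0 (1 / 2) c d τ * 1) + 2 * χ with hf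
  have hfam : KFamily 0 (N * hh) f := by
    refine KFamily.add ?_ (kfamily_const _ _)
    exact kfamily_sum (E := fun _ _ _ => 1) hN ha hq (by simp) (by simp) (by simp)
      (fun _ _ _ => differentiableOn_const 1) (fun _ _ => growth_const 1)
  have hbase : ∀ u : ℤ, Prim (N * hh) 0 u → ∀ τ : ℂ, 0 < τ.im →
      ex (τ / 2) * f 0 u τ = combZero s C χ (ex (τ / 2)) := by
    intro u hu τ hτ
    have hNM : N ∣ N * hh := Dvd.intro hh rfl
    have e1 := tprod12_half_zero h hN ha hNM hu hτ
    have e2 := tprod12_half_half h hN ha hNM hu hτ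
    have e3 := tprod12_zero_half h hN ha hNM hu hτ
    have e4 := prod_zpow_const hN hNM a 1 (r := C) (by simpa using hC) hu
    simp only [Int.cast_one, one_mul] at e4
    rw [e4] at e3
    simp only [hf]
    rw [e3, combZero, ← ex_eq_half_sq]
    linear_combination e1 + e2 + C * pochProd s (-ex τ) (ex τ) * ex (τ / 2) * ex_eq_half_sq τ
  have h0 := hfam.eq_zero (by positivity) le_rfl
    (fun u hu τ hτ => mul_left_cancel₀ (ex_ne_zero (τ / 2))
      ((hbase u hu τ hτ).trans (hbase 1 (prim_one _) τ hτ).symm)) hL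
    (isBigO_of_mul (combZero_isBigO (fun k hk => (h.1 k hk).1) hck) (hbase 1 (prim_one _)))
    (by push_cast; omega) hτ
  rw [← hbase 1 (prim_one _) τ hτ, h0, mul_zero]

lemma halfE_one {τ : ℂ} (hτ : 0 < τ.im) : halfE 1 1 (ex (τ / 2)) = 12 * etq (1 / 2) 0 τ := by
  have e : ex τ * ex (-(τ / 2)) = ex (τ / 2) := by rw [← ex_add]; ring_nf
  rw [halfE, E2x, etq, etfun, wfun, show ((1 / 2 : ℚ) : ℂ) * τ + ((0 : ℚ) : ℂ) = τ / 2 by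
    push_cast; ring, e, E2_eq_afun hτ, mul_one, ← ex_eq_half_sq]
  push_cast
  rw [pow_one, one_mul]
  ring

lemma halfE_neg_one {τ : ℂ} (hτ : 0 < τ.im) :
    halfE (-1) 1 (ex (τ / 2)) = 12 * etq (1 / 2) (1 / 2) τ := by
  have e : ex τ * ex (-(τ / 2)) = ex (τ / 2) := by rw [← ex_add]; ring_nf
  have e1 : ex (τ / 2 + 1 / 2) = -ex (τ / 2) := by rw [ex_add, ex_half, mul_neg_one]
  have e2 : ex τ * ex (-(τ / 2 + 1 / 2)) = -ex (τ / 2) := by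
    rw [ex_neg, e1, inv_neg, mul_neg, ← ex_neg, e]
  rw [halfE, E2x, etq, etfun, wfun, show ((1 / 2 : ℚ) : ℂ) * τ + ((1 / 2 : ℚ) : ℂ) = τ / 2 + 1 / 2 by
    push_cast; ring, e2, e1, E2_eq_afun hτ, mul_one, ← ex_eq_half_sq]
  push_cast
  rw [pow_one, neg_one_mul]
  ring

/-- The parameter at the half period 1/2 is -1, on the unit circle; its term gives 12·`gfun` (-1) =
-3. -/
lemma halfE_neg_two {τ : ℂ} (hτ : 0 < τ.im) :
    halfE (-1) 2 (ex (τ / 2)) - 3 = 12 * etq 0 (1 / 2) τ := by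
  rw [halfE, E2x, etq, etfun, wfun_eq_gfun_add hτ, show ((0 : ℚ) : ℂ) * τ + ((1 / 2 : ℚ) : ℂ) = 1 / 2 by
    push_cast; ring, ex_neg, ex_half, E2_eq_afun hτ, mul_one, ← ex_eq_half_sq, gfun]
  push_cast
  rw [neg_one_mul, inv_neg, inv_one, mul_neg_one]
  ring

lemma E2_nat_mul {n : ℕ} (hn : 0 < n) {τ : ℂ} (hτ : 0 < τ.im) : E2 (n * τ) = E2x n (ex (τ / 2)) := by
  rw [E2_eq_afun (im_nat_mul hn hτ), ex_nat_mul, ex_eq_half_sq, ← pow_mul, E2x]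

lemma E2_eq_E2x {τ : ℂ} (hτ : 0 < τ.im) : E2 τ = E2x 1 (ex (τ / 2)) := by
  have := E2_nat_mul one_pos hτ
  rwa [Nat.cast_one, one_mul] at this

/-- A linear combination of the forms `Λ_n`. -/
def lamSum (lams : List (ℤ × ℕ)) (τ : ℂ) : ℂ := (lams.map fun p => (p.1 : ℂ) * Lam p.2 τ).sum

lemma lamSum_eq {lams : List (ℤ × ℕ)} (hl : ∀ p ∈ lams, 0 < p.2) {τ : ℂ} (hτ : 0 < τ.im) :
    24 * lamSum lams τ = (lams.map fun p => (p.1 * p.2 : ℂ) *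
      (p.2 * E2x p.2 (ex (τ / 2)) - E2x 1 (ex (τ / 2)))).sum := by
  rw [lamSum, ← List.sum_map_mul_left]
  congr 1
  refine List.map_congr_left fun p hp => ?_
  rw [Lam, E2_nat_mul (hl p hp) hτ, E2_eq_E2x hτ]
  ring

lemma kfamily_eisList {M : ℕ} {lams : List (ℤ × ℕ)} (hl : ∀ p ∈ lams, 0 < p.2 ∧ p.2 ∣ M) :
    KFamily 2 M fun c d τ => (lams.map fun p => (p.1 : ℂ) * eisSum p.2 c d τ).sum := by
  induction lams with
  | nil =>
    have := (kfamily_eisSum (n := 1) one_pos (one_dvd M)).const_mul 0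
    simpa using this
  | cons p L ih =>
    simp only [List.map_cons, List.sum_cons]
    obtain ⟨h1, h2⟩ := hl p List.mem_cons_self
    exact ((kfamily_eisSum h1 h2).const_mul _).add (ih fun r hr => hl r (List.mem_cons_of_mem _ hr))

lemma eisList_zero {M : ℕ} {lams : List (ℤ × ℕ)} (hl : ∀ p ∈ lams, 0 < p.2 ∧ p.2 ∣ M) {u : ℤ}
    (hu : Prim M 0 u) {τ : ℂ} (hτ : 0 < τ.im) :
    (lams.map fun p => (p.1 : ℂ) * eisSum p.2 0 u τ).sum = -2 * lamSum lams τ := by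
  rw [lamSum, ← List.sum_map_mul_left]
  congr 1
  refine List.map_congr_left fun p hp => ?_
  rw [eisSum_zero (hl p hp).1 (hl p hp).2 hu hτ]
  ring

lemma tendsto_pochProd (L : List ℕ) (hL : ∀ m ∈ L, 0 < m) :
    Tendsto (fun x : ℂ => pochProd L (x ^ 2) (x ^ 2)) (𝓝 0) (𝓝 1) := by
  induction L with
  | nil => simp [pochProd]
  | cons m L ih =>
    have hm := hL m List.mem_cons_self
    have h1 : Tendsto (fun x : ℂ => (x ^ 2) ^ m) (𝓝 0) (𝓝 0) := by
      simp only [← pow_mul]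
      exact tendsto_pow_zero (by positivity)
    have := (tendsto_poch h1 h1).mul (ih fun k hk => hL k (List.mem_cons_of_mem _ hk))
    simpa [pochProd] using this

lemma pochProd_ne_zero {L : List ℕ} (hL : ∀ m ∈ L, 0 < m) {q : ℂ} (hq : ‖q‖ < 1) :
    pochProd L q q ≠ 0 := by
  rw [pochProd, Ne, List.prod_eq_zero_iff, List.mem_map]
  rintro ⟨m, hm, h⟩
  refine poch_self_ne_zero ?_ h
  rw [norm_pow]; exact pow_lt_one₀ (norm_nonneg _) hq (hL m hm).ne'

/-- The family of weight two is the sum of the shifted products weighted by ℘ at the half periods, a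
multiple r of the unshifted product of ten Klein forms, the Eisenstein families, and the optional
eta quotient X. Multiplication by 12·den·x and by the denominator of the eta quotient makes the
expansion at the cusp integral; that factor is nonzero on the upper half-plane and tends to a
nonzero constant times x. -/
theorem combTwo_eq_zero {m : ℕ} {den δ cX : ℤ} {lams : List (ℤ × ℕ)} {num dn : List ℕ}
    (h : EigenData N a s) (hN : 0 < N) (hhh : 0 < hh)
    (ha : ∑ i, a i = 0) (h10 : a 10 = 0) (h11 : a 11 = 0)
    (hq : (2 * N : ℤ) ∣ hh * ∑ i, a i ^ 2)
    (hC : ∏ i, (1 + ex (1 / N) ^ (-a i)) = C) (hden : den ≠ 0)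
    {r : ℂ} (hr : ∀ u : ℤ, Prim (N * hh) 0 u → r * ∏ i, (1 - ex (u / N) ^ (-cut a i)) = -(δ / den))
    {X : ℤ → ℤ → ℂ → ℂ} (hX : KFamily 2 (N * hh) X)
    (hXb : ∀ u : ℤ, Prim (N * hh) 0 u → ∀ τ : ℂ, 0 < τ.im →
      cX * (X 0 u τ * pochProd dn (ex τ) (ex τ)) = cX * pochProd num (ex τ) (ex τ))
    (hl : ∀ p ∈ lams, 0 < p.2 ∧ p.2 ∣ N * hh) (hnum : ∀ m ∈ num, 0 < m) (hdn : ∀ m ∈ dn, 0 < m)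
    (hL : closedList (N * hh) (primList (N * hh)) = true)
    (hm : (primList (N * hh)).length * 16 < 12 * (m + 1))
    (hck : checkTwo (m + 1) s C den δ cX lams num dn = true) {τ : ℂ} (hτ : 0 < τ.im) :
    combTwo s C den δ cX lams num dn (ex (τ / 2)) = 0 := by
  have hNM : N ∣ N * hh := Dvd.intro hh rfl
  have hden' : (den : ℂ) ≠ 0 := by exact_mod_cast hden
  set f : ℤ → ℤ → ℂ → ℂ := fun c d τ => (tprod12 a N (1 / 2) 0 c d τ * etq (1 / 2) 0 τ +
      tprod12 a N (1 / 2) (1 / 2) c d τ * etq (1 / 2) (1 / 2) τ +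
      tprod12 a N 0 (1 / 2) c d τ * etq 0 (1 / 2) τ) +
      r * (disc τ ^ 1 * kprod (cut a) (fun _ => 1) N 0 0 c d τ) +
      (den : ℂ)⁻¹ * (lams.map fun p => (p.1 : ℂ) * eisSum p.2 c d τ).sum +
      (-2 * cX) * X c d τ with hf
  have hcut1 := sum_cut ha h10 h11
  have hcut2 : ∑ i, cut a i ^ 2 = ∑ i, a i ^ 2 := by
    have : ∑ i, a i ^ 2 = ∑ i : Fin 10, a (i.castAdd 2) ^ 2 + ∑ i : Fin 2, a (i.natAdd 10) ^ 2 :=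
      Fin.sum_univ_add (a := 10) (b := 2) (fun i : Fin 12 => a i ^ 2)
    have h1 : a (Fin.natAdd 10 (0 : Fin 2)) = 0 := h10
    have h2 : a (Fin.natAdd 10 (1 : Fin 2)) = 0 := h11
    rw [Fin.sum_univ_two, h1, h2] at this
    unfold cut
    linarith
  have hfam : KFamily 2 (N * hh) f := by
    refine (((KFamily.add ?_ (KFamily.const_mul ?_ r)).add
      ((kfamily_eisList hl).const_mul _)).add (hX.const_mul _))
    · exact kfamily_sum (E := etq) hN ha hq (fun h₁ h₂ τ hτ _ h => etq_S hτ h)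
        (fun h₁ h₂ τ hτ => etq_T hτ h₁ h₂) (fun h₁ h₂ τ hτ m n => etq_add_int hτ h₁ h₂ m n)
        (fun h₁ h₂ h => differentiableOn_etq h) growth_etq
    · have := kfamily_kprod (a := cut a) (e := fun _ => 1) (hh := hh) (ε := 1) hN
        (by simp only [one_mul, ← Finset.sum_mul, hcut1, zero_mul]; exact Even.zero)
        (by simpa only [one_mul, hcut2] using hq) (by simp) (by simp)
      simpa using this
  have hbase : ∀ u : ℤ, Prim (N * hh) 0 u → ∀ τ : ℂ, 0 < τ.im →
      12 * den * ex (τ / 2) * f 0 u τ * pochProd dn (ex τ) (ex τ) =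
        combTwo s C den δ cX lams num dn (ex (τ / 2)) := by
    intro u hu τ hτ
    have e1 := tprod12_half_zero h hN ha hNM hu hτ
    have e2 := tprod12_half_half h hN ha hNM hu hτ
    have e3 := tprod12_zero_half h hN ha hNM hu hτ
    have e4 := prod_zpow_const hN hNM a 1 (r := C) (by simpa using hC) hu
    simp only [Int.cast_one, one_mul] at e4
    rw [e4] at e3
    have e5 := kprod_cut h hN ha h10 h11 hNM hu hτ
    have e6 := eisList_zero hl hu hτ
    have e7 := lamSum_eq (fun p hp => (hl p hp).1) hτ
    have e8 := hXb u hu τ hτ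
    have e9 : (den : ℂ) * (r * ∏ i, (1 - ex (u / N) ^ (-cut a i))) = -δ := by
      rw [hr u hu]; field_simp
    have e10 : (den : ℂ) * (den : ℂ)⁻¹ = 1 := mul_inv_cancel₀ hden'
    simp only [hf]
    rw [combTwo, halfE_one hτ, halfE_neg_one hτ, halfE_neg_two hτ, ← e7, pow_one, e6, e3,
      show ex (τ / 2) ^ 3 = ex (τ / 2) * ex (τ / 2) ^ 2 by ring, ← ex_eq_half_sq, e5]
    linear_combination (12 * den * etq (1 / 2) 0 τ * pochProd dn (ex τ) (ex τ)) * e1 +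
      (12 * den * etq (1 / 2) (1 / 2) τ * pochProd dn (ex τ) (ex τ)) * e2 -
      12 * ex (τ / 2) * pochProd dn (ex τ) (ex τ) * (ex τ * pochProd s (ex τ) (ex τ)) * e9 -
      24 * ex (τ / 2) * pochProd dn (ex τ) (ex τ) * lamSum lams τ * e10 -
      24 * den * ex (τ / 2) * e8
  have hdn0 : ∀ {τ : ℂ}, 0 < τ.im → pochProd dn (ex τ) (ex τ) ≠ 0 := fun hτ =>
    pochProd_ne_zero hdn (norm_ex_lt_one hτ)
  have hO : (fun x => combTwo s C den δ cX lams num dn x *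
      (12 * den * pochProd dn (x ^ 2) (x ^ 2))⁻¹) =O[𝓝 0] fun x : ℂ => x ^ (m + 1) := by
    have h1 : Tendsto (fun x : ℂ => (12 * den * pochProd dn (x ^ 2) (x ^ 2))⁻¹) (𝓝 0)
        (𝓝 (12 * den * 1)⁻¹) :=
      ((tendsto_pochProd dn hdn).const_mul _).inv₀ (by simpa using hden')
    have h2 := (combTwo_isBigO (fun k hk => (h.1 k hk).1) (fun p hp => (hl p hp).1) hnum hdn
      hck).mul (h1.isBigO_one ℂ)
    simpa only [mul_one] using h2
  have h0 := hfam.eq_zero (by positivity) (by norm_num)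
    (fun u hu τ hτ => by
      have h1 := (hbase u hu τ hτ).trans (hbase 1 (prim_one _) τ hτ).symm
      have h2 : 12 * den * ex (τ / 2) ≠ 0 := by
        simp [hden', ex_ne_zero]
      exact mul_left_cancel₀ h2 (mul_right_cancel₀ (hdn0 hτ) h1)) hL
    (isBigO_of_mul hO (fun τ hτ => by
      rw [← hbase 1 (prim_one _) τ hτ, ← ex_eq_half_sq]
      have := hdn0 hτ
      field_simp))
    (by push_cast; omega) hτ
  rw [← hbase 1 (prim_one _) τ hτ, h0, mul_zero, zero_mul]

end vanishing

end Mathieu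

namespace Mathieu

open Filter Topology

/-! ### The constants -/

section constants

variable {N : ℕ} {a : Fin 12 → ℤ} {s : List ℕ}

lemma one_add_ex_neg (t : ℂ) : 1 + ex (-t) = ex (-t / 2) * (2 * Complex.cos (Real.pi * t)) := by
  rw [Complex.two_cos, ex, ex, mul_add, ← Complex.exp_add, ← Complex.exp_add, ← Complex.exp_zero]
  ring_nf

/-- The square of the product is the characteristic polynomial at -1, as the factors for λ and λ⁻¹
have the same product when ∏λ = 1. For the sign, 1 + e^(-2πit) = e^(-πit)·2cos πt; the phases
cancel, and the cosines are positive when all |2a| < N. -/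
lemma EigenData.prod_one_add (h : EigenData N a s) (hN : 0 < N) (ha : ∑ i, a i = 0) {C : ℤ}
    (hC : C ^ 2 = (s.map fun m => 1 - (-1 : ℤ) ^ m).prod)
    (hpos : C = 0 ∨ 0 < C ∧ ∀ i, |2 * a i| < N) : ∏ i, (1 + ex (1 / N) ^ (-a i)) = C := by
  have hζ := isPrimitiveRoot_ex hN dvd_rfl (prim_one N)
  rw [Int.cast_one] at hζ
  have hNc : (N : ℂ) ≠ 0 := by exact_mod_cast hN.ne'
  set ζ := ex (1 / N) with hζd
  have hζ0 : ζ ≠ 0 := ex_ne_zero _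
  have hsq : (∏ i, (1 + ζ ^ (-a i))) ^ 2 = (C : ℂ) ^ 2 := by
    have h1 := h.prod_one_sub hN hζ (-1)
    have h2 : ∏ i, ζ ^ a i = 1 := by
      have := zpow_sum Finset.univ hζ0 a
      rw [← this, ha, zpow_zero]
    have h3 : ∏ i, (1 + ζ ^ a i) = ∏ i, (1 + ζ ^ (-a i)) := by
      calc ∏ i, (1 + ζ ^ a i) = ∏ i, ζ ^ a i * (1 + ζ ^ (-a i)) := by
            refine Finset.prod_congr rfl fun i _ => ?_
            rw [mul_add, mul_one, ← zpow_add₀ hζ0, add_neg_cancel, zpow_zero, add_comm]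
        _ = _ := by rw [Finset.prod_mul_distrib, h2, one_mul]
    have h4 : ((C : ℂ)) ^ 2 = (s.map fun m => 1 - (-1 : ℂ) ^ m).prod := by
      rw [← Int.cast_pow, hC, Int.cast_list_prod, List.map_map]
      congr 1
      refine List.map_congr_left fun m _ => ?_
      simp
    rw [h4, ← h1, pow_two]
    simp only [mul_neg_one, sub_neg_eq_add]
    rw [Finset.prod_mul_distrib, h3]
  rcases hpos with rfl | ⟨hC0, hlt⟩
  · simpa using hsq
  have hreal : ∏ i, (1 + ζ ^ (-a i)) = ((∏ i, 2 * Real.cos (Real.pi * (a i / N)) : ℝ) : ℂ) := by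
    have e : ∀ i, 1 + ζ ^ (-a i) = ex (0 + a i * (-1 / (2 * N))) *
        ((2 * Real.cos (Real.pi * (a i / N)) : ℝ) : ℂ) := by
      intro i
      have : ζ ^ (-a i) = ex (-((a i : ℂ) / N)) := by
        rw [hζd, ← ex_int_mul]; congr 1; push_cast; ring
      rw [this, one_add_ex_neg]
      push_cast
      congr 2
      field_simp; ring
    simp only [e]
    rw [Finset.prod_mul_distrib, prod_ex_const _ _ ha, mul_zero, ex_zero, one_mul]
    push_cast; rfl
  have hp : 0 < ∏ i, 2 * Real.cos (Real.pi * (a i / N)) := by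
    refine Finset.prod_pos fun i _ => ?_
    refine mul_pos two_pos (Real.cos_pos_of_mem_Ioo ?_)
    have h1 := abs_lt.1 (hlt i)
    have hN' : (0 : ℝ) < N := by exact_mod_cast hN
    have h2 : (-(N : ℝ)) < 2 * a i ∧ (2 * a i : ℝ) < N := by exact_mod_cast h1
    have h3 : -(1 / 2) < (a i / N : ℝ) := by rw [lt_div_iff₀ hN']; linarith
    have h4 : (a i / N : ℝ) < 1 / 2 := by rw [div_lt_iff₀ hN']; linarith
    constructor <;> nlinarith [Real.pi_pos]
  rw [hreal] at hsq ⊢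
  have hsq' : (∏ i, 2 * Real.cos (Real.pi * (a i / N)) : ℝ) ^ 2 = (C : ℝ) ^ 2 := by
    exact_mod_cast hsq
  have := (pow_left_inj₀ hp.le (by exact_mod_cast hC0.le) two_ne_zero).1 hsq'
  rw [this]; norm_cast

end constants

section ten

open Polynomial

lemma prod_X_pow_sub_one (s : List ℕ) :
    (s.map fun m => (X ^ m - 1 : ℂ[X])).prod =
      (X - 1) ^ s.length * (s.map fun m => ∑ i ∈ Finset.range m, (X : ℂ[X]) ^ i).prod := by
  induction s with
  | nil => simp
  | cons m s ih =>
    rw [List.map_cons, List.prod_cons, ih, List.map_cons, List.prod_cons, List.length_cons,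
      ← geom_sum_mul]
    ring

lemma lam_ne_zero {lam : Fin 12 → ℂ} {s : List ℕ} (hs : ∀ m ∈ s, 0 < m)
    (h : ∏ i, (X - C (lam i)) * (X - C (lam i)⁻¹) = (s.map fun m => (X ^ m - 1 : ℂ[X])).prod)
    (i : Fin 12) : lam i ≠ 0 := by
  intro h0
  have h1 := congrArg (eval 0) h
  rw [eval_prod, Finset.prod_eq_zero (Finset.mem_univ i) (by simp [h0]), eval_list_prod,
    List.map_map, eq_comm, List.prod_eq_zero_iff, List.mem_map] at h1
  obtain ⟨m, hm, h2⟩ := h1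
  simp [(hs m hm).ne'] at h2

/-- The square of the product of the `ν (1 - λ⁻¹)` over the first ten indices. -/
lemma prod_ten_sq {lam nu : Fin 12 → ℂ} {s : List ℕ} (hs : ∀ m ∈ s, 0 < m)
    (h : ∏ i, (X - C (lam i)) * (X - C (lam i)⁻¹) = (s.map fun m => (X ^ m - 1 : ℂ[X])).prod)
    (hnu : ∀ i, nu i ^ 2 = lam i) (h10 : lam 10 = 1) (h11 : lam 11 = 1) (hlen : 4 ≤ s.length) :
    (∏ i : Fin 10, nu (i.castAdd 2) * (1 - (lam (i.castAdd 2))⁻¹)) ^ 2 =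
      0 ^ (s.length - 4) * (s.map fun m : ℕ => (m : ℂ)).prod := by
  have h0 := lam_ne_zero hs h
  have h1 : (∏ i : Fin 10, (X - C (lam (i.castAdd 2))) * (X - C (lam (i.castAdd 2))⁻¹)) *
      (X - 1) ^ 4 = ∏ i, (X - C (lam i)) * (X - C (lam i)⁻¹) := by
    rw [prod_fin_twelve, h10, h11]
    simp only [inv_one, map_one]
    ring
  rw [h, prod_X_pow_sub_one, mul_comm] at h1
  obtain ⟨k, hk⟩ := Nat.exists_eq_add_of_le hlen
  rw [hk, pow_add, mul_assoc] at h1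
  have hX : (X - 1 : ℂ[X]) ^ 4 ≠ 0 := pow_ne_zero _ (X_sub_C_ne_zero 1)
  have h2 := congrArg (eval 1) (mul_left_cancel₀ hX h1)
  rw [eval_prod, eval_mul, eval_pow, eval_list_prod, List.map_map] at h2
  have h3 : (eval 1 ∘ fun m => ∑ i ∈ Finset.range m, (X : ℂ[X]) ^ i) = fun m : ℕ => (m : ℂ) := by
    funext m
    simp [eval_finsetSum]
  rw [h3] at h2
  simp only [eval_mul, eval_sub, eval_X, eval_C, eval_one, sub_self] at h2
  rw [hk, Nat.add_sub_cancel_left, ← h2, ← Finset.prod_pow]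
  have h4 : ∀ i : Fin 10, (nu (i.castAdd 2) * (1 - (lam (i.castAdd 2))⁻¹)) ^ 2 =
      -1 * ((1 - lam (i.castAdd 2)) * (1 - (lam (i.castAdd 2))⁻¹)) := by
    intro i
    have := h0 (i.castAdd 2)
    rw [mul_pow, hnu]
    field_simp
    ring
  simp only [h4]
  rw [Finset.prod_mul_distrib, Finset.prod_const, Finset.card_univ, Fintype.card_fin]
  norm_num

end ten

section constants

variable {N : ℕ} {a : Fin 12 → ℤ} {s : List ℕ}

lemma EigenData.prod_cut (h : EigenData N a s) (hN : 0 < N) (ha : ∑ i, a i = 0) (h10 : a 10 = 0)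
    (h11 : a 11 = 0) (hlen : 4 ≤ s.length) {t : ℤ}
    (ht : t ^ 2 = 0 ^ (s.length - 4) * (s.map fun m : ℕ => (m : ℤ)).prod) :
    ∏ i, (1 - ex (1 / N) ^ (-cut a i)) = t ∨ ∏ i, (1 - ex (1 / N) ^ (-cut a i)) = -t := by
  have hζ := isPrimitiveRoot_ex hN dvd_rfl (prim_one N)
  rw [Int.cast_one] at hζ
  have hp := h.prod_X_sub hN hζ
  set ζ := ex (1 / N) with hζd
  have hζ0 : ζ ≠ 0 := ex_ne_zero _
  have h1 := prod_ten_sq (lam := fun i => ζ ^ a i) (nu := fun i => ex (a i / (2 * N)))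
    (fun m hm => (h.1 m hm).1) (by simpa only [zpow_neg] using hp)
    (fun i => by
      rw [hζd, ← ex_int_mul, ← ex_nat_mul]
      congr 1
      push_cast; field_simp) (by simp [h10]) (by simp [h11]) hlen
  have hcut1 := sum_cut ha h10 h11
  have h2 : ∏ i : Fin 10, ex ((a (i.castAdd 2) : ℂ) / (2 * N)) = 1 := by
    have := prod_ex_const 0 (1 / (2 * N : ℂ)) hcut1
    rw [mul_zero, ex_zero] at this
    rw [← this]
    refine Finset.prod_congr rfl fun i _ => ?_
    rw [cut]; ring_nf
  rw [Finset.prod_mul_distrib, h2, one_mul] at h1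
  refine sq_eq_sq_iff_eq_or_eq_neg.1 ?_
  have h3 : ((t : ℂ)) ^ 2 = 0 ^ (s.length - 4) * (s.map fun m : ℕ => (m : ℂ)).prod := by
    have h4 : (s.map fun m : ℕ => (m : ℂ)).prod = (((s.map fun m : ℕ => (m : ℤ)).prod : ℤ) : ℂ) := by
      rw [Int.cast_list_prod, List.map_map]
      simp [Function.comp_def]
    rw [h4]
    exact_mod_cast ht
  rw [h3, ← h1]
  congr 1
  exact Finset.prod_congr rfl fun i _ => by rw [zpow_neg]; rfl

/-- Only the square of the product is known from the cycle shape. The scalar r absorbs the unknown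
sign, so none has to be computed, and Galois invariance makes it independent of u. -/
lemma EigenData.exists_cut_const (h : EigenData N a s) (hN : 0 < N) (ha : ∑ i, a i = 0)
    (h10 : a 10 = 0) (h11 : a 11 = 0) (hlen : 4 ≤ s.length) {t : ℤ}
    (ht : t ^ 2 = 0 ^ (s.length - 4) * (s.map fun m : ℕ => (m : ℤ)).prod) {M : ℕ} (hNM : N ∣ M)
    (c : ℂ) (hc : t = 0 → c = 0) :
    ∃ r : ℂ, ∀ u : ℤ, Prim M 0 u → r * ∏ i, (1 - ex (u / N) ^ (-cut a i)) = c := by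
  rcases eq_or_ne t 0 with h0 | h0
  · exact ⟨0, fun u _ => by rw [hc h0, zero_mul]⟩
  obtain ⟨t', ht', h1⟩ : ∃ t' : ℤ, t' ≠ 0 ∧ ∏ i, (1 - ex (1 / N) ^ (-cut a i)) = t' := by
    rcases h.prod_cut hN ha h10 h11 hlen ht with h1 | h1
    · exact ⟨t, h0, h1⟩
    · exact ⟨-t, neg_ne_zero.2 h0, by rw [h1]; push_cast; rfl⟩
  refine ⟨c / t', fun u hu => ?_⟩
  have h2 := prod_zpow_const hN hNM (cut a) (-1) (r := t') (by simpa [← sub_eq_add_neg] using h1) hu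
  have h3 : ∏ i, (1 - ex (u / N) ^ (-cut a i)) = t' := by simpa [← sub_eq_add_neg] using h2
  have h4 : (t' : ℂ) ≠ 0 := by exact_mod_cast ht'
  rw [h3]; field_simp

end constants

/-! ### Two eta quotients as products of Klein forms -/

section quotients

lemma klein_cusp {N : ℕ} (hN : 0 < N) (u a : ℤ) {τ : ℂ} (hτ : 0 < τ.im) :
    klein (a * (0 : ℤ) / N + 0) (a * u / N + 0) τ =
      -Complex.I * (ex (u / (2 * N)) ^ a - ex (u / (2 * N)) ^ (-a)) *
        (poch (ex τ * ex (u / N) ^ a) (ex τ) * poch (ex τ * ex (u / N) ^ (-a)) (ex τ)) /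
          poch (ex τ) (ex τ) ^ 2 := by
  have hNc : (N : ℂ) ≠ 0 := by exact_mod_cast hN.ne'
  have e1 : ex (((a * u / N : ℚ) : ℂ) / 2) = ex (u / (2 * N)) ^ a := by
    rw [← ex_int_mul]; congr 1; push_cast; field_simp
  have e2 : ex (u / N) = ex (u / (2 * N)) ^ 2 := by
    rw [← ex_nat_mul]; congr 1; push_cast; field_simp
  have e4 : ex (u / N) ^ a = (ex (u / (2 * N)) ^ a) ^ 2 := by
    rw [e2, pow_two, pow_two, mul_zpow]
  rw [show (a : ℚ) * (0 : ℤ) / N + 0 = 0 by push_cast; ring, add_zero, klein_zero hτ,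
    ex_neg, ex_rat_div, zpow_neg, zpow_neg, e1, e4]
  set t := ex (u / (2 * N)) ^ a
  have ht : t ≠ 0 := zpow_ne_zero _ (ex_ne_zero _)
  field_simp

/-- A polynomial identity between cyclotomic products passes to infinite products by inserting X =
qⁿ⁺¹. -/
lemma prod_poch_mul {ι : Type*} [Fintype ι] {w : ι → ℂ} {A B : List ℕ} (hA : ∀ m ∈ A, 0 < m)
    (hB : ∀ m ∈ B, 0 < m)
    (h : ∀ X : ℂ, (∏ i, (1 - w i * X)) * (A.map fun m => 1 - X ^ m).prod =
      (B.map fun m => 1 - X ^ m).prod) {q : ℂ} (hq : ‖q‖ < 1) :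
    (∏ i, poch (q * w i) q) * pochProd A q q = pochProd B q q := by
  obtain ⟨h1, h2⟩ := list_prod_poch (w := q) hq A hA
  obtain ⟨h3, h4⟩ := list_prod_poch (w := q) hq B hB
  rw [pochProd, pochProd, ← h2, ← h4, prod_poch hq,
    ← (multipliable_prod fun i _ => multipliable_poch _ hq).tprod_mul h1]
  refine tprod_congr fun n => ?_
  rw [← h]
  congr 1
  exact Finset.prod_congr rfl fun i _ => by ring

lemma pochProd_cons (m : ℕ) (s : List ℕ) (w q : ℂ) :
    pochProd (m :: s) w q = poch (w ^ m) (q ^ m) * pochProd s w q := by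
  rw [pochProd, List.map_cons, List.prod_cons, pochProd]

lemma pochProd_nil (w q : ℂ) : pochProd [] w q = 1 := by simp [pochProd]

lemma poch_pow_ne_zero {q : ℂ} (hq : ‖q‖ < 1) {n : ℕ} (hn : n ≠ 0) : poch (q ^ n) (q ^ n) ≠ 0 :=
  poch_self_ne_zero (by rw [norm_pow]; exact pow_lt_one₀ (norm_nonneg _) hq hn)

/-- The family of the eta quotient `η(τ)³ η(2τ) η(5τ) / η(10τ)`. -/
def quotTen (c d : ℤ) (τ : ℂ) : ℂ := kprod ![1, 3] (fun _ => -1) 10 0 0 c d τ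

lemma kfamily_quotTen : KFamily 2 (10 * 2) quotTen := by
  have := kfamily_kprod (a := ![1, 3]) (e := fun _ => -1) (N := 10) (hh := 2) (ε := 0) (by norm_num)
    (by decide) (by decide) (by decide) (by decide)
  simp only [Nat.cast_zero, pow_zero, one_mul] at this
  exact this

/-- The two Klein forms run over the primitive tenth roots of unity. The expansion follows from
Φ₁₀(X) = (1-X)(1-X¹⁰)/((1-X²)(1-X⁵)), and the constant factor at the cusp is 1 by the relation
Φ₁₀(ζ) = 0. -/
lemma quotTen_zero {u : ℤ} (hu : Prim (10 * 2) 0 u) {τ : ℂ} (hτ : 0 < τ.im) :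
    quotTen 0 u τ * pochProd [10] (ex τ) (ex τ) = pochProd [1, 1, 1, 2, 5] (ex τ) (ex τ) := by
  have hζ := isPrimitiveRoot_ex (N := 10) (by norm_num) (Dvd.intro 2 rfl) hu
  have hq := norm_ex_lt_one hτ
  rw [quotTen, kprod, Fin.prod_univ_two]
  simp only [Matrix.cons_val_zero, Matrix.cons_val_one, zpow_neg_one]
  rw [klein_cusp (by norm_num) u 1 hτ, klein_cusp (by norm_num) u 3 hτ]
  set ξ := ex (u / (2 * (10 : ℕ))) with hξ
  have hξζ : ex (u / (10 : ℕ)) = ξ ^ 2 := by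
    rw [hξ, ← ex_nat_mul]; congr 1; push_cast; ring
  set ζ := ex (u / (10 : ℕ)) with hζd
  have hζ0 : ζ ≠ 0 := ex_ne_zero _
  have hξ0 : ξ ≠ 0 := ex_ne_zero _
  have h10 : ζ ^ 10 = 1 := hζ.pow_eq_one
  have h5 : ζ ^ 5 ≠ 1 := hζ.pow_ne_one_of_pos_of_lt (by norm_num) (by norm_num)
  have h2 : ζ ^ 2 ≠ 1 := hζ.pow_ne_one_of_pos_of_lt (by norm_num) (by norm_num)
  have h5' : ζ ^ 5 = -1 := by
    have : (ζ ^ 5 - 1) * (ζ ^ 5 + 1) = 0 := by linear_combination h10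
    rcases mul_eq_zero.1 this with h | h
    · exact absurd (sub_eq_zero.1 h) h5
    · linear_combination h
  have hΦ : ζ ^ 4 - ζ ^ 3 + ζ ^ 2 - ζ + 1 = 0 := by
    have : (ζ + 1) * (ζ ^ 4 - ζ ^ 3 + ζ ^ 2 - ζ + 1) = 0 := by linear_combination h5'
    rcases mul_eq_zero.1 this with h | h
    · exact absurd (by linear_combination (ζ - 1) * h) h2
    · exact h
  have hz1 : ζ ^ (-1 : ℤ) = -ζ ^ 4 := by
    rw [zpow_neg_one]
    exact (eq_inv_of_mul_eq_one_left (by linear_combination -h5')).symm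
  have hz3 : ζ ^ (-3 : ℤ) = -ζ ^ 2 := by
    rw [show (-3 : ℤ) = (-1) * 3 by norm_num, zpow_mul, hz1, zpow_ofNat]
    linear_combination (ζ ^ 7 - ζ ^ 2) * (-h5')
  have hconst : (ξ ^ (1 : ℤ) - ξ ^ (-1 : ℤ)) * (ξ ^ (3 : ℤ) - ξ ^ (-3 : ℤ)) = -1 := by
    have e1 : (ξ ^ (1 : ℤ) - ξ ^ (-1 : ℤ)) * (ξ ^ (3 : ℤ) - ξ ^ (-3 : ℤ)) =
        ζ ^ 2 - ζ - ζ ^ (-1 : ℤ) + (ζ ^ (-1 : ℤ)) ^ 2 := by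
      rw [hξζ, zpow_neg_one, zpow_neg_one, zpow_one, zpow_neg, zpow_ofNat]
      field_simp
      ring
    rw [e1, hz1]
    linear_combination hΦ + ζ ^ 3 * h5'
  have hpoly := prod_poch_mul (w := ![ζ ^ (1 : ℤ), ζ ^ (-1 : ℤ), ζ ^ (3 : ℤ), ζ ^ (-3 : ℤ)])
    (A := [2, 5]) (B := [1, 10]) (by simp) (by simp) (fun X => by
      rw [Fin.prod_univ_four]
      simp only [Matrix.cons_val_zero, Matrix.cons_val_one, Matrix.cons_val_two,
        Matrix.cons_val_three, Matrix.tail_cons, Matrix.head_cons, List.map_cons, List.map_nil,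
        List.prod_cons, List.prod_nil, hz1, hz3, zpow_ofNat]
      have h : (1 - ζ ^ 1 * X) * (1 - -ζ ^ 4 * X) * (1 - ζ ^ 3 * X) * (1 - -ζ ^ 2 * X) =
          1 - X + X ^ 2 - X ^ 3 + X ^ 4 := by
        have e1 : (1 - ζ * X) * (1 - -ζ ^ 4 * X) = 1 + (ζ ^ 4 - ζ) * X + X ^ 2 := by
          linear_combination (-X ^ 2) * h5'
        have e2 : (1 - ζ ^ 3 * X) * (1 - -ζ ^ 2 * X) = 1 + (ζ ^ 2 - ζ ^ 3) * X + X ^ 2 := by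
          linear_combination (-X ^ 2) * h5'
        have e3 : (ζ ^ 4 - ζ) * (ζ ^ 2 - ζ ^ 3) = -1 := by
          linear_combination hΦ + (ζ - ζ ^ 2) * h5'
        rw [pow_one, e1, mul_assoc, e2]
        linear_combination (X + X ^ 3) * hΦ + X ^ 2 * e3
      rw [h]
      ring) hq
  rw [Fin.prod_univ_four] at hpoly
  simp only [Matrix.cons_val_zero, Matrix.cons_val_one, Matrix.cons_val, pochProd_cons,
    pochProd_nil, mul_one, pow_one] at hpoly ⊢
  have p1 := poch_self_ne_zero hq
  have p2 := poch_pow_ne_zero hq (n := 2) (by norm_num)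
  have p5 := poch_pow_ne_zero hq (n := 5) (by norm_num)
  have p10 := poch_pow_ne_zero hq (n := 10) (by norm_num)
  generalize poch (ex τ * ζ ^ (1 : ℤ)) (ex τ) = A1 at *
  generalize poch (ex τ * ζ ^ (-1 : ℤ)) (ex τ) = A2 at *
  generalize poch (ex τ * ζ ^ (3 : ℤ)) (ex τ) = A3 at *
  generalize poch (ex τ * ζ ^ (-3 : ℤ)) (ex τ) = A4 at *
  generalize poch (ex τ) (ex τ) = P1 at *
  generalize poch (ex τ ^ 2) (ex τ ^ 2) = P2 at *
  generalize poch (ex τ ^ 5) (ex τ ^ 5) = P5 at *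
  generalize poch (ex τ ^ 10) (ex τ ^ 10) = P10 at *
  have hA : A1 * A2 * A3 * A4 ≠ 0 := by
    intro h
    rw [h, zero_mul] at hpoly
    exact mul_ne_zero p1 p10 hpoly.symm
  generalize (ξ ^ (1 : ℤ) - ξ ^ (-1 : ℤ)) = c1 at *
  generalize (ξ ^ (3 : ℤ) - ξ ^ (-3 : ℤ)) = c2 at *
  have hprod : -Complex.I * c1 * (A1 * A2) / P1 ^ 2 * (-Complex.I * c2 * (A3 * A4) / P1 ^ 2) =
      A1 * A2 * A3 * A4 / P1 ^ 4 := by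
    have := Complex.I_sq
    field_simp
    linear_combination (c1 * c2 * A1 * A2 * A3 * A4) * this - A1 * A2 * A3 * A4 * hconst
  rw [← mul_inv, hprod, inv_div, div_mul_eq_mul_div, div_eq_iff hA]
  linear_combination (-P1 ^ 3) * hpoly

/-- The family of the eta quotient
`η(τ)³ η(4τ)² η(6τ)³ / (η(2τ) η(3τ) η(12τ)²)`. -/
def quotTwelve (c d : ℤ) (τ : ℂ) : ℂ :=
  1 / 2 * kprod ![2, 6, 1, 5] ![1, 1, -2, -2] 12 0 0 c d τ

lemma kfamily_quotTwelve : KFamily 2 (12 * 2) quotTwelve := by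
  have := (kfamily_kprod (a := ![2, 6, 1, 5]) (e := ![1, 1, -2, -2]) (N := 12) (hh := 2) (ε := 0)
    (by norm_num) (by decide) (by decide) (by decide) (by decide)).const_mul (1 / 2)
  simp only [pow_zero, one_mul] at this
  exact this

/-- The inverted forms at 1 and 5 give the primitive twelfth roots; those at 2 and 6 give the
primitive sixth roots and -1, twice. The leading constants of the two pairs are 2 and 1, which
explains the factor 1/2 in `quotTwelve`. -/
lemma quotTwelve_zero {u : ℤ} (hu : Prim (12 * 2) 0 u) {τ : ℂ} (hτ : 0 < τ.im) :
    quotTwelve 0 u τ * pochProd [2, 3, 12, 12] (ex τ) (ex τ) =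
      pochProd [1, 1, 1, 4, 4, 6, 6, 6] (ex τ) (ex τ) := by
  have hζ := isPrimitiveRoot_ex (N := 12) (by norm_num) (Dvd.intro 2 rfl) hu
  have hq := norm_ex_lt_one hτ
  rw [quotTwelve, kprod, Fin.prod_univ_four]
  simp only [Matrix.cons_val_zero, Matrix.cons_val_one, Matrix.cons_val, zpow_one]
  rw [klein_cusp (by norm_num) u 2 hτ, klein_cusp (by norm_num) u 6 hτ,
    klein_cusp (by norm_num) u 1 hτ, klein_cusp (by norm_num) u 5 hτ]
  set ξ := ex (u / (2 * (12 : ℕ))) with hξ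
  have hξζ : ex (u / (12 : ℕ)) = ξ ^ 2 := by
    rw [hξ, ← ex_nat_mul]; congr 1; push_cast; ring
  set ζ := ex (u / (12 : ℕ)) with hζd
  have hζ0 : ζ ≠ 0 := ex_ne_zero _
  have hξ0 : ξ ≠ 0 := ex_ne_zero _
  have h12 : ζ ^ 12 = 1 := hζ.pow_eq_one
  have h6 : ζ ^ 6 ≠ 1 := hζ.pow_ne_one_of_pos_of_lt (by norm_num) (by norm_num)
  have h4 : ζ ^ 4 ≠ 1 := hζ.pow_ne_one_of_pos_of_lt (by norm_num) (by norm_num)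
  have h6' : ζ ^ 6 = -1 := by
    have : (ζ ^ 6 - 1) * (ζ ^ 6 + 1) = 0 := by linear_combination h12
    rcases mul_eq_zero.1 this with h | h
    · exact absurd (sub_eq_zero.1 h) h6
    · linear_combination h
  have hΦ : ζ ^ 4 - ζ ^ 2 + 1 = 0 := by
    have : (ζ ^ 2 + 1) * (ζ ^ 4 - ζ ^ 2 + 1) = 0 := by linear_combination h6'
    rcases mul_eq_zero.1 this with h | h
    · exact absurd (by linear_combination (ζ ^ 2 - 1) * h) h4
    · exact h
  have hz1 : ζ ^ (-1 : ℤ) = -ζ ^ 5 := by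
    rw [zpow_neg_one]
    exact (eq_inv_of_mul_eq_one_left (by linear_combination -h6')).symm
  have hz2 : ζ ^ (-2 : ℤ) = -ζ ^ 4 := by
    rw [show (-2 : ℤ) = (-1) * 2 by norm_num, zpow_mul, hz1, zpow_ofNat]
    linear_combination ζ ^ 4 * h6'
  have hz5 : ζ ^ (-5 : ℤ) = -ζ := by
    rw [zpow_neg, zpow_ofNat]
    exact (eq_inv_of_mul_eq_one_left (by linear_combination -h6')).symm
  have hz6 : ζ ^ (-6 : ℤ) = -1 := by
    rw [zpow_neg, zpow_ofNat, h6']; norm_num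
  have hξ24 : ξ ^ 12 = -1 := by rw [← h6', hξζ]; ring
  have hξi : ξ⁻¹ = -ξ ^ 11 := (eq_inv_of_mul_eq_one_left (by linear_combination -hξ24)).symm
  have hΦ' : ξ ^ 8 - ξ ^ 4 + 1 = 0 := by
    rw [← hΦ, hξζ]; ring
  have hconst1 : (ξ ^ (2 : ℤ) - ξ ^ (-2 : ℤ)) * (ξ ^ (6 : ℤ) - ξ ^ (-6 : ℤ)) = -2 := by
    have e1 : ξ ^ (-2 : ℤ) = -ξ ^ 10 := by
      rw [zpow_neg, zpow_ofNat]
      exact (eq_inv_of_mul_eq_one_left (by linear_combination -hξ24)).symm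
    have e2 : ξ ^ (-6 : ℤ) = -ξ ^ 6 := by
      rw [zpow_neg, zpow_ofNat]
      exact (eq_inv_of_mul_eq_one_left (by linear_combination -hξ24)).symm
    rw [e1, e2, zpow_ofNat, zpow_ofNat]
    linear_combination 2 * hΦ' + 2 * ξ ^ 4 * hξ24
  have hconst2 : (ξ ^ (1 : ℤ) - ξ ^ (-1 : ℤ)) * (ξ ^ (5 : ℤ) - ξ ^ (-5 : ℤ)) = -1 := by
    have e1 : ξ ^ (-1 : ℤ) = -ξ ^ 11 := by rw [zpow_neg_one, hξi]
    have e2 : ξ ^ (-5 : ℤ) = -ξ ^ 7 := by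
      rw [zpow_neg, zpow_ofNat]
      exact (eq_inv_of_mul_eq_one_left (by linear_combination -hξ24)).symm
    rw [e1, e2, zpow_ofNat, zpow_ofNat]
    linear_combination hΦ' + (ξ ^ 4 + ξ ^ 6) * hξ24
  have hpoly1 := prod_poch_mul (w := ![ζ ^ (2 : ℤ), ζ ^ (-2 : ℤ), ζ ^ (6 : ℤ), ζ ^ (-6 : ℤ)])
    (A := [1, 3]) (B := [2, 6]) (by simp) (by simp) (fun X => by
      rw [Fin.prod_univ_four]
      simp only [Matrix.cons_val_zero, Matrix.cons_val_one, Matrix.cons_val, List.map_cons,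
        List.map_nil, List.prod_cons, List.prod_nil, hz2, hz6, zpow_ofNat, h6']
      have e1 : (1 - ζ ^ 2 * X) * (1 - -ζ ^ 4 * X) = 1 - X + X ^ 2 := by
        linear_combination (-X ^ 2) * h6' + X * hΦ
      rw [e1]
      ring) hq
  have hpoly2 := prod_poch_mul (w := ![ζ ^ (1 : ℤ), ζ ^ (-1 : ℤ), ζ ^ (5 : ℤ), ζ ^ (-5 : ℤ)])
    (A := [4, 6]) (B := [2, 12]) (by simp) (by simp) (fun X => by
      rw [Fin.prod_univ_four]
      simp only [Matrix.cons_val_zero, Matrix.cons_val_one, Matrix.cons_val, List.map_cons,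
        List.map_nil, List.prod_cons, List.prod_nil, hz1, hz5, zpow_ofNat]
      have e1 : (1 - ζ ^ 1 * X) * (1 - -ζ ^ 5 * X) = 1 + (ζ ^ 5 - ζ) * X + X ^ 2 := by
        linear_combination (-X ^ 2) * h6'
      have e2 : (1 - ζ ^ 5 * X) * (1 - -ζ * X) = 1 - (ζ ^ 5 - ζ) * X + X ^ 2 := by
        linear_combination (-X ^ 2) * h6'
      have e3 : (ζ ^ 5 - ζ) ^ 2 = 3 := by
        linear_combination (ζ ^ 4 - 2) * h6' - hΦ
      rw [e1, mul_assoc (1 + (ζ ^ 5 - ζ) * X + X ^ 2), e2]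
      linear_combination (-X ^ 2 * ((1 - X ^ 4) * (1 - X ^ 6))) * e3) hq
  rw [Fin.prod_univ_four] at hpoly1 hpoly2
  simp only [Matrix.cons_val_zero, Matrix.cons_val_one, Matrix.cons_val, pochProd_cons,
    pochProd_nil, mul_one, pow_one] at hpoly1 hpoly2 ⊢
  have p1 := poch_self_ne_zero hq
  have p2 := poch_pow_ne_zero hq (n := 2) (by norm_num)
  have p3 := poch_pow_ne_zero hq (n := 3) (by norm_num)
  have p4 := poch_pow_ne_zero hq (n := 4) (by norm_num)
  have p6 := poch_pow_ne_zero hq (n := 6) (by norm_num)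
  have p12 := poch_pow_ne_zero hq (n := 12) (by norm_num)
  generalize poch (ex τ * ζ ^ (1 : ℤ)) (ex τ) = A1 at *
  generalize poch (ex τ * ζ ^ (-1 : ℤ)) (ex τ) = A2 at *
  generalize poch (ex τ * ζ ^ (5 : ℤ)) (ex τ) = A3 at *
  generalize poch (ex τ * ζ ^ (-5 : ℤ)) (ex τ) = A4 at *
  generalize poch (ex τ * ζ ^ (2 : ℤ)) (ex τ) = B1 at *
  generalize poch (ex τ * ζ ^ (-2 : ℤ)) (ex τ) = B2 at *
  generalize poch (ex τ * ζ ^ (6 : ℤ)) (ex τ) = B3 at *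
  generalize poch (ex τ * ζ ^ (-6 : ℤ)) (ex τ) = B4 at *
  generalize poch (ex τ) (ex τ) = P1 at *
  generalize poch (ex τ ^ 2) (ex τ ^ 2) = P2 at *
  generalize poch (ex τ ^ 3) (ex τ ^ 3) = P3 at *
  generalize poch (ex τ ^ 4) (ex τ ^ 4) = P4 at *
  generalize poch (ex τ ^ 6) (ex τ ^ 6) = P6 at *
  generalize poch (ex τ ^ 12) (ex τ ^ 12) = P12 at *
  generalize (ξ ^ (2 : ℤ) - ξ ^ (-2 : ℤ)) = c1 at *
  generalize (ξ ^ (6 : ℤ) - ξ ^ (-6 : ℤ)) = c2 at *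
  generalize (ξ ^ (1 : ℤ) - ξ ^ (-1 : ℤ)) = d1 at *
  generalize (ξ ^ (5 : ℤ) - ξ ^ (-5 : ℤ)) = d2 at *
  have hI := Complex.I_sq
  have hprod1 : -Complex.I * c1 * (B1 * B2) / P1 ^ 2 * (-Complex.I * c2 * (B3 * B4) / P1 ^ 2) =
      2 * (P2 * P6 / (P1 * P3)) / P1 ^ 4 := by
    rw [← hpoly1]
    field_simp
    linear_combination (B1 * B2 * B3 * B4) * ((c1 * c2) * hI - hconst1)
  have hprod2 : -Complex.I * d1 * (A1 * A2) / P1 ^ 2 * (-Complex.I * d2 * (A3 * A4) / P1 ^ 2) =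
      P2 * P12 / (P4 * P6) / P1 ^ 4 := by
    rw [← hpoly2]
    field_simp
    linear_combination (A1 * A2 * A3 * A4) * ((d1 * d2) * hI - hconst2)
  rw [hprod1, mul_assoc (2 * (P2 * P6 / (P1 * P3)) / P1 ^ 4), ← mul_zpow, hprod2,
    show (-2 : ℤ) = -((2 : ℕ) : ℤ) by norm_num, zpow_neg, zpow_natCast]
  field_simp

end quotients

end Mathieu

namespace Mathieu

open Filter Topology

/-! ### The identities for the cycle shapes -/

/-- Numerical data attached to a cycle shape `s`: exponents `a` of the eigenvalues as powers of a
primitive `N`th root of unity, the level `N * hh`, the constants `C` and `-t` of the Jacobi form,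
and the weight two form, which is `den⁻¹` times the sum of the `c Λ_n` for `(c, n)` in `lams` and
of `δF` times the eta product of `s`, plus `cX` times an eta quotient given by `num` and `dn`. -/
structure ShapeData where
  N : ℕ
  hh : ℕ
  a : Fin 12 → ℤ
  s : List ℕ
  C : ℤ
  t : ℤ
  den : ℤ
  δF : ℤ
  cX : ℤ
  lams : List (ℤ × ℕ)
  num : List ℕ
  dn : List ℕ
  m : ℕ

instance (N : ℕ) (a : Fin 12 → ℤ) (s : List ℕ) : Decidable (EigenData N a s) := by
  unfold EigenData; infer_instance

/-- The conditions under which the identities of the cycle shape follow from the expansions. -/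
def ShapeData.Valid (d : ShapeData) : Prop :=
  (EigenData d.N d.a d.s ∧ 0 < d.N ∧ 0 < d.hh ∧ ∑ i, d.a i = 0 ∧ d.a 10 = 0 ∧ d.a 11 = 0) ∧
  ((2 * d.N : ℤ) ∣ d.hh * ∑ i, d.a i ^ 2) ∧
  d.C ^ 2 = (d.s.map fun m => 1 - (-1 : ℤ) ^ m).prod ∧
  (d.C = 0 ∨ 0 < d.C ∧ ∀ i, |2 * d.a i| < d.N) ∧
  (d.den ≠ 0 ∧ 4 ≤ d.s.length ∧ 0 ≤ d.t ∧
    d.t ^ 2 = 0 ^ (d.s.length - 4) * (d.s.map fun m : ℕ => (m : ℤ)).prod ∧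
    (d.t = 0 → d.δF = 0)) ∧
  ((∀ p ∈ d.lams, 0 < p.2 ∧ p.2 ∣ d.N * d.hh) ∧ (∀ m ∈ d.num, 0 < m) ∧ ∀ m ∈ d.dn, 0 < m) ∧
  closedList (d.N * d.hh) (primList (d.N * d.hh)) = true ∧
  (primList (d.N * d.hh)).length * 16 < 12 * (d.m + 1) ∧
  checkZero (d.m + 1) d.s d.C (d.s.count 1) = true ∧
  checkTwo (d.m + 1) d.s d.C d.den (-d.den * d.t - 2 * d.δF) d.cX d.lams d.num d.dn = true

instance (d : ShapeData) : Decidable d.Valid := by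
  unfold ShapeData.Valid; infer_instance

/-- The eta quotient of the data is the value at `(0, 1)` of a family of weight two. -/
def ShapeData.HasQuot (d : ShapeData) : Prop :=
  d.cX = 0 ∨ ∃ X : ℤ → ℤ → ℂ → ℂ, KFamily 2 (d.N * d.hh) X ∧
    ∀ u : ℤ, Prim (d.N * d.hh) 0 u → ∀ τ : ℂ, 0 < τ.im →
      X 0 u τ * pochProd d.dn (ex τ) (ex τ) = pochProd d.num (ex τ) (ex τ)

/-- The weight two form of the data. -/
def ShapeData.form (d : ShapeData) (τ : ℂ) : ℂ :=
  (lamSum d.lams τ + d.δF * (ex τ * pochProd d.s (ex τ) (ex τ))) / d.den +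
    d.cX * (pochProd d.num (ex τ) (ex τ) / pochProd d.dn (ex τ) (ex τ))

/-- The coefficient of the Weierstrass function in the main identity: up to the factor -1/2 and a
power of x, the first three terms are the coefficients of the theta quotients in φ_g. -/
theorem ShapeData.weight_zero {d : ShapeData} (hd : d.Valid) {τ : ℂ} (hτ : 0 < τ.im) :
    pochProd d.s (ex (τ / 2)) (ex τ) - pochProd d.s (-ex (τ / 2)) (ex τ) +
      d.C * (ex (τ / 2) * (ex τ * pochProd d.s (-ex τ) (ex τ))) +
      2 * (d.s.count 1 : ℕ) * ex (τ / 2) = 0 := by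
  obtain ⟨⟨h1, h2, h3, h4, h5, h6⟩, h7, h8, h9, -, -, h10, h11, h12, -⟩ := hd
  have := combZero_eq_zero (m := d.m) h1 h2 h3 h4 h7 (h1.prod_one_add h2 h4 h8 h9) h10
    (by omega) h12 hτ
  rw [combZero, ← ex_eq_half_sq] at this
  rw [← this]
  push_cast
  linear_combination (d.C * ex (τ / 2) * pochProd d.s (-ex τ) (ex τ)) * ex_eq_half_sq τ

/-- The constant term of the main identity, with t = -D_g. The summand -den·t - 2δF in the check
collects both occurrences of η_g, the one from φ_g and the one from F_g. -/
theorem ShapeData.weight_two {d : ShapeData} (hd : d.Valid) (hX : d.HasQuot) {τ : ℂ}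
    (hτ : 0 < τ.im) :
    pochProd d.s (ex (τ / 2)) (ex τ) * etq (1 / 2) 0 τ -
      pochProd d.s (-ex (τ / 2)) (ex τ) * etq (1 / 2) (1 / 2) τ +
      d.C * (ex (τ / 2) * (ex τ * pochProd d.s (-ex τ) (ex τ))) * etq 0 (1 / 2) τ -
      d.t * (ex (τ / 2) * (ex τ * pochProd d.s (ex τ) (ex τ))) =
    2 * ex (τ / 2) * d.form τ := by
  obtain ⟨⟨h1, h2, h3, h4, h5, h6⟩, h7, h8, h9, ⟨hden, hlen, -, ht, ht0⟩, ⟨hl, hnum, hdn⟩, h10, h11,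
    -, hck⟩ := hd
  obtain ⟨r, hr⟩ := h1.exists_cut_const h2 h4 h5 h6 hlen ht (M := d.N * d.hh) (Dvd.intro _ rfl)
    (-(((-d.den * d.t - 2 * d.δF : ℤ) : ℂ) / d.den)) (fun h => by rw [h, ht0 h]; simp)
  obtain ⟨X, hX1, hX2⟩ : ∃ X : ℤ → ℤ → ℂ → ℂ, KFamily 2 (d.N * d.hh) X ∧
      ∀ u : ℤ, Prim (d.N * d.hh) 0 u → ∀ τ : ℂ, 0 < τ.im →
        d.cX * (X 0 u τ * pochProd d.dn (ex τ) (ex τ)) = d.cX * pochProd d.num (ex τ) (ex τ) := by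
    rcases hX with h | ⟨X, hX, hX'⟩
    · exact ⟨_, kfamily_eisSum one_pos (one_dvd _), fun u _ τ _ => by simp [h]⟩
    · exact ⟨X, hX, fun u hu τ hτ => by rw [hX' u hu τ hτ]⟩
  have h := combTwo_eq_zero h1 h2 h3 h4 h5 h6 h7 (h1.prod_one_add h2 h4 h8 h9) hden hr hX1 hX2
    hl hnum hdn h10 h11 hck hτ
  have hden' : (d.den : ℂ) ≠ 0 := by exact_mod_cast hden
  have hdn0 := pochProd_ne_zero hdn (norm_ex_lt_one hτ)
  rw [combTwo, halfE_one hτ, halfE_neg_one hτ, halfE_neg_two hτ,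
    ← lamSum_eq (fun p hp => (hl p hp).1) hτ,
    show ex (τ / 2) ^ 3 = ex (τ / 2) * ex (τ / 2) ^ 2 by ring, ← ex_eq_half_sq] at h
  have h12 : (12 * d.den * pochProd d.dn (ex τ) (ex τ) : ℂ) ≠ 0 := by
    simp [hden', hdn0]
  refine mul_left_cancel₀ h12 ?_
  have e : d.den * pochProd d.dn (ex τ) (ex τ) * d.form τ = pochProd d.dn (ex τ) (ex τ) *
      (lamSum d.lams τ + d.δF * (ex τ * pochProd d.s (ex τ) (ex τ))) +
      d.den * d.cX * pochProd d.num (ex τ) (ex τ) := by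
    rw [ShapeData.form]; field_simp
  push_cast at h
  linear_combination h - 24 * ex (τ / 2) * e

end Mathieu

/-! ### The fifteen cycle shapes -/

namespace Mathieu

open Filter Topology

/-- The signs of the exponents are chosen so that they sum to zero as integers, and with |2a| < N
when C is nonzero. The last entry m is the least one allowed by the bound for weight two. The factor
`hh` is 2 for 2B, 4A, 10A and 12A. -/
def data1A : ShapeData := ⟨1, 1, 0, List.replicate 24 1, 4096, 0, 1, 0, 0, [], [], [], 1⟩
def data2A : ShapeData := ⟨2, 1, ![1, -1, 1, -1, 0, 0, 0, 0, 0, 0, 0, 0],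
  List.replicate 8 1 ++ List.replicate 8 2, 0, 0, 1, 0, 0, [(16, 2)], [], [], 4⟩
def data2B : ShapeData := ⟨2, 2, ![1, -1, 1, -1, 1, -1, 0, 0, 0, 0, 0, 0],
  List.replicate 12 2, 0, 0, 1, 0, 0, [(-24, 2), (8, 4)], [], [], 8⟩
def data3A : ShapeData := ⟨3, 1, ![1, -1, 1, -1, 1, -1, 0, 0, 0, 0, 0, 0],
  List.replicate 6 1 ++ List.replicate 6 3, 64, 0, 1, 0, 0, [(6, 3)], [], [], 5⟩
def data4A : ShapeData := ⟨4, 2, ![1, -1, 1, -1, 2, -2, 2, -2, 0, 0, 0, 0],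
  [2, 2, 2, 2, 4, 4, 4, 4], 0, 0, 1, 0, 0, [(4, 2), (-6, 4), (2, 8)], [], [], 16⟩
def data4B : ShapeData := ⟨4, 1, ![1, 1, 1, -1, 2, -2, -2, 0, 0, 0, 0, 0],
  [1, 1, 1, 1, 2, 2, 4, 4, 4, 4], 0, 0, 1, 0, 0, [(4, 4), (-4, 2)], [], [], 8⟩
def data5A : ShapeData := ⟨5, 1, ![1, -1, 1, -1, 2, -2, 2, -2, 0, 0, 0, 0],
  [1, 1, 1, 1, 5, 5, 5, 5], 16, 0, 1, 0, 0, [(2, 5)], [], [], 8⟩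
def data6A : ShapeData := ⟨6, 1, ![1, -1, 2, -2, 2, -2, 3, -3, 0, 0, 0, 0],
  [1, 1, 2, 2, 3, 3, 6, 6], 0, 0, 1, 0, 0, [(-2, 2), (-2, 3), (2, 6)], [], [], 16⟩
def data7A : ShapeData := ⟨7, 1, ![1, 2, -3, 1, 2, -3, 1, 2, -3, 0, 0, 0],
  [1, 1, 1, 7, 7, 7], 8, 0, 1, 0, 0, [(1, 7)], [], [], 10⟩
def data8A : ShapeData := ⟨8, 1, ![2, 2, 2, -3, -3, 1, -1, 4, -4, 0, 0, 0],
  [1, 1, 2, 4, 8, 8], 0, 0, 1, 0, 0, [(-1, 4), (1, 8)], [], [], 16⟩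
def data10A : ShapeData := ⟨10, 2, ![1, -1, 2, -2, 3, -3, 4, -4, 5, -5, 0, 0],
  [2, 2, 10, 10], 0, 20, 1, 0, 2, [], [1, 1, 1, 2, 5], [10], 48⟩
def data11A : ShapeData := ⟨11, 1, ![1, -1, 2, -2, 3, -3, 4, -4, 5, -5, 0, 0],
  [1, 1, 11, 11], 4, 11, 5, -22, 0, [(2, 11)], [], [], 16⟩
def data12A : ShapeData := ⟨12, 2, ![1, 5, -6, 2, 4, -6, 2, -3, -3, 4, 0, 0],
  [2, 4, 6, 12], 0, 24, 1, 0, 2, [], [1, 1, 1, 4, 4, 6, 6, 6], [2, 3, 12, 12], 64⟩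
def data14A : ShapeData := ⟨14, 1, ![1, 2, 3, 4, 4, 6, -7, -6, -5, -2, 0, 0],
  [1, 2, 7, 14], 0, 14, 3, -14, 0, [(-1, 2), (-1, 7), (1, 14)], [], [], 32⟩
def data15A : ShapeData := ⟨15, 1, ![1, 2, 4, 3, 6, 5, -7, -6, -5, -3, 0, 0],
  [1, 3, 5, 15], 4, 15, 4, -15, 0, [(-1, 3), (-1, 5), (1, 15)], [], [], 32⟩

lemma data1A_valid : data1A.Valid := by decide +kernel
lemma data2A_valid : data2A.Valid := by decide +kernel
lemma data2B_valid : data2B.Valid := by decide +kernel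
lemma data3A_valid : data3A.Valid := by decide +kernel
lemma data4A_valid : data4A.Valid := by decide +kernel
lemma data4B_valid : data4B.Valid := by decide +kernel
lemma data5A_valid : data5A.Valid := by decide +kernel
lemma data6A_valid : data6A.Valid := by decide +kernel
lemma data7A_valid : data7A.Valid := by decide +kernel
lemma data8A_valid : data8A.Valid := by decide +kernel
lemma data10A_valid : data10A.Valid := by decide +kernel
lemma data11A_valid : data11A.Valid := by decide +kernel
lemma data12A_valid : data12A.Valid := by decide +kernel
lemma data14A_valid : data14A.Valid := by decide +kernel
lemma data15A_valid : data15A.Valid := by decide +kernel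

end Mathieu

namespace Mathieu

/-! ### The Golay code in terms of bit masks -/

/-- The number of a letter. -/
def enc : Letter → ℕ
  | none => 23
  | some x => x.val

/-- The letter with a given number. -/
def dec (n : ℕ) : Letter := if n < 23 then some n else none

lemma enc_lt (x : Letter) : enc x < 24 := by
  cases x with
  | none => decide
  | some x => exact (ZMod.val_lt x).trans (by norm_num)

lemma dec_enc (x : Letter) : dec (enc x) = x := by
  cases x with
  | none => rfl
  | some x =>
    have h : x.val < 23 := ZMod.val_lt x
    simp [enc, dec, h]

lemma enc_injective : Function.Injective enc := Function.LeftInverse.injective dec_enc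

lemma enc_dec {n : ℕ} (hn : n < 24) : enc (dec n) = n := by
  unfold dec
  split_ifs with h
  · exact ZMod.val_cast_of_lt h
  · simp only [enc]; omega

/-- The word whose support is given by the binary digits of a number. -/
def word (n : ℕ) (x : Letter) : ZMod 2 := if n.testBit (enc x) then 1 else 0

lemma word_zero : word 0 = 0 := by
  funext x; simp [word]

lemma word_xor (m n : ℕ) : word (m ^^^ n) = word m + word n := by
  funext x
  simp only [word, Nat.testBit_xor, Pi.add_apply]
  cases m.testBit (enc x) <;> cases n.testBit (enc x) <;> decide

/-- The mask of `golayWord a`. -/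
def golayMask (a : ℕ) : ℕ :=
  (List.range 24).foldr (fun i n => if golayWord a (dec i) = 1 then n ||| 2 ^ i else n) 0

/-- Reduction of a mask by the masks in a list in echelon form. -/
def reduce : List ℕ → ℕ → ℕ
  | [], n => n
  | r :: R, n => reduce R (if n ^^^ r < n then n ^^^ r else n)

/-- The list of all sums of the masks in a list. -/
def sums : List ℕ → List ℕ
  | [] => [0]
  | r :: R => sums R ++ (sums R).map (r ^^^ ·)

lemma zero_mem_sums (R : List ℕ) : 0 ∈ sums R := by
  induction R with
  | nil => simp [sums]
  | cons r R ih => simp [sums, ih]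

lemma xor_mem_sums {R : List ℕ} {m n : ℕ} (hm : m ∈ sums R) (hn : n ∈ sums R) :
    m ^^^ n ∈ sums R := by
  induction R generalizing m n with
  | nil => simp_all [sums]
  | cons r R ih =>
    simp only [sums, List.mem_append, List.mem_map] at hm hn ⊢
    rcases hm with hm | ⟨m, hm, rfl⟩ <;> rcases hn with hn | ⟨n, hn, rfl⟩
    · exact Or.inl (ih hm hn)
    · exact Or.inr ⟨m ^^^ n, ih hm hn, by rw [← Nat.xor_assoc, ← Nat.xor_assoc, Nat.xor_comm r]⟩
    · exact Or.inr ⟨m ^^^ n, ih hm hn, by rw [Nat.xor_assoc]⟩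
    · refine Or.inl ?_
      rw [Nat.xor_comm r n, Nat.xor_assoc, ← Nat.xor_assoc m n r, Nat.xor_comm _ r,
        ← Nat.xor_assoc, Nat.xor_self, Nat.zero_xor]
      exact ih hm hn

lemma mem_sums_of_reduce {R : List ℕ} {n : ℕ} (h : reduce R n = 0) : n ∈ sums R := by
  induction R generalizing n with
  | nil => simpa [sums, reduce] using h
  | cons r R ih =>
    rw [reduce] at h
    simp only [sums, List.mem_append, List.mem_map]
    split_ifs at h with h1
    · refine Or.inr ⟨n ^^^ r, ih h, ?_⟩
      rw [Nat.xor_comm n r, ← Nat.xor_assoc, Nat.xor_self, Nat.zero_xor]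
    · exact Or.inl (ih h)

/-- The masks of the words that span the Golay code. -/
def golayMasks : List ℕ := [16436384, 16095553, 15413891, 14050567, 11323919, 14259230, 11741245,
  15093882, 13410549, 10043883, 11699158, 15009708, 13242201, 9707187, 11025766, 13662924, 10548633,
  12708658, 8640101, 8891594, 9394580, 10400552, 12412496]

/-- An echelon basis of the Golay code. -/
def golayBasis : List ℕ := [16436384, 1005025, 1179171, 2358342, 4716684, 42232, 84464, 145176,
  290352, 15777, 18147, 5279]

lemma golayMasks_eq : (List.range 23).map golayMask = golayMasks := by decide +kernel

lemma golayBasis_eq : golayMasks.foldl (fun R a => let n := reduce R a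
    if n = 0 then R else R ++ [n]) [] = golayBasis := by decide +kernel

lemma testBit_mask (f : ℕ → Prop) [DecidablePred f] (l : List ℕ) (i : ℕ) :
    (l.foldr (fun i n => if f i then n ||| 2 ^ i else n) 0).testBit i =
      decide (i ∈ l ∧ f i) := by
  induction l with
  | nil => simp
  | cons j l ih =>
    rw [List.foldr_cons]
    split_ifs with h
    · rw [Nat.testBit_or, ih, Nat.testBit_two_pow]
      by_cases hij : j = i
      · subst hij; simp [h]
      · simp [hij, Ne.symm hij]
    · rw [ih]
      by_cases hij : i = j
      · subst hij; simp [h]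
      · simp [hij]

lemma word_golayMask (a : ℕ) : word (golayMask a) = golayWord a := by
  funext x
  rw [word, golayMask, testBit_mask fun i => golayWord (a : ZMod 23) (dec i) = 1, dec_enc]
  have h : golayWord (a : ZMod 23) x = 0 ∨ golayWord (a : ZMod 23) x = 1 := by
    cases x with
    | none => exact Or.inr rfl
    | some x => simp only [golayWord]; split_ifs <;> simp
  have h2 := enc_lt x
  rcases h with h | h <;> simp [h, h2]

lemma golayMask_mem (a : ℕ) : word (golayMask a) ∈ golayCode := by
  rw [word_golayMask]
  exact Submodule.subset_span ⟨_, rfl⟩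

lemma mem_of_mem_golayMasks : ∀ n ∈ golayMasks, word n ∈ golayCode := by
  intro n hn
  rw [← golayMasks_eq] at hn
  obtain ⟨a, -, rfl⟩ := List.mem_map.1 hn
  exact golayMask_mem a

lemma golayWord_eq (a : ZMod 23) : ∃ n ∈ golayMasks, golayWord a = word n := by
  refine ⟨golayMask a.val, ?_, by rw [word_golayMask, ZMod.natCast_zmod_val]⟩
  rw [← golayMasks_eq]
  exact List.mem_map.2 ⟨_, List.mem_range.2 (ZMod.val_lt a), rfl⟩

lemma word_reduce_mem {R : List ℕ} (hR : ∀ r ∈ R, word r ∈ golayCode) {n : ℕ} :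
    word (reduce R n) ∈ golayCode ↔ word n ∈ golayCode := by
  induction R generalizing n with
  | nil => rfl
  | cons r R ih =>
    rw [reduce, ih fun s hs => hR s (List.mem_cons_of_mem _ hs)]
    split_ifs
    · rw [word_xor]
      exact Submodule.add_mem_iff_left _ (hR r List.mem_cons_self)
    · rfl

lemma golayBasis_mem : ∀ r ∈ golayBasis, word r ∈ golayCode := by
  rw [← golayBasis_eq]
  have hl := mem_of_mem_golayMasks
  generalize golayMasks = l at hl
  have key : ∀ R : List ℕ, (∀ r ∈ R, word r ∈ golayCode) → ∀ r ∈ l.foldl (fun R a =>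
      let n := reduce R a; if n = 0 then R else R ++ [n]) R, word r ∈ golayCode := by
    induction l with
    | nil => simp
    | cons a l ih =>
      intro R hR
      rw [List.foldl_cons]
      refine ih (fun n hn => hl n (List.mem_cons_of_mem _ hn)) _ ?_
      intro r hr
      dsimp only at hr
      split_ifs at hr
      · exact hR r hr
      · rcases List.mem_append.1 hr with hr | hr
        · exact hR r hr
        · rw [List.mem_singleton.1 hr]
          exact (word_reduce_mem hR).2 (hl a List.mem_cons_self)
  exact key [] (by simp)

lemma word_mem_of_reduce {n : ℕ} (h : reduce golayBasis n = 0) : word n ∈ golayCode := by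
  rw [← word_reduce_mem golayBasis_mem, h, word_zero]
  exact golayCode.zero_mem

lemma reduce_golayMasks : (golayMasks.all fun n => reduce golayBasis n == 0) = true := by
  decide +kernel

/-- The spanning words reduce to zero against the twelve basis masks, so the code is contained in
the explicit list of their 2¹² sums. -/
lemma exists_mem_sums {c : Letter → ZMod 2} (hc : c ∈ golayCode) :
    ∃ n ∈ sums golayBasis, c = word n := by
  induction hc using Submodule.span_induction with
  | mem c h =>
    obtain ⟨a, rfl⟩ := h
    obtain ⟨n, hn, h⟩ := golayWord_eq a
    have := List.all_eq_true.1 reduce_golayMasks n hn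
    exact ⟨n, mem_sums_of_reduce (by simpa using this), h⟩
  | zero => exact ⟨0, zero_mem_sums _, word_zero.symm⟩
  | add c d _ _ hc hd =>
    obtain ⟨m, hm, rfl⟩ := hc
    obtain ⟨n, hn, rfl⟩ := hd
    exact ⟨m ^^^ n, xor_mem_sums hm hn, (word_xor m n).symm⟩
  | smul t c _ hc =>
    obtain ⟨m, hm, rfl⟩ := hc
    have ht : t = 0 ∨ t = 1 := by revert t; decide
    rcases ht with rfl | rfl
    · exact ⟨0, zero_mem_sums _, by rw [word_zero, zero_smul]⟩
    · exact ⟨m, hm, one_smul _ _⟩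

/-- The numbers of binary digits `1` of the numbers below `256`, as digits in base `16`. -/
def weightTable : ℕ :=
  0x8776766576656554766565546554544376656554655454436554544354434332766565546554544365545443544343326554544354434332544343324332322176656554655454436554544354434332655454435443433254434332433232216554544354434332544343324332322154434332433232214332322132212110

/-- The number of binary digits `1` of a number below `2 ^ 24`. -/
def weight (n : ℕ) : ℕ :=
  weightTable / 16 ^ (n % 256) % 16 + weightTable / 16 ^ (n / 256 % 256) % 16 +
    weightTable / 16 ^ (n / 65536 % 256) % 16

lemma weightTable_eq : ∀ k < 256,
    weightTable / 16 ^ k % 16 = ((List.range 8).filter k.testBit).length := by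
  decide +kernel

lemma weight_eq_length (n : ℕ) : weight n = ((List.range 24).filter n.testBit).length := by
  have h1 : List.range 24 = List.range 8 ++ (List.range 8).map (8 + ·) ++
      (List.range 8).map (16 + ·) := by decide
  have h2 : ∀ k i, i ∈ List.range 8 → (n / 2 ^ k % 256).testBit i = n.testBit (k + i) := by
    intro k i hi
    rw [show 256 = 2 ^ 8 by norm_num, Nat.testBit_mod_two_pow, Nat.testBit_div_two_pow, add_comm i]
    simp [List.mem_range.1 hi]
  have h3 : ∀ k, weightTable / 16 ^ (n / 2 ^ k % 256) % 16 =
      (((List.range 8).map (k + ·)).filter n.testBit).length := by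
    intro k
    rw [weightTable_eq _ (Nat.mod_lt _ (by norm_num)), List.filter_map, List.length_map]
    congr 1
    exact List.filter_congr fun i hi => h2 k i hi
  have h4 := h3 0
  simp only [pow_zero, Nat.div_one, zero_add, List.map_id'] at h4
  rw [weight, h4, show 256 = 2 ^ 8 by norm_num, show 65536 = 2 ^ 16 by norm_num, h1,
    List.filter_append, List.filter_append, List.length_append, List.length_append, ← h3, ← h3]
  norm_num

lemma weight_eq (n : ℕ) : weight n = (Finset.univ.filter fun x => word n x ≠ 0).card := by
  have h1 : weight n = ((Finset.range 24).filter fun i => n.testBit i).card := by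
    rw [weight_eq_length, Finset.card_def, Finset.filter_val, Finset.range_val, Multiset.range,
      Multiset.filter_coe, Multiset.coe_card]
    simp
  rw [h1]
  symm
  refine Finset.card_bij (fun x _ => enc x) ?_ (fun _ _ _ _ h => enc_injective h) ?_
  · intro x hx
    simp only [word] at hx
    simp only [Finset.mem_filter, Finset.mem_range, enc_lt, true_and]
    by_contra h
    simp [h] at hx
  · intro i hi
    simp only [Finset.mem_filter, Finset.mem_range] at hi
    refine ⟨dec i, ?_, enc_dec hi.1⟩
    simp [word, enc_dec hi.1, hi.2]

lemma sums_weight : ((sums golayBasis).all fun n => n == 0 || decide (8 ≤ weight n)) = true := by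
  decide +kernel

/-- The Golay code has minimum distance eight. -/
lemma eight_le_of_mem {c : Letter → ZMod 2} (hc : c ∈ golayCode) (h0 : c ≠ 0) :
    8 ≤ (Finset.univ.filter fun x => c x ≠ 0).card := by
  obtain ⟨n, hn, rfl⟩ := exists_mem_sums hc
  have h := List.all_eq_true.1 sums_weight n hn
  simp only [Bool.or_eq_true, beq_iff_eq, decide_eq_true_eq] at h
  rcases h with rfl | h
  · exact absurd word_zero h0
  · rwa [← weight_eq]

/-- An element of `M₂₄` that fixes five points of an octad preserves the octad. -/
lemma fix_octad {h : Equiv.Perm Letter} (hh : h ∈ M24) {w : Letter → ZMod 2} (hw : w ∈ golayCode)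
    (h8 : (Finset.univ.filter fun x => w x ≠ 0).card = 8) {S : Finset Letter}
    (hS : ∀ x ∈ S, w x ≠ 0 ∧ h x = x) (h5 : 5 ≤ S.card) (x : Letter) : w (h x) = w x := by
  classical
  have hsum : w ∘ h + w ∈ golayCode := golayCode.add_mem ((hh w).2 hw) hw
  by_contra hne
  have h0 : w ∘ h + w ≠ 0 := by
    intro h0
    have h1 := congrFun h0 x
    simp only [Pi.add_apply, Function.comp_apply, Pi.zero_apply] at h1
    apply hne
    generalize w (h x) = a at h1 ⊢
    generalize w x = b at h1 ⊢
    revert a b; decide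
  have h1 := eight_le_of_mem hsum h0
  set A := Finset.univ.filter fun x => w x ≠ 0 with hA
  set B := Finset.univ.filter fun x => w (h x) ≠ 0 with hB
  have hBc : B.card = 8 := by
    rw [← h8]
    refine Finset.card_bij (fun x _ => h x) (fun x hx => by simpa [hA, hB] using hx)
      (fun _ _ _ _ e => h.injective e) fun y hy => ⟨h.symm y, by simpa [hA, hB] using hy, by simp⟩
  -- The octad and its preimage share the five fixed letters, so they differ in at most 3 + 3
  -- letters, fewer than the minimum distance eight.
  have hsub : (Finset.univ.filter fun x => (w ∘ h + w) x ≠ 0) ⊆ (A \ S) ∪ (B \ S) := by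
    intro y hy
    simp only [Finset.mem_filter, Finset.mem_univ, true_and, Pi.add_apply,
      Function.comp_apply] at hy
    have hyS : y ∉ S := fun hyS => hy (by
      rw [(hS y hyS).2]
      generalize w y = b
      revert b; decide)
    simp only [hA, hB, Finset.mem_union, Finset.mem_sdiff, Finset.mem_filter, Finset.mem_univ,
      true_and]
    by_contra hcon
    push Not at hcon
    have e1 : w y = 0 := by
      by_contra e; exact hyS (hcon.1 e)
    have e2 : w (h y) = 0 := by
      by_contra e; exact hyS (hcon.2 e)
    exact hy (by rw [e1, e2, add_zero])
  have h2 := (Finset.card_le_card hsub).trans (Finset.card_union_le _ _)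
  have hSA : S ⊆ A := fun y hy => by simp [hA, (hS y hy).1]
  have hSB : S ⊆ B := fun y hy => by simp [hB, (hS y hy).2, (hS y hy).1]
  rw [Finset.card_sdiff_of_subset hSA, Finset.card_sdiff_of_subset hSB, h8, hBc] at h2
  omega

end Mathieu

namespace Mathieu

/-! ### Permutations as tables -/

/-- The list `l` is the table of values of the permutation `g`. -/
def Rep (l : List ℕ) (g : Equiv.Perm Letter) : Prop :=
  l.length = 24 ∧ ∀ x, enc (g x) = l.getD (enc x) 0

/-- Composition of tables. -/
def compTab (l m : List ℕ) : List ℕ := m.map fun i => l.getD i 0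

lemma Rep.comp {l m : List ℕ} {g h : Equiv.Perm Letter} (hl : Rep l g) (hm : Rep m h) :
    Rep (compTab l m) (g * h) := by
  refine ⟨by simp [compTab, hm.1], fun x => ?_⟩
  have h1 : enc x < m.length := hm.1 ▸ enc_lt x
  rw [Equiv.Perm.mul_apply, hl.2, hm.2, compTab]
  simp [List.getD_eq_getElem?_getD, h1]

lemma Rep.apply {l : List ℕ} {g : Equiv.Perm Letter} (hl : Rep l g) {i : ℕ} (hi : i < 24) :
    g (dec i) = dec (l.getD i 0) := by
  rw [← dec_enc (g (dec i)), hl.2, enc_dec hi]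

/-- The mask of the composition of a word with a permutation. -/
def permMask : List ℕ → ℕ → ℕ
  | [], _ => 0
  | x :: l, n => 2 * permMask l n + n / 2 ^ x % 2

lemma testBit_permMask (l : List ℕ) (n i : ℕ) :
    (permMask l n).testBit i = (decide (i < l.length) && n.testBit (l.getD i 0)) := by
  induction l generalizing i with
  | nil => simp [permMask]
  | cons x l ih =>
    rw [permMask]
    have h2 : n / 2 ^ x % 2 < 2 := Nat.mod_lt _ two_pos
    cases i with
    | zero =>
      rw [Nat.testBit_zero, List.getD_cons_zero, Nat.testBit_eq_decide_div_mod_eq]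
      simp [Nat.add_mod]
    | succ i =>
      rw [Nat.testBit_succ, show (2 * permMask l n + n / 2 ^ x % 2) / 2 = permMask l n by omega, ih]
      simp

/-- The table of a permutation in `M₂₄`. -/
def goodTab (l : List ℕ) : Bool :=
  l.length == 24 && (l.all fun i => decide (i < 24)) && decide l.Nodup &&
    golayMasks.all fun n => reduce golayBasis (permMask l n) == 0

/-- One inclusion suffices, because the inverse is a power of g. -/
lemma mem_M24_of_forall {g : Equiv.Perm Letter}
    (h : ∀ c ∈ golayCode, c ∘ g ∈ golayCode) : g ∈ M24 := by
  have hpow : ∀ (n : ℕ) (c), c ∈ golayCode → c ∘ ⇑(g ^ n) ∈ golayCode := by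
    intro n
    induction n with
    | zero => intro c hc; exact hc
    | succ n ih => intro c hc; rw [pow_succ']; exact ih _ (h c hc)
  intro c
  refine ⟨fun hc => ?_, h c⟩
  have h1 := hpow (orderOf g - 1) _ hc
  have h2 : g * g ^ (orderOf g - 1) = 1 := by
    rw [← pow_succ', Nat.sub_add_cancel (orderOf_pos g), pow_orderOf_eq_one]
  have h3 : (c ∘ g) ∘ ⇑(g ^ (orderOf g - 1)) = c ∘ ⇑(g * g ^ (orderOf g - 1)) := rfl
  rwa [h3, h2] at h1

/-- A table without repetitions is a permutation, and by linearity it is enough to test the spanning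
words of the code. -/
lemma exists_of_goodTab {l : List ℕ} (h : goodTab l = true) : ∃ g ∈ M24, Rep l g := by
  simp only [goodTab, Bool.and_eq_true, beq_iff_eq, List.all_eq_true, decide_eq_true_eq] at h
  obtain ⟨⟨⟨h1, h2⟩, h3⟩, h4⟩ := h
  have hlt : ∀ x : Letter, enc x < l.length := fun x => h1 ▸ enc_lt x
  have hget : ∀ x : Letter, l.getD (enc x) 0 = l[enc x]'(hlt x) := fun x => by
    simp [List.getD_eq_getElem?_getD, hlt x]
  have henc : ∀ x : Letter, enc (dec (l.getD (enc x) 0)) = l.getD (enc x) 0 := fun x =>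
    enc_dec (by rw [hget]; exact h2 _ (List.getElem_mem _))
  have hinj : Function.Injective fun x : Letter => dec (l.getD (enc x) 0) := by
    intro x y hxy
    have h5 := congrArg enc hxy
    simp only [henc] at h5
    rw [hget, hget] at h5
    exact enc_injective (h3.getElem_inj_iff.1 h5)
  set g : Equiv.Perm Letter := Equiv.ofBijective _ (Finite.injective_iff_bijective.1 hinj)
  have hg : ∀ x, g x = dec (l.getD (enc x) 0) := fun _ => rfl
  refine ⟨g, mem_M24_of_forall fun c hc => ?_, h1, fun x => by rw [hg, henc]⟩
  have hle : golayCode ≤ golayCode.comap (LinearMap.funLeft (ZMod 2) (ZMod 2) g) := by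
    rw [golayCode, Submodule.span_le]
    rintro _ ⟨a, rfl⟩
    obtain ⟨n, hn, e⟩ := golayWord_eq a
    have h5 := word_mem_of_reduce (h4 n hn)
    have h6 : word (permMask l n) = golayWord a ∘ g := by
      funext x
      rw [e, Function.comp_apply, hg, word, word, testBit_permMask, henc]
      simp [hlt]
    rw [h6] at h5
    exact h5
  exact hle hc

/-- The table whose entries are the base `32` digits of a number. -/
def unpack (n : ℕ) : List ℕ := (List.range 24).map fun i => n / 32 ^ i % 32

/-- For `i < 7`, the `i`th list consists of elements of `M₂₄` that fix the first `i` letters of the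
base `0, 1, 2, 3, 4, 7, 5` and map the letters of the corresponding orbit to the `i`th one. -/
def transversals : List (List ℕ) := [
  [0xbdab49ca307b9ac5a928398a418820,
   0xb82d5a4e5183dcd62d4941cc520c41,
   0x5883388a1c8f5140b46cd317aed7,
   0xb8416ad2728c1ee6b16a4a0e629062,
   0xbda928398a41882056717b56939461,
   0x89a93bcab24d161c4d57515283017,
   0xbbeab0158e84949a21b130ac321e61,
   0xb8820b56939460f7358b5250731483,
   0x10dca440cc2d120248f67d5738b437,
   0xbc2cc099af8cd6aaa5d238c042a282,
   0xb86d4941cc520c4102b38bdab49ca3,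
   0xbd20c410137ace3b49ca30ab16a4a1,
   0x8c51699353b9f42a9722426c402d7,
   0xcd3114868214d53bacb501ac851f7,
   0xb85f5580ac7424a4d10d89856190f3,
   0x191eb4c4ed355412cd008599493857,
   0x151521cc89298f643c0c585cd8d617,
   0xb8a16604cd7c66b5552e91c6021514,
   0xbd82d8aeae380b4830cf9a93219102,
   0xbcd89812ab8b5d209d4f052c828cc2,
   0x194937a1604c2363b1b434aae50837,
   0xa443218f65360f9c6482d5cb03297,
   0x11a4fa35072900c1aec97415588677,
   0xbb2158b82a058a69a48b6c8efa2062],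
  [0xbdab49ca307b9ac5a928398a418820,
   0x14e2170eab530c5b26e46c1123d1e0,
   0x4d946385f19c185b91cd90868a5560,
   0x406cb8a465351cc78ab79a8923b600,
   0x9326789895289d6851230dd4b435e0,
   0xaae874d86a935c49b037119f0444a0,
   0xc8b57d169446ce392773086a831a0,
   0x4c8934458358aaf0aa90698eeb96c0,
   0xaa216b98323bc492314b68e912ba60,
   0x1b268511b2adec5885c9819f411d60,
   0xa3aaf61e36496089dc5232c8368540,
   0xbcd306bd5572ca8149861d0e40c6c0,
   0x23e76adce880585552227264369960,
   0x3aecf612414990d2de229aa83855c0,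
   0x8d82dbcce919992715e2a414b25500,
   0x89173141e36aa979153631c35431c0,
   0x395c44c8c388a68abd975c141a36c0,
   0x489ab920caab03324071395d7b51e0,
   0x55cd275a840b20839569a8a716bc60,
   0x4b2331aa56236812aea78204fbb8c0,
   0x4b2970bca48d6ca92c4e335033ce00,
   0x41137641d6a556f195a151a4788a60,
   0xa39e6589451b2324d67068487bd900],
  [0xbdab49ca307b9ac5a928398a418820,
   0x15a8b50cf065491749057a4cd9dc20,
   0xade864898a835d178cabb1e7241020,
   0x64e2a3c10eb2cd42352fa96e314820,
   0x51262b8dab35516a464e2b0e97c020,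
   0x99d4fbac96a08688baa68312d91420,
   0x41cb53384a242974b5968ac727cc20,
   0x4910eab6f359caa6469633c6284820,
   0x8b1c4124f0451aaacad32dccb78c20,
   0x64dcf6ae2a1921215aa8a1d2535c20,
   0xa096945e32812a764cceb3d432b420,
   0x8a8f27c0b5b392b6910ca1853b8c20,
   0x2bcd44d6f26c162412363ba6362820,
   0x3c6adba1f02ac92a0eca3092e64c20,
   0xa2646636f670cf1509057c27559020,
   0x9204f8a5c75928c6947681ab3ba820,
   0x1c924aa1cf3d1773304d9c6c582820,
   0x3d5b6610735484f42e257512685c20,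
   0xa1d763110d10dd094e2f555372b020,
   0xb5ea6451b17a5638126e1164762820,
   0x45c8e858c23c58f68eb4526722ac20,
   0x736e59c871628c7791624a215a5820],
  [0xbdab49ca307b9ac5a928398a418820,
   0x2b6f371d4c4a0cba125088ecfa8820,
   0x3c492514cd75d30a3ecb1b2a898820,
   0x6d4ee4d9945165024d77444c378820,
   0x22d891c0d12d2b66ca773a90f70820,
   0x3c5ccb568d22d3330d577c8a880820,
   0x38e165b4cc954898bdc8a166ab8820,
   0x61de86c22a5d069acaee29ac498820,
   0x8a9e7258664164c9a5b4aaef070820,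
   0x2bad3551a321a2b84927455f760820,
   0x35e2893573258ec7ba858287548820,
   0x8a90b6de667d24e1d48549ed060820,
   0xaa4eab8df0b2d94920ad34e2e20820,
   0x199057d589b9ecd93a349c08b50820,
   0x49077b46127d4ad42a875999370820,
   0x4b89695cf51c60f519742cd0c68820,
   0xbaced9a5ccb0d0a7c094354b288820,
   0xb164b3b215335148a4737b88ab8820,
   0x45483a1e569dd4d4be113396560820,
   0x39a965b1357b66353a442c11788820,
   0xaad2a7527129ded95903830c4b8820],
  [0xbdab49ca307b9ac5a928398a418820,
   0x55ccb95994691282cdd5844ef18820,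
   0x9c987b29e93408e6deab8d10518820,
   0x9c52b219ec542d5bb5c79151418820,
   0x9c54769114abd8929af25ba1618820,
   0x2c976399c45452f6a2ac852f318820,
   0x22e6894195a1df7b38cd2a55118820,
   0xac0b7b45a9349c479e6b5228c18820,
   0x349d7415709a62c69eaf252ca18820,
   0x9ae926550a23db7315278da0e18820,
   0x9aa25b5d0b4bdd53c886a320d18820,
   0x932704beab3350e3c5562929718820,
   0x3d8b78448f9b1cd4d4c8a2d5218820,
   0x79655b51065c1aab92293ba6c18820,
   0x8d88aa9cb4939884c0cd7aef318820,
   0xb29d195cd5a24b024d8d79d6818820,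
   0x2b6cb525cc3c4d394284456ef18820,
   0x6912b89ab7752cf64d4541e5018820,
   0x2a18431dd64c55484a6b6bef518820,
   0x3b9104cd965a9f5bd0a66c49218820],
  [0xbdab49ca307b9ac5a928398a418820,
   0x7acae6de759222a49ed461a0418820,
   0xbc12ba18ad946c79b11553dc418820],
  [0xbdab49ca307b9ac5a928398a418820,
   0x94dd1b5e89354ac42a0b3bda418820,
   0xa20b75c6464b5cc9a9f63c2a418820,
   0x2a695835d34464c32acf3aee418820,
   0x5c613a22d56a5ecba9d2394c418820,
   0x8adb2452ef816acb28d33a5c418820,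
   0x71a4d7d4a89de8c4a9703da2418820,
   0x6c22e496b65d2ec7aa663a24418820,
   0x451368ae6e2c0cc92ab73b5e418820,
   0xabee5339abb4a2c829093ce8418820,
   0x9c8cbbd90573d2ca29b13d60418820,
   0x33a70abd349590c2aa2d3dd6418820,
   0xb5de894d6da9a0c8a8b43b92418820,
   0x4950f6c0d2a2e6c72af53c6c418820,
   0x7d6c971a11bcd6c6aa853c90418820,
   0x835662a5f78a2ccaaa4e3d26418820]]

lemma goodTab_transversals :
    (transversals.all fun T => T.all fun n => goodTab (unpack n)) = true := by
  decide +kernel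

end Mathieu

namespace Mathieu

/-! ### Transitivity and stabilizers -/

/-- A base of `M₂₄`: the identity is the only element that fixes these letters. -/
def base : List ℕ := [0, 1, 2, 3, 4, 7, 5]

/-- The octad of the first five letters of the base. -/
def octad : List ℕ := [0, 1, 2, 3, 4, 7, 10, 12]

/-- The mask of a list. -/
def maskOf (l : List ℕ) : ℕ := l.foldr (fun i k => k ||| 2 ^ i) 0

/-- The `i`th list of the transversals maps the letters in `Y` to the `i`th letter of the base. -/
def levelCheck (i : ℕ) (Y : List ℕ) : Bool :=
  ((transversals.getD i []).all fun n => (base.take i).all fun b => (unpack n).getD b 0 == b) &&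
    Y.all fun y => (transversals.getD i []).any fun n => (unpack n).getD y 0 == base.getD i 0

lemma exists_rep_transversal {i n : ℕ} (hn : n ∈ transversals.getD i []) :
    ∃ u ∈ M24, Rep (unpack n) u := by
  have h1 : transversals.getD i [] ∈ transversals := by
    rw [List.getD_eq_getElem?_getD] at hn ⊢
    by_cases h : i < transversals.length
    · simp [h]
    · simp [h] at hn
  exact exists_of_goodTab
    (List.all_eq_true.1 (List.all_eq_true.1 goodTab_transversals _ h1) n hn)

lemma exists_of_levelCheck {i : ℕ} {Y : List ℕ} (h : levelCheck i Y = true)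
    (hb : ∀ b ∈ base.take i, b < 24) {x : Letter} (hx : enc x ∈ Y) :
    ∃ n ∈ transversals.getD i [], ∃ u ∈ M24, Rep (unpack n) u ∧
      (∀ b ∈ base.take i, u (dec b) = dec b) ∧ u x = dec (base.getD i 0) := by
  simp only [levelCheck, Bool.and_eq_true, List.all_eq_true, List.any_eq_true, beq_iff_eq] at h
  obtain ⟨n, hn, h1⟩ := h.2 _ hx
  obtain ⟨u, hu, hr⟩ := exists_rep_transversal hn
  refine ⟨n, hn, u, hu, hr, fun b hb' => ?_, ?_⟩
  · rw [hr.apply (hb b hb'), h.1 n hn b hb']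
  · rw [← dec_enc x, hr.apply (enc_lt x), h1]

lemma base_lt : ∀ b ∈ base, b < 24 := by decide

lemma levelCheck_lt : ∀ i < 5, levelCheck i ((List.range 24).filter (· ∉ base.take i)) = true := by
  decide +kernel

lemma levelCheck_five : levelCheck 5 [7, 10, 12] = true := by decide +kernel

lemma levelCheck_six : levelCheck 6 ((List.range 24).filter (· ∉ octad)) = true := by
  decide +kernel

/-- `M₂₄` is five times transitive. -/
lemma exists_map_base {k : ℕ} (hk : k ≤ 5) {x : ℕ → Letter}
    (hx : ∀ i < k, ∀ j < k, x i = x j → i = j) :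
    ∃ u ∈ M24, ∀ i < k, u (x i) = dec (base.getD i 0) := by
  induction k with
  | zero => exact ⟨1, M24.one_mem, fun i hi => absurd hi (Nat.not_lt_zero _)⟩
  | succ k ih =>
    obtain ⟨u, hu, h1⟩ := ih (by omega) fun i hi j hj => hx i (by omega) j (by omega)
    have hmem : ∀ b ∈ base.take k, ∃ i < k, b = base.getD i 0 := by
      intro b hb
      obtain ⟨i, hi, rfl⟩ := List.mem_take_iff_getElem.1 hb
      have : i < base.length := by omega
      exact ⟨i, by omega, by simp [List.getD_eq_getElem?_getD, this]⟩
    obtain ⟨n, -, v, hv, -, h2, h3⟩ := exists_of_levelCheck (x := u (x k)) (levelCheck_lt k (by omega))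
      (fun b hb => base_lt b (List.mem_of_mem_take hb)) (by
        simp only [List.mem_filter, List.mem_range, enc_lt, true_and, decide_eq_true_eq]
        intro h
        obtain ⟨i, hi, h4⟩ := hmem _ h
        have h5 : u (x k) = u (x i) := by rw [h1 i hi, ← h4, dec_enc]
        have := hx k (by omega) i (by omega) (u.injective h5)
        omega)
    refine ⟨v * u, M24.mul_mem hv hu, fun i hi => ?_⟩
    rw [Equiv.Perm.mul_apply]
    rcases Nat.lt_succ_iff_lt_or_eq.1 hi with h | rfl
    · rw [h1 i h]
      refine h2 _ ?_
      have : i < base.length := by simp [base]; omega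
      rw [List.getD_eq_getElem?_getD, List.getElem?_eq_getElem this, Option.getD_some]
      exact List.mem_take_iff_getElem.2 ⟨i, by omega, rfl⟩
    · exact h3

/-- A sixth letter can be moved to one of two places, according to whether it lies in the octad of
the first five ones. -/
lemma exists_map_base_six {x : ℕ → Letter} (hx : ∀ i < 6, ∀ j < 6, x i = x j → i = j) :
    ∃ u ∈ M24, (∀ i < 5, u (x i) = dec (base.getD i 0)) ∧
      (u (x 5) = dec 7 ∨ u (x 5) = dec 5) := by
  obtain ⟨u, hu, h1⟩ := exists_map_base le_rfl fun i hi j hj => hx i (by omega) j (by omega)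
  have hne : ∀ i < 5, enc (u (x 5)) ≠ base.getD i 0 := by
    intro i hi h
    have h5 : u (x 5) = u (x i) := by rw [h1 i hi, ← h, dec_enc]
    have := hx 5 (by omega) i (by omega) (u.injective h5)
    omega
  have hlt := enc_lt (u (x 5))
  have hfix : ∀ {v : Equiv.Perm Letter}, (∀ b ∈ base.take 5, v (dec b) = dec b) →
      ∀ i < 5, (v * u) (x i) = dec (base.getD i 0) := by
    intro v hv i hi
    rw [Equiv.Perm.mul_apply, h1 i hi]
    refine hv _ ?_
    interval_cases i <;> decide
  by_cases h : enc (u (x 5)) ∈ octad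
  · obtain ⟨n, -, v, hv, -, h2, h3⟩ := exists_of_levelCheck (x := u (x 5)) levelCheck_five
      (by decide) (by
        have h0 := hne 0 (by omega)
        have h1 := hne 1 (by omega)
        have h2 := hne 2 (by omega)
        have h3 := hne 3 (by omega)
        have h4 := hne 4 (by omega)
        simp only [octad, List.mem_cons, List.not_mem_nil, or_false] at h ⊢
        simp [base] at h0 h1 h2 h3 h4
        omega)
    exact ⟨v * u, M24.mul_mem hv hu, hfix h2, Or.inl h3⟩
  · obtain ⟨n, -, v, hv, -, h2, h3⟩ := exists_of_levelCheck (x := u (x 5)) levelCheck_six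
      (by decide) (by simp [hlt, h])
    refine ⟨v * u, M24.mul_mem hv hu, hfix fun b hb => h2 b ?_, Or.inr h3⟩
    revert b; decide

/-! ### The stabilizer of five letters -/

lemma word_mem_of_mem_sums {R : List ℕ} (hR : ∀ r ∈ R, word r ∈ golayCode) {n : ℕ}
    (hn : n ∈ sums R) : word n ∈ golayCode := by
  induction R generalizing n with
  | nil =>
    rw [List.mem_singleton.1 hn, word_zero]
    exact golayCode.zero_mem
  | cons r R ih =>
    have hR' := fun s hs => hR s (List.mem_cons_of_mem _ hs)
    simp only [sums, List.mem_append, List.mem_map] at hn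
    rcases hn with hn | ⟨m, hm, rfl⟩
    · exact ih hR' hn
    · rw [word_xor]
      exact golayCode.add_mem (hR r List.mem_cons_self) (ih hR' hm)

lemma word_ne_zero_iff (n : ℕ) (x : Letter) : word n x ≠ 0 ↔ n.testBit (enc x) = true := by
  rw [word]
  cases n.testBit (enc x) <;> simp

/-- An element of `M₂₄` that fixes five letters of an octad preserves the mask of the octad. -/
lemma testBit_fix {h : Equiv.Perm Letter} (hh : h ∈ M24) {F : List ℕ} (hF : ∀ b ∈ F, b < 24)
    (hnd : F.Nodup) (hfix : ∀ b ∈ F, h (dec b) = dec b) {n : ℕ} (hn : word n ∈ golayCode)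
    (h8 : weight n = 8) (h5 : 5 ≤ (F.filter n.testBit).length) (x : Letter) :
    n.testBit (enc (h x)) = n.testBit (enc x) := by
  classical
  have hinj : Set.InjOn dec {b | b < 24} := fun a ha b hb e => by
    rw [← enc_dec ha, ← enc_dec hb, e]
  have := fix_octad hh hn (by rw [← weight_eq, h8])
    (S := ((F.filter n.testBit).map dec).toFinset) (fun y hy => by
      simp only [List.mem_toFinset, List.mem_map, List.mem_filter] at hy
      obtain ⟨b, ⟨hb, hb'⟩, rfl⟩ := hy
      exact ⟨(word_ne_zero_iff _ _).2 (by rwa [enc_dec (hF b hb)]), hfix b hb⟩) (by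
      rw [List.toFinset_card_of_nodup, List.length_map]
      · exact h5
      · refine List.Nodup.map_on (fun a ha b hb e => hinj (hF a (List.mem_of_mem_filter ha))
          (hF b (List.mem_of_mem_filter hb)) e) (hnd.filter _)) x
  rw [Bool.eq_iff_iff, ← word_ne_zero_iff, ← word_ne_zero_iff, this]

/-- The octads that contain five letters of a list. -/
def octadsThrough (F : List ℕ) : List ℕ :=
  (sums golayBasis).filter fun n => decide (5 ≤ (F.filter n.testBit).length) && weight n == 8

/-- The letters in `F'` are separated from the others by the octads through `F`. -/
def separated (F F' : List ℕ) : Bool :=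
  let O := octadsThrough F
  F'.all fun x => (List.range 24).all fun y => y == x || O.any fun o => o.testBit x != o.testBit y

/-- Every octad with five letters in `F` is preserved, so a letter and its image lie in the same
ones. If these octads separate the letter from all others, it is fixed. -/
lemma fix_of_separated {h : Equiv.Perm Letter} (hh : h ∈ M24) {F F' : List ℕ}
    (hF : ∀ b ∈ F, b < 24) (hF' : ∀ b ∈ F', b < 24) (hnd : F.Nodup)
    (hfix : ∀ b ∈ F, h (dec b) = dec b) (hs : separated F F' = true) :
    ∀ b ∈ F', h (dec b) = dec b := by
  intro b hb
  simp only [separated, List.all_eq_true, List.any_eq_true, List.mem_range, Bool.or_eq_true,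
    beq_iff_eq, bne_iff_ne, octadsThrough, List.mem_filter, Bool.and_eq_true,
    decide_eq_true_eq] at hs
  rcases hs b hb (enc (h (dec b))) (enc_lt _) with h1 | ⟨o, ⟨ho, h5, h8⟩, hne⟩
  · rw [← dec_enc (h (dec b)), h1]
  · have := testBit_fix hh hF hnd hfix (word_mem_of_mem_sums golayBasis_mem ho) h8 h5 (dec b)
    rw [enc_dec (hF' b hb)] at this
    exact absurd this.symm hne

lemma separated_base : separated base (base ++ [6, 8, 9, 11]) = true := by decide +kernel

lemma separated_range : separated (base ++ [6, 8, 9, 11]) (List.range 24) = true := by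
  decide +kernel

/-- The octads through five letters of the base determine four more letters, and the octads through
five of the eleven letters now fixed separate all 24. -/
lemma eq_one_of_fix_base {h : Equiv.Perm Letter} (hh : h ∈ M24)
    (hfix : ∀ b ∈ base, h (dec b) = dec b) : h = 1 := by
  have h1 := fix_of_separated hh base_lt (by decide) (by decide) hfix separated_base
  have h2 := fix_of_separated hh (by decide) (by simp) (by decide) h1 separated_range
  ext1 x
  have := h2 (enc x) (List.mem_range.2 (enc_lt x))
  rwa [dec_enc] at this

lemma octad_check : reduce golayBasis (maskOf octad) = 0 ∧ weight (maskOf octad) = 8 ∧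
    5 ≤ ((base.take 5).filter (maskOf octad).testBit).length ∧
    ∀ i < 24, (maskOf octad).testBit i = decide (i ∈ octad) := by
  decide +kernel

/-- The elements of `M₂₄` that fix the first five letters of the base. -/
lemma exists_of_fix_five {h : Equiv.Perm Letter} (hh : h ∈ M24)
    (hfix : ∀ b ∈ base.take 5, h (dec b) = dec b) :
    ∃ n ∈ transversals.getD 5 [], ∃ m ∈ transversals.getD 6 [], ∃ u v : Equiv.Perm Letter,
      Rep (unpack n) u ∧ Rep (unpack m) v ∧ v * (u * h) = 1 := by
  obtain ⟨o1, o2, o3, o4⟩ := octad_check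
  -- Preservation of the octad restricts the image of the letter 7 to the three remaining letters of
  -- the octad, and the image of the letter 5 to the sixteen letters outside.
  have hoct : ∀ {h : Equiv.Perm Letter}, h ∈ M24 → (∀ b ∈ base.take 5, h (dec b) = dec b) →
      ∀ x, enc (h x) ∈ octad ↔ enc x ∈ octad := by
    intro h hh hfix x
    have := testBit_fix hh (by decide) (by decide) hfix (word_mem_of_reduce o1) o2 o3 x
    rw [o4 _ (enc_lt _), o4 _ (enc_lt _)] at this
    simpa using this
  have hne : ∀ b ∈ base.take 5, enc (h (dec 7)) ≠ b := by
    intro b hb e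
    have h1 : h (dec 7) = h (dec b) := by rw [hfix b hb, ← e, dec_enc]
    have h2 : ∀ b ∈ base.take 5, enc (dec 7) ≠ enc (dec b) := by decide
    exact h2 b hb (congrArg enc (h.injective h1))
  obtain ⟨n, hn, u, hu, hru, h2, h3⟩ := exists_of_levelCheck (x := h (dec 7)) levelCheck_five
    (by decide) (by
      have h1 : enc (h (dec 7)) ∈ octad := (hoct hh hfix _).2 (by decide)
      generalize enc (h (dec 7)) = e at h1 hne
      revert e
      decide)
  have hu6 : ∀ b ∈ base.take 6, (u * h) (dec b) = dec b := by
    intro b hb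
    rw [Equiv.Perm.mul_apply]
    have : b ∈ base.take 5 ∨ b = 7 := by revert b; decide
    rcases this with h' | rfl
    · rw [hfix b h', h2 b h']
    · exact h3
  have hu5 : ∀ b ∈ base.take 5, (u * h) (dec b) = dec b := fun b hb => hu6 b (by
    revert b; decide)
  have huh : u * h ∈ M24 := M24.mul_mem hu hh
  obtain ⟨m, hm, v, hv, hrv, h4, h5⟩ := exists_of_levelCheck (x := (u * h) (dec 5)) levelCheck_six
    (by decide) (by
      have h1 : ¬ enc ((u * h) (dec 5)) ∈ octad := by
        rw [hoct huh hu5]; decide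
      simp only [List.mem_filter, List.mem_range, enc_lt, true_and, decide_eq_true_eq]
      exact h1)
  refine ⟨n, hn, m, hm, u, v, hru, hrv, eq_one_of_fix_base (M24.mul_mem hv huh) fun b hb => ?_⟩
  rw [Equiv.Perm.mul_apply]
  have : b ∈ base.take 6 ∨ b = 5 := by revert b; decide
  rcases this with h' | rfl
  · rw [hu6 b h', h4 b h']
  · exact h5

end Mathieu

namespace Mathieu

/-! ### Cycle shapes -/

lemma cycleType_formPerm {l : List Letter} (hl : l.Nodup) :
    l.formPerm.cycleType = Multiset.filter (1 < ·) {l.length} := by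
  by_cases h : 2 ≤ l.length
  · have h1 : 1 < l.length := h
    rw [(List.isCycle_formPerm hl h).cycleType, List.support_formPerm_of_nodup _ hl,
      List.toFinset_card_of_nodup hl, Multiset.filter_singleton, if_pos h1]
    intro x hx
    simp [hx] at h
  · have h1 : ¬ 1 < l.length := h
    rw [(List.formPerm_eq_one_iff _ hl).2 (by omega), Multiset.filter_singleton, if_neg h1,
      Equiv.Perm.cycleType_one]
    rfl

/-- Peeling off one listed cycle leaves a permutation disjoint from it. Lists of length one are
allowed and contribute nothing. -/
lemma cycleType_of_formPerm {L : List (List Letter)} {g : Equiv.Perm Letter}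
    (hnd : L.flatten.Nodup) (h1 : ∀ l ∈ L, ∀ x ∈ l, g x = l.formPerm x)
    (h2 : ∀ x, x ∉ L.flatten → g x = x) :
    g.cycleType = Multiset.filter (1 < ·) (L.map List.length : List ℕ) := by
  induction L generalizing g with
  | nil =>
    have : g = 1 := by ext1 x; exact h2 x (by simp)
    simp [this]
  | cons l L ih =>
    rw [List.flatten_cons, List.nodup_append] at hnd
    obtain ⟨hl, hL, hd⟩ := hnd
    set p := l.formPerm
    have hp : ∀ x, x ∉ l → p⁻¹ x = x := fun x hx => by
      rw [Equiv.Perm.inv_eq_iff_eq]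
      exact (List.formPerm_apply_of_notMem hx).symm
    have hin : ∀ x ∈ l, (p⁻¹ * g) x = x := fun x hx => by
      rw [Equiv.Perm.mul_apply, h1 l List.mem_cons_self x hx, Equiv.Perm.inv_eq_iff_eq]
    have hL' : ∀ m ∈ L, ∀ x ∈ m, (p⁻¹ * g) x = m.formPerm x := by
      intro m hm x hx
      rw [Equiv.Perm.mul_apply, h1 m (List.mem_cons_of_mem _ hm) x hx]
      refine hp _ fun h => hd _ h _ (List.mem_flatten.2 ⟨m, hm, ?_⟩) rfl
      exact List.formPerm_apply_mem_of_mem hx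
    have hout : ∀ x, x ∉ L.flatten → (p⁻¹ * g) x = x := by
      intro x hx
      by_cases hx' : x ∈ l
      · exact hin x hx'
      · rw [Equiv.Perm.mul_apply, h2 x (by simp_all), hp x hx']
    have hdis : Equiv.Perm.Disjoint p (p⁻¹ * g) := by
      intro x
      by_cases hx' : x ∈ l
      · exact Or.inr (hin x hx')
      · exact Or.inl (List.formPerm_apply_of_notMem hx')
    have hg : g = p * (p⁻¹ * g) := by group
    rw [hg, hdis.cycleType_mul, ih hL hL' hout, cycleType_formPerm hl, List.map_cons,
      ← Multiset.cons_coe, ← Multiset.filter_add, Multiset.singleton_add]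

/-- The number whose base `32` digits are the entries of a table. -/
def packTab (l : List ℕ) : ℕ := l.foldr (fun i k => i + 32 * k) 0

/-- The orbit of `y` under a packed table, as far as it has not been visited. -/
def orbitTab (n : ℕ) : ℕ → ℕ → ℕ → List ℕ × ℕ
  | 0, v, _ => ([], v)
  | k + 1, v, y => if v.testBit y then ([], v) else
      let r := orbitTab n k (v ||| 2 ^ y) (n / 32 ^ y % 32)
      (y :: r.1, r.2)

/-- The orbits of a packed table. -/
def orbitsTab (n : ℕ) : List (List ℕ) :=
  ((List.range 24).foldr (fun y r =>
    if r.2.testBit y then r else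
      let o := orbitTab n 24 r.2 y
      (o.1 :: r.1, o.2)) (([], 0) : List (List ℕ) × ℕ)).1

/-- The cycle shapes of the elements of `M₂₄`. -/
def shapes : List (List ℕ) := [[], [2, 2, 2, 2, 2, 2, 2, 2], [2, 2, 2, 2, 2, 2, 2, 2, 2, 2, 2, 2],
  [3, 3, 3, 3, 3, 3], [2, 2, 2, 2, 4, 4, 4, 4], [2, 2, 4, 4, 4, 4], [5, 5, 5, 5],
  [2, 2, 3, 3, 6, 6], [7, 7, 7], [2, 4, 8, 8], [2, 2, 10, 10], [11, 11], [2, 4, 6, 12],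
  [2, 7, 14], [3, 5, 15], [3, 3, 3, 3, 3, 3, 3, 3], [4, 4, 4, 4, 4, 4], [6, 6, 6, 6], [12, 12],
  [3, 21], [23]]

lemma testBit_maskOf (l : List ℕ) (i : ℕ) : (maskOf l).testBit i = decide (i ∈ l) := by
  induction l with
  | nil => simp [maskOf]
  | cons j l ih =>
    have h : maskOf (j :: l) = maskOf l ||| 2 ^ j := rfl
    rw [h, Nat.testBit_or, ih, Nat.testBit_two_pow]
    rw [Bool.or_comm]
    simp [eq_comm]

/-- The table has one of the cycle shapes in the list. -/
def shapeCheck (l : List ℕ) : Bool :=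
  let L := orbitsTab (packTab l)
  L.flatten.length == 24 && maskOf L.flatten == 2 ^ 24 - 1 &&
    (L.all fun o => o.map (fun i => l.getD i 0) == o.rotate 1) &&
    shapes.elem (((L.map List.length).filter (1 < ·)).insertionSort (· ≤ ·))

lemma formPerm_of_map_eq_rotate {o : List Letter} (ho : o.Nodup) {g : Equiv.Perm Letter}
    (h : o.map g = o.rotate 1) {x : Letter} (hx : x ∈ o) : g x = o.formPerm x := by
  obtain ⟨i, hi, rfl⟩ := List.mem_iff_getElem.1 hx
  rw [List.formPerm_apply_getElem _ ho]
  have h1 : (o.map g)[i]? = (o.rotate 1)[i]? := by rw [h]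
  rw [List.getElem?_eq_getElem (by simpa using hi), List.getElem?_eq_getElem (by simpa using hi)] at h1
  simpa [List.getElem_rotate] using h1

/-- The orbit computation need not be trusted: the check verifies that the output partitions the
letters and that the table acts on each part as a rotation. -/
lemma cycleType_of_shapeCheck {l : List ℕ} {g : Equiv.Perm Letter} (hl : Rep l g)
    (h : shapeCheck l = true) : ∃ s ∈ shapes, g.cycleType = (s : Multiset ℕ) := by
  simp only [shapeCheck, Bool.and_eq_true, beq_iff_eq, List.all_eq_true,
    List.elem_iff] at h
  obtain ⟨⟨⟨h1, h2⟩, h4⟩, h5⟩ := h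
  refine ⟨_, h5, ?_⟩
  set L := orbitsTab (packTab l)
  have hperm : (List.range 24).Perm L.flatten := by
    refine (List.subperm_of_subset List.nodup_range fun i hi => ?_).perm_of_length_le (by
      rw [h1, List.length_range])
    have h3 := testBit_maskOf L.flatten i
    rw [h2, Nat.testBit_two_pow_sub_one] at h3
    simpa [List.mem_range.1 hi] using h3
  have h3 : ∀ i ∈ L.flatten, i < 24 := fun i hi => List.mem_range.1 (hperm.mem_iff.2 hi)
  have hfl : (L.map (List.map dec)).flatten = L.flatten.map dec := by
    rw [List.map_flatten]
  have hnd : (L.map (List.map dec)).flatten.Nodup := by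
    rw [hfl]
    exact (hperm.nodup_iff.1 List.nodup_range).map_on fun a ha b hb e => by
      rw [← enc_dec (h3 a ha), ← enc_dec (h3 b hb), e]
  have hall : ∀ x, x ∈ (L.map (List.map dec)).flatten := by
    have hc : (L.map (List.map dec)).flatten.toFinset = Finset.univ := by
      rw [← Finset.card_eq_iff_eq_univ, List.toFinset_card_of_nodup hnd, hfl, List.length_map, h1]
      decide
    intro x
    rw [← List.mem_toFinset, hc]
    exact Finset.mem_univ x
  rw [cycleType_of_formPerm hnd, List.map_map, Multiset.filter_coe, Multiset.coe_eq_coe]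
  · have e : (List.length ∘ List.map dec : List ℕ → ℕ) = List.length := by
      funext o; simp
    rw [e]
    exact (List.perm_insertionSort _ _).symm
  · intro o' ho' x hx
    obtain ⟨o, ho, rfl⟩ := List.mem_map.1 ho'
    refine formPerm_of_map_eq_rotate ?_ ?_ hx
    · exact (List.nodup_flatten.1 hnd).1 _ ho'
    · rw [← List.map_rotate, ← h4 o ho, List.map_map, List.map_map]
      refine List.map_congr_left fun i hi => ?_
      exact hl.apply (h3 i (List.mem_flatten.2 ⟨o, ho, hi⟩))
  · intro x hx
    exact absurd (hall x) hx

/-- The table of a permutation that maps the letters in the list to those of the base. -/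
def siftTab : List ℕ → ℕ → List ℕ → List ℕ
  | [], _, acc => acc
  | x :: c, i, acc => siftTab c (i + 1)
      (match (transversals.getD i []).find?
          fun n => (unpack n).getD (acc.getD x 0) 0 == base.getD i 0 with
        | some n => compTab (unpack n) acc
        | none => acc)

lemma exists_rep_siftTab (c : List ℕ) (i : ℕ) {acc : List ℕ}
    (h : ∃ u ∈ M24, Rep acc u) : ∃ u ∈ M24, Rep (siftTab c i acc) u := by
  induction c generalizing i acc with
  | nil => exact h
  | cons x c ih =>
    refine ih _ ?_
    split
    · next n hn =>
      obtain ⟨u, hu, hr⟩ := h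
      obtain ⟨v, hv, hs⟩ := exists_rep_transversal (List.mem_of_find?_eq_some hn)
      exact ⟨v * u, M24.mul_mem hv hu, hs.comp hr⟩
    · exact h

/-- All elements of `M₂₄` that map the first five letters of the base to those in the list have
one of the cycle shapes in the list. -/
def imageCheck (c : List ℕ) : Bool :=
  let P := siftTab c 0 (List.range 24)
  ((List.range 5).all fun i => P.getD (c.getD i 0) 0 == base.getD i 0 && decide (c.getD i 0 < 24)) &&
    (transversals.getD 5 []).all fun n =>
      let P' := compTab (unpack n) P
      (transversals.getD 6 []).all fun m => shapeCheck (compTab (unpack m) P')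

/-- A known element w moves the images back, so wg fixes five letters of the base and v(u(wg)) = 1
for one of the 3·16 pairs of tables. Then g⁻¹ = v(uw) is explicit and has the cycle shape of g. -/
lemma cycleType_of_imageCheck {c : List ℕ} (hc : imageCheck c = true) {g : Equiv.Perm Letter}
    (hg : g ∈ M24) (h : ∀ i < 5, g (dec (base.getD i 0)) = dec (c.getD i 0)) :
    ∃ s ∈ shapes, g.cycleType = (s : Multiset ℕ) := by
  simp only [imageCheck, Bool.and_eq_true, List.all_eq_true, beq_iff_eq, List.mem_range,
    decide_eq_true_eq] at hc
  obtain ⟨h1, h2⟩ := hc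
  obtain ⟨w, hw, hr⟩ := exists_rep_siftTab c 0 (acc := List.range 24)
    ⟨1, M24.one_mem, by simp, fun x => by simp [List.getD_eq_getElem?_getD, enc_lt]⟩
  obtain ⟨n, hn, m, hm, u, v, hu, hv, he⟩ := exists_of_fix_five (M24.mul_mem hw hg) (by
    intro b hb
    obtain ⟨i, hi, rfl⟩ := List.mem_take_iff_getElem.1 hb
    have hi' : i < base.length := by omega
    have e : base[i] = base.getD i 0 := by simp [List.getD_eq_getElem?_getD, hi']
    rw [e, Equiv.Perm.mul_apply, h i (by omega), hr.apply (h1 i (by omega)).2, (h1 i (by omega)).1])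
  have hinv : g⁻¹ = v * (u * w) := inv_eq_of_mul_eq_one_left (by rw [← he]; group)
  rw [← Equiv.Perm.cycleType_inv, hinv]
  exact cycleType_of_shapeCheck (hv.comp (hu.comp hr)) (h2 n hn m hm)

end Mathieu

/-! ### Reduction to prescribed actions on five letters -/

namespace Mathieu

/-- In these checks the fifth letter of the base is sent either to one of the five or to a new
letter. A new one may be taken to be 7 or 5, inside or outside the octad, by conjugation with an
element fixing the first five. -/
lemma imageCheck_cycle : ∀ y ∈ [0, 7, 5], imageCheck [1, 2, 3, 4, y] = true := by decide +kernel

lemma imageCheck_four : ∀ y ∈ [4, 7, 5], imageCheck [1, 2, 3, 0, y] = true := by decide +kernel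

lemma imageCheck_three : ∀ y ∈ [3, 7, 5], imageCheck [1, 2, 0, 4, y] = true := by decide +kernel

lemma imageCheck_three_fixed : imageCheck [1, 2, 0, 3, 4] = true := by decide +kernel

lemma imageCheck_two : ∀ y ∈ [4, 7, 5], imageCheck [1, 0, 3, 2, y] = true := by decide +kernel

lemma imageCheck_two_fixed : imageCheck [1, 0, 2, 3, 4] = true := by decide +kernel

/-- The action on five letters determines the cycle shape, if it is known up to conjugacy. -/
lemma cycleType_of_five {g : Equiv.Perm Letter} (hg : g ∈ M24) {l : List Letter} (hl : l.Nodup)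
    (h5 : l.length = 5) {c : List ℕ}
    (h : ∀ i < 5, c.getD i 0 < 5 ∧ g (l.getD i none) = l.getD (c.getD i 0) none)
    (hc : imageCheck ((List.range 5).map fun i => base.getD (c.getD i 0) 0) = true) :
    ∃ s ∈ shapes, g.cycleType = (s : Multiset ℕ) := by
  obtain ⟨u, hu, h1⟩ := exists_map_base (x := fun i => l.getD i none) le_rfl (by
    intro i hi j hj e
    rw [List.getD_eq_getElem _ _ (by omega), List.getD_eq_getElem _ _ (by omega)] at e
    exact hl.getElem_inj_iff.1 e)
  rw [← Equiv.Perm.cycleType_conj (τ := u)]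
  refine cycleType_of_imageCheck hc (M24.mul_mem (M24.mul_mem hu hg) (M24.inv_mem hu)) ?_
  intro i hi
  have h2 : u⁻¹ (dec (base.getD i 0)) = l.getD i none := by
    rw [Equiv.Perm.inv_eq_iff_eq, h1 i hi]
  rw [Equiv.Perm.mul_apply, Equiv.Perm.mul_apply, h2, (h i hi).2, h1 _ (h i hi).1]
  simp [List.getD_eq_getElem?_getD, hi]

/-- The case in which the fifth letter is mapped to a new one. -/
lemma cycleType_of_six {g : Equiv.Perm Letter} (hg : g ∈ M24) {l : List Letter} (hl : l.Nodup)
    (h6 : l.length = 6) {c : List ℕ}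
    (h : ∀ i < 4, c.getD i 0 < 5 ∧ g (l.getD i none) = l.getD (c.getD i 0) none)
    (h4 : g (l.getD 4 none) = l.getD 5 none)
    (hc : ∀ y ∈ [7, 5],
      imageCheck ((List.range 5).map fun i => if i < 4 then base.getD (c.getD i 0) 0 else y) = true) :
    ∃ s ∈ shapes, g.cycleType = (s : Multiset ℕ) := by
  obtain ⟨u, hu, h1, h2⟩ := exists_map_base_six (x := fun i => l.getD i none) (by
    intro i hi j hj e
    rw [List.getD_eq_getElem _ _ (by omega), List.getD_eq_getElem _ _ (by omega)] at e
    exact hl.getElem_inj_iff.1 e)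
  obtain ⟨y, hy, hy'⟩ : ∃ y ∈ [7, 5], u (l.getD 5 none) = dec y := by
    rcases h2 with h2 | h2
    · exact ⟨7, by simp, h2⟩
    · exact ⟨5, by simp, h2⟩
  rw [← Equiv.Perm.cycleType_conj (τ := u)]
  refine cycleType_of_imageCheck (hc y hy) (M24.mul_mem (M24.mul_mem hu hg) (M24.inv_mem hu)) ?_
  intro i hi
  have h2 : u⁻¹ (dec (base.getD i 0)) = l.getD i none := by
    rw [Equiv.Perm.inv_eq_iff_eq, h1 i hi]
  rw [Equiv.Perm.mul_apply, Equiv.Perm.mul_apply, h2]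
  by_cases hi4 : i < 4
  · rw [(h i hi4).2, h1 _ (h i hi4).1]
    simp [List.getD_eq_getElem?_getD, hi, hi4]
  · obtain rfl : i = 4 := by omega
    rw [h4, hy']
    simp

/-- The case of a letter that is not fixed by the square. -/
lemma cycleType_of_sq_ne {g : Equiv.Perm Letter} (hg : g ∈ M24) {x : Letter}
    (h2 : g (g x) ≠ x) : ∃ s ∈ shapes, g.cycleType = (s : Multiset ℕ) := by
  have h1 : g x ≠ x := fun h => h2 (by rw [h, h])
  have key : ∀ {a b : Letter}, g a ≠ b → b ≠ g a := fun h => h.symm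
  by_cases h3 : g (g (g x)) = x
  -- A 3-cycle supplies only three letters; a further moved letter and its image complete them to
  -- five.
  · by_cases hz : ∃ z, g z ≠ z ∧ z ≠ x ∧ z ≠ g x ∧ z ≠ g (g x)
    · obtain ⟨z, z1, z2, z3, z4⟩ := hz
      have z5 : g z ≠ x := by rw [← h3]; simpa using z4
      have z6 : g z ≠ g x := by simpa using z2
      have z7 : g z ≠ g (g x) := by simpa using z3
      by_cases hz2 : g (g z) = z
      · refine cycleType_of_five hg (l := [x, g x, g (g x), z, g z]) (c := [1, 2, 0, 4, 3])
          ?_ rfl ?_ (imageCheck_three 3 (by simp))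
        · simp [h1.symm, h2.symm, z1.symm, z2.symm, z3.symm, z4.symm, z5.symm]
        · intro i hi; interval_cases i <;> simp [h3, hz2]
      · refine cycleType_of_six hg (l := [x, g x, g (g x), z, g z, g (g z)]) (c := [1, 2, 0, 4])
          ?_ rfl ?_ rfl ?_
        · have z8 : g (g z) ≠ x := by rw [← h3]; simpa using z7
          have z9 : x ≠ g (g z) := z8.symm
          have z10 : z ≠ g (g z) := fun h => hz2 h.symm
          simp [h1.symm, h2.symm, z1.symm, z2.symm, z3.symm, z4.symm, z5.symm, z9, z10]
        · intro i hi; interval_cases i <;> simp [h3]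
        · intro y hy; exact imageCheck_three y (by simp at hy ⊢; omega)
    -- All letters outside the 3-cycle are fixed. This case is not excluded in advance; two fixed
    -- letters serve as the missing ones.
    · push Not at hz
      obtain ⟨a, ha⟩ : ∃ a, a ∉ ({x, g x, g (g x)} : Finset Letter) := by
        by_contra! h
        have := Finset.card_le_card (fun a _ => h a : (Finset.univ : Finset Letter) ⊆ _)
        have h' := Finset.card_le_three (a := x) (b := g x) (c := g (g x))
        have h'' : (Finset.univ : Finset Letter).card = 24 := by decide
        omega
      obtain ⟨b, hb⟩ : ∃ b, b ∉ ({x, g x, g (g x), a} : Finset Letter) := by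
        by_contra! h
        have := Finset.card_le_card (fun a _ => h a : (Finset.univ : Finset Letter) ⊆ _)
        have h' := Finset.card_le_four (a := x) (b := g x) (c := g (g x)) (d := a)
        have h'' : (Finset.univ : Finset Letter).card = 24 := by decide
        omega
      simp only [Finset.mem_insert, Finset.mem_singleton, not_or] at ha hb
      have ga : g a = a := by
        by_contra h; exact ha.2.2 (hz a h ha.1 ha.2.1)
      have gb : g b = b := by
        by_contra h; exact hb.2.2.1 (hz b h hb.1 hb.2.1)
      refine cycleType_of_five hg (l := [x, g x, g (g x), a, b]) (c := [1, 2, 0, 3, 4])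
          ?_ rfl ?_ imageCheck_three_fixed
      · simp [h1.symm, h2.symm, Ne.symm ha.1, Ne.symm ha.2.1, Ne.symm ha.2.2, Ne.symm hb.1,
          Ne.symm hb.2.1, Ne.symm hb.2.2.1, Ne.symm hb.2.2.2]
      · intro i hi; interval_cases i <;> simp [h3, ga, gb]
  · have h3' : x ≠ g (g (g x)) := fun h => h3 h.symm
    by_cases h4 : g (g (g (g x))) = x
    · obtain ⟨a, ha⟩ : ∃ a, a ∉ ({x, g x, g (g x), g (g (g x))} : Finset Letter) := by
        by_contra! h
        have := Finset.card_le_card (fun a _ => h a : (Finset.univ : Finset Letter) ⊆ _)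
        have h' := Finset.card_le_four (a := x) (b := g x) (c := g (g x)) (d := g (g (g x)))
        have h'' : (Finset.univ : Finset Letter).card = 24 := by decide
        omega
      simp only [Finset.mem_insert, Finset.mem_singleton, not_or] at ha
      obtain ⟨a1, a2, a3, a4⟩ := ha
      by_cases ga : g a = a
      · refine cycleType_of_five hg (l := [x, g x, g (g x), g (g (g x)), a])
          (c := [1, 2, 3, 0, 4]) ?_ rfl ?_ (imageCheck_four 4 (by simp))
        · simp [h1.symm, h2.symm, h3', Ne.symm a1, Ne.symm a2, Ne.symm a3, Ne.symm a4]
        · intro i hi; interval_cases i <;> simp [h4, ga]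
      · refine cycleType_of_six hg (l := [x, g x, g (g x), g (g (g x)), a, g a])
          (c := [1, 2, 3, 0]) ?_ rfl ?_ rfl ?_
        · have a5 : x ≠ g a := by rw [← h4]; simpa using Ne.symm a4
          have a6 : a ≠ g a := Ne.symm ga
          simp [h1.symm, h2.symm, h3', Ne.symm a1, Ne.symm a2, Ne.symm a3, Ne.symm a4, a5, a6]
        · intro i hi; interval_cases i <;> simp [h4]
        · intro y hy; exact imageCheck_four y (by simp at hy ⊢; omega)
    · have h4' : x ≠ g (g (g (g x))) := fun h => h4 h.symm
      by_cases h5 : g (g (g (g (g x)))) = x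
      · refine cycleType_of_five hg (l := [x, g x, g (g x), g (g (g x)), g (g (g (g x)))])
          (c := [1, 2, 3, 4, 0]) ?_ rfl ?_ (imageCheck_cycle 0 (by simp))
        · simp [h1.symm, h2.symm, h3', h4']
        · intro i hi; interval_cases i <;> simp [h5]
      · have h5' : x ≠ g (g (g (g (g x)))) := fun h => h5 h.symm
        refine cycleType_of_six hg
          (l := [x, g x, g (g x), g (g (g x)), g (g (g (g x))), g (g (g (g (g x))))])
          (c := [1, 2, 3, 4]) ?_ rfl ?_ rfl ?_
        · simp [h1.symm, h2.symm, h3', h4', h5']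
        · intro i hi; interval_cases i <;> simp
        · intro y hy; exact imageCheck_cycle y (by simp at hy ⊢; omega)

/-- The cycle shapes of the elements of `M₂₄`. -/
theorem exists_cycleType_eq {g : Equiv.Perm Letter} (hg : g ∈ M24) :
    ∃ s ∈ shapes, g.cycleType = (s : Multiset ℕ) := by
  by_cases h2 : ∃ x, g (g x) ≠ x
  · obtain ⟨x, hx⟩ := h2
    exact cycleType_of_sq_ne hg hx
  push Not at h2
  -- Here g² = 1, and two transpositions with one more letter are used if they exist.
  by_cases h1 : ∃ x, g x ≠ x
  · obtain ⟨x, h1⟩ := h1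
    by_cases hz : ∃ z, g z ≠ z ∧ z ≠ x ∧ z ≠ g x
    · obtain ⟨z, z1, z2, z3⟩ := hz
      have z5 : x ≠ g z := by rw [← h2 x]; simpa using z3.symm
      obtain ⟨a, ha⟩ : ∃ a, a ∉ ({x, g x, z, g z} : Finset Letter) := by
        by_contra! h
        have := Finset.card_le_card (fun a _ => h a : (Finset.univ : Finset Letter) ⊆ _)
        have h' := Finset.card_le_four (a := x) (b := g x) (c := z) (d := g z)
        have h'' : (Finset.univ : Finset Letter).card = 24 := by decide
        omega
      simp only [Finset.mem_insert, Finset.mem_singleton, not_or] at ha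
      obtain ⟨a1, a2, a3, a4⟩ := ha
      by_cases ga : g a = a
      · refine cycleType_of_five hg (l := [x, g x, z, g z, a])
          (c := [1, 0, 3, 2, 4]) ?_ rfl ?_ (imageCheck_two 4 (by simp))
        · simp [h1.symm, z1.symm, z2.symm, z3.symm, z5, Ne.symm a1, Ne.symm a2, Ne.symm a3,
            Ne.symm a4]
        · intro i hi; interval_cases i <;> simp [h2, ga]
      · refine cycleType_of_six hg (l := [x, g x, z, g z, a, g a])
          (c := [1, 0, 3, 2]) ?_ rfl ?_ rfl ?_
        · have a5 : x ≠ g a := by rw [← h2 x]; simpa using Ne.symm a2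
          have a6 : z ≠ g a := by rw [← h2 z]; simpa using Ne.symm a4
          have a7 : a ≠ g a := Ne.symm ga
          simp [h1.symm, z1.symm, z2.symm, z3.symm, z5, Ne.symm a1, Ne.symm a2, Ne.symm a3,
            Ne.symm a4, a5, a6, a7]
        · intro i hi; interval_cases i <;> simp [h2]
        · intro y hy; exact imageCheck_two y (by simp at hy ⊢; omega)
    · push Not at hz
      have hfix : ∀ a, a ≠ x → a ≠ g x → g a = a := fun a a1 a2 => by
        by_contra h; exact a2 (hz a h a1)
      obtain ⟨a, ha⟩ : ∃ a, a ∉ ({x, g x} : Finset Letter) := by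
        by_contra! h
        have := Finset.card_le_card (fun a _ => h a : (Finset.univ : Finset Letter) ⊆ _)
        have h' := Finset.card_le_two (a := x) (b := g x)
        have h'' : (Finset.univ : Finset Letter).card = 24 := by decide
        omega
      obtain ⟨b, hb⟩ : ∃ b, b ∉ ({x, g x, a} : Finset Letter) := by
        by_contra! h
        have := Finset.card_le_card (fun a _ => h a : (Finset.univ : Finset Letter) ⊆ _)
        have h' := Finset.card_le_three (a := x) (b := g x) (c := a)
        have h'' : (Finset.univ : Finset Letter).card = 24 := by decide
        omega
      obtain ⟨c, hc⟩ : ∃ c, c ∉ ({x, g x, a, b} : Finset Letter) := by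
        by_contra! h
        have := Finset.card_le_card (fun a _ => h a : (Finset.univ : Finset Letter) ⊆ _)
        have h' := Finset.card_le_four (a := x) (b := g x) (c := a) (d := b)
        have h'' : (Finset.univ : Finset Letter).card = 24 := by decide
        omega
      simp only [Finset.mem_insert, Finset.mem_singleton, not_or] at ha hb hc
      refine cycleType_of_five hg (l := [x, g x, a, b, c]) (c := [1, 0, 2, 3, 4])
          ?_ rfl ?_ imageCheck_two_fixed
      · simp [h1.symm, Ne.symm ha.1, Ne.symm ha.2, Ne.symm hb.1,
          Ne.symm hb.2.1, Ne.symm hb.2.2, Ne.symm hc.1, Ne.symm hc.2.1, Ne.symm hc.2.2.1,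
          Ne.symm hc.2.2.2]
      · intro i hi
        have := hfix a ha.1 ha.2
        have := hfix b hb.1 hb.2.1
        have := hfix c hc.1 hc.2.1
        interval_cases i <;> simp [*]
  · push Not at h1
    obtain rfl : g = 1 := by ext1 x; exact h1 x
    exact ⟨[], by simp [shapes], by simp⟩

end Mathieu

namespace Mathieu

open Polynomial

/-! ### The characteristic polynomial of a permutation -/

section charpoly

lemma permMatrix_apply {n : Type*} [DecidableEq n] (σ : Equiv.Perm n) (i j : n) :
    σ.permMatrix ℂ i j = if σ i = j then 1 else 0 := by
  simp [Equiv.Perm.permMatrix, PEquiv.toMatrix_apply, Equiv.toPEquiv_apply, eq_comm]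

variable {n : Type*} [DecidableEq n]

lemma permMatrix_add_of_disjoint {σ τ : Equiv.Perm n} (h : σ.Disjoint τ) :
    σ.permMatrix ℂ + τ.permMatrix ℂ = 1 + (σ * τ).permMatrix ℂ := by
  ext i j
  simp only [Matrix.add_apply, permMatrix_apply, Matrix.one_apply]
  rcases h i with h1 | h1
  · have h2 : (σ * τ) i = τ i := by
      rw [Equiv.Perm.mul_apply]
      rcases h (τ i) with h2 | h2
      · exact h2
      · rw [τ.injective h2, h1]
    rw [h1, h2]
  · have h2 : (σ * τ) i = σ i := by rw [Equiv.Perm.mul_apply, h1]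
    rw [h1, h2, add_comm]

variable [Fintype n]

/-- For disjoint permutations P + Q = 1 + PQ, hence (X - P)(X - Q) = (X - 1)(X - PQ); take
determinants. -/
lemma charpoly_mul_of_disjoint {σ τ : Equiv.Perm n} (h : σ.Disjoint τ) :
    (σ.permMatrix ℂ).charpoly * (τ.permMatrix ℂ).charpoly =
      (X - 1) ^ Fintype.card n * ((σ * τ).permMatrix ℂ).charpoly := by
  have h1 : (X - 1 : ℂ[X]) ^ Fintype.card n = (1 : Matrix n n ℂ).charpoly := Matrix.charpoly_one.symm
  rw [h1, Matrix.charpoly, Matrix.charpoly, Matrix.charpoly, Matrix.charpoly, ← Matrix.det_mul,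
    ← Matrix.det_mul]
  congr 1
  apply (matPolyEquiv (R := ℂ) (n := n)).injective
  simp only [map_mul, Matrix.matPolyEquiv_charmatrix]
  have h2 : (τ.permMatrix ℂ) + (σ.permMatrix ℂ) = 1 + (σ * τ).permMatrix ℂ := by
    rw [add_comm, permMatrix_add_of_disjoint h]
  have h3 : (σ * τ).permMatrix ℂ = σ.permMatrix ℂ * τ.permMatrix ℂ := by
    rw [h.commute.eq, Matrix.permMatrix_mul]
  have h4 : C (σ.permMatrix ℂ) * C (τ.permMatrix ℂ) = C ((σ * τ).permMatrix ℂ) := by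
    rw [h3, map_mul]
  have h5 : C (τ.permMatrix ℂ) + C (σ.permMatrix ℂ) = C 1 + C ((σ * τ).permMatrix ℂ) := by
    rw [← map_add, h2, map_add]
  simp only [sub_mul, mul_sub, h4, X_mul_C, map_one, one_mul]
  have h6 := congrArg (· * (X : (Matrix n n ℂ)[X])) h5
  simp only [add_mul, map_one, one_mul] at h6
  have h7 : C (τ.permMatrix ℂ) * X = X + C ((σ * τ).permMatrix ℂ) * X - C (σ.permMatrix ℂ) * X := by
    rw [← h6]; abel
  rw [h7]; abel

lemma perm_eq_one_or_eq_of_isCycle {c σ : Equiv.Perm n} (hc : c.IsCycle)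
    (h : ∀ i, σ i = i ∨ σ i = c i) : σ = 1 ∨ σ = c := by
  by_cases h1 : ∃ x, σ x ≠ x
  · right
    obtain ⟨x, hx⟩ := h1
    have hx1 : σ x = c x := (h x).resolve_left hx
    have hcx : c x ≠ x := hx1 ▸ hx
    have hpow : ∀ k : ℕ, σ ((c ^ k) x) = c ((c ^ k) x) := by
      intro k
      induction k with
      | zero => simpa using hx1
      | succ k ih =>
        refine (h _).resolve_left fun h2 => ?_
        rw [pow_succ', Equiv.Perm.mul_apply, ← ih] at h2
        have h3 := σ.injective h2
        rw [ih] at h3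
        have h4 : (c ^ k) (c x) = (c ^ k) x := by
          rw [← Equiv.Perm.mul_apply, ← pow_succ, pow_succ', Equiv.Perm.mul_apply, h3]
        exact hcx ((c ^ k).injective h4)
    ext1 y
    by_cases hy : c y = y
    · rcases h y with h2 | h2
      · rw [h2, hy]
      · exact h2
    · obtain ⟨k, -, rfl⟩ := (hc.sameCycle hcx hy).exists_pow_eq'
      exact hpow k
  · left
    push Not at h1
    ext1 x
    exact h1 x

/-- In the Leibniz formula a term is nonzero only if the permutation sends each i to i or to c i.
For a cycle c these are 1 and c alone, by `perm_eq_one_or_eq_of_isCycle`. -/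
lemma charpoly_of_isCycle {c : Equiv.Perm n} (hc : c.IsCycle) :
    (c.permMatrix ℂ).charpoly =
      (X ^ c.support.card - 1) * (X - 1) ^ (Fintype.card n - c.support.card) := by
  rw [Matrix.charpoly, ← Matrix.det_transpose, Matrix.det_apply']
  have hcard : Fintype.card n - c.support.card = c.supportᶜ.card := (Finset.card_compl _).symm
  have hent : ∀ i j, (c.permMatrix ℂ).charmatrix i j =
      (if i = j then X else 0) - if c i = j then 1 else 0 := by
    intro i j
    rw [Matrix.charmatrix_apply, permMatrix_apply, Matrix.diagonal_apply]
    split_ifs <;> simp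
  simp only [Matrix.transpose_apply, hent]
  rw [← Finset.sum_subset (Finset.subset_univ {1, c})]
  · rw [Finset.sum_pair hc.ne_one.symm, hc.sign]
    have h1 : ∀ i, ((if i = (1 : Equiv.Perm n) i then (X : ℂ[X]) else 0) -
        if c i = (1 : Equiv.Perm n) i then 1 else 0) = if i ∈ c.support then X else X - 1 := by
      intro i
      by_cases h : c i = i <;> simp [h]
    have h2 : ∀ i, ((if i = c i then (X : ℂ[X]) else 0) - if c i = c i then 1 else 0) =
        if i ∈ c.support then -1 else X - 1 := by
      intro i
      by_cases h : c i = i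
      · simp [h]
      · simp [h, Ne.symm h]
    rw [Finset.prod_congr rfl fun i _ => h1 i, Finset.prod_congr rfl fun i _ => h2 i]
    have h3 : ∀ a b : ℂ[X], ∏ i, (if i ∈ c.support then a else b) =
        a ^ c.support.card * b ^ c.supportᶜ.card := by
      intro a b
      rw [Finset.prod_ite, Finset.prod_const, Finset.prod_const]
      congr 3
      · ext; simp
      · ext; simp
    rw [h3, h3, hcard]
    simp only [Equiv.Perm.sign_one]
    have h4 : (-1 : ℂ[X]) ^ c.support.card * (-1) ^ c.support.card = 1 := by
      rw [← mul_pow]; simp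
    push_cast
    linear_combination -(X - 1) ^ c.supportᶜ.card * h4
  · intro σ _ hσ
    rw [Finset.mem_insert, Finset.mem_singleton] at hσ
    by_cases h : ∀ i, σ i = i ∨ σ i = c i
    · exact absurd (perm_eq_one_or_eq_of_isCycle hc h) hσ
    · push Not at h
      obtain ⟨i, h1, h2⟩ := h
      rw [Finset.prod_eq_zero (Finset.mem_univ i), mul_zero]
      rw [if_neg h1.symm, if_neg h2.symm, sub_zero]

lemma X_sub_one_ne_zero : (X - 1 : ℂ[X]) ≠ 0 := by
  simpa using X_sub_C_ne_zero (1 : ℂ)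

lemma charpoly_permMatrix (σ : Equiv.Perm n) :
    (σ.permMatrix ℂ).charpoly = (σ.cycleType.map fun m => (X ^ m - 1 : ℂ[X])).prod *
      (X - 1) ^ (Fintype.card n - σ.support.card) := by
  induction σ using Equiv.Perm.cycle_induction_on with
  | base_one => simp [Matrix.permMatrix_one, Matrix.charpoly_one]
  | base_cycles σ hσ => simp [charpoly_of_isCycle hσ, hσ.cycleType]
  | induction_disjoint σ τ hd _ h1 h2 =>
    have h3 := charpoly_mul_of_disjoint hd
    refine mul_left_cancel₀ (pow_ne_zero (Fintype.card n) X_sub_one_ne_zero) ?_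
    rw [← h3, h1, h2, hd.cycleType_mul, Multiset.map_add, Multiset.prod_add, hd.card_support_mul]
    have h4 : σ.support.card + τ.support.card ≤ Fintype.card n := by
      rw [← hd.card_support_mul]; exact Finset.card_le_univ _
    have h5 : (X - 1 : ℂ[X]) ^ (Fintype.card n - σ.support.card) *
        (X - 1) ^ (Fintype.card n - τ.support.card) = (X - 1) ^ Fintype.card n *
        (X - 1) ^ (Fintype.card n - (σ.support.card + τ.support.card)) := by
      rw [← pow_add, ← pow_add]; congr 1; omega
    linear_combination (σ.cycleType.map fun m => (X ^ m - 1 : ℂ[X])).prod *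
      (τ.cycleType.map fun m => (X ^ m - 1 : ℂ[X])).prod * h5

/-- If the cycle shape, cycles of length one included, is the list `s`. -/
lemma charpoly_of_cycleType {σ : Equiv.Perm n} {s : List ℕ} (hs : ∀ m ∈ s, 0 < m)
    (hsum : s.sum = Fintype.card n) (h : σ.cycleType = Multiset.filter (1 < ·) (s : Multiset ℕ)) :
    (σ.permMatrix ℂ).charpoly = (s.map fun m => (X ^ m - 1 : ℂ[X])).prod ∧
      Fintype.card n - σ.support.card = s.count 1 := by
  have h1 : (s : Multiset ℕ) = σ.cycleType + Multiset.replicate (s.count 1) 1 := by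
    rw [h, ← Multiset.coe_count, ← Multiset.filter_eq']
    conv_lhs => rw [← Multiset.filter_add_not (1 < ·) (s : Multiset ℕ)]
    congr 1
    refine Multiset.filter_congr fun m hm => ?_
    have := hs m (by simpa using hm)
    omega
  have h2 : Fintype.card n - σ.support.card = s.count 1 := by
    have := congrArg Multiset.sum h1
    rw [Multiset.sum_add, Multiset.sum_coe, hsum, σ.sum_cycleType] at this
    simp at this
    omega
  refine ⟨?_, h2⟩
  rw [charpoly_permMatrix, h2, ← Multiset.prod_coe, ← Multiset.map_coe, h1, Multiset.map_add,
    Multiset.prod_add]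
  simp

end charpoly

end Mathieu

namespace Mathieu

open Polynomial

/-! ### Products over the eigenvalues -/

lemma poch_split (w : ℂ) {q : ℂ} (hq : ‖q‖ < 1) :
    poch w q = poch w (q ^ 2) * poch (w * q) (q ^ 2) := by
  have hq2 : ‖q ^ 2‖ < 1 := by
    rw [norm_pow]; exact pow_lt_one₀ (norm_nonneg _) hq two_ne_zero
  have h1 : ∀ k : ℕ, 1 - w * (q ^ 2) ^ k = 1 - w * q ^ (2 * k) := fun k => by rw [pow_mul]
  have h2 : ∀ k : ℕ, 1 - w * q * (q ^ 2) ^ k = 1 - w * q ^ (2 * k + 1) := fun k => by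
    rw [← pow_mul]; ring
  have m1 := multipliable_poch w hq2
  have m2 := multipliable_poch (w * q) hq2
  rw [poch, poch, poch]
  simp only [h1, h2] at m1 m2 ⊢
  exact (tprod_even_mul_odd (f := fun n : ℕ => 1 - w * q ^ n) m1 m2).symm

lemma pochProd_split {s : List ℕ} (hs : ∀ m ∈ s, 0 < m) (w : ℂ) {q : ℂ} (hq : ‖q‖ < 1) :
    pochProd s w q = pochProd s w (q ^ 2) * pochProd s (w * q) (q ^ 2) := by
  rw [pochProd, pochProd, pochProd, ← List.prod_map_mul]
  congr 1
  refine List.map_congr_left fun m hm => ?_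
  have hm' : ‖q ^ m‖ < 1 := by
    rw [norm_pow]; exact pow_lt_one₀ (norm_nonneg _) hq (hs m hm).ne'
  rw [poch_split _ hm', mul_pow, pow_right_comm]

lemma pochProd_ne_zero_of_norm_lt {s : List ℕ} (hs : ∀ m ∈ s, 0 < m) {w q : ℂ} (hw : ‖w‖ < 1)
    (hq : ‖q‖ < 1) : pochProd s w q ≠ 0 := by
  rw [pochProd, Ne, List.prod_eq_zero_iff, List.mem_map]
  rintro ⟨m, hm, h⟩
  have hm' : ∀ {x : ℂ}, ‖x‖ < 1 → ‖x ^ m‖ < 1 := fun hx => by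
    rw [norm_pow]; exact pow_lt_one₀ (norm_nonneg _) hx (hs m hm).ne'
  refine poch_ne_zero (hm' hq) (fun n h1 => ?_) h
  have h2 := congrArg norm h1
  rw [norm_mul, norm_pow (q ^ m), norm_one] at h2
  have := mul_lt_one_of_nonneg_of_lt_one_left (norm_nonneg (w ^ m)) (hm' hw)
    (pow_le_one₀ (norm_nonneg _) (hm' hq).le : ‖q ^ m‖ ^ n ≤ 1)
  linarith

section eigenvalues

variable {lam : Fin 12 → ℂ} {s : List ℕ}

lemma prod_one_sub_eigenvalue (hs : ∀ m ∈ s, 0 < m)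
    (h : ∏ i, (X - C (lam i)) * (X - C (lam i)⁻¹) = (s.map fun m => (X ^ m - 1 : ℂ[X])).prod)
    (x : ℂ) :
    ∏ i, (1 - (lam i)⁻¹ * x) * (1 - lam i * x) = (s.map fun m => 1 - x ^ m).prod := by
  have h0 := lam_ne_zero hs h
  have h1 : ∀ x : ℂ, ∏ i, (1 - (lam i)⁻¹ * x) * (1 - lam i * x) =
      (-1) ^ s.length * (s.map fun m => 1 - x ^ m).prod := by
    intro x
    have h2 := congrArg (eval x) h
    rw [eval_prod, eval_list_prod, List.map_map] at h2
    have h3 : (s.map (eval x ∘ fun m => (X ^ m - 1 : ℂ[X]))).prod =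
        (-1) ^ s.length * (s.map fun m => 1 - x ^ m).prod := by
      clear h h0 h2 hs
      induction s with
      | nil => simp
      | cons m s ih => simp only [List.map_cons, List.prod_cons, List.length_cons, ih, pow_succ,
          Function.comp_apply, eval_sub, eval_pow, eval_X, eval_one]; ring
    rw [← h3, ← h2]
    refine Finset.prod_congr rfl fun i _ => ?_
    have := h0 i
    simp only [eval_mul, eval_sub, eval_X, eval_C]
    field_simp
    ring
  -- The sign (-1) to the number of cycles is found to be 1 by evaluating at zero.
  have h4 := h1 0
  have h5 : (s.map fun m => 1 - (0 : ℂ) ^ m).prod = 1 := by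
    refine List.prod_eq_one fun y hy => ?_
    obtain ⟨m, hm, rfl⟩ := List.mem_map.1 hy
    simp [(hs m hm).ne']
  rw [h5] at h4
  rw [h1 x]
  simp at h4
  rw [← h4, one_mul]

lemma etaEig_eq (hs : ∀ m ∈ s, 0 < m)
    (h : ∏ i, (X - C (lam i)) * (X - C (lam i)⁻¹) = (s.map fun m => (X ^ m - 1 : ℂ[X])).prod)
    {τ : ℂ} (hτ : 0 < τ.im) : etaEig lam τ = ex τ * pochProd s (ex τ) (ex τ) := by
  rw [etaEig, pochProd, ← (list_prod_poch (norm_ex_lt_one hτ) s hs).2]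
  congr 1
  refine tprod_congr fun n => ?_
  rw [← prod_one_sub_eigenvalue hs h]
  refine Finset.prod_congr rfl fun i _ => ?_
  rw [← pow_succ', ← ex_nat_mul]
  push_cast
  ring

lemma etaEig_neg_eq (hs : ∀ m ∈ s, 0 < m)
    (h : ∏ i, (X - C (lam i)) * (X - C (lam i)⁻¹) = (s.map fun m => (X ^ m - 1 : ℂ[X])).prod)
    {τ : ℂ} (hτ : 0 < τ.im) :
    etaEig (fun i => -lam i) τ = ex τ * pochProd s (-ex τ) (ex τ) := by
  rw [etaEig, pochProd, ← (list_prod_poch (norm_ex_lt_one hτ) s hs).2]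
  congr 1
  refine tprod_congr fun n => ?_
  rw [← prod_one_sub_eigenvalue hs h]
  refine Finset.prod_congr rfl fun i _ => ?_
  rw [neg_mul (ex τ), ← pow_succ', ← ex_nat_mul, inv_neg]
  push_cast
  ring

lemma lam_pow_eq_one
    (h : ∏ i, (X - C (lam i)) * (X - C (lam i)⁻¹) = (s.map fun m => (X ^ m - 1 : ℂ[X])).prod)
    {k : ℕ} (hk : ∀ m ∈ s, m ∣ k) (i : Fin 12) : lam i ^ k = 1 := by
  have h1 := congrArg (eval (lam i)) h
  rw [eval_prod, Finset.prod_eq_zero (Finset.mem_univ i) (by simp), eval_list_prod,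
    List.map_map, eq_comm, List.prod_eq_zero_iff, List.mem_map] at h1
  obtain ⟨m, hm, h2⟩ := h1
  simp only [Function.comp_apply, eval_sub, eval_pow, eval_X, eval_one, sub_eq_zero] at h2
  obtain ⟨j, rfl⟩ := hk m hm
  rw [pow_mul, h2, one_pow]

/-- Eigenvalues up to inversion are determined by the characteristic polynomial. -/
lemma prod_eq_of_prod_X_sub_eq {mu : Fin 12 → ℂ}
    (h : ∏ i, (X - C (lam i)) * (X - C (lam i)⁻¹) = ∏ i, (X - C (mu i)) * (X - C (mu i)⁻¹))
    {f : ℂ → ℂ} (hf : ∀ x, f x⁻¹ = f x) : ∏ i, f (lam i) = ∏ i, f (mu i) := by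
  -- Since f is invariant under inversion, the multiset of its values at the roots is twice the
  -- multiset of the f(λᵢ), and multiplication by two is injective on multisets.
  have key : ∀ l : Fin 12 → ℂ, ((∏ i, (X - C (l i)) * (X - C (l i)⁻¹)).roots).map f =
      2 • (Finset.univ.val.map fun i => f (l i)) := by
    intro l
    have h1 : ∏ i, (X - C (l i)) * (X - C (l i)⁻¹) =
        (((Finset.univ.val.map l) + (Finset.univ.val.map fun i => (l i)⁻¹)).map
          fun a => X - C a).prod := by
      rw [Multiset.map_add, Multiset.prod_add, Multiset.map_map, Multiset.map_map,
        Finset.prod_mul_distrib]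
      rfl
    rw [h1, roots_multiset_prod_X_sub_C, Multiset.map_add, Multiset.map_map, Multiset.map_map,
      two_nsmul]
    congr 1
    exact Multiset.map_congr rfl fun i _ => hf _
  have h2 : 2 • (Finset.univ.val.map fun i => f (lam i)) =
      2 • (Finset.univ.val.map fun i => f (mu i)) := by
    rw [← key, ← key, h]
  have h3 : (Finset.univ.val.map fun i => f (lam i)) = Finset.univ.val.map fun i => f (mu i) := by
    ext a
    have := congrArg (Multiset.count a) h2
    rw [Multiset.count_nsmul, Multiset.count_nsmul] at this
    omega
  exact congrArg Multiset.prod h3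

end eigenvalues

end Mathieu

namespace Mathieu

open Polynomial

/-! ### Labellings -/

/-- The data belong to the cycle shape of `g`. -/
def ShapeData.Fits (d : ShapeData) (g : Equiv.Perm Letter) : Prop :=
  d.s.sum = 24 ∧ g.cycleType = Multiset.filter (1 < ·) (d.s : Multiset ℕ)

lemma ShapeData.Valid.eigenData {d : ShapeData} (hd : d.Valid) : EigenData d.N d.a d.s := hd.1.1

lemma ShapeData.Valid.pos {d : ShapeData} (hd : d.Valid) : ∀ m ∈ d.s, 0 < m :=
  fun m hm => (hd.eigenData.1 m hm).1

lemma ShapeData.Valid.N_pos {d : ShapeData} (hd : d.Valid) : 0 < d.N := hd.1.2.1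

lemma ShapeData.Valid.sum_eq {d : ShapeData} (hd : d.Valid) : ∑ i, d.a i = 0 := hd.1.2.2.2.1

lemma ShapeData.Valid.fixed {d : ShapeData} (hd : d.Valid) : d.a 10 = 0 ∧ d.a 11 = 0 :=
  hd.1.2.2.2.2

lemma ShapeData.Valid.C_sq {d : ShapeData} (hd : d.Valid) :
    d.C ^ 2 = (d.s.map fun m => 1 - (-1 : ℤ) ^ m).prod := hd.2.2.1

lemma ShapeData.Valid.C_pos {d : ShapeData} (hd : d.Valid) :
    d.C = 0 ∨ 0 < d.C ∧ ∀ i, |2 * d.a i| < d.N := hd.2.2.2.1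

lemma ShapeData.Valid.t_sq {d : ShapeData} (hd : d.Valid) : 4 ≤ d.s.length ∧ 0 ≤ d.t ∧
    d.t ^ 2 = 0 ^ (d.s.length - 4) * (d.s.map fun m : ℕ => (m : ℤ)).prod :=
  ⟨hd.2.2.2.2.1.2.1, hd.2.2.2.2.1.2.2.1, hd.2.2.2.2.1.2.2.2.1⟩

section labelling

variable {d : ShapeData} {g : Equiv.Perm Letter}

lemma ShapeData.Fits.charpoly (hg : d.Fits g) (hd : d.Valid) :
    (g.permMatrix ℂ).charpoly = (d.s.map fun m => (X ^ m - 1 : ℂ[X])).prod :=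
  (charpoly_of_cycleType hd.pos (by rw [hg.1]; decide) hg.2).1

lemma ShapeData.Fits.chi_eq (hg : d.Fits g) (hd : d.Valid) : chi g = d.s.count 1 := by
  have h := (charpoly_of_cycleType (σ := g) hd.pos
    (by rw [hg.1]; decide) hg.2).2
  rw [← h, chi, ← Finset.card_compl]
  congr 1
  ext x
  simp

lemma ShapeData.Fits.dvd_orderOf (hg : d.Fits g) (hd : d.Valid) : ∀ m ∈ d.s, m ∣ orderOf g := by
  intro m hm
  by_cases h : m = 1
  · exact h ▸ one_dvd _
  · refine Equiv.Perm.dvd_of_mem_cycleType ?_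
    rw [hg.2, Multiset.mem_filter]
    have := hd.pos m hm
    exact ⟨by simpa using hm, by omega⟩

lemma ShapeData.Fits.odd_orderOf (hg : d.Fits g) (hC : (d.s.map fun m => 1 - (-1 : ℤ) ^ m).prod ≠ 0) :
    Odd (orderOf g) := by
  have h1 : ∀ m ∈ d.s, Odd m := by
    intro m hm
    by_contra h
    rw [Nat.not_odd_iff_even] at h
    exact hC (List.prod_eq_zero (List.mem_map.2 ⟨m, hm, by simp [h]⟩))
  have h2 : Odd d.s.prod := by
    clear hC hg
    generalize d.s = s at h1
    induction s with
    | nil => simp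
    | cons m s ih =>
      rw [List.prod_cons]
      exact (h1 m List.mem_cons_self).mul (ih fun n hn => h1 n (List.mem_cons_of_mem _ hn))
  refine h2.of_dvd_nat ?_
  rw [← Equiv.Perm.lcm_cycleType, Multiset.lcm_dvd]
  intro m hm
  rw [hg.2, Multiset.mem_filter] at hm
  exact List.dvd_prod (by simpa using hm.1)

lemma ShapeData.Valid.prod_X_sub (hd : d.Valid) :
    ∏ i, (X - Polynomial.C (ex (1 / d.N) ^ d.a i)) * (X - Polynomial.C (ex (1 / d.N) ^ d.a i)⁻¹) =
      (d.s.map fun m => (X ^ m - 1 : ℂ[X])).prod := by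
  have hζ := isPrimitiveRoot_ex hd.N_pos dvd_rfl (prim_one d.N)
  rw [Int.cast_one] at hζ
  simpa only [zpow_neg] using hd.eigenData.prod_X_sub hd.N_pos hζ

lemma ShapeData.Valid.prod_ten_eq (hd : d.Valid) {lam nu : Fin 12 → ℂ}
    (h : ∏ i, (X - Polynomial.C (lam i)) * (X - Polynomial.C (lam i)⁻¹) =
      (d.s.map fun m => (X ^ m - 1 : ℂ[X])).prod)
    (hnu : ∀ i, nu i ^ 2 = lam i) (h10 : lam 10 = 1) (h11 : lam 11 = 1) :
    (∏ i : Fin 10, nu (i.castAdd 2) * (1 - (lam (i.castAdd 2))⁻¹)) = d.t ∨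
      (∏ i : Fin 10, nu (i.castAdd 2) * (1 - (lam (i.castAdd 2))⁻¹)) = -d.t := by
  refine sq_eq_sq_iff_eq_or_eq_neg.1 ?_
  obtain ⟨hlen, -, ht⟩ := hd.t_sq
  rw [prod_ten_sq hd.pos h hnu h10 h11 hlen]
  have := congrArg (Int.cast : ℤ → ℂ) ht
  push_cast [List.map_map] at this
  rw [this]
  simp only [Function.comp_def, Int.cast_natCast]

/-- There is a labelling of the eigenvalues. -/
theorem ShapeData.Fits.nonempty_labelling (hg : d.Fits g) (hd : d.Valid) :
    Nonempty (Labelling g) := by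
  have hN : (d.N : ℂ) ≠ 0 := by exact_mod_cast hd.N_pos.ne'
  set lam : Fin 12 → ℂ := fun i => ex (1 / d.N) ^ d.a i with hlam
  set nu : Fin 12 → ℂ := fun i => ex (d.a i / (2 * d.N)) with hnud
  have hnu : ∀ i, nu i ^ 2 = lam i := by
    intro i
    rw [hlam, hnud]
    simp only
    rw [← ex_int_mul, ← ex_nat_mul]
    congr 1
    push_cast
    field_simp
  have hch : ∏ i, (X - Polynomial.C (lam i)) * (X - Polynomial.C (lam i)⁻¹) =
    (d.s.map fun m => (X ^ m - 1 : ℂ[X])).prod := hd.prod_X_sub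
  have h10 : d.a 10 = 0 := hd.fixed.1
  have h11 : d.a 11 = 0 := hd.fixed.2
  have hprod : ∏ i, nu i = 1 := by
    have h1 : ∏ i, nu i = ex (∑ i, (d.a i : ℂ) / (2 * d.N)) := (ex_sum _ _).symm
    rw [h1, ← Finset.sum_div, ← Int.cast_sum, hd.sum_eq]
    simp [ex]
  have h0 := lam_ne_zero hd.pos hch
  have hn0 : ∀ i, nu i ≠ 0 := fun i => ex_ne_zero _
  have hl10 : lam 10 = 1 := by simp [hlam, h10]
  have hl11 : lam 11 = 1 := by simp [hlam, h11]
  have hn10 : nu 10 = 1 := by simp [hnud, h10, ex]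
  have hn11 : nu 11 = 1 := by simp [hnud, h11, ex]
  have ht : (0 : ℤ) ≤ d.t := hd.t_sq.2.1
  rcases hd.prod_ten_eq (lam := lam) hch hnu hl10 hl11 with hD | hD
  -- If the standard labelling has D_g = t ≥ 0, inverting one eigenvalue changes the sign.
  · refine ⟨⟨Function.update lam 0 (lam 0)⁻¹, Function.update nu 0 (nu 0)⁻¹, ?_, ?_, ?_, ?_, ?_⟩⟩
    · rw [hg.charpoly hd, ← hch]
      refine Finset.prod_congr rfl fun i _ => ?_
      by_cases hi : i = 0
      · subst hi
        rw [Function.update_self, inv_inv, mul_comm]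
      · rw [Function.update_of_ne hi]
    · intro i
      by_cases hi : i = 0
      · subst hi
        rw [Function.update_self, Function.update_self, inv_pow, hnu]
      · rw [Function.update_of_ne hi, Function.update_of_ne hi, hnu]
    · rw [Function.update_of_ne (by decide), Function.update_of_ne (by decide)]
      exact ⟨hn10, hn11⟩
    · intro _
      -- The product of the square roots was 1 and is multiplied by ν₀⁻² = λ₀⁻¹, whose order divides
      -- that of g; the condition on the lift persists.
      have h1 : ∏ i, Function.update nu 0 (nu 0)⁻¹ i = (lam 0)⁻¹ := by
        rw [Fin.prod_univ_succ] at hprod ⊢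
        rw [Function.update_self]
        have h2 : ∀ i : Fin 11, Function.update nu 0 (nu 0)⁻¹ i.succ = nu i.succ := fun i =>
          Function.update_of_ne (Fin.succ_ne_zero i) _ _
        simp only [h2]
        rw [eq_inv_of_mul_eq_one_right hprod, ← hnu, pow_two, mul_inv]
      rw [h1, inv_pow, lam_pow_eq_one hch (hg.dvd_orderOf hd), inv_one]
    · have h1 : ∏ i : Fin 10, Function.update nu 0 (nu 0)⁻¹ (i.castAdd 2) *
          (1 - (Function.update lam 0 (lam 0)⁻¹ (i.castAdd 2))⁻¹) = -d.t := by
        rw [← hD, Fin.prod_univ_succ, eq_comm, Fin.prod_univ_succ, ← neg_mul, eq_comm]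
        have hz : (Fin.castAdd 2 (0 : Fin 10)) = (0 : Fin 12) := rfl
        congr 1
        rw [hz, Function.update_self, Function.update_self, inv_inv, ← hnu]
        have := hn0 0
        field_simp
        ring
      rw [h1]
      simpa using ht
  · refine ⟨⟨lam, nu, ?_, hnu, ⟨hn10, hn11⟩, fun _ => by rw [hprod, one_pow], ?_⟩⟩
    · rw [hg.charpoly hd, ← hch]
    · rw [hD]
      simpa using ht

end labelling

section invariants

variable {d : ShapeData} {g : Equiv.Perm Letter} (L : Labelling g)

lemma Labelling.prod_X_sub (hg : d.Fits g) (hd : d.Valid) :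
    ∏ i, (X - C (L.lam i)) * (X - C (L.lam i)⁻¹) =
      (d.s.map fun m => (X ^ m - 1 : ℂ[X])).prod := by
  rw [← hg.charpoly hd, L.charpoly_eq]

/-- The square of D_g is determined by the cycle shape through the value at 1 of the characteristic
polynomial divided by (X - 1)⁴; the sign condition selects the nonpositive root. -/
lemma Labelling.D_eq (hg : d.Fits g) (hd : d.Valid) : L.D = -d.t := by
  have h10 : L.lam 10 = 1 := by rw [← L.nu_sq, L.nu_fixed.1, one_pow]
  have h11 : L.lam 11 = 1 := by rw [← L.nu_sq, L.nu_fixed.2, one_pow]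
  rcases hd.prod_ten_eq (L.prod_X_sub hg hd) L.nu_sq h10 h11 with h | h
  · have h1 := L.sign
    rw [h] at h1
    have h2 : (0 : ℤ) ≤ d.t := hd.t_sq.2.1
    have h3 : d.t = 0 := by
      have : (d.t : ℝ) ≤ 0 := by simpa using h1
      have : d.t ≤ 0 := by exact_mod_cast this
      omega
    rw [Labelling.D, h, h3]
    simp
  · exact h

lemma Labelling.CNeg_sq (hg : d.Fits g) (hd : d.Valid) : L.CNeg ^ 2 = d.C ^ 2 := by
  have hs : ∀ m ∈ d.s, 0 < m := hd.pos
  have h1 := prod_one_sub_eigenvalue hs (L.prod_X_sub hg hd) (-1)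
  have h0 := lam_ne_zero hs (L.prod_X_sub hg hd)
  have h2 : L.CNeg ^ 2 = ∏ i, (1 - (L.lam i)⁻¹ * (-1)) * (1 - L.lam i * (-1)) := by
    rw [Labelling.CNeg, mul_pow, ← Finset.prod_pow, ← Finset.prod_pow, ← Finset.prod_mul_distrib]
    refine Finset.prod_congr rfl fun i _ => ?_
    rw [L.nu_sq]
    have := h0 i
    field_simp
    ring
  have h3 := congrArg (Int.cast : ℤ → ℂ) hd.C_sq
  push_cast [List.map_map] at h3
  rw [h2, h1, h3]
  simp [Function.comp_def]

lemma pow_mul_one_add_inv {w : ℂ} (hw : w ≠ 0) {k : ℕ} (h : w ^ (2 * k + 1) = 1) :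
    w ^ (k + 1) * (1 + w⁻¹) = w ^ (k + 1) + w⁻¹ ^ (k + 1) := by
  have h1 : w ^ k = w⁻¹ ^ (k + 1) := by
    rw [inv_pow]
    refine eq_inv_of_mul_eq_one_left ?_
    rw [← pow_add, ← h]; ring
  rw [← h1, pow_succ]
  field_simp

/-- If C is zero, the square decides. Otherwise the order of g is odd, say 2k + 1, and the lift
condition gives ∏ν = ∏λ^(k+1). Then C_{-g} = ∏(λ^(k+1) + λ^(-k-1)) is invariant under inversion of
each eigenvalue and can be compared with the standard labelling. -/
lemma Labelling.CNeg_eq (hg : d.Fits g) (hd : d.Valid) : L.CNeg = d.C := by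
  by_cases hC : d.C = 0
  · have := L.CNeg_sq hg hd
    rw [hC, Int.cast_zero, zero_pow two_ne_zero] at this
    rw [hC, Int.cast_zero]
    exact pow_eq_zero_iff two_ne_zero |>.1 this
  have hodd : Odd (orderOf g) := hg.odd_orderOf (by
    rw [← hd.C_sq]
    exact pow_ne_zero 2 hC)
  obtain ⟨k, hk⟩ := hodd
  have hs : ∀ m ∈ d.s, 0 < m := hd.pos
  have h0 := lam_ne_zero hs (L.prod_X_sub hg hd)
  have hl := L.lift ⟨k, hk⟩
  have hdiv := hg.dvd_orderOf hd
  rw [hk] at hl hdiv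
  have hpow := lam_pow_eq_one (L.prod_X_sub hg hd) hdiv
  have h1 : ∏ i, L.nu i = ∏ i, L.lam i ^ (k + 1) := by
    simp only [← L.nu_sq, ← pow_mul]
    rw [Finset.prod_pow, show 2 * (k + 1) = 2 * k + 1 + 1 by ring, pow_succ, hl, one_mul]
  have h2 : L.CNeg = ∏ i, (L.lam i ^ (k + 1) + (L.lam i)⁻¹ ^ (k + 1)) := by
    rw [Labelling.CNeg, h1, ← Finset.prod_mul_distrib]
    refine Finset.prod_congr rfl fun i _ => ?_
    exact pow_mul_one_add_inv (h0 i) (hpow i)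
  have hstd := hd.prod_X_sub
  rw [h2, prod_eq_of_prod_X_sub_eq (f := fun x => x ^ (k + 1) + x⁻¹ ^ (k + 1))
    ((L.prod_X_sub hg hd).trans hstd.symm) (fun x => by rw [inv_inv, add_comm])]
  have h5 := hd.eigenData.prod_one_add hd.N_pos hd.sum_eq hd.C_sq hd.C_pos
  rw [← h5]
  have hpow' := lam_pow_eq_one hstd hdiv
  set ζ := ex (1 / d.N)
  have hζ0 : ζ ≠ 0 := ex_ne_zero _
  have h6 : ∏ i, (ζ ^ d.a i) ^ (k + 1) = 1 := by
    rw [Finset.prod_pow, ← zpow_sum _ hζ0, hd.sum_eq, zpow_zero, one_pow]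
  have h7 : ∏ i, (1 + ζ ^ (-d.a i)) = (∏ i, (ζ ^ d.a i) ^ (k + 1)) * ∏ i, (1 + ζ ^ (-d.a i)) := by
    rw [h6, one_mul]
  rw [h7, ← Finset.prod_mul_distrib]
  refine Finset.prod_congr rfl fun i _ => ?_
  rw [zpow_neg]
  exact (pow_mul_one_add_inv (zpow_ne_zero _ hζ0) (hpow' i)).symm

lemma Labelling.etaPos_eq (hg : d.Fits g) (hd : d.Valid) {τ : ℂ} (hτ : 0 < τ.im) :
    L.etaPos τ = ex τ * pochProd d.s (ex τ) (ex τ) :=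
  etaEig_eq hd.pos (L.prod_X_sub hg hd) hτ

lemma Labelling.etaNeg_eq (hg : d.Fits g) (hd : d.Valid) {τ : ℂ} (hτ : 0 < τ.im) :
    L.etaNeg τ = ex τ * pochProd d.s (-ex τ) (ex τ) :=
  etaEig_neg_eq hd.pos (L.prod_X_sub hg hd) hτ

lemma im_half_pos {τ : ℂ} (hτ : 0 < τ.im) : 0 < (τ / 2).im := by
  have : (τ / 2).im = τ.im / 2 := by simp
  rw [this]; linarith

/-- With x = q^(1/2), splitting into even and odd powers of x cancels the denominator. -/
lemma Labelling.etaPos_div (hg : d.Fits g) (hd : d.Valid) {τ : ℂ} (hτ : 0 < τ.im) :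
    L.etaPos (τ / 2) / L.etaPos τ = (ex (τ / 2))⁻¹ * pochProd d.s (ex (τ / 2)) (ex τ) := by
  have hs : ∀ m ∈ d.s, 0 < m := hd.pos
  have hx := norm_ex_lt_one (im_half_pos hτ)
  have hq := norm_ex_lt_one hτ
  rw [L.etaPos_eq hg hd hτ, L.etaPos_eq hg hd (im_half_pos hτ), pochProd_split hs _ hx,
    ← pow_two, ex_eq_half_sq τ]
  rw [ex_eq_half_sq τ] at hq
  have h1 := pochProd_ne_zero_of_norm_lt hs hq hq
  have h2 := ex_ne_zero (τ / 2)
  field_simp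

lemma Labelling.etaNeg_div (hg : d.Fits g) (hd : d.Valid) {τ : ℂ} (hτ : 0 < τ.im) :
    L.etaNeg (τ / 2) / L.etaNeg τ = (ex (τ / 2))⁻¹ * pochProd d.s (-ex (τ / 2)) (ex τ) := by
  have hs : ∀ m ∈ d.s, 0 < m := hd.pos
  have hx := norm_ex_lt_one (im_half_pos hτ)
  have hq := norm_ex_lt_one hτ
  rw [L.etaNeg_eq hg hd hτ, L.etaNeg_eq hg hd (im_half_pos hτ), pochProd_split hs _ hx,
    neg_mul, ← pow_two, ex_eq_half_sq τ]
  rw [ex_eq_half_sq τ] at hq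
  have h1 := pochProd_ne_zero_of_norm_lt hs (w := -ex (τ / 2) ^ 2) (by rwa [norm_neg]) hq
  have h2 := ex_ne_zero (τ / 2)
  field_simp

end invariants

end Mathieu

namespace Mathieu

/-! ### Quotients of theta functions -/

section theta

variable {τ : ℂ}

lemma poch_inv_mul_poch (hτ : 0 < τ.im) {w : ℂ} (hw : w ≠ 0) :
    poch w⁻¹ (ex τ) * poch (ex τ * w) (ex τ) = -w⁻¹ * (poch (ex τ * w⁻¹) (ex τ) * poch w (ex τ)) := by
  have hq := norm_ex_lt_one hτ
  rw [poch_succ w⁻¹ hq, poch_succ w hq, mul_comm w⁻¹ (ex τ), mul_comm w (ex τ)]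
  field_simp
  ring

/-- The hypothesis holds for h = τ/2 and for h = (τ + 1)/2, so one computation serves θ₄ and θ₃. -/
lemma kfun_mul_kfun_of_sq (hτ : 0 < τ.im) {h : ℂ} (hh : ex h ^ 2 = ex τ) (z : ℂ) :
    kfun (z + h) τ * kfun (z - h) τ = ex (-h) / poch (ex τ) (ex τ) ^ 6 *
      (poch (ex (h - z)) (ex τ) * poch (ex (h + z)) (ex τ) * poch (ex τ) (ex τ)) ^ 2 := by
  have hP := poch_self_ne_zero (norm_ex_lt_one hτ)
  have h0 := ex_ne_zero h
  have key : ∀ z, kfun (z + h) τ = Complex.I * ex (-(z + h) / 2) *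
      (poch (ex (h - z)) (ex τ) * poch (ex (h + z)) (ex τ)) / poch (ex τ) (ex τ) ^ 2 := by
    intro z
    have h1 := poch_inv_mul_poch hτ (ex_ne_zero (z + h))
    have h2 : ex τ * (ex (z + h))⁻¹ = ex (h - z) := by
      rw [← hh, ex_add, ex_sub]
      have := ex_ne_zero z
      field_simp
    have h3 : ex ((z + h) / 2) * (ex (z + h))⁻¹ = ex (-(z + h) / 2) := by
      rw [← ex_neg, ← ex_add]; ring_nf
    rw [kfun, ex_neg, h1, h2, ← h3, add_comm h z]
    ring
  have h4 : kfun (z - h) τ = -kfun (-z + h) τ := by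
    rw [← kfun_neg hτ]; ring_nf
  have h5 : ex (-h) = ex (-(z + h) / 2) * ex (-(-z + h) / 2) := by
    rw [← ex_add]; ring_nf
  rw [h4, key, key, h5, sub_neg_eq_add, ← sub_eq_add_neg]
  generalize ex (-(z + h) / 2) = u
  generalize ex (-(-z + h) / 2) = v
  field_simp
  linear_combination -(u * v * poch (ex (h - z)) (ex τ) ^ 2 * poch (ex (h + z)) (ex τ) ^ 2) *
    Complex.I_sq

lemma kfun_mul_kfun_half (hτ : 0 < τ.im) (z : ℂ) :
    kfun (z + 1 / 2) τ * kfun (z - 1 / 2) τ = -(ex (τ / 8) * poch (ex τ) (ex τ) ^ 3)⁻¹ ^ 2 *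
      theta2 τ z ^ 2 := by
  have hP := poch_self_ne_zero (norm_ex_lt_one hτ)
  have h0 := ex_ne_zero (τ / 8)
  have h1 : kfun (z - 1 / 2) τ = -kfun (z + 1 / 2) τ := by
    rw [show z + 1 / 2 = z - 1 / 2 + 1 by ring, kfun_add_one, neg_neg]
  have h2 : kfun (z + 1 / 2) τ = (ex (τ / 8) * poch (ex τ) (ex τ) ^ 3)⁻¹ * theta2 τ z := by
    have e1 : ex ((z + 1 / 2) / 2) = ex (z / 2) * Complex.I := by
      rw [← ex_quarter, ← ex_add]; ring_nf
    have e2 : ex (-(z + 1 / 2)) = -ex (-z) := by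
      rw [neg_add, ex_add, ex_neg (1 / 2), ex_half]; ring
    have e3 : ex (z + 1 / 2) = -ex z := by rw [ex_add, ex_half]; ring
    rw [theta2_eq_poch hτ, kfun, e1, e2, e3, mul_neg (ex τ)]
    field_simp
    linear_combination -(ex (z / 2) * poch (-ex (-z)) (ex τ) * poch (-(ex τ * ex z)) (ex τ)) *
      Complex.I_sq
  rw [h1, h2]
  ring

/-- The quotient of a theta function by its value at `0` in terms of the Weierstrass function. -/
lemma eta_mul_theta_div (hτ : 0 < τ.im) {θ : ℂ → ℂ} {h c : ℂ} (hh : ¬ inLat τ h)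
    (hk : ∀ z, kfun (z + h) τ * kfun (z - h) τ = c * θ z ^ 2) {z : ℂ} (hz : ¬ inLat τ z) :
    ModularForm.eta τ ^ 6 * (θ z ^ 2 / θ 0 ^ 2) / theta1 τ z ^ 2 = wfun h τ - wfun z τ := by
  have h1 := kfun_add_mul_kfun_sub hτ hz hh
  have h2 := hk 0
  have hkz := kfun_ne_zero hτ hz
  have hkh := kfun_ne_zero hτ hh
  rw [zero_add, zero_sub, kfun_neg hτ] at h2
  have h3 : c * θ 0 ^ 2 ≠ 0 := by rw [← h2]; simp [hkh]
  have h4 : c ≠ 0 := left_ne_zero_of_mul h3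
  have h5 : θ 0 ≠ 0 := fun h => h3 (by rw [h]; ring)
  have h6 := eta_ne_zero hτ
  rw [hk z] at h1
  have h7 : kfun h τ ^ 2 = -(c * θ 0 ^ 2) := by rw [← h2]; ring
  rw [h7] at h1
  rw [theta1_eq_kfun hτ, ← neg_sub (wfun z τ), ← h1]
  field_simp

lemma theta4_div (hτ : 0 < τ.im) {z : ℂ} (hz : ¬ inLat τ z) :
    ModularForm.eta τ ^ 6 * (theta4 τ z ^ 2 / theta4 τ 0 ^ 2) / theta1 τ z ^ 2 =
      etq (1 / 2) 0 τ - E2 τ / 12 - wfun z τ := by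
  have hh : ¬ inLat τ (τ / 2) := by
    have := (inLat_rat hτ (a := 1 / 2) (b := 0)).not.2 (by
      rintro ⟨m, -, h, -⟩
      field_simp at h
      have : (1 : ℤ) = 2 * m := by exact_mod_cast h
      omega)
    push_cast at this
    rwa [show (1 : ℂ) / 2 * τ + 0 = τ / 2 by ring] at this
  rw [eta_mul_theta_div hτ hh (c := ex (-(τ / 2)) / poch (ex τ) (ex τ) ^ 6) (fun z => ?_) hz, etq,
    etfun]
  · push_cast
    rw [show (1 : ℂ) / 2 * τ + 0 = τ / 2 by ring]
    ring
  · rw [kfun_mul_kfun_of_sq hτ (ex_eq_half_sq τ).symm, theta4_eq_poch hτ]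

lemma theta3_div (hτ : 0 < τ.im) {z : ℂ} (hz : ¬ inLat τ z) :
    ModularForm.eta τ ^ 6 * (theta3 τ z ^ 2 / theta3 τ 0 ^ 2) / theta1 τ z ^ 2 =
      etq (1 / 2) (1 / 2) τ - E2 τ / 12 - wfun z τ := by
  have hh : ¬ inLat τ (τ / 2 + 1 / 2) := by
    have := (inLat_rat hτ (a := 1 / 2) (b := 1 / 2)).not.2 (by
      rintro ⟨m, -, h, -⟩
      field_simp at h
      have : (1 : ℤ) = 2 * m := by exact_mod_cast h
      omega)
    push_cast at this
    rwa [show (1 : ℂ) / 2 * τ = τ / 2 by ring] at this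
  have hex : ∀ w, ex (τ / 2 + 1 / 2 + w) = -ex (τ / 2 + w) := fun w => by
    rw [show τ / 2 + 1 / 2 + w = τ / 2 + w + 1 / 2 by ring, ex_add _ (1 / 2), ex_half]; ring
  rw [eta_mul_theta_div hτ hh (c := ex (-(τ / 2 + 1 / 2)) / poch (ex τ) (ex τ) ^ 6)
    (fun z => ?_) hz, etq, etfun]
  · push_cast
    rw [show (1 : ℂ) / 2 * τ = τ / 2 by ring]
    ring
  · rw [kfun_mul_kfun_of_sq hτ, theta3_eq_poch hτ, sub_eq_add_neg, hex, hex, ← sub_eq_add_neg]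
    rw [ex_add, ex_half, mul_neg_one, neg_sq, ex_eq_half_sq τ]

lemma theta2_div (hτ : 0 < τ.im) {z : ℂ} (hz : ¬ inLat τ z) :
    ModularForm.eta τ ^ 6 * (theta2 τ z ^ 2 / theta2 τ 0 ^ 2) / theta1 τ z ^ 2 =
      etq 0 (1 / 2) τ - E2 τ / 12 - wfun z τ := by
  have hh : ¬ inLat τ (1 / 2) := by
    have := (inLat_rat hτ (a := 0) (b := 1 / 2)).not.2 (by
      rintro ⟨-, m, -, h⟩
      field_simp at h
      have : (1 : ℤ) = 2 * m := by exact_mod_cast h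
      omega)
    push_cast at this
    rwa [zero_mul, zero_add] at this
  rw [eta_mul_theta_div hτ hh (fun z => kfun_mul_kfun_half hτ z) hz, etq, etfun]
  push_cast
  rw [zero_mul, zero_add]
  ring

end theta

/-! ### The main identity -/

lemma H_mul_eta {g : Equiv.Perm Letter} {τ : ℂ} (hτ : 0 < τ.im) :
    H g τ * ModularForm.eta τ ^ 3 =
      chi g * (2 * F2 τ - E2 τ / 12) - weightTwo g.cycleType τ := by
  have := eta_ne_zero hτ
  rw [H, He]
  field_simp
  ring

/-- After the theta quotients are replaced by differences of `wfun`, the values at half periods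
combine by the weight two identity, and the common part E₂/12 + `wfun` z is multiplied by the
combination of weight zero. -/
theorem Labelling.eta_mul_phi {d : ShapeData} {g : Equiv.Perm Letter} (L : Labelling g)
    (hg : d.Fits g) (hd : d.Valid) (hX : d.HasQuot) {τ : ℂ} (hτ : 0 < τ.im) {z : ℂ}
    (hz : ¬ inLat τ z) : ModularForm.eta τ ^ 6 * L.phi τ z / theta1 τ z ^ 2 =
      -d.form τ - chi g * (E2 τ / 12 + wfun z τ) := by
  have h4 := theta4_div hτ hz
  have h3 := theta3_div hτ hz
  have h2 := theta2_div hτ hz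
  have w0 := d.weight_zero hd hτ
  have w2 := d.weight_two hd hX hτ
  have hη := eta_ne_zero hτ
  have hθ : theta1 τ z ≠ 0 := by
    rw [theta1_eq_kfun hτ]
    exact mul_ne_zero (kfun_ne_zero hτ hz) (pow_ne_zero 3 hη)
  have hx := ex_ne_zero (τ / 2)
  rw [← hg.chi_eq hd] at w0
  rw [Labelling.phi, L.D_eq hg hd, L.CNeg_eq hg hd, L.etaPos_div hg hd hτ, L.etaNeg_div hg hd hτ,
    L.etaPos_eq hg hd hτ, L.etaNeg_eq hg hd hτ]
  set x := ex (τ / 2)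
  set R4 := theta4 τ z ^ 2 / theta4 τ 0 ^ 2
  set R3 := theta3 τ z ^ 2 / theta3 τ 0 ^ 2
  set R2 := theta2 τ z ^ 2 / theta2 τ 0 ^ 2
  have e : ModularForm.eta τ ^ 6 * (-(1 / 2) * (R4 * (x⁻¹ * pochProd d.s x (ex τ)) -
      R3 * (x⁻¹ * pochProd d.s (-x) (ex τ))) - 1 / 2 *
        (-d.t * (ex τ * pochProd d.s (ex τ) (ex τ)) * (theta1 τ z ^ 2 / ModularForm.eta τ ^ 6) +
        d.C * (ex τ * pochProd d.s (-ex τ) (ex τ)) * R2)) / theta1 τ z ^ 2 =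
      -(1 / 2) * x⁻¹ * (ModularForm.eta τ ^ 6 * R4 / theta1 τ z ^ 2 * pochProd d.s x (ex τ) -
        ModularForm.eta τ ^ 6 * R3 / theta1 τ z ^ 2 * pochProd d.s (-x) (ex τ) +
        ModularForm.eta τ ^ 6 * R2 / theta1 τ z ^ 2 *
          (d.C * (x * (ex τ * pochProd d.s (-ex τ) (ex τ)))) -
        d.t * (x * (ex τ * pochProd d.s (ex τ) (ex τ)))) := by
    field_simp
    ring
  rw [e, h4, h3, h2]
  have hxx : x⁻¹ * x = 1 := inv_mul_cancel₀ hx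
  linear_combination -(1 / 2) * x⁻¹ * w2 + (1 / 2) * x⁻¹ * (E2 τ / 12 + wfun z τ) * w0 -
    (d.form τ + chi g * (E2 τ / 12 + wfun z τ)) * hxx

theorem conclusion_of_data {d : ShapeData} {g : Equiv.Perm Letter} (hg : d.Fits g) (hd : d.Valid)
    (hX : d.HasQuot)
    (hF : ∀ τ : ℂ, 0 < τ.im → weightTwo g.cycleType τ = d.form τ) (L : Labelling g) {τ : ℂ}
    (hτ : 0 < τ.im) {z : ℂ} (hz : ¬ inLat τ z) :
    ModularForm.eta τ ^ 6 * L.phi τ z / theta1 τ z ^ 2 =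
        chi g * (ModularForm.eta τ ^ 3 * mu τ z + 2 * F2 τ) + Q g τ ∧
      ModularForm.eta τ ^ 6 * L.phi τ z / theta1 τ z ^ 2 =
        H g τ * ModularForm.eta τ ^ 3 + chi g * (ModularForm.eta τ ^ 3 * mu τ z) := by
  have h1 := L.eta_mul_phi hg hd hX hτ hz
  have h2 := eta_cube_mul_mu_add hτ hz
  have h3 := H_mul_eta (g := g) hτ
  rw [hF τ hτ] at h3
  refine ⟨?_, ?_⟩
  · rw [h1, Q, h3]
    linear_combination -(chi g : ℂ) * h2
  · rw [h1, h3]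
    linear_combination -(chi g : ℂ) * h2

end Mathieu

namespace Mathieu

/-! ### The classes -/

lemma etaAt_eq (m : ℕ) (τ : ℂ) :
    etaAt m τ = ex (τ / 24) ^ m * poch (ex τ ^ m) (ex τ ^ m) := by
  rw [etaAt, eta_eq_poch, mul_div_assoc, ex_nat_mul, ex_nat_mul]

lemma ex_eq_pow (τ : ℂ) : ex τ = ex (τ / 24) ^ 24 := by
  rw [← ex_nat_mul]; congr 1; push_cast; ring

section weightTwo

variable {τ : ℂ}

lemma weightTwo_1A : weightTwo 0 τ = data1A.form τ := by
  rw [weightTwo, if_pos rfl]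
  simp [ShapeData.form, data1A, lamSum]

lemma weightTwo_2A : weightTwo (Multiset.replicate 8 2) τ = data2A.form τ := by
  rw [weightTwo, if_neg (by decide), if_pos rfl]
  simp [ShapeData.form, data2A, lamSum]

lemma weightTwo_2B : weightTwo (Multiset.replicate 12 2) τ = data2B.form τ := by
  rw [weightTwo, if_neg (by decide), if_neg (by decide), if_pos rfl]
  simp [ShapeData.form, data2B, lamSum]

lemma weightTwo_3A : weightTwo (Multiset.replicate 6 3) τ = data3A.form τ := by
  rw [weightTwo, if_neg (by decide), if_neg (by decide), if_neg (by decide), if_pos rfl]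
  simp [ShapeData.form, data3A, lamSum]

lemma weightTwo_4A : weightTwo ({2, 2, 2, 2, 4, 4, 4, 4} : Multiset ℕ) τ = data4A.form τ := by
  rw [weightTwo, if_neg (by decide), if_neg (by decide), if_neg (by decide), if_neg (by decide),
    if_pos rfl]
  simp [ShapeData.form, data4A, lamSum]
  ring

lemma weightTwo_4B : weightTwo ({2, 2, 4, 4, 4, 4} : Multiset ℕ) τ = data4B.form τ := by
  rw [weightTwo, if_neg (by decide), if_neg (by decide), if_neg (by decide), if_neg (by decide),
    if_neg (by decide), if_pos rfl]
  simp [ShapeData.form, data4B, lamSum]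
  ring

lemma weightTwo_5A : weightTwo ({5, 5, 5, 5} : Multiset ℕ) τ = data5A.form τ := by
  rw [weightTwo, if_neg (by decide), if_neg (by decide), if_neg (by decide), if_neg (by decide),
    if_neg (by decide), if_neg (by decide), if_pos rfl]
  simp [ShapeData.form, data5A, lamSum]

lemma weightTwo_6A : weightTwo ({2, 2, 3, 3, 6, 6} : Multiset ℕ) τ = data6A.form τ := by
  rw [weightTwo, if_neg (by decide), if_neg (by decide), if_neg (by decide), if_neg (by decide),
    if_neg (by decide), if_neg (by decide), if_neg (by decide), if_pos rfl]
  simp [ShapeData.form, data6A, lamSum]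
  ring

lemma weightTwo_7A : weightTwo ({7, 7, 7} : Multiset ℕ) τ = data7A.form τ := by
  rw [weightTwo, if_neg (by decide), if_neg (by decide), if_neg (by decide), if_neg (by decide),
    if_neg (by decide), if_neg (by decide), if_neg (by decide), if_neg (by decide), if_pos rfl]
  simp [ShapeData.form, data7A, lamSum]

lemma weightTwo_8A : weightTwo ({2, 4, 8, 8} : Multiset ℕ) τ = data8A.form τ := by
  rw [weightTwo, if_neg (by decide), if_neg (by decide), if_neg (by decide), if_neg (by decide),
    if_neg (by decide), if_neg (by decide), if_neg (by decide), if_neg (by decide),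
    if_neg (by decide), if_pos rfl]
  simp [ShapeData.form, data8A, lamSum]

lemma weightTwo_10A (hτ : 0 < τ.im) : weightTwo ({2, 2, 10, 10} : Multiset ℕ) τ = data10A.form τ := by
  rw [weightTwo, if_neg (by decide), if_neg (by decide), if_neg (by decide), if_neg (by decide),
    if_neg (by decide), if_neg (by decide), if_neg (by decide), if_neg (by decide),
    if_neg (by decide), if_neg (by decide), if_pos rfl]
  have h10 := poch_pow_ne_zero (norm_ex_lt_one hτ) (n := 10) (by norm_num)
  have h0 := ex_ne_zero (τ / 24)
  simp only [etaAt_eq, ShapeData.form, data10A, lamSum, pochProd_cons, pochProd_nil]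
  simp
  field_simp

lemma weightTwo_11A : weightTwo ({11, 11} : Multiset ℕ) τ = data11A.form τ := by
  rw [weightTwo, if_neg (by decide), if_neg (by decide), if_neg (by decide), if_neg (by decide),
    if_neg (by decide), if_neg (by decide), if_neg (by decide), if_neg (by decide),
    if_neg (by decide), if_neg (by decide), if_neg (by decide), if_pos rfl]
  simp only [etaAt_eq, ShapeData.form, data11A, lamSum, pochProd_cons, pochProd_nil, ex_eq_pow τ]
  simp
  ring

lemma weightTwo_12A (hτ : 0 < τ.im) : weightTwo ({2, 4, 6, 12} : Multiset ℕ) τ = data12A.form τ := by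
  rw [weightTwo, if_neg (by decide), if_neg (by decide), if_neg (by decide), if_neg (by decide),
    if_neg (by decide), if_neg (by decide), if_neg (by decide), if_neg (by decide),
    if_neg (by decide), if_neg (by decide), if_neg (by decide), if_neg (by decide), if_pos rfl]
  have h2 := poch_pow_ne_zero (norm_ex_lt_one hτ) (n := 2) (by norm_num)
  have h3 := poch_pow_ne_zero (norm_ex_lt_one hτ) (n := 3) (by norm_num)
  have h12 := poch_pow_ne_zero (norm_ex_lt_one hτ) (n := 12) (by norm_num)
  have h0 := ex_ne_zero (τ / 24)
  simp only [etaAt_eq, ShapeData.form, data12A, lamSum, pochProd_cons, pochProd_nil]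
  simp
  field_simp

lemma weightTwo_14A : weightTwo ({2, 7, 14} : Multiset ℕ) τ = data14A.form τ := by
  rw [weightTwo, if_neg (by decide), if_neg (by decide), if_neg (by decide), if_neg (by decide),
    if_neg (by decide), if_neg (by decide), if_neg (by decide), if_neg (by decide),
    if_neg (by decide), if_neg (by decide), if_neg (by decide), if_neg (by decide),
    if_neg (by decide), if_pos rfl]
  simp only [etaAt_eq, ShapeData.form, data14A, lamSum, pochProd_cons, pochProd_nil, ex_eq_pow τ]
  simp
  ring

lemma weightTwo_15A : weightTwo ({3, 5, 15} : Multiset ℕ) τ = data15A.form τ := by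
  rw [weightTwo, if_neg (by decide), if_neg (by decide), if_neg (by decide), if_neg (by decide),
    if_neg (by decide), if_neg (by decide), if_neg (by decide), if_neg (by decide),
    if_neg (by decide), if_neg (by decide), if_neg (by decide), if_neg (by decide),
    if_neg (by decide), if_neg (by decide), if_pos rfl]
  simp only [etaAt_eq, ShapeData.form, data15A, lamSum, pochProd_cons, pochProd_nil, ex_eq_pow τ]
  simp
  ring

end weightTwo

/-- The data of the class of `g`. -/
theorem exists_data {g : Equiv.Perm Letter} (hg : g ∈ M24)
    (hclass : g.cycleType ∉ excludedShapes) : ∃ d : ShapeData, d.Fits g ∧ d.Valid ∧ d.HasQuot ∧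
      ∀ τ : ℂ, 0 < τ.im → weightTwo g.cycleType τ = d.form τ := by
  obtain ⟨s, hs, h⟩ := exists_cycleType_eq hg
  rw [h] at hclass ⊢
  simp only [shapes, List.mem_cons, List.not_mem_nil, or_false] at hs
  have ten : data10A.HasQuot := Or.inr ⟨_, kfamily_quotTen, fun u hu τ hτ => quotTen_zero hu hτ⟩
  have twelve : data12A.HasQuot :=
    Or.inr ⟨_, kfamily_quotTwelve, fun u hu τ hτ => quotTwelve_zero hu hτ⟩
  rcases hs with rfl | rfl | rfl | rfl | rfl | rfl | rfl | rfl | rfl | rfl | rfl | rfl | rfl | rfl |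
    rfl | rfl | rfl | rfl | rfl | rfl | rfl
  · exact ⟨data1A, ⟨by decide, h.trans (by decide)⟩, data1A_valid, Or.inl rfl, fun _ _ => weightTwo_1A⟩
  · exact ⟨data2A, ⟨by decide, h.trans (by decide)⟩, data2A_valid, Or.inl rfl, fun _ _ => weightTwo_2A⟩
  · exact ⟨data2B, ⟨by decide, h.trans (by decide)⟩, data2B_valid, Or.inl rfl, fun _ _ => weightTwo_2B⟩
  · exact ⟨data3A, ⟨by decide, h.trans (by decide)⟩, data3A_valid, Or.inl rfl, fun _ _ => weightTwo_3A⟩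
  · exact ⟨data4A, ⟨by decide, h.trans (by decide)⟩, data4A_valid, Or.inl rfl, fun _ _ => weightTwo_4A⟩
  · exact ⟨data4B, ⟨by decide, h.trans (by decide)⟩, data4B_valid, Or.inl rfl, fun _ _ => weightTwo_4B⟩
  · exact ⟨data5A, ⟨by decide, h.trans (by decide)⟩, data5A_valid, Or.inl rfl, fun _ _ => weightTwo_5A⟩
  · exact ⟨data6A, ⟨by decide, h.trans (by decide)⟩, data6A_valid, Or.inl rfl, fun _ _ => weightTwo_6A⟩
  · exact ⟨data7A, ⟨by decide, h.trans (by decide)⟩, data7A_valid, Or.inl rfl, fun _ _ => weightTwo_7A⟩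
  · exact ⟨data8A, ⟨by decide, h.trans (by decide)⟩, data8A_valid, Or.inl rfl, fun _ _ => weightTwo_8A⟩
  · exact ⟨data10A, ⟨by decide, h.trans (by decide)⟩, data10A_valid, ten, fun τ hτ => weightTwo_10A hτ⟩
  · exact ⟨data11A, ⟨by decide, h.trans (by decide)⟩, data11A_valid, Or.inl rfl, fun _ _ => weightTwo_11A⟩
  · exact ⟨data12A, ⟨by decide, h.trans (by decide)⟩, data12A_valid, twelve, fun τ hτ => weightTwo_12A hτ⟩
  · exact ⟨data14A, ⟨by decide, h.trans (by decide)⟩, data14A_valid, Or.inl rfl, fun _ _ => weightTwo_14A⟩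
  · exact ⟨data15A, ⟨by decide, h.trans (by decide)⟩, data15A_valid, Or.inl rfl, fun _ _ => weightTwo_15A⟩
  -- The remaining six shapes are the excluded ones.
  all_goals
    refine absurd ?_ hclass
    simp only [excludedShapes, Set.mem_insert_iff, Set.mem_singleton_iff]
    decide

end Mathieu

end

open Mathieu in
theorem mainTheorem4 (g : Equiv.Perm Letter) (hg : g ∈ M24)
    (hclass : g.cycleType ∉ excludedShapes) :
    Nonempty (Labelling g) ∧
    ∀ (L : Labelling g) (τ : ℍ) (z : ℂ), (∀ m n : ℤ, z ≠ m * (τ : ℂ) + n) →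
      ModularForm.eta τ ^ 6 * L.phi τ z / theta1 τ z ^ 2 =
          chi g * (ModularForm.eta τ ^ 3 * mu τ z + 2 * F2 τ) + Q g τ ∧
      ModularForm.eta τ ^ 6 * L.phi τ z / theta1 τ z ^ 2 =
          H g τ * ModularForm.eta τ ^ 3 + chi g * (ModularForm.eta τ ^ 3 * mu τ z) := by
  obtain ⟨d, h1, h2, h3, h4⟩ := exists_data hg hclass
  exact ⟨h1.nonempty_labelling h2, fun L τ z hz =>
    conclusion_of_data h1 h2 h3 h4 L τ.im_pos fun ⟨m, n, h⟩ => hz m n h⟩
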